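/- **Setting.** Let $\Bbbk$ be a field of characteristic $\neq 2$ and $A=(a_{ij})_{i,j\in I}$ a symmetric generalized Cartan matrix. For $i\ne j$ let $\mathcal Q_{ij}(u,v)=\sum t_{i,j;r,s}u^rv^s\in\Bbbk[u,v]$, the sum being over $r,s\ge 0$ with $r\le -a_{ij}$, $s\le -a_{ji}$, $a_{ji}r+a_{ij}s=-a_{ij}a_{ji}$, where $t_{i,j;r,s}=t_{j,i;s,r}$ and $t_{i,j;-a_{ij},0}\neq0$; put $\mathcal Q_{ii}=0$. Let $J=I\times\mathbb Z/2$, $c(i,\varepsilon)=(i,1-\varepsilon)$ and, for $\mu=(i,\varepsilon)$, $\eta=(j,\varepsilon')$ in $J$, $\tilde{\mathcal Q}_{\mu\eta}(u,v)=\mathcal Q_{ij}((-1)^{\varepsilon}u,(-1)^{\varepsilon'}v)$. Assume the symmetric case: $\tilde{\mathcal Q}_{\mu\eta}(u,v)\in\Bbbk[(-1)^\varepsilon u-(-1)^{\varepsilon'}v]$ for all $\mu,\eta$. Let $\mathsf Q^+=\bigoplus_{i}\mathbb Z_{\ge0}\alpha_i$; for $\beta\in\mathsf Q^+$ of height $n$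 let $I^\beta$ be the set of $\nu\in I^n$ with $\sum_p\alpha_{\nu_p}=\beta$, and $J^\beta$ the set of $\nu\in J^n$ with the same property for first components. **The superalgebra $RC_\beta$.** It is generated by even $e(\nu)$ ($\nu\in J^\beta$), $x_p$ ($1\le p\le n$), $\sigma_a$ ($1\le a<n$) and odd $\mathfrak c_p$ ($1\le p\le n$), with relations: the $e(\nu)$ are orthogonal idempotents with sum $1$; $x_pe(\nu)=e(\nu)x_p$; $\mathfrak c_pe(\nu)=e(c_p\nu)\mathfrak c_p$, where $c_p$ applies $c$ to the $p$-th entry; $\sigma_ae(\nu)=e(s_a\nu)\sigma_a$; $x_px_q=x_qx_p$; $\mathfrak c_p^2=1$; $\mathfrak c_p\mathfrak c_q=-\mathfrak c_q\mathfrak c_p$ and $\mathfrak c_px_q=x_q\mathfrak c_p$ for $p\ne q$; $\mathfrak c_px_p=-x_p\mathfrak c_p$; $\sigma_a\mathfrak c_p=\mathfrak c_{s_a(p)}\sigma_a$; $\sigma_ax_p=x_p\sigma_a$ for $p\neq a,a+1$; $\sigma_a\sigma_b=\sigma_b\sigma_a$ for $|a-b|>1$; $$(\sigma_ax_{a+1}-x_a\sigma_a)e(\nu)=\begin{cases}e(\nu)&\nu_a=\nu_{a+1}\\-\mathfrak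 c_a\mathfrak c_{a+1}e(\nu)&\nu_a=c(\nu_{a+1})\\0&\text{otherwise}\end{cases}\qquad(x_{a+1}\sigma_a-\sigma_ax_a)e(\nu)=\begin{cases}e(\nu)&\nu_a=\nu_{a+1}\\\mathfrak c_a\mathfrak c_{a+1}e(\nu)&\nu_a=c(\nu_{a+1})\\0&\text{otherwise;}\end{cases}$$ $\sigma_a^2e(\nu)=\tilde{\mathcal Q}_{\nu_a\nu_{a+1}}(x_a,x_{a+1})e(\nu)$; and $(\sigma_{a+1}\sigma_a\sigma_{a+1}-\sigma_a\sigma_{a+1}\sigma_a)e(\nu)$ equals $$\frac{\tilde{\mathcal Q}_{\nu_a\nu_{a+1}}(x_{a+2},x_{a+1})-\tilde{\mathcal Q}_{\nu_a\nu_{a+1}}(x_a,x_{a+1})}{x_{a+2}-x_a}e(\nu)\ \text{ if }\nu_a=\nu_{a+2},$$ $$\frac{\tilde{\mathcal Q}_{\nu_a\nu_{a+1}}(x_{a+2},x_{a+1})-\tilde{\mathcal Q}_{\nu_a\nu_{a+1}}(-x_a,x_{a+1})}{x_{a+2}+x_a}\,\mathfrak c_a\mathfrak c_{a+2}e(\nu)\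 \text{ if }\nu_a=c(\nu_{a+2}),$$ and $0$ otherwise. **The algebra $R_\beta$.** The quiver Hecke algebra $R_\beta$ of the same data is generated by $e(\nu)$ ($\nu\in I^\beta$), $x_p$, $\sigma_a$; its relations are those above that do not involve the $\mathfrak c_p$, with $\mathcal Q_{ij}$ in place of $\tilde{\mathcal Q}_{\mu\eta}$ and with the cases $\nu_a=c(\nu_{a+1})$, $\nu_a=c(\nu_{a+2})$ removed. **The functor $F$.** For $\nu\in I^\beta$ put $\nu^\dagger=((\nu_1,0),\dots,(\nu_n,0))$, and let $e^\dagger(\beta)=\sum_{\nu\in I^\beta}e(\nu^\dagger)\in RC_\beta$. For an $RC_\beta$-module $M$ let $F(M)=F_\beta(M)=e^\dagger(\beta)M$, on which $R_\beta$ acts through $e(\nu)\mapsto e(\nu^\dagger)$, $x_p\mapsto x_p$, $\sigma_a\mapsto\sigma_a$; homomorphisms are restricted. **Convolution and R-matrices.** For supermodules $M$ over $RC_{\beta_1}$ and $N$ over $RC_{\beta_2}$ let $M\circ N=RC_{\beta_1+\beta_2}e(\beta_1,\beta_2)\otimes_{RC_{\beta_1}\otimes RC_{\beta_2}}(M\otimes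 N)$, where $M\otimes N$ carries the Koszul sign rule; convolution of $R$-modules is defined in the same way, without signs. On the $RC$ side let $\varphi_a$ be given by $$\varphi_ae(\nu)=\begin{cases}\sigma_ae(\nu)&\text{if }\nu_a,\nu_{a+1}\text{ have different first components},\\(-1)^{\varepsilon}(\sigma_ax_a-x_a\sigma_a)e(\nu)&\text{if }\nu_a=\nu_{a+1}=(i,\varepsilon),\\(-1)^{\varepsilon}(\sigma_ax_a+x_a\sigma_a)e(\nu)&\text{if }\nu_a=(i,\varepsilon)=c(\nu_{a+1}),\end{cases}$$ and on the $R$ side by $\varphi_ae(\nu)=\sigma_ae(\nu)$ if $\nu_a\ne\nu_{a+1}$ and $\varphi_ae(\nu)=(\sigma_ax_a-x_a\sigma_a)e(\nu)$ if $\nu_a=\nu_{a+1}$. For the permutation $w[n,m]$ of $\{1,\dots,n+m\}$ with $p\mapsto p+m$ for $p\le n$ and $p\mapsto p-n$ for $p>n$, let $\varphi_{w[n,m]}$ be the product of the $\varphi_a$ along a reduced expression. With $m=|\beta_1|$, $n=|\beta_2|$, the R-matrix $R_{M,N}\colon M\circ N\to N\circ M$ is the homomorphism with $$u\otimes v\mapsto(-1)^{p(u)p(v)}\varphi_{w[n,m]}(v\otimes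 u)\quad(RC\text{-modules}),\qquad u\otimes v\mapsto\varphi_{w[n,m]}(v\otimes u)\quad(R\text{-modules}).$$ **Affinization and renormalization.** The affinization of an $RC_\beta$-supermodule $M$ is $M_z=\Bbbk[z]\otimes M$, where $e(\nu),\sigma_a,\mathfrak c_p$ act on the second factor and $x_pe(\nu)(f\otimes u)=(-1)^{\varepsilon_p}zf\otimes e(\nu)u+f\otimes x_pe(\nu)u$ with $\nu_p=(i_p,\varepsilon_p)$; for $R_\beta$-modules the sign is absent. For non-zero $M,N$ put $$r(M,N)=\max\{a\ge 0:\operatorname{Im}R_{M_z,N}\subset z^a(N\circ M_z)\},\qquad s(M,N)=\max\{b\ge 0:\operatorname{Im}R_{M,N_z}\subset z^b(N_z\circ M)\},$$ $$r_{M,N}=z^{-r(M,N)}R_{M_z,N}\big|_{z=0},\qquad r'_{M,N}=z^{-s(M,N)}R_{M,N_z}\big|_{z=0}\colon\ M\circ N\to N\circ M.$$ **Proposition.** Let $\beta_1,\beta_2\in\mathsf Q^+$ and let $M_i$ be a non-zero $RC_{\beta_i}$-supermodule ($i=1,2$). The maps $u\otimes v\mapsto u\otimes v$ are isomorphisms $F(M_1)\circ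 F(M_2)\to F(M_1\circ M_2)$ and $F(M_2)\circ F(M_1)\to F(M_2\circ M_1)$, by which these modules are identified. All the objects just introduced are well defined for $(M_1,M_2)$ and for $(F(M_1),F(M_2))$ (the R-matrices and the maxima exist, $z^{-r}R$, $z^{-s}R$ exist and are unique, and so do and are their specializations at $z=0$), the exponents coincide, $$r(M_1,M_2)=r(F(M_1),F(M_2)),\qquad s(M_1,M_2)=s(F(M_1),F(M_2)),$$ and for all homogeneous $m_1\in M_1$, $m_2\in M_2$ $$F(r_{M_1,M_2})(e^\dagger(\beta_1)m_1\otimes e^\dagger(\beta_2)m_2)=(-1)^{p(m_1)p(m_2)}\,r_{F(M_1),F(M_2)}(e^\dagger(\beta_1)m_1\otimes e^\dagger(\beta_2)m_2),$$ $$F(r'_{M_1,M_2})(e^\dagger(\beta_1)m_1\otimes e^\dagger(\beta_2)m_2)=(-1)^{p(m_1)p(m_2)}\,r'_{F(M_1),F(M_2)}(e^\dagger(\beta_1)m_1\otimes e^\dagger(\beta_2)m_2).$$ -/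

import Mathlib

open scoped TensorProduct

universe u v w w₁ w₂ w₃ w₄

noncomputable section

namespace QHC

/-! ### Polynomials in two commuting variables -/

section Poly

variable {k : Type u} [Field k] {B : Type w} [Ring B] [Algebra k B]

/-- The sign `(-1)^p` of a parity `p`. -/
def sgn (k : Type u) [Field k] (p : ZMod 2) : k := if p = 0 then 1 else -1

/-- `f(X, Y) = ∑ c r s X^r Y^s`, the sum being over `r ≤ d₁`, `s ≤ d₂`. It is only used for commuting
`X`, `Y`. -/
def polyEval (c : ℕ → ℕ → k) (d₁ d₂ : ℕ) (X Y : B) : B :=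
  ∑ r ∈ Finset.range (d₁ + 1), ∑ s ∈ Finset.range (d₂ + 1), c r s • (X ^ r * Y ^ s)

/-- The divided difference `(f(W, Y) - f(X, Y)) / (W - X)` of `f(X, Y) = ∑ c r s X^r Y^s`, that is
`∑ c r s (W^(r-1) + W^(r-2) X + ⋯ + X^(r-1)) Y^s`. It is only used for commuting `W`, `X`, `Y`. -/
def polyDiff (c : ℕ → ℕ → k) (d₁ d₂ : ℕ) (W X Y : B) : B :=
  ∑ r ∈ Finset.range (d₁ + 1), ∑ s ∈ Finset.range (d₂ + 1),
    c r s • ((∑ l ∈ Finset.range r, W ^ l * X ^ (r - 1 - l)) * Y ^ s)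

theorem polyDiff_mul {B : Type w} [CommRing B] [Algebra k B] (c : ℕ → ℕ → k) (d₁ d₂ : ℕ)
    (W X Y : B) :
    polyDiff c d₁ d₂ W X Y * (W - X) = polyEval c d₁ d₂ W Y - polyEval c d₁ d₂ X Y := by
  simp only [polyDiff, polyEval, ← Finset.sum_sub_distrib]
  rw [Finset.sum_mul]
  refine Finset.sum_congr rfl fun r _ => ?_
  rw [Finset.sum_mul]
  refine Finset.sum_congr rfl fun s _ => ?_
  rw [smul_mul_assoc, mul_right_comm, ← smul_sub, ← sub_mul]
  congr 2
  exact (Commute.all W X).geom_sum₂_mul r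

end Poly

/-! ### The data -/

/-- A symmetrizable generalized Cartan matrix `A` on an index set `I` with scalars
`t i j r s = t_{i,j;r,s}` for `i ≠ j` and `(r, s) ∈ S_{ij}` (the other values of `t` are not used);
all vertices are even. -/
structure Datum (k : Type u) [Field k] (I : Type v) where
  A : I → I → ℤ
  diag : ∀ i, A i i = 2
  nonpos : ∀ i j, i ≠ j → A i j ≤ 0
  zero_iff : ∀ i j, A i j = 0 ↔ A j i = 0
  symmetrizable : ∃ d : I → ℤ, (∀ i, 0 < d i) ∧ ∀ i j, d i * A i j = d j * A j i
  t : I → I → ℕ → ℕ → k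
  t_symm : ∀ i j, i ≠ j → ∀ r s : ℕ, (r : ℤ) ≤ -A i j → (s : ℤ) ≤ -A j i →
    A j i * r + A i j * s = -(A i j * A j i) → t i j r s = t j i s r
  t_ne : ∀ i j, i ≠ j → t i j (-A i j).toNat 0 ≠ 0

namespace Datum

variable {k : Type u} [Field k] {I : Type v} (D : Datum k I)

/-- `(r, s) ∈ S_{ij}`. -/
def S (i j : I) (r s : ℕ) : Prop :=
  (r : ℤ) ≤ -D.A i j ∧ (s : ℤ) ≤ -D.A j i ∧ D.A j i * r + D.A i j * s = -(D.A i j * D.A j i)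

open Classical in
/-- The coefficients of `𝒬_{ij}(u, v) = ∑_{(r,s) ∈ S_{ij}} t_{i,j;r,s} u^r v^s`, where `𝒬_{ii} = 0`. -/
def q (i j : I) (r s : ℕ) : k := if i ≠ j ∧ D.S i j r s then D.t i j r s else 0

/-- `𝒬_{ij}(X, Y)`. -/
def Q {B : Type w} [Ring B] [Algebra k B] (i j : I) (X Y : B) : B :=
  polyEval (D.q i j) (-D.A i j).toNat (-D.A j i).toNat X Y

/-- `(𝒬_{ij}(W, Y) - 𝒬_{ij}(X, Y)) / (W - X)`. -/
def dQ {B : Type w} [Ring B] [Algebra k B] (i j : I) (W X Y : B) : B :=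
  polyDiff (D.q i j) (-D.A i j).toNat (-D.A j i).toNat W X Y

/-- The coefficients of `𝒬̃_{μη}(u, v) = 𝒬_{ij}((-1)^ε u, (-1)^ε' v)`, where `μ = (i, ε)` and
`η = (j, ε')` belong to `J = I × {0, 1}`. -/
def qt (μ η : I × ZMod 2) (r s : ℕ) : k :=
  sgn k μ.2 ^ r * sgn k η.2 ^ s * D.q μ.1 η.1 r s

/-- `𝒬̃_{μη}(X, Y)`. -/
def Qt {B : Type w} [Ring B] [Algebra k B] (μ η : I × ZMod 2) (X Y : B) : B :=
  polyEval (D.qt μ η) (-D.A μ.1 η.1).toNat (-D.A η.1 μ.1).toNat X Y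

/-- `(𝒬̃_{μη}(W, Y) - 𝒬̃_{μη}(X, Y)) / (W - X)`. -/
def dQt {B : Type w} [Ring B] [Algebra k B] (μ η : I × ZMod 2) (W X Y : B) : B :=
  polyDiff (D.qt μ η) (-D.A μ.1 η.1).toNat (-D.A η.1 μ.1).toNat W X Y

/-- The symmetric case: `A` is symmetric and `𝒬̃_{μη}(u, v)` is a polynomial in
`(-1)^ε u - (-1)^ε' v`, where `μ = (i, ε)` and `η = (j, ε')`. -/
class IsSymmetric : Prop where
  symm : ∀ i j, D.A i j = D.A j i
  poly : ∀ μ η : I × ZMod 2, ∃ p : Polynomial k,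
    D.Qt μ η (MvPolynomial.X 0 : MvPolynomial (Fin 2) k) (MvPolynomial.X 1) =
      Polynomial.aeval (sgn k μ.2 • MvPolynomial.X 0 - sgn k η.2 • MvPolynomial.X 1) p

end Datum

/-! ### Sequences -/

section Seq

variable {I : Type v}

/-- The height `|β|` of `β ∈ 𝖰⁺ = ⊕ ℕ α_i`. -/
abbrev ht (β : I →₀ ℕ) : ℕ := β.degree

/-- The position `a`. -/
def lo {n : ℕ} (a : Fin (n - 1)) : Fin n := ⟨a, by omega⟩

/-- The position `a + 1`. -/
def hi {n : ℕ} (a : Fin (n - 1)) : Fin n := ⟨a + 1, by omega⟩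

/-- The involution `c (i, ε) = (i, 1 - ε)` of `J = I × {0, 1}`. -/
def cJ (μ : I × ZMod 2) : I × ZMod 2 := (μ.1, 1 - μ.2)

/-- `I^β`. -/
@[ext]
structure ISeq (β : I →₀ ℕ) : Type v where
  seq : Fin (ht β) → I
  sum_eq : ∑ p, Finsupp.single (seq p) 1 = β

/-- `J^β`. -/
@[ext]
structure JSeq (β : I →₀ ℕ) : Type v where
  seq : Fin (ht β) → I × ZMod 2
  sum_eq : ∑ p, Finsupp.single (seq p).1 1 = β

theorem mem_support_of_sum {n : ℕ} {β : I →₀ ℕ} {ν : Fin n → I}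
    (h : ∑ p, Finsupp.single (ν p) 1 = β) (p : Fin n) : ν p ∈ β.support := by
  classical
  rw [Finsupp.mem_support_iff, ← h, Finsupp.finsetSum_apply]
  have : (Finsupp.single (ν p) 1 : I →₀ ℕ) (ν p) ≤ ∑ x, (Finsupp.single (ν x) 1 : I →₀ ℕ) (ν p) :=
    Finset.single_le_sum (f := fun x => (Finsupp.single (ν x) 1 : I →₀ ℕ) (ν p))
      (fun _ _ => Nat.zero_le _) (Finset.mem_univ p)
  rw [Finsupp.single_eq_same] at this
  omega

instance ISeq.finite (β : I →₀ ℕ) : Finite (ISeq β) := by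
  refine Finite.of_injective
    (fun (ν : ISeq β) (p : Fin (ht β)) => (⟨ν.1 p, mem_support_of_sum ν.2 p⟩ : β.support)) ?_
  intro ν μ h
  exact ISeq.ext (funext fun p => congrArg Subtype.val (congrFun h p))

instance JSeq.finite (β : I →₀ ℕ) : Finite (JSeq β) := by
  refine Finite.of_injective (fun (ν : JSeq β) (p : Fin (ht β)) =>
    ((⟨(ν.1 p).1, mem_support_of_sum (ν := fun p => (ν.1 p).1) ν.2 p⟩ : β.support),
      (ν.1 p).2)) ?_
  intro ν μ h
  refine JSeq.ext (funext fun p => Prod.ext ?_ ?_)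
  · exact congrArg (fun x => (x.1 : I)) (congrFun h p)
  · exact congrArg (fun x => x.2) (congrFun h p)

instance ISeq.fintype (β : I →₀ ℕ) : Fintype (ISeq β) := Fintype.ofFinite _

instance JSeq.fintype (β : I →₀ ℕ) : Fintype (JSeq β) := Fintype.ofFinite _

variable {β : I →₀ ℕ}

/-- `s_a ν`. -/
def ISeq.swap (a : Fin (ht β - 1)) (ν : ISeq β) : ISeq β :=
  ⟨fun p => ν.1 (Equiv.swap (lo a) (hi a) p), by
    rw [Equiv.sum_comp (Equiv.swap (lo a) (hi a)) (fun p => Finsupp.single (ν.1 p) 1)]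
    exact ν.2⟩

/-- `s_a ν`. -/
def JSeq.swap (a : Fin (ht β - 1)) (ν : JSeq β) : JSeq β :=
  ⟨fun p => ν.1 (Equiv.swap (lo a) (hi a) p), by
    rw [Equiv.sum_comp (Equiv.swap (lo a) (hi a)) (fun p => Finsupp.single (ν.1 p).1 1)]
    exact ν.2⟩

/-- `c_p ν`. -/
def JSeq.flip (p : Fin (ht β)) (ν : JSeq β) : JSeq β :=
  ⟨Function.update ν.1 p (cJ (ν.1 p)), by
    refine Eq.trans (Finset.sum_congr rfl fun x _ => ?_) ν.2
    by_cases hx : x = p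
    · subst hx; simp [cJ]
    · simp [hx]⟩

/-- `ν† = ((ν_1, 0), …, (ν_n, 0))`. -/
def ISeq.dag (ν : ISeq β) : JSeq β := ⟨fun p => (ν.1 p, 0), ν.2⟩

variable {β₁ β₂ : I →₀ ℕ}

theorem ht_add (h : β₁ + β₂ = β) : ht β₁ + ht β₂ = ht β := by
  rw [← h]; exact (map_add Finsupp.degree β₁ β₂).symm

/-- The first `|β₁|` of the `|β|` positions. -/
def inL (h : β₁ + β₂ = β) (p : Fin (ht β₁)) : Fin (ht β) :=
  ⟨p, by have := ht_add h; omega⟩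

/-- The last `|β₂|` of the `|β|` positions. -/
def inR (h : β₁ + β₂ = β) (p : Fin (ht β₂)) : Fin (ht β) :=
  ⟨ht β₁ + p, by have := ht_add h; omega⟩

/-- The crossing number `a` of the first `|β₁|` strands. -/
def crL (h : β₁ + β₂ = β) (a : Fin (ht β₁ - 1)) : Fin (ht β - 1) :=
  ⟨a, by have := ht_add h; omega⟩

/-- The crossing number `a` of the last `|β₂|` strands. -/
def crR (h : β₁ + β₂ = β) (a : Fin (ht β₂ - 1)) : Fin (ht β - 1) :=
  ⟨ht β₁ + a, by have := ht_add h; omega⟩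

/-- Concatenation of functions along `|β₁| + |β₂| = |β|`. -/
def concat {X : Type*} (h : β₁ + β₂ = β) (f : Fin (ht β₁) → X) (g : Fin (ht β₂) → X) :
    Fin (ht β) → X :=
  fun p => Fin.append f g (Fin.cast (ht_add h).symm p)

theorem sum_concat {X : Type*} (h : β₁ + β₂ = β) (f : Fin (ht β₁) → X) (g : Fin (ht β₂) → X)
    (F : X → I →₀ ℕ) : ∑ p, F (concat h f g p) = ∑ p, F (f p) + ∑ p, F (g p) := by
  have := Equiv.sum_comp (finCongr (ht_add h).symm) (fun p => F (Fin.append f g p))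
  rw [Fin.sum_univ_add] at this
  simp only [Fin.append_left, Fin.append_right] at this
  exact this

/-- The concatenation `ν * η`. -/
def ISeq.append (h : β₁ + β₂ = β) (ν : ISeq β₁) (η : ISeq β₂) : ISeq β :=
  ⟨concat h ν.1 η.1, by
    rw [sum_concat h ν.1 η.1 (fun i => Finsupp.single i 1), ν.2, η.2, h]⟩

/-- The concatenation `ν * η`. -/
def JSeq.append (h : β₁ + β₂ = β) (ν : JSeq β₁) (η : JSeq β₂) : JSeq β :=
  ⟨concat h ν.1 η.1, by
    rw [sum_concat h ν.1 η.1 (fun i => Finsupp.single i.1 1), ν.2, η.2, h]⟩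

theorem ISeq.dag_append (h : β₁ + β₂ = β) (ν : ISeq β₁) (η : ISeq β₂) :
    (ISeq.append h ν η).dag = JSeq.append h ν.dag η.dag := by
  refine JSeq.ext (funext fun p => ?_)
  simp only [ISeq.dag, ISeq.append, JSeq.append, concat]
  induction Fin.cast (ht_add h).symm p using Fin.addCases <;> simp

end Seq

/-! ### Quiver Hecke--Clifford superalgebras and quiver Hecke algebras -/

/-- The generators of `RC_β`. The crossings `σ_a` are indexed by `0 ≤ a < n - 1` and the positions of
`x_p` and `𝔠_p` by `0 ≤ p < n`. -/
inductive GenC {I : Type v} (β : I →₀ ℕ) : Type v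
  | e (ν : JSeq β)
  | x (p : Fin (ht β))
  | s (a : Fin (ht β - 1))
  | c (p : Fin (ht β))

/-- The generators of `R_β`. -/
inductive GenR {I : Type v} (β : I →₀ ℕ) : Type v
  | e (ν : ISeq β)
  | x (p : Fin (ht β))
  | s (a : Fin (ht β - 1))

section Algebras

variable {k : Type u} [Field k] {I : Type v}

namespace FreeC
variable (k) {β : I →₀ ℕ}
/-- The free generator `e(ν)`. -/
def e (ν : JSeq β) : FreeAlgebra k (GenC β) := FreeAlgebra.ι k (.e ν)
/-- The free generator `x_p`. -/
def x (p : Fin (ht β)) : FreeAlgebra k (GenC β) := FreeAlgebra.ι k (.x p)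
/-- The free generator `σ_a`. -/
def s (a : Fin (ht β - 1)) : FreeAlgebra k (GenC β) := FreeAlgebra.ι k (.s a)
/-- The free generator `𝔠_p`. -/
def c (p : Fin (ht β)) : FreeAlgebra k (GenC β) := FreeAlgebra.ι k (.c p)
end FreeC

open FreeC in
/-- The defining relations of `RC_β`. -/
inductive RelC (D : Datum k I) (β : I →₀ ℕ) :
    FreeAlgebra k (GenC β) → FreeAlgebra k (GenC β) → Prop
  | e_mul_self (ν : JSeq β) : RelC D β (e k ν * e k ν) (e k ν)
  | e_mul_ne (μ ν : JSeq β) : μ ≠ ν → RelC D β (e k μ * e k ν) 0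
  | sum_e : RelC D β (∑ ν : JSeq β, e k ν) 1
  | x_e (p : Fin (ht β)) (ν : JSeq β) : RelC D β (x k p * e k ν) (e k ν * x k p)
  | c_e (p : Fin (ht β)) (ν : JSeq β) : RelC D β (c k p * e k ν) (e k (ν.flip p) * c k p)
  | x_x (p q : Fin (ht β)) : RelC D β (x k p * x k q) (x k q * x k p)
  | c_sq (p : Fin (ht β)) : RelC D β (c k p * c k p) 1
  | c_c (p q : Fin (ht β)) : p ≠ q → RelC D β (c k p * c k q) (-(c k q * c k p))
  | c_x_self (p : Fin (ht β)) : RelC D β (c k p * x k p) (-(x k p * c k p))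
  | c_x (p q : Fin (ht β)) : p ≠ q → RelC D β (c k p * x k q) (x k q * c k p)
  | s_e (a : Fin (ht β - 1)) (ν : JSeq β) : RelC D β (s k a * e k ν) (e k (ν.swap a) * s k a)
  | s_c (a : Fin (ht β - 1)) (p : Fin (ht β)) :
      RelC D β (s k a * c k p) (c k (Equiv.swap (lo a) (hi a) p) * s k a)
  | s_x (a : Fin (ht β - 1)) (p : Fin (ht β)) : p ≠ lo a → p ≠ hi a →
      RelC D β (s k a * x k p) (x k p * s k a)
  | s_hi_eq (a : Fin (ht β - 1)) (ν : JSeq β) : ν.1 (lo a) = ν.1 (hi a) →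
      RelC D β ((s k a * x k (hi a) - x k (lo a) * s k a) * e k ν) (e k ν)
  | s_hi_conj (a : Fin (ht β - 1)) (ν : JSeq β) : ν.1 (lo a) = cJ (ν.1 (hi a)) →
      RelC D β ((s k a * x k (hi a) - x k (lo a) * s k a) * e k ν)
        (-(c k (lo a) * c k (hi a) * e k ν))
  | s_hi_ne (a : Fin (ht β - 1)) (ν : JSeq β) : ν.1 (lo a) ≠ ν.1 (hi a) →
      ν.1 (lo a) ≠ cJ (ν.1 (hi a)) →
      RelC D β ((s k a * x k (hi a) - x k (lo a) * s k a) * e k ν) 0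
  | s_lo_eq (a : Fin (ht β - 1)) (ν : JSeq β) : ν.1 (lo a) = ν.1 (hi a) →
      RelC D β ((x k (hi a) * s k a - s k a * x k (lo a)) * e k ν) (e k ν)
  | s_lo_conj (a : Fin (ht β - 1)) (ν : JSeq β) : ν.1 (lo a) = cJ (ν.1 (hi a)) →
      RelC D β ((x k (hi a) * s k a - s k a * x k (lo a)) * e k ν)
        (c k (lo a) * c k (hi a) * e k ν)
  | s_lo_ne (a : Fin (ht β - 1)) (ν : JSeq β) : ν.1 (lo a) ≠ ν.1 (hi a) →
      ν.1 (lo a) ≠ cJ (ν.1 (hi a)) →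
      RelC D β ((x k (hi a) * s k a - s k a * x k (lo a)) * e k ν) 0
  | s_sq (a : Fin (ht β - 1)) (ν : JSeq β) :
      RelC D β (s k a * s k a * e k ν)
        (D.Qt (ν.1 (lo a)) (ν.1 (hi a)) (x k (lo a)) (x k (hi a)) * e k ν)
  | s_s (a b : Fin (ht β - 1)) : (a : ℕ) + 1 < b → RelC D β (s k a * s k b) (s k b * s k a)
  | braid_eq (a b : Fin (ht β - 1)) (ν : JSeq β) : (b : ℕ) = a + 1 →
      ν.1 (lo a) = ν.1 (hi b) →
      RelC D β ((s k b * s k a * s k b - s k a * s k b * s k a) * e k ν)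
        (D.dQt (ν.1 (lo a)) (ν.1 (hi a)) (x k (hi b)) (x k (lo a)) (x k (hi a)) * e k ν)
  | braid_conj (a b : Fin (ht β - 1)) (ν : JSeq β) : (b : ℕ) = a + 1 →
      ν.1 (lo a) = cJ (ν.1 (hi b)) →
      RelC D β ((s k b * s k a * s k b - s k a * s k b * s k a) * e k ν)
        (D.dQt (ν.1 (lo a)) (ν.1 (hi a)) (x k (hi b)) (-x k (lo a)) (x k (hi a)) *
          (c k (lo a) * c k (hi b)) * e k ν)
  | braid_ne (a b : Fin (ht β - 1)) (ν : JSeq β) : (b : ℕ) = a + 1 →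
      ν.1 (lo a) ≠ ν.1 (hi b) → ν.1 (lo a) ≠ cJ (ν.1 (hi b)) →
      RelC D β ((s k b * s k a * s k b - s k a * s k b * s k a) * e k ν) 0

/-- The quiver Hecke--Clifford superalgebra `RC_β`. -/
def RC (D : Datum k I) (β : I →₀ ℕ) : Type (max u v) := RingQuot (RelC D β)

instance (D : Datum k I) (β : I →₀ ℕ) : Ring (RC D β) := inferInstanceAs (Ring (RingQuot _))
instance (D : Datum k I) (β : I →₀ ℕ) : Algebra k (RC D β) :=
  inferInstanceAs (Algebra k (RingQuot _))

namespace FreeR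
variable (k) {β : I →₀ ℕ}
/-- The free generator `e(ν)`. -/
def e (ν : ISeq β) : FreeAlgebra k (GenR β) := FreeAlgebra.ι k (.e ν)
/-- The free generator `x_p`. -/
def x (p : Fin (ht β)) : FreeAlgebra k (GenR β) := FreeAlgebra.ι k (.x p)
/-- The free generator `σ_a`. -/
def s (a : Fin (ht β - 1)) : FreeAlgebra k (GenR β) := FreeAlgebra.ι k (.s a)
end FreeR

open FreeR in
/-- The defining relations of `R_β`. -/
inductive RelR (D : Datum k I) (β : I →₀ ℕ) :
    FreeAlgebra k (GenR β) → FreeAlgebra k (GenR β) → Prop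
  | e_mul_self (ν : ISeq β) : RelR D β (e k ν * e k ν) (e k ν)
  | e_mul_ne (μ ν : ISeq β) : μ ≠ ν → RelR D β (e k μ * e k ν) 0
  | sum_e : RelR D β (∑ ν : ISeq β, e k ν) 1
  | x_e (p : Fin (ht β)) (ν : ISeq β) : RelR D β (x k p * e k ν) (e k ν * x k p)
  | x_x (p q : Fin (ht β)) : RelR D β (x k p * x k q) (x k q * x k p)
  | s_e (a : Fin (ht β - 1)) (ν : ISeq β) : RelR D β (s k a * e k ν) (e k (ν.swap a) * s k a)
  | s_x (a : Fin (ht β - 1)) (p : Fin (ht β)) : p ≠ lo a → p ≠ hi a →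
      RelR D β (s k a * x k p) (x k p * s k a)
  | s_hi_eq (a : Fin (ht β - 1)) (ν : ISeq β) : ν.1 (lo a) = ν.1 (hi a) →
      RelR D β ((s k a * x k (hi a) - x k (lo a) * s k a) * e k ν) (e k ν)
  | s_hi_ne (a : Fin (ht β - 1)) (ν : ISeq β) : ν.1 (lo a) ≠ ν.1 (hi a) →
      RelR D β ((s k a * x k (hi a) - x k (lo a) * s k a) * e k ν) 0
  | s_lo_eq (a : Fin (ht β - 1)) (ν : ISeq β) : ν.1 (lo a) = ν.1 (hi a) →
      RelR D β ((x k (hi a) * s k a - s k a * x k (lo a)) * e k ν) (e k ν)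
  | s_lo_ne (a : Fin (ht β - 1)) (ν : ISeq β) : ν.1 (lo a) ≠ ν.1 (hi a) →
      RelR D β ((x k (hi a) * s k a - s k a * x k (lo a)) * e k ν) 0
  | s_sq (a : Fin (ht β - 1)) (ν : ISeq β) :
      RelR D β (s k a * s k a * e k ν)
        (D.Q (ν.1 (lo a)) (ν.1 (hi a)) (x k (lo a)) (x k (hi a)) * e k ν)
  | s_s (a b : Fin (ht β - 1)) : (a : ℕ) + 1 < b → RelR D β (s k a * s k b) (s k b * s k a)
  | braid_eq (a b : Fin (ht β - 1)) (ν : ISeq β) : (b : ℕ) = a + 1 →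
      ν.1 (lo a) = ν.1 (hi b) →
      RelR D β ((s k b * s k a * s k b - s k a * s k b * s k a) * e k ν)
        (D.dQ (ν.1 (lo a)) (ν.1 (hi a)) (x k (hi b)) (x k (lo a)) (x k (hi a)) * e k ν)
  | braid_ne (a b : Fin (ht β - 1)) (ν : ISeq β) : (b : ℕ) = a + 1 →
      ν.1 (lo a) ≠ ν.1 (hi b) →
      RelR D β ((s k b * s k a * s k b - s k a * s k b * s k a) * e k ν) 0

/-- The quiver Hecke algebra `R_β`. -/
def KLR (D : Datum k I) (β : I →₀ ℕ) : Type (max u v) := RingQuot (RelR D β)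

instance (D : Datum k I) (β : I →₀ ℕ) : Ring (KLR D β) := inferInstanceAs (Ring (RingQuot _))
instance (D : Datum k I) (β : I →₀ ℕ) : Algebra k (KLR D β) :=
  inferInstanceAs (Algebra k (RingQuot _))

end Algebras

/-! ### Helper facts on polynomials in commuting elements -/

section PolyFacts

variable {k : Type u} [Field k] {B : Type w} [Ring B] [Algebra k B]

theorem sgn_mul_self (p : ZMod 2) : sgn k p * sgn k p = 1 := by
  unfold sgn; split_ifs <;> simp

theorem sgn_one_sub (p : ZMod 2) : sgn k (1 - p) = -sgn k p := by
  have h : p = 0 ∨ p = 1 := by decide +revert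
  rcases h with rfl | rfl <;> simp [sgn]

theorem map_polyEval {C : Type w₁} [Ring C] [Algebra k C] (φ : C →ₐ[k] B) (c : ℕ → ℕ → k)
    (d₁ d₂ : ℕ) (X Y : C) : φ (polyEval c d₁ d₂ X Y) = polyEval c d₁ d₂ (φ X) (φ Y) := by
  simp [polyEval]

theorem map_polyDiff {C : Type w₁} [Ring C] [Algebra k C] (φ : C →ₐ[k] B) (c : ℕ → ℕ → k)
    (d₁ d₂ : ℕ) (W X Y : C) :
    φ (polyDiff c d₁ d₂ W X Y) = polyDiff c d₁ d₂ (φ W) (φ X) (φ Y) := by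
  simp [polyDiff]

open scoped IsMulCommutative in
theorem exists_hom {n : ℕ} (f : Fin n → B) (h : ∀ i j, f i * f j = f j * f i) :
    ∃ φ : MvPolynomial (Fin n) k →ₐ[k] B, ∀ i, φ (MvPolynomial.X i) = f i := by
  have : IsMulCommutative (Algebra.adjoin k (Set.range f)) :=
    Algebra.isMulCommutative_adjoin k (by rintro _ ⟨i, rfl⟩ _ ⟨j, rfl⟩; exact h i j)
  refine ⟨(Algebra.adjoin k (Set.range f)).val.comp (MvPolynomial.aeval
    fun i => (⟨f i, Algebra.subset_adjoin ⟨i, rfl⟩⟩ : Algebra.adjoin k (Set.range f))), ?_⟩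
  intro i
  simp

theorem pow_mul_of_mul {X X' e : B} (h : X * e = X' * e) (hc : Commute X' e) (r : ℕ) :
    X ^ r * e = X' ^ r * e := by
  induction r with
  | zero => simp
  | succ r ih =>
    rw [pow_succ, mul_assoc, h, hc.eq, ← mul_assoc, ih, mul_assoc, ← hc.eq, ← mul_assoc,
      ← pow_succ]

theorem pow_mul_pow_mul {X X' Y Y' e : B} (hX : X * e = X' * e) (hX' : Commute X' e)
    (hY : Y * e = Y' * e) (hY' : Commute Y' e) (r s : ℕ) :
    X ^ r * Y ^ s * e = X' ^ r * Y' ^ s * e := by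
  rw [mul_assoc, pow_mul_of_mul hY hY', (hY'.pow_left s).eq, ← mul_assoc,
    pow_mul_of_mul hX hX', mul_assoc, ← (hY'.pow_left s).eq, ← mul_assoc]

theorem polyEval_mul {X X' Y Y' e : B} (hX : X * e = X' * e) (hX' : Commute X' e)
    (hY : Y * e = Y' * e) (hY' : Commute Y' e) (c : ℕ → ℕ → k) (d₁ d₂ : ℕ) :
    polyEval c d₁ d₂ X Y * e = polyEval c d₁ d₂ X' Y' * e := by
  simp only [polyEval, Finset.sum_mul, smul_mul_assoc, pow_mul_pow_mul hX hX' hY hY']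

theorem polyDiff_mul' {W W' X X' Y Y' e : B} (hW : W * e = W' * e) (hW' : Commute W' e)
    (hX : X * e = X' * e) (hX' : Commute X' e)
    (hY : Y * e = Y' * e) (hY' : Commute Y' e) (c : ℕ → ℕ → k) (d₁ d₂ : ℕ) :
    polyDiff c d₁ d₂ W X Y * e = polyDiff c d₁ d₂ W' X' Y' * e := by
  have key : ∀ i j s : ℕ, W ^ i * X ^ j * Y ^ s * e = W' ^ i * X' ^ j * Y' ^ s * e := by
    intro i j s
    rw [mul_assoc, pow_mul_of_mul hY hY', (hY'.pow_left s).eq, ← mul_assoc,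
      pow_mul_pow_mul hW hW' hX hX', mul_assoc, ← (hY'.pow_left s).eq, ← mul_assoc]
  simp only [polyDiff, Finset.sum_mul, smul_mul_assoc, key]

namespace Datum

variable {I : Type v} (D : Datum k I)

theorem map_Q {C : Type w₁} [Ring C] [Algebra k C] (φ : C →ₐ[k] B) (i j : I) (X Y : C) :
    φ (D.Q i j X Y) = D.Q i j (φ X) (φ Y) := map_polyEval φ _ _ _ X Y

theorem map_dQ {C : Type w₁} [Ring C] [Algebra k C] (φ : C →ₐ[k] B) (i j : I) (W X Y : C) :
    φ (D.dQ i j W X Y) = D.dQ i j (φ W) (φ X) (φ Y) := map_polyDiff φ _ _ _ W X Y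

theorem map_Qt {C : Type w₁} [Ring C] [Algebra k C] (φ : C →ₐ[k] B) (μ η : I × ZMod 2)
    (X Y : C) : φ (D.Qt μ η X Y) = D.Qt μ η (φ X) (φ Y) := map_polyEval φ _ _ _ X Y

theorem map_dQt {C : Type w₁} [Ring C] [Algebra k C] (φ : C →ₐ[k] B) (μ η : I × ZMod 2)
    (W X Y : C) : φ (D.dQt μ η W X Y) = D.dQt μ η (φ W) (φ X) (φ Y) :=
  map_polyDiff φ _ _ _ W X Y

theorem qt_zero (i j : I) : D.qt (i, 0) (j, 0) = D.q i j := by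
  funext r s; simp [qt, sgn]

theorem Qt_zero (i j : I) (X Y : B) : D.Qt (i, 0) (j, 0) X Y = D.Q i j X Y := by
  rw [Qt, Q, qt_zero]

theorem dQt_zero (i j : I) (W X Y : B) : D.dQt (i, 0) (j, 0) W X Y = D.dQ i j W X Y := by
  rw [dQt, dQ, qt_zero]

variable [D.IsSymmetric]

theorem Qt_shift_aux {C : Type w} [CommRing C] [Algebra k C] (μ η : I × ZMod 2) (X Y z : C) :
    D.Qt μ η (X + sgn k μ.2 • z) (Y + sgn k η.2 • z) = D.Qt μ η X Y := by
  obtain ⟨p, hp⟩ := IsSymmetric.poly (D := D) μ η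
  have key : ∀ X Y : C, D.Qt μ η X Y = Polynomial.aeval (sgn k μ.2 • X - sgn k η.2 • Y) p := by
    intro X Y
    have := congrArg (MvPolynomial.aeval (R := k) ![X, Y]) hp
    rw [D.map_Qt] at this
    simpa [← Polynomial.aeval_algHom_apply] using this
  rw [key, key]
  congr 2
  simp only [smul_add, smul_smul, sgn_mul_self, one_smul]
  ring

theorem Qt_shift (μ η : I × ZMod 2) (X Y z : B) (h₁ : Commute X Y) (h₂ : Commute X z)
    (h₃ : Commute Y z) :
    D.Qt μ η (X + sgn k μ.2 • z) (Y + sgn k η.2 • z) = D.Qt μ η X Y := by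
  obtain ⟨φ, hφ⟩ := exists_hom (k := k) ![X, Y, z] (by
    intro i j
    fin_cases i <;> fin_cases j <;>
      simp [h₁.eq, h₂.eq, h₃.eq])
  have h0 : φ (MvPolynomial.X 0) = X := hφ 0
  have h1 : φ (MvPolynomial.X 1) = Y := hφ 1
  have h2 : φ (MvPolynomial.X 2) = z := hφ 2
  have := congrArg φ (D.Qt_shift_aux μ η (MvPolynomial.X 0 : MvPolynomial (Fin 3) k)
    (MvPolynomial.X 1) (MvPolynomial.X 2))
  simpa only [D.map_Qt, map_add, map_smul, h0, h1, h2] using this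

theorem dQt_shift (μ η : I × ZMod 2) (W X Y z : B) (h₁ : Commute W X) (h₂ : Commute W Y)
    (h₃ : Commute X Y) (h₄ : Commute W z) (h₅ : Commute X z) (h₆ : Commute Y z) :
    D.dQt μ η (W + sgn k μ.2 • z) (X + sgn k μ.2 • z) (Y + sgn k η.2 • z) =
      D.dQt μ η W X Y := by
  obtain ⟨φ, hφ⟩ := exists_hom (k := k) ![W, X, Y, z] (by
    intro i j
    fin_cases i <;> fin_cases j <;>
      simp [h₁.eq, h₂.eq, h₃.eq, h₄.eq, h₅.eq, h₆.eq])
  have h0 : φ (MvPolynomial.X 0) = W := hφ 0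
  have h1 : φ (MvPolynomial.X 1) = X := hφ 1
  have h2 : φ (MvPolynomial.X 2) = Y := hφ 2
  have h3 : φ (MvPolynomial.X 3) = z := hφ 3
  let x (i : Fin 4) : MvPolynomial (Fin 4) k := MvPolynomial.X i
  have key : D.dQt μ η (x 0 + sgn k μ.2 • x 3) (x 1 + sgn k μ.2 • x 3)
      (x 2 + sgn k η.2 • x 3) = D.dQt μ η (x 0) (x 1) (x 2) := by
    have hne : x 0 - x 1 ≠ 0 := by
      rw [sub_ne_zero]
      intro h
      exact absurd (MvPolynomial.X_injective h) (by decide)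
    apply mul_right_cancel₀ hne
    have e1 := polyDiff_mul (D.qt μ η) (-D.A μ.1 η.1).toNat (-D.A η.1 μ.1).toNat
      (x 0 + sgn k μ.2 • x 3) (x 1 + sgn k μ.2 • x 3) (x 2 + sgn k η.2 • x 3)
    have e2 := polyDiff_mul (D.qt μ η) (-D.A μ.1 η.1).toNat (-D.A η.1 μ.1).toNat
      (x 0) (x 1) (x 2)
    have e3 := D.Qt_shift_aux μ η (x 0) (x 2) (x 3)
    have e4 := D.Qt_shift_aux μ η (x 1) (x 2) (x 3)
    rw [add_sub_add_right_eq_sub] at e1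
    unfold dQt
    unfold Qt at e3 e4
    rw [e1, e2, e3, e4]
  have := congrArg φ key
  simpa only [x, D.map_dQt, map_add, map_smul, h0, h1, h2, h3] using this

theorem Q_shift (i j : I) (X Y z : B) (h₁ : Commute X Y) (h₂ : Commute X z)
    (h₃ : Commute Y z) : D.Q i j (X + z) (Y + z) = D.Q i j X Y := by
  simpa [Qt_zero, sgn] using D.Qt_shift (i, 0) (j, 0) X Y z h₁ h₂ h₃

theorem dQ_shift (i j : I) (W X Y z : B) (h₁ : Commute W X) (h₂ : Commute W Y)
    (h₃ : Commute X Y) (h₄ : Commute W z) (h₅ : Commute X z) (h₆ : Commute Y z) :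
    D.dQ i j (W + z) (X + z) (Y + z) = D.dQ i j W X Y := by
  simpa [dQt_zero, sgn] using D.dQt_shift (i, 0) (j, 0) W X Y z h₁ h₂ h₃ h₄ h₅ h₆

end Datum

end PolyFacts

/-! ### Generators, relations, and shifts of the polynomial generators -/

section Algebras

variable {k : Type u} [Field k] {I : Type v}

namespace RC

variable (D : Datum k I) {β : I →₀ ℕ}

/-- The quotient map. -/
def π (β : I →₀ ℕ) : FreeAlgebra k (GenC β) →ₐ[k] RC D β := RingQuot.mkAlgHom k (RelC D β)

/-- The generators of `RC_β`. -/
def gen (g : GenC β) : RC D β := π D β (FreeAlgebra.ι k g)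

/-- The idempotent `e(ν)`. -/
def e (ν : JSeq β) : RC D β := gen D (.e ν)
/-- The generator `x_p`. -/
def x (p : Fin (ht β)) : RC D β := gen D (.x p)
/-- The generator `σ_a`. -/
def s (a : Fin (ht β - 1)) : RC D β := gen D (.s a)
/-- The generator `𝔠_p`. -/
def c (p : Fin (ht β)) : RC D β := gen D (.c p)

@[simp] theorem π_e (ν : JSeq β) : π D β (FreeC.e k ν) = e D ν := rfl
@[simp] theorem π_x (p : Fin (ht β)) : π D β (FreeC.x k p) = x D p := rfl
@[simp] theorem π_s (a : Fin (ht β - 1)) : π D β (FreeC.s k a) = s D a := rfl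
@[simp] theorem π_c (p : Fin (ht β)) : π D β (FreeC.c k p) = c D p := rfl

variable {D}

theorem π_rel {a b : FreeAlgebra k (GenC β)} (h : RelC D β a b) : π D β a = π D β b :=
  RingQuot.mkAlgHom_rel k h

/-- The homomorphism out of `RC_β` with given values on generators that satisfy the relations. -/
def lift {B : Type w} [Ring B] [Algebra k B] (f : GenC β → B)
    (h : ∀ a b, RelC D β a b → FreeAlgebra.lift k f a = FreeAlgebra.lift k f b) :
    RC D β →ₐ[k] B :=
  RingQuot.liftAlgHom k ⟨FreeAlgebra.lift k f, fun a b => h a b⟩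

theorem lift_gen {B : Type w} [Ring B] [Algebra k B] (f : GenC β → B)
    (h : ∀ a b, RelC D β a b → FreeAlgebra.lift k f a = FreeAlgebra.lift k f b) (g : GenC β) :
    lift f h (gen D g) = f g := by
  refine (RingQuot.liftAlgHom_mkAlgHom_apply k _ _ _).trans ?_
  exact FreeAlgebra.lift_ι_apply f g

@[elab_as_elim]
theorem induction {P : RC D β → Prop} (h0 : ∀ r, P (algebraMap k _ r)) (hg : ∀ g, P (gen D g))
    (hm : ∀ a b, P a → P b → P (a * b)) (ha : ∀ a b, P a → P b → P (a + b)) (a : RC D β) : P a := by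
  obtain ⟨a, rfl⟩ : ∃ b, π D β b = a := RingQuot.mkAlgHom_surjective k (RelC D β) a
  induction a with
  | grade0 r => rw [AlgHom.commutes]; exact h0 r
  | grade1 g => exact hg g
  | mul a b iha ihb => rw [map_mul]; exact hm _ _ iha ihb
  | add a b iha ihb => rw [map_add]; exact ha _ _ iha ihb

/-- A linear map that commutes with the generators of `RC_β` is `RC_β`-linear. -/
def linOfGen {V : Type w₁} {W : Type w₂} [AddCommGroup V] [Module k V] [Module (RC D β) V]
    [IsScalarTower k (RC D β) V] [AddCommGroup W] [Module k W] [Module (RC D β) W]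
    [IsScalarTower k (RC D β) W] (f : V →ₗ[k] W)
    (h : ∀ (g : GenC β) (v : V), f (gen D g • v) = gen D g • f v) : V →ₗ[RC D β] W where
  toFun := f
  map_add' := f.map_add
  map_smul' a := by
    induction a using RC.induction with
    | h0 r => intro v; simp
    | hg g => exact h g
    | hm a b iha ihb =>
      intro v
      simp only [RingHom.id_apply] at *
      rw [mul_smul, iha, ihb, mul_smul]
    | ha a b iha ihb =>
      intro v
      simp only [RingHom.id_apply] at *
      rw [add_smul, map_add, iha, ihb, add_smul]

theorem e_mul_self (ν : JSeq β) : e D ν * e D ν = e D ν := by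
  simpa using π_rel (RelC.e_mul_self (D := D) ν)
theorem e_mul_ne {μ ν : JSeq β} (h : μ ≠ ν) : e D μ * e D ν = 0 := by
  simpa using π_rel (RelC.e_mul_ne (D := D) μ ν h)
theorem sum_e : ∑ ν : JSeq β, e D ν = 1 := by
  simpa using π_rel (RelC.sum_e (D := D) (β := β))
theorem x_e (p : Fin (ht β)) (ν : JSeq β) : x D p * e D ν = e D ν * x D p := by
  simpa using π_rel (RelC.x_e (D := D) p ν)
theorem c_e (p : Fin (ht β)) (ν : JSeq β) : c D p * e D ν = e D (ν.flip p) * c D p := by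
  simpa using π_rel (RelC.c_e (D := D) p ν)
theorem x_x (p q : Fin (ht β)) : x D p * x D q = x D q * x D p := by
  simpa using π_rel (RelC.x_x (D := D) p q)
theorem s_e (a : Fin (ht β - 1)) (ν : JSeq β) : s D a * e D ν = e D (ν.swap a) * s D a := by
  simpa using π_rel (RelC.s_e (D := D) a ν)

/-- `∑_ν (-1)^{π₂(ν_p)} e(ν)`. -/
def sg (D : Datum k I) (p : Fin (ht β)) : RC D β := ∑ ν : JSeq β, sgn k (ν.1 p).2 • e D ν

theorem sum_smul_mul_e (f : JSeq β → k) (ν : JSeq β) :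
    (∑ μ : JSeq β, f μ • e D μ) * e D ν = f ν • e D ν := by
  classical
  rw [Finset.sum_mul, Finset.sum_eq_single ν]
  · rw [smul_mul_assoc, e_mul_self]
  · intro μ _ h
    rw [smul_mul_assoc, e_mul_ne h, smul_zero]
  · simp

theorem e_mul_sum_smul (f : JSeq β → k) (ν : JSeq β) :
    e D ν * (∑ μ : JSeq β, f μ • e D μ) = f ν • e D ν := by
  classical
  rw [Finset.mul_sum, Finset.sum_eq_single ν]
  · rw [mul_smul_comm, e_mul_self]
  · intro μ _ h
    rw [mul_smul_comm, e_mul_ne h.symm, smul_zero]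
  · simp

theorem sg_mul_e (p : Fin (ht β)) (ν : JSeq β) : sg D p * e D ν = sgn k (ν.1 p).2 • e D ν :=
  sum_smul_mul_e _ ν

theorem e_mul_sg (p : Fin (ht β)) (ν : JSeq β) : e D ν * sg D p = sgn k (ν.1 p).2 • e D ν :=
  e_mul_sum_smul _ ν

theorem ext_e {B : Type w} [Ring B] [Algebra k B] (ι : RC D β →ₐ[k] B) {a b : B}
    (h : ∀ ν, a * ι (e D ν) = b * ι (e D ν)) : a = b := by
  have : ∀ a : B, a = ∑ ν : JSeq β, a * ι (e D ν) := by
    intro a; rw [← Finset.mul_sum, ← map_sum, sum_e, map_one, mul_one]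
  rw [this a, this b]
  exact Finset.sum_congr rfl fun ν _ => h ν

theorem sg_sg (p q : Fin (ht β)) : sg D p * sg D q = sg D q * sg D p := by
  refine ext_e (AlgHom.id k _) fun ν => ?_
  simp only [AlgHom.coe_id, id, mul_assoc, sg_mul_e, mul_smul_comm, smul_smul, mul_comm]

theorem x_sg (p q : Fin (ht β)) : x D p * sg D q = sg D q * x D p := by
  simp only [sg, Finset.mul_sum, Finset.sum_mul, mul_smul_comm, smul_mul_assoc, x_e]

theorem c_sg_self (p : Fin (ht β)) : c D p * sg D p = -(sg D p * c D p) := by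
  refine ext_e (AlgHom.id k _) fun ν => ?_
  simp only [AlgHom.coe_id, id, mul_assoc, sg_mul_e, mul_smul_comm, c_e, neg_mul]
  rw [← mul_assoc, sg_mul_e, smul_mul_assoc]
  simp [JSeq.flip, cJ, sgn_one_sub]

theorem c_sg {p q : Fin (ht β)} (h : p ≠ q) : c D p * sg D q = sg D q * c D p := by
  refine ext_e (AlgHom.id k _) fun ν => ?_
  simp only [AlgHom.coe_id, id, mul_assoc, sg_mul_e, mul_smul_comm, c_e]
  rw [← mul_assoc, sg_mul_e, smul_mul_assoc]
  simp [JSeq.flip, h.symm]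

theorem s_sg (a : Fin (ht β - 1)) (p : Fin (ht β)) :
    s D a * sg D p = sg D (Equiv.swap (lo a) (hi a) p) * s D a := by
  refine ext_e (AlgHom.id k _) fun ν => ?_
  simp only [AlgHom.coe_id, id, mul_assoc, sg_mul_e, mul_smul_comm, s_e]
  rw [← mul_assoc, sg_mul_e, smul_mul_assoc]
  simp [JSeq.swap]

section Shift

variable {B : Type w} [Ring B] [Algebra k B] (ι : RC D β →ₐ[k] B) (z : B)

/-- `e(ν) ↦ e(ν)`, `x_p ↦ x_p + ∑_ν (-1)^{π₂(ν_p)} z e(ν)`, `σ_a ↦ σ_a`, `𝔠_p ↦ 𝔠_p`. -/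
def shiftGen : GenC β → B
  | .e ν => ι (e D ν)
  | .x p => ι (x D p) + z * ι (sg D p)
  | .s a => ι (s D a)
  | .c p => ι (c D p)

variable {z}

theorem shift_mul_e (p : Fin (ht β)) (ν : JSeq β) :
    (ι (x D p) + z * ι (sg D p)) * ι (e D ν) =
      (ι (x D p) + sgn k (ν.1 p).2 • z) * ι (e D ν) := by
  rw [add_mul, add_mul, mul_assoc z, ← map_mul, ← map_mul, sg_mul_e, map_smul, mul_smul_comm,
    smul_mul_assoc]

theorem commute_shift (hz : ∀ a, z * ι a = ι a * z) (p : Fin (ht β)) (t : k) (ν : JSeq β) :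
    Commute (ι (x D p) + t • z) (ι (e D ν)) := by
  refine Commute.add_left ?_ (Commute.smul_left (hz _) t)
  rw [Commute, SemiconjBy, ← map_mul, ← map_mul, x_e]

theorem s_shift (hz : ∀ a, z * ι a = ι a * z) (a : Fin (ht β - 1)) (p : Fin (ht β)) :
    ι (s D a) * (z * ι (sg D p)) = z * ι (sg D (Equiv.swap (lo a) (hi a) p)) * ι (s D a) := by
  rw [← mul_assoc, ← hz, mul_assoc, mul_assoc, ← map_mul, ← map_mul, s_sg]

variable [D.IsSymmetric]

theorem shiftGen_rel (hz : ∀ a, z * ι a = ι a * z) (a b : FreeAlgebra k (GenC β)) (h : RelC D β a b) :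
    FreeAlgebra.lift k (shiftGen ι z) a = FreeAlgebra.lift k (shiftGen ι z) b := by
  have Le : ∀ ν, FreeAlgebra.lift k (shiftGen ι z) (FreeC.e k ν) = ι (e D ν) := fun ν =>
    FreeAlgebra.lift_ι_apply _ _
  have Lx : ∀ p, FreeAlgebra.lift k (shiftGen ι z) (FreeC.x k p) = ι (x D p) + z * ι (sg D p) :=
    fun p => FreeAlgebra.lift_ι_apply _ _
  have Ls : ∀ a, FreeAlgebra.lift k (shiftGen ι z) (FreeC.s k a) = ι (s D a) := fun a =>
    FreeAlgebra.lift_ι_apply _ _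
  have Lc : ∀ p, FreeAlgebra.lift k (shiftGen ι z) (FreeC.c k p) = ι (c D p) := fun p =>
    FreeAlgebra.lift_ι_apply _ _
  have E := congrArg ι (π_rel h)
  have hxx : ∀ p q, Commute (ι (x D p)) (ι (x D q)) := fun p q => by
    rw [Commute, SemiconjBy, ← map_mul, ← map_mul, x_x]
  have hxz : ∀ p, Commute (ι (x D p)) z := fun p => (hz _).symm
  have hhi : ∀ a, ι (s D a) * (ι (x D (hi a)) + z * ι (sg D (hi a))) -
      (ι (x D (lo a)) + z * ι (sg D (lo a))) * ι (s D a) =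
      ι (s D a) * ι (x D (hi a)) - ι (x D (lo a)) * ι (s D a) := by
    intro a
    rw [mul_add, add_mul, s_shift ι hz, Equiv.swap_apply_right]
    abel
  have hlo : ∀ a, (ι (x D (hi a)) + z * ι (sg D (hi a))) * ι (s D a) -
      ι (s D a) * (ι (x D (lo a)) + z * ι (sg D (lo a))) =
      ι (x D (hi a)) * ι (s D a) - ι (s D a) * ι (x D (lo a)) := by
    intro a
    rw [mul_add, add_mul, s_shift ι hz, Equiv.swap_apply_left]
    abel
  cases h
  case x_e p ν =>
    simp only [map_mul, Le, Lx, π_e, π_x] at E ⊢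
    have h1 : ι (sg D p) * ι (e D ν) = ι (e D ν) * ι (sg D p) := by
      rw [← map_mul, ← map_mul, sg_mul_e, e_mul_sg]
    rw [add_mul, mul_add, E, mul_assoc, ← mul_assoc _ z, ← hz, mul_assoc, h1]
  case x_x p q =>
    simp only [map_mul, Lx]
    have h1 : ∀ p q, Commute (ι (x D p)) (z * ι (sg D q)) := fun p q =>
      (hxz p).mul_right (by rw [Commute, SemiconjBy, ← map_mul, ← map_mul, x_sg])
    have h2 : Commute (z * ι (sg D p)) (z * ι (sg D q)) := by
      refine Commute.mul_left (Commute.mul_right rfl (hz _)) (Commute.mul_right (hz _).symm ?_)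
      rw [Commute, SemiconjBy, ← map_mul, ← map_mul, sg_sg]
    exact ((hxx p q).add_right (h1 p q)).add_left ((h1 q p).symm.add_right h2)
  case c_x_self p =>
    simp only [map_mul, map_neg, Lx, Lc, π_c, π_x] at E ⊢
    have h1 : ι (c D p) * ι (sg D p) = -(ι (sg D p) * ι (c D p)) := by
      rw [← map_mul, ← map_mul, c_sg_self, map_neg]
    rw [add_mul, mul_add, E, ← mul_assoc, ← hz, mul_assoc, mul_assoc, h1, mul_neg, neg_add]
  case c_x p q hpq =>
    simp only [map_mul, Lx, Lc, π_c, π_x] at E ⊢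
    have h1 : ι (c D p) * ι (sg D q) = ι (sg D q) * ι (c D p) := by
      rw [← map_mul, ← map_mul, c_sg hpq]
    rw [add_mul, mul_add, E, ← mul_assoc, ← hz, mul_assoc, mul_assoc, h1]
  case s_x a p h1 h2 =>
    simp only [map_mul, Lx, Ls, π_s, π_x] at E ⊢
    rw [add_mul, mul_add, E, s_shift ι hz, Equiv.swap_apply_of_ne_of_ne h1 h2]
  case s_sq a ν =>
    simp only [map_mul, D.map_Qt, Le, Lx, Ls, π_e, π_x, π_s] at E ⊢
    rw [E]
    unfold Datum.Qt
    rw [polyEval_mul (shift_mul_e ι _ ν) (commute_shift ι hz _ _ ν)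
      (shift_mul_e ι _ ν) (commute_shift ι hz _ _ ν)]
    congr 1
    exact (D.Qt_shift _ _ _ _ z (hxx _ _) (hxz _) (hxz _)).symm
  case braid_eq a b ν hab hν =>
    simp only [map_mul, map_sub, D.map_dQt, Le, Lx, Ls, π_e, π_x, π_s] at E ⊢
    rw [E]
    unfold Datum.dQt
    rw [polyDiff_mul' (shift_mul_e ι _ ν) (commute_shift ι hz _ _ ν)
      (shift_mul_e ι _ ν) (commute_shift ι hz _ _ ν)
      (shift_mul_e ι _ ν) (commute_shift ι hz _ _ ν), ← hν]
    congr 1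
    exact (D.dQt_shift _ _ _ _ _ z (hxx _ _) (hxx _ _) (hxx _ _) (hxz _) (hxz _) (hxz _)).symm
  case braid_conj a b ν hab hν =>
    simp only [map_mul, map_sub, map_neg, D.map_dQt, Le, Lx, Ls, Lc, π_e, π_x, π_s, π_c] at E ⊢
    rw [E]
    have hne1 : lo a ≠ hi b := by simp only [lo, hi, ne_eq, Fin.mk.injEq]; omega
    have hne2 : hi a ≠ hi b := by simp only [hi, ne_eq, Fin.mk.injEq]; omega
    have hne3 : hi a ≠ lo a := by simp only [lo, hi, ne_eq, Fin.mk.injEq]; omega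
    set μ : JSeq β := (ν.flip (hi b)).flip (lo a) with hμ
    have h1 : μ.1 (lo a) = cJ (ν.1 (lo a)) := by simp [hμ, JSeq.flip, hne1]
    have h2 : μ.1 (hi b) = cJ (ν.1 (hi b)) := by simp [hμ, JSeq.flip, hne1.symm]
    have h3 : μ.1 (hi a) = ν.1 (hi a) := by simp [hμ, JSeq.flip, hne2, hne3]
    have hcc : ι (c D (lo a)) * ι (c D (hi b)) * ι (e D ν) =
        ι (e D μ) * (ι (c D (lo a)) * ι (c D (hi b))) := by
      simp only [← map_mul]
      rw [mul_assoc, c_e, ← mul_assoc, c_e, mul_assoc]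
    have hP : ∀ P : B, P * (ι (c D (lo a)) * ι (c D (hi b))) * ι (e D ν) =
        P * ι (e D μ) * (ι (c D (lo a)) * ι (c D (hi b))) := fun P => by
      rw [mul_assoc, hcc, ← mul_assoc]
    rw [hP, hP]
    congr 1
    have hx : -(ι (x D (lo a)) + z * ι (sg D (lo a))) * ι (e D μ) =
        (-ι (x D (lo a)) + sgn k (ν.1 (lo a)).2 • z) * ι (e D μ) := by
      rw [neg_mul, shift_mul_e ι, ← neg_mul, neg_add, h1]
      simp [cJ, sgn_one_sub]
    have hx' : Commute (-ι (x D (lo a)) + sgn k (ν.1 (lo a)).2 • z) (ι (e D μ)) := by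
      have := (commute_shift ι hz (lo a) (-sgn k (ν.1 (lo a)).2) μ).neg_left
      rwa [neg_add, neg_smul, neg_neg] at this
    have hs : sgn k (μ.1 (hi b)).2 = sgn k (ν.1 (lo a)).2 := by
      rw [h2, hν]
    have hy := shift_mul_e ι (z := z) (hi a) μ
    have hw := shift_mul_e ι (z := z) (hi b) μ
    rw [h3] at hy
    rw [hs] at hw
    unfold Datum.dQt
    rw [polyDiff_mul' hw (commute_shift ι hz _ _ μ) hx hx' hy (commute_shift ι hz _ _ μ)]
    congr 1
    exact (D.dQt_shift _ _ _ _ _ z (hxx _ _).neg_right (hxx _ _) (hxx _ _).neg_left (hxz _)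
      (hxz _).neg_left (hxz _)).symm
  all_goals
    simp only [map_mul, map_sub, map_neg, map_sum, map_one, map_zero, Le, Lx, Ls, Lc, hhi, hlo,
      π_e, π_x, π_s, π_c] at E ⊢
    exact E

/-- The homomorphism `e(ν) ↦ e(ν)`, `x_p e(ν) ↦ (x_p + (-1)^{π₂(ν_p)} z) e(ν)`, `σ_a ↦ σ_a`,
`𝔠_p ↦ 𝔠_p`, where `z` is central. -/
def shift (hz : ∀ a, z * ι a = ι a * z) : RC D β →ₐ[k] B := lift (shiftGen ι z) (shiftGen_rel ι hz)

theorem shift_gen (hz : ∀ a, z * ι a = ι a * z) (g : GenC β) : shift ι hz (gen D g) = shiftGen ι z g := lift_gen _ _ g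

end Shift

end RC


namespace KLR

variable (D : Datum k I) {β : I →₀ ℕ}

/-- The quotient map. -/
def π (β : I →₀ ℕ) : FreeAlgebra k (GenR β) →ₐ[k] KLR D β := RingQuot.mkAlgHom k (RelR D β)

/-- The generators of `R_β`. -/
def gen (g : GenR β) : KLR D β := π D β (FreeAlgebra.ι k g)

/-- The idempotent `e(ν)`. -/
def e (ν : ISeq β) : KLR D β := gen D (.e ν)
/-- The generator `x_p`. -/
def x (p : Fin (ht β)) : KLR D β := gen D (.x p)
/-- The generator `σ_a`. -/
def s (a : Fin (ht β - 1)) : KLR D β := gen D (.s a)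

@[simp] theorem π_e (ν : ISeq β) : π D β (FreeR.e k ν) = e D ν := rfl
@[simp] theorem π_x (p : Fin (ht β)) : π D β (FreeR.x k p) = x D p := rfl
@[simp] theorem π_s (a : Fin (ht β - 1)) : π D β (FreeR.s k a) = s D a := rfl

variable {D}

theorem π_rel {a b : FreeAlgebra k (GenR β)} (h : RelR D β a b) : π D β a = π D β b :=
  RingQuot.mkAlgHom_rel k h

/-- The homomorphism out of `R_β` with given values on generators that satisfy the relations. -/
def lift {B : Type w} [Ring B] [Algebra k B] (f : GenR β → B)
    (h : ∀ a b, RelR D β a b → FreeAlgebra.lift k f a = FreeAlgebra.lift k f b) :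
    KLR D β →ₐ[k] B :=
  RingQuot.liftAlgHom k ⟨FreeAlgebra.lift k f, fun a b => h a b⟩

theorem lift_gen {B : Type w} [Ring B] [Algebra k B] (f : GenR β → B)
    (h : ∀ a b, RelR D β a b → FreeAlgebra.lift k f a = FreeAlgebra.lift k f b) (g : GenR β) :
    lift f h (gen D g) = f g := by
  refine (RingQuot.liftAlgHom_mkAlgHom_apply k _ _ _).trans ?_
  exact FreeAlgebra.lift_ι_apply f g

@[elab_as_elim]
theorem induction {P : KLR D β → Prop} (h0 : ∀ r, P (algebraMap k _ r)) (hg : ∀ g, P (gen D g))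
    (hm : ∀ a b, P a → P b → P (a * b)) (ha : ∀ a b, P a → P b → P (a + b)) (a : KLR D β) :
    P a := by
  obtain ⟨a, rfl⟩ : ∃ b, π D β b = a := RingQuot.mkAlgHom_surjective k (RelR D β) a
  induction a with
  | grade0 r => rw [AlgHom.commutes]; exact h0 r
  | grade1 g => exact hg g
  | mul a b iha ihb => rw [map_mul]; exact hm _ _ iha ihb
  | add a b iha ihb => rw [map_add]; exact ha _ _ iha ihb

/-- A linear map that commutes with the generators of `R_β` is `R_β`-linear. -/
def linOfGen {V : Type w₁} {W : Type w₂} [AddCommGroup V] [Module k V] [Module (KLR D β) V]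
    [IsScalarTower k (KLR D β) V] [AddCommGroup W] [Module k W] [Module (KLR D β) W]
    [IsScalarTower k (KLR D β) W] (f : V →ₗ[k] W)
    (h : ∀ (g : GenR β) (v : V), f (gen D g • v) = gen D g • f v) : V →ₗ[KLR D β] W where
  toFun := f
  map_add' := f.map_add
  map_smul' a := by
    induction a using KLR.induction with
    | h0 r => intro v; simp
    | hg g => exact h g
    | hm a b iha ihb =>
      intro v
      simp only [RingHom.id_apply] at *
      rw [mul_smul, iha, ihb, mul_smul]
    | ha a b iha ihb =>
      intro v
      simp only [RingHom.id_apply] at *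
      rw [add_smul, map_add, iha, ihb, add_smul]

theorem e_mul_self (ν : ISeq β) : e D ν * e D ν = e D ν := by
  simpa using π_rel (RelR.e_mul_self (D := D) ν)
theorem sum_e : ∑ ν : ISeq β, e D ν = 1 := by
  simpa using π_rel (RelR.sum_e (D := D) (β := β))
theorem x_x (p q : Fin (ht β)) : x D p * x D q = x D q * x D p := by
  simpa using π_rel (RelR.x_x (D := D) p q)

section Shift

variable [D.IsSymmetric] {B : Type w} [Ring B] [Algebra k B] (ι : KLR D β →ₐ[k] B) (z : B)

/-- `e(ν) ↦ e(ν)`, `x_p ↦ x_p + z`, `σ_a ↦ σ_a`. -/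
def shiftGen : GenR β → B
  | .e ν => ι (e D ν)
  | .x p => ι (x D p) + z
  | .s a => ι (s D a)

variable {z}

theorem shiftGen_rel (hz : ∀ a, z * ι a = ι a * z) (a b : FreeAlgebra k (GenR β)) (h : RelR D β a b) :
    FreeAlgebra.lift k (shiftGen ι z) a = FreeAlgebra.lift k (shiftGen ι z) b := by
  have Le : ∀ ν, FreeAlgebra.lift k (shiftGen ι z) (FreeR.e k ν) = ι (e D ν) := fun ν =>
    FreeAlgebra.lift_ι_apply _ _
  have Lx : ∀ p, FreeAlgebra.lift k (shiftGen ι z) (FreeR.x k p) = ι (x D p) + z :=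
    fun p => FreeAlgebra.lift_ι_apply _ _
  have Ls : ∀ a, FreeAlgebra.lift k (shiftGen ι z) (FreeR.s k a) = ι (s D a) := fun a =>
    FreeAlgebra.lift_ι_apply _ _
  have E := congrArg ι (π_rel h)
  have hxx : ∀ p q, Commute (ι (x D p)) (ι (x D q)) := fun p q => by
    rw [Commute, SemiconjBy, ← map_mul, ← map_mul, x_x]
  have hxz : ∀ p, Commute (ι (x D p)) z := fun p => (hz _).symm
  have hhi : ∀ a, ι (s D a) * (ι (x D (hi a)) + z) - (ι (x D (lo a)) + z) * ι (s D a) =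
      ι (s D a) * ι (x D (hi a)) - ι (x D (lo a)) * ι (s D a) := by
    intro a
    rw [mul_add, add_mul, hz]
    abel
  have hlo : ∀ a, (ι (x D (hi a)) + z) * ι (s D a) - ι (s D a) * (ι (x D (lo a)) + z) =
      ι (x D (hi a)) * ι (s D a) - ι (s D a) * ι (x D (lo a)) := by
    intro a
    rw [mul_add, add_mul, hz]
    abel
  cases h
  case x_x p q =>
    simp only [map_mul, Lx]
    exact ((hxx p q).add_right (hxz p)).add_left ((hxz q).symm.add_right rfl)
  case s_sq a ν =>
    simp only [map_mul, D.map_Q, Le, Lx, Ls, π_e, π_x, π_s] at E ⊢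
    rw [E, D.Q_shift _ _ _ _ z (hxx _ _) (hxz _) (hxz _)]
  case braid_eq a b ν hab hν =>
    simp only [map_mul, map_sub, D.map_dQ, Le, Lx, Ls, π_e, π_x, π_s] at E ⊢
    rw [E, D.dQ_shift _ _ _ _ _ z (hxx _ _) (hxx _ _) (hxx _ _) (hxz _) (hxz _) (hxz _)]
  case x_e p ν =>
    simp only [map_mul, Le, Lx, π_e, π_x] at E ⊢
    rw [add_mul, mul_add, E, hz]
  case s_x a p h1 h2 =>
    simp only [map_mul, Lx, Ls, π_s, π_x] at E ⊢
    rw [add_mul, mul_add, E, hz]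
  all_goals
    simp only [map_mul, map_sub, map_sum, map_one, map_zero, Le, Lx, Ls, hhi, hlo,
      π_e, π_x, π_s] at E ⊢
    exact E

/-- The homomorphism `e(ν) ↦ e(ν)`, `x_p ↦ x_p + z`, `σ_a ↦ σ_a`, where `z` is central. -/
def shift (hz : ∀ a, z * ι a = ι a * z) : KLR D β →ₐ[k] B := lift (shiftGen ι z) (shiftGen_rel ι hz)

theorem shift_gen (hz : ∀ a, z * ι a = ι a * z) (g : GenR β) : shift ι hz (gen D g) = shiftGen ι z g := lift_gen _ _ g

end Shift

end KLR

end Algebras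

/-! ### Modules and affinization -/

section Modules

variable {k : Type u} [Field k] {I : Type v}

/-- The parity of the generators of `RC_β`. -/
def GenC.parity {β : I →₀ ℕ} : GenC β → ZMod 2
  | .c _ => 1
  | _ => 0

/-- A left supermodule over `RC_β`: a module `V = V_0 ⊕ V_1` on which even generators preserve and odd
generators change the parity, so that `(RC_β)_i V_j ⊆ V_{i+j}`. -/
structure SMod (D : Datum k I) (β : I →₀ ℕ) : Type (max u v (w + 1)) where
  V : Type w
  [grp : AddCommGroup V]
  [modk : Module k V]
  [mod : Module (RC D β) V]
  [tower : IsScalarTower k (RC D β) V]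
  par : ZMod 2 → Submodule k V
  compl : IsCompl (par 0) (par 1)
  gen_mem : ∀ (g : GenC β) (p : ZMod 2) (m : V), m ∈ par p → RC.gen D g • m ∈ par (p + g.parity)

/-- A left module over `R_β`. -/
structure KMod (D : Datum k I) (β : I →₀ ℕ) : Type (max u v (w + 1)) where
  V : Type w
  [grp : AddCommGroup V]
  [modk : Module k V]
  [mod : Module (KLR D β) V]
  [tower : IsScalarTower k (KLR D β) V]

attribute [instance] SMod.grp SMod.modk SMod.mod SMod.tower
attribute [instance] KMod.grp KMod.modk KMod.mod KMod.tower

section Aff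

/-- `𝕜[z] ⊗ V`. -/
abbrev Aff (k : Type u) [Field k] (V : Type w) [AddCommGroup V] [Module k V] : Type (max u w) :=
  Polynomial k ⊗[k] V

variable (V : Type w) [AddCommGroup V] [Module k V]

/-- `f ⊗ u ↦ f ⊗ a u`. -/
def Aff.ext : Module.End k V →ₐ[k] Module.End k (Aff k V) :=
  Module.End.lTensorAlgHom k V (Polynomial k)

/-- `f ⊗ u ↦ z f ⊗ u`. -/
def Aff.z : Module.End k (Aff k V) :=
  LinearMap.rTensor V (LinearMap.mulLeft k (Polynomial.X : Polynomial k))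

/-- `f ⊗ u ↦ f(0) u`. -/
def Aff.ev : Aff k V →ₗ[k] V :=
  TensorProduct.lift ((LinearMap.lsmul k V).comp (Polynomial.aeval (0 : k)).toLinearMap)

variable {V}

/-- `f ⊗ u`. -/
abbrev Aff.tmul (f : Polynomial k) (u : V) : Aff k V := f ⊗ₜ[k] u

theorem Aff.ext_tmul (a : Module.End k V) (f : Polynomial k) (u : V) :
    Aff.ext V a (Aff.tmul f u) = Aff.tmul f (a u) := rfl

theorem Aff.z_tmul (f : Polynomial k) (u : V) :
    Aff.z V (Aff.tmul f u) = Aff.tmul (Polynomial.X * f) u := rfl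

theorem Aff.ev_tmul (f : Polynomial k) (u : V) :
    Aff.ev V (Aff.tmul f u) = f.eval 0 • u := by
  simp [Aff.ev]

theorem Aff.hom_ext {V : Type w} [AddCommGroup V] [Module k V] {W : Type w₂} [AddCommGroup W]
    [Module k W] {f g : Aff k V →ₗ[k] W}
    (h : ∀ p u, f (Aff.tmul p u) = g (Aff.tmul p u)) : f = g :=
  TensorProduct.ext' h

theorem Aff.z_ext (a : Module.End k V) : Aff.z V * Aff.ext V a = Aff.ext V a * Aff.z V :=
  Aff.hom_ext (k := k) fun _ _ => rfl

theorem Aff.ev_z : Aff.ev V ∘ₗ Aff.z V = (0 : Aff k V →ₗ[k] V) := by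
  refine Aff.hom_ext fun p u => ?_
  simp [Aff.z_tmul, Aff.ev_tmul]

theorem Aff.ev_ext (a : Module.End k V) (m : Aff k V) : Aff.ev V (Aff.ext V a m) = a (Aff.ev V m) :=
  LinearMap.congr_fun (f := Aff.ev V ∘ₗ Aff.ext V a) (g := a ∘ₗ Aff.ev V)
    (Aff.hom_ext fun p u => by simp [Aff.ext_tmul, Aff.ev_tmul]) m

/-- `𝕜[z] ⊗ U` for a subspace `U` of `V`. -/
def Aff.sub (U : Submodule k V) : Submodule k (Aff k V) :=
  LinearMap.range (LinearMap.lTensor (Polynomial k) U.subtype)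

theorem Aff.tmul_mem {U : Submodule k V} {u : V} (hu : u ∈ U) (f : Polynomial k) :
    Aff.tmul f u ∈ Aff.sub U := ⟨f ⊗ₜ ⟨u, hu⟩, by simp⟩

theorem Aff.sub_induction {U : Submodule k V} {W : Type w₂} [AddCommGroup W] [Module k W]
    (f : Aff k V →ₗ[k] W) (U' : Submodule k W) (h : ∀ p u, u ∈ U → f (Aff.tmul p u) ∈ U')
    {m : Aff k V} (hm : m ∈ Aff.sub U) : f m ∈ U' := by
  obtain ⟨t, rfl⟩ := hm
  induction t with
  | zero => rw [map_zero]; exact (map_zero f) ▸ U'.zero_mem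
  | tmul p u => exact h p u u.2
  | add a b iha ihb =>
    rw [map_add]
    exact (map_add f _ _) ▸ U'.add_mem iha ihb

theorem Aff.isCompl {U U' : Submodule k V} (h : IsCompl U U') :
    IsCompl (Aff.sub (k := k) U) (Aff.sub U') := by
  constructor
  · rw [Submodule.disjoint_def]
    rintro _ ⟨x, rfl⟩ ⟨y, hy⟩
    have h1 := congrArg (LinearMap.lTensor (Polynomial k) (U.projectionOnto U' h)) hy
    rw [← LinearMap.comp_apply, ← LinearMap.comp_apply, ← LinearMap.lTensor_comp,
      ← LinearMap.lTensor_comp] at h1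
    have e1 : U.projectionOnto U' h ∘ₗ U'.subtype = 0 := by
      ext u; simp
    have e2 : U.projectionOnto U' h ∘ₗ U.subtype = LinearMap.id := by
      ext u; simp
    rw [e1, e2, LinearMap.lTensor_zero, LinearMap.lTensor_id] at h1
    have : x = 0 := by simpa using h1.symm
    rw [this, map_zero]
  · rw [codisjoint_iff, eq_top_iff]
    rintro t -
    induction t using TensorProduct.induction_on with
    | zero => exact Submodule.zero_mem _
    | tmul p u =>
      obtain ⟨a, ha, b, hb, rfl⟩ : ∃ a ∈ U, ∃ b ∈ U', a + b = u := by
        rw [← Submodule.mem_sup, h.sup_eq_top]; trivial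
      rw [TensorProduct.tmul_add]
      exact Submodule.add_mem_sup (Aff.tmul_mem ha p) (Aff.tmul_mem hb p)
    | add a b iha ihb => exact Submodule.add_mem _ iha ihb

end Aff

variable {D : Datum k I} {β : I →₀ ℕ}

namespace SMod

section
variable (M : SMod.{u, v, w} D β)

theorem e_mem (ν : JSeq β) {p : ZMod 2} {m : M.V} (hm : m ∈ M.par p) :
    RC.e D ν • m ∈ M.par p := by
  have h := M.gen_mem (.e ν) p m hm
  have h0 : (GenC.e ν).parity = 0 := rfl
  rwa [h0, add_zero] at h

theorem sg_mem (a : Fin (ht β)) {p : ZMod 2} {m : M.V} (hm : m ∈ M.par p) :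
    RC.sg D a • m ∈ M.par p := by
  rw [RC.sg, Finset.sum_smul]
  refine Submodule.sum_mem _ fun ν _ => ?_
  rw [smul_assoc]
  exact Submodule.smul_mem _ _ (M.e_mem ν hm)

end

variable (M : SMod.{u, v, w} D β)

/-- `RC_β → End (𝕜[z] ⊗ V)`, `a ↦ id ⊗ a`. -/
def affExt : RC D β →ₐ[k] Module.End k (Aff k M.V) :=
  (Aff.ext M.V).comp (Algebra.lsmul k k M.V)

theorem affExt_comm (a : RC D β) : Aff.z M.V * M.affExt a = M.affExt a * Aff.z M.V :=
  Aff.z_ext _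

variable [D.IsSymmetric]

/-- The action of `RC_β` on `V_z = 𝕜[z] ⊗ V`: the generators `e(ν)`, `σ_a`, `𝔠_p` act on `V`, and
`x_p e(ν) (f ⊗ u) = (-1)^{π₂(ν_p)} z f ⊗ e(ν) u + f ⊗ x_p e(ν) u`. -/
def affHom : RC D β →ₐ[k] Module.End k (Aff k M.V) :=
  RC.shift M.affExt (z := Aff.z M.V) M.affExt_comm

/-- The affinization `M_z`. -/
def aff : SMod.{u, v, max u w} D β where
  V := Aff k M.V
  mod := Module.compHom (Aff k M.V) M.affHom.toRingHom
  tower := by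
    let _ := Module.compHom (Aff k M.V) M.affHom.toRingHom
    refine ⟨fun r a m => ?_⟩
    change M.affHom (r • a) m = r • M.affHom a m
    rw [map_smul]; rfl
  par p := Aff.sub (M.par p)
  compl := Aff.isCompl M.compl
  gen_mem g p m hm := by
    have hgen : ∀ g : GenC β, M.affExt (RC.gen D g) m ∈ Aff.sub (M.par (p + g.parity)) :=
      fun g => Aff.sub_induction (M.affExt (RC.gen D g)) _
        (fun q u hu => Aff.tmul_mem (M.gen_mem g p u hu) q) hm
    change M.affHom (RC.gen D g) m ∈ _
    rw [affHom, RC.shift_gen]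
    cases g with
    | e ν => exact hgen (.e ν)
    | s a => exact hgen (.s a)
    | c a => exact hgen (.c a)
    | x a =>
      refine Submodule.add_mem _ (hgen (.x a)) ?_
      refine Aff.sub_induction (Aff.z M.V * M.affExt (RC.sg D a)) _ (fun q u hu => ?_) hm
      exact Aff.tmul_mem (by
        have h0 : (GenC.x a).parity = 0 := rfl
        rw [h0, add_zero]; exact M.sg_mem a hu) _

theorem aff_gen_smul (g : GenC β) (m : M.aff.V) :
    RC.gen D g • m = RC.shiftGen M.affExt (Aff.z M.V) g m := by
  rw [← RC.shift_gen M.affExt (z := Aff.z M.V) M.affExt_comm]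
  rfl

/-- Multiplication by `z` on `M_z`, as a `𝕜`-linear map. -/
def affZk : M.aff.V →ₗ[k] M.aff.V := Aff.z M.V

/-- The specialization `M_z → M` at `z = 0`, as a `𝕜`-linear map. -/
def affEvk : M.aff.V →ₗ[k] M.V := Aff.ev M.V

/-- Multiplication by `z` on `M_z`. -/
def affZ : M.aff.V →ₗ[RC D β] M.aff.V :=
  RC.linOfGen (V := M.aff.V) (W := M.aff.V) M.affZk fun g m => by
    unfold affZk
    rw [aff_gen_smul, aff_gen_smul]
    have h : ∀ a, Commute (Aff.z M.V) (M.affExt a) := fun a => Aff.z_ext _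
    have hc : Commute (Aff.z M.V) (RC.shiftGen M.affExt (Aff.z M.V) g) := by
      cases g with
      | e ν => exact h _
      | s a => exact h _
      | c a => exact h _
      | x a => exact (h _).add_right (Commute.mul_right rfl (h _))
    exact LinearMap.congr_fun hc.eq m

/-- The specialization `M_z → M` at `z = 0`. -/
def affEv : M.aff.V →ₗ[RC D β] M.V :=
  RC.linOfGen (V := M.aff.V) (W := M.V) M.affEvk fun g m => by
    unfold affEvk
    rw [aff_gen_smul]
    have h : ∀ a, Aff.ev M.V (M.affExt a m) = a • Aff.ev M.V m := fun a => Aff.ev_ext _ m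
    cases g with
    | e ν => exact h _
    | s a => exact h _
    | c a => exact h _
    | x a =>
      refine (map_add (Aff.ev M.V) _ _).trans ?_
      rw [h]
      exact (congrArg _ (LinearMap.congr_fun Aff.ev_z _)).trans (add_zero _)

theorem affZ_mem (p : ZMod 2) (m : M.aff.V) (hm : m ∈ M.aff.par p) : M.affZ m ∈ M.aff.par p :=
  Aff.sub_induction (Aff.z M.V) _ (fun q _ hu => Aff.tmul_mem hu (Polynomial.X * q)) hm

theorem affEv_mem (p : ZMod 2) (m : M.aff.V) (hm : m ∈ M.aff.par p) : M.affEv m ∈ M.par p :=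
  Aff.sub_induction (Aff.ev M.V) _
    (fun q u hu => by rw [Aff.ev_tmul]; exact Submodule.smul_mem _ _ hu) hm

end SMod

namespace KMod

variable (M : KMod.{u, v, w} D β)

/-- `R_β → End (𝕜[z] ⊗ V)`, `a ↦ id ⊗ a`. -/
def affExt : KLR D β →ₐ[k] Module.End k (Aff k M.V) :=
  (Aff.ext M.V).comp (Algebra.lsmul k k M.V)

theorem affExt_comm (a : KLR D β) : Aff.z M.V * M.affExt a = M.affExt a * Aff.z M.V :=
  Aff.z_ext _

variable [D.IsSymmetric]

/-- The action of `R_β` on `V_z = 𝕜[z] ⊗ V`: the generators `e(ν)`, `σ_a` act on `V`, and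
`x_p (f ⊗ u) = z f ⊗ u + f ⊗ x_p u`. -/
def affHom : KLR D β →ₐ[k] Module.End k (Aff k M.V) :=
  KLR.shift M.affExt (z := Aff.z M.V) M.affExt_comm

/-- The affinization `M_z`. -/
def aff : KMod.{u, v, max u w} D β where
  V := Aff k M.V
  mod := Module.compHom (Aff k M.V) M.affHom.toRingHom
  tower := by
    let _ := Module.compHom (Aff k M.V) M.affHom.toRingHom
    refine ⟨fun r a m => ?_⟩
    change M.affHom (r • a) m = r • M.affHom a m
    rw [map_smul]; rfl

theorem aff_gen_smul (g : GenR β) (m : M.aff.V) :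
    KLR.gen D g • m = KLR.shiftGen M.affExt (Aff.z M.V) g m := by
  rw [← KLR.shift_gen M.affExt (z := Aff.z M.V) M.affExt_comm]
  rfl

/-- Multiplication by `z` on `M_z`, as a `𝕜`-linear map. -/
def affZk : M.aff.V →ₗ[k] M.aff.V := Aff.z M.V

/-- The specialization `M_z → M` at `z = 0`, as a `𝕜`-linear map. -/
def affEvk : M.aff.V →ₗ[k] M.V := Aff.ev M.V

/-- Multiplication by `z` on `M_z`. -/
def affZ : M.aff.V →ₗ[KLR D β] M.aff.V :=
  KLR.linOfGen (V := M.aff.V) (W := M.aff.V) M.affZk fun g m => by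
    unfold affZk
    rw [aff_gen_smul, aff_gen_smul]
    have h : ∀ a, Commute (Aff.z M.V) (M.affExt a) := fun a => Aff.z_ext _
    have hc : Commute (Aff.z M.V) (KLR.shiftGen M.affExt (Aff.z M.V) g) := by
      cases g with
      | e ν => exact h _
      | s a => exact h _
      | x a => exact (h _).add_right rfl
    exact LinearMap.congr_fun hc.eq m

/-- The specialization `M_z → M` at `z = 0`. -/
def affEv : M.aff.V →ₗ[KLR D β] M.V :=
  KLR.linOfGen (V := M.aff.V) (W := M.V) M.affEvk fun g m => by
    unfold affEvk
    rw [aff_gen_smul]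
    have h : ∀ a, Aff.ev M.V (M.affExt a m) = a • Aff.ev M.V m := fun a => Aff.ev_ext _ m
    cases g with
    | e ν => exact h _
    | s a => exact h _
    | x a =>
      refine (map_add (Aff.ev M.V) _ _).trans ?_
      rw [h]
      exact (congrArg _ (LinearMap.congr_fun Aff.ev_z _)).trans (add_zero _)

end KMod

end Modules

/-! ### Induced modules -/

section Ind

variable {k : Type u} [Field k] {A : Type v} [Ring A] [Algebra k A] {W : Type w} [AddCommGroup W]
  [Module k W]

/-- The quotient of the free `A`-module `A ⊗ W` by the `A`-submodule generated by `r`. -/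
def Ind (r : Set (A ⊗[k] W)) : Type (max v w) := (A ⊗[k] W) ⧸ Submodule.span A r

variable (r : Set (A ⊗[k] W))

instance : AddCommGroup (Ind r) := inferInstanceAs (AddCommGroup ((A ⊗[k] W) ⧸ Submodule.span A r))
instance : Module A (Ind r) := inferInstanceAs (Module A ((A ⊗[k] W) ⧸ Submodule.span A r))
instance : Module k (Ind r) := inferInstanceAs (Module k ((A ⊗[k] W) ⧸ Submodule.span A r))
instance : IsScalarTower k A (Ind r) :=
  inferInstanceAs (IsScalarTower k A ((A ⊗[k] W) ⧸ Submodule.span A r))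

/-- The quotient map. -/
def Ind.proj : (A ⊗[k] W) →ₗ[A] Ind r := (Submodule.span A r).mkQ

/-- `w ↦ 1 ⊗ w`. -/
def Ind.mk : W →ₗ[k] Ind r := (Ind.proj r).restrictScalars k ∘ₗ TensorProduct.mk k A W 1

theorem Ind.proj_tmul (a : A) (w : W) : Ind.proj r (a ⊗ₜ w) = a • Ind.mk r w := by
  change Ind.proj r (a ⊗ₜ w) = a • Ind.proj r (1 ⊗ₜ w)
  rw [← map_smul, TensorProduct.smul_tmul', smul_eq_mul, mul_one]

variable {r}

theorem Ind.rel {a : A} {w w' : W} (h : a ⊗ₜ w - 1 ⊗ₜ w' ∈ r) : a • Ind.mk r w = Ind.mk r w' := by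
  have : Ind.proj r (a ⊗ₜ w - 1 ⊗ₜ w') = 0 :=
    (Submodule.Quotient.mk_eq_zero _).2 (Submodule.subset_span h)
  rwa [map_sub, Ind.proj_tmul, Ind.proj_tmul, one_smul, sub_eq_zero] at this

variable {N : Type w₁} [AddCommGroup N] [Module k N] [Module A N] [IsScalarTower k A N]

/-- `a ⊗ w ↦ a g(w)`. -/
def Ind.act (g : W →ₗ[k] N) : (A ⊗[k] W) →ₗ[A] N :=
  TensorProduct.AlgebraTensorModule.lift (LinearMap.toSpanSingleton A (W →ₗ[k] N) g)

theorem Ind.act_tmul (g : W →ₗ[k] N) (a : A) (w : W) : Ind.act g (a ⊗ₜ w) = a • g w := rfl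

/-- `a ⊗ w ↦ a g(w)` on the quotient. -/
def Ind.lift (g : W →ₗ[k] N) (h : ∀ t ∈ r, Ind.act g t = 0) : Ind r →ₗ[A] N :=
  (Submodule.span A r).liftQ (Ind.act g) (Submodule.span_le.2 h)

theorem Ind.lift_mk (g : W →ₗ[k] N) (h : ∀ t ∈ r, Ind.act g t = 0) (w : W) :
    Ind.lift g h (Ind.mk r w) = g w := by
  change Ind.act g (1 ⊗ₜ w) = g w
  rw [Ind.act_tmul, one_smul]

end Ind

/-! ### Convolution products -/

section Conv

variable {k : Type u} [Field k] {I : Type v} {D : Datum k I} {β β₁ β₂ : I →₀ ℕ}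

namespace SMod

/-- The relations `a g ⊗ m = a ⊗ g m` (for `a = 1`) of the tensor product over
`RC_{β₁} ⊗ RC_{β₂}`, where `g` runs over the algebra generators `e(ν) ⊗ e(η)`, `x_p ⊗ 1`, `1 ⊗ x_p`,
`σ_a ⊗ 1`, `1 ⊗ σ_a`, `𝔠_p ⊗ 1`, `1 ⊗ 𝔠_p`, which act on `RC_β` on the right via
`e(ν) ⊗ e(η) ↦ e(ν * η)` etc., and on `M ⊗ N` by
`(g₁ ⊗ g₂)(u ⊗ v) = (-1)^{p(g₂)p(u)} g₁ u ⊗ g₂ v`. -/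
inductive ConvRel (h : β₁ + β₂ = β) (M : SMod.{u, v, w₁} D β₁) (N : SMod.{u, v, w₂} D β₂) :
    RC D β ⊗[k] (M.V ⊗[k] N.V) → Prop
  | e (ν : JSeq β₁) (η : JSeq β₂) (u : M.V) (v : N.V) : ConvRel h M N
      (RC.e D (JSeq.append h ν η) ⊗ₜ (u ⊗ₜ v) - 1 ⊗ₜ ((RC.e D ν • u) ⊗ₜ (RC.e D η • v)))
  | xL (p : Fin (ht β₁)) (u : M.V) (v : N.V) : ConvRel h M N
      (RC.x D (inL h p) ⊗ₜ (u ⊗ₜ v) - 1 ⊗ₜ ((RC.x D p • u) ⊗ₜ v))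
  | xR (p : Fin (ht β₂)) (u : M.V) (v : N.V) : ConvRel h M N
      (RC.x D (inR h p) ⊗ₜ (u ⊗ₜ v) - 1 ⊗ₜ (u ⊗ₜ (RC.x D p • v)))
  | sL (a : Fin (ht β₁ - 1)) (u : M.V) (v : N.V) : ConvRel h M N
      (RC.s D (crL h a) ⊗ₜ (u ⊗ₜ v) - 1 ⊗ₜ ((RC.s D a • u) ⊗ₜ v))
  | sR (a : Fin (ht β₂ - 1)) (u : M.V) (v : N.V) : ConvRel h M N
      (RC.s D (crR h a) ⊗ₜ (u ⊗ₜ v) - 1 ⊗ₜ (u ⊗ₜ (RC.s D a • v)))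
  | cL (p : Fin (ht β₁)) (u : M.V) (v : N.V) : ConvRel h M N
      (RC.c D (inL h p) ⊗ₜ (u ⊗ₜ v) - 1 ⊗ₜ ((RC.c D p • u) ⊗ₜ v))
  | cR (p : Fin (ht β₂)) (i : ZMod 2) (u : M.V) (v : N.V) : u ∈ M.par i → ConvRel h M N
      (RC.c D (inR h p) ⊗ₜ (u ⊗ₜ v) - 1 ⊗ₜ (sgn k i • (u ⊗ₜ (RC.c D p • v))))

/-- The convolution product
`M ∘ N = RC_β e(β₁, β₂) ⊗_{RC_{β₁} ⊗ RC_{β₂}} (M ⊗ N)`, where `β = β₁ + β₂`. -/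
abbrev conv (h : β₁ + β₂ = β) (M : SMod.{u, v, w₁} D β₁) (N : SMod.{u, v, w₂} D β₂) :
    Type (max u v w₁ w₂) := Ind {t | ConvRel h M N t}

variable (h : β₁ + β₂ = β) (M : SMod.{u, v, w₁} D β₁) (N : SMod.{u, v, w₂} D β₂)

/-- The element `u ⊗ v` of `M ∘ N`. -/
def tens (u : M.V) (v : N.V) : conv h M N := Ind.mk _ (u ⊗ₜ v)

/-- The functoriality of `M ∘ N` with respect to even homomorphisms. -/
def convMap (M : SMod.{u, v, w₁} D β₁) (M' : SMod.{u, v, w₃} D β₁) (N : SMod.{u, v, w₂} D β₂)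
    (N' : SMod.{u, v, w₄} D β₂) (f : M.V →ₗ[RC D β₁] M'.V)
    (hf : ∀ p m, m ∈ M.par p → f m ∈ M'.par p) (g : N.V →ₗ[RC D β₂] N'.V) :
    conv h M N →ₗ[RC D β] conv h M' N' :=
  Ind.lift (Ind.mk _ ∘ₗ TensorProduct.map (f.restrictScalars k) (g.restrictScalars k)) <| by
    intro t ht
    cases ht <;>
      simp only [map_sub, Ind.act_tmul, one_smul, map_smul, LinearMap.comp_apply,
        TensorProduct.map_tmul, LinearMap.coe_restrictScalars, sub_eq_zero]
    case e ν η u v => exact Ind.rel (ConvRel.e ν η (f u) (g v))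
    case xL p u v => exact Ind.rel (ConvRel.xL p (f u) (g v))
    case xR p u v => exact Ind.rel (ConvRel.xR p (f u) (g v))
    case sL p u v => exact Ind.rel (ConvRel.sL p (f u) (g v))
    case sR p u v => exact Ind.rel (ConvRel.sR p (f u) (g v))
    case cL p u v => exact Ind.rel (ConvRel.cL p (f u) (g v))
    case cR p i u v hu =>
      exact (Ind.rel (ConvRel.cR p i (f u) (g v) (hf i u hu))).trans
        (map_smul (Ind.mk {t | ConvRel h M' N' t}) _ _)

end SMod

namespace KMod

/-- The relations `a g ⊗ m = a ⊗ g m` (for `a = 1`) of the tensor product over `R_{β₁} ⊗ R_{β₂}`,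
where `g` runs over the algebra generators. -/
inductive ConvRel (h : β₁ + β₂ = β) (M : KMod.{u, v, w₁} D β₁) (N : KMod.{u, v, w₂} D β₂) :
    KLR D β ⊗[k] (M.V ⊗[k] N.V) → Prop
  | e (ν : ISeq β₁) (η : ISeq β₂) (u : M.V) (v : N.V) : ConvRel h M N
      (KLR.e D (ISeq.append h ν η) ⊗ₜ (u ⊗ₜ v) - 1 ⊗ₜ ((KLR.e D ν • u) ⊗ₜ (KLR.e D η • v)))
  | xL (p : Fin (ht β₁)) (u : M.V) (v : N.V) : ConvRel h M N
      (KLR.x D (inL h p) ⊗ₜ (u ⊗ₜ v) - 1 ⊗ₜ ((KLR.x D p • u) ⊗ₜ v))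
  | xR (p : Fin (ht β₂)) (u : M.V) (v : N.V) : ConvRel h M N
      (KLR.x D (inR h p) ⊗ₜ (u ⊗ₜ v) - 1 ⊗ₜ (u ⊗ₜ (KLR.x D p • v)))
  | sL (a : Fin (ht β₁ - 1)) (u : M.V) (v : N.V) : ConvRel h M N
      (KLR.s D (crL h a) ⊗ₜ (u ⊗ₜ v) - 1 ⊗ₜ ((KLR.s D a • u) ⊗ₜ v))
  | sR (a : Fin (ht β₂ - 1)) (u : M.V) (v : N.V) : ConvRel h M N
      (KLR.s D (crR h a) ⊗ₜ (u ⊗ₜ v) - 1 ⊗ₜ (u ⊗ₜ (KLR.s D a • v)))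

/-- The convolution product `M ∘ N = R_β e(β₁, β₂) ⊗_{R_{β₁} ⊗ R_{β₂}} (M ⊗ N)`, where
`β = β₁ + β₂`. -/
abbrev conv (h : β₁ + β₂ = β) (M : KMod.{u, v, w₁} D β₁) (N : KMod.{u, v, w₂} D β₂) :
    Type (max u v w₁ w₂) := Ind {t | ConvRel h M N t}

variable (h : β₁ + β₂ = β) (M : KMod.{u, v, w₁} D β₁) (N : KMod.{u, v, w₂} D β₂)

/-- The element `u ⊗ v` of `M ∘ N`. -/
def tens (u : M.V) (v : N.V) : conv h M N := Ind.mk _ (u ⊗ₜ v)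

/-- The functoriality of `M ∘ N`. -/
def convMap (M : KMod.{u, v, w₁} D β₁) (M' : KMod.{u, v, w₃} D β₁) (N : KMod.{u, v, w₂} D β₂)
    (N' : KMod.{u, v, w₄} D β₂) (f : M.V →ₗ[KLR D β₁] M'.V) (g : N.V →ₗ[KLR D β₂] N'.V) :
    conv h M N →ₗ[KLR D β] conv h M' N' :=
  Ind.lift (Ind.mk _ ∘ₗ TensorProduct.map (f.restrictScalars k) (g.restrictScalars k)) <| by
    intro t ht
    cases ht <;>
      simp only [map_sub, Ind.act_tmul, one_smul, map_smul, LinearMap.comp_apply,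
        TensorProduct.map_tmul, LinearMap.coe_restrictScalars, sub_eq_zero]
    case e ν η u v => exact Ind.rel (ConvRel.e ν η (f u) (g v))
    case xL p u v => exact Ind.rel (ConvRel.xL p (f u) (g v))
    case xR p u v => exact Ind.rel (ConvRel.xR p (f u) (g v))
    case sL p u v => exact Ind.rel (ConvRel.sL p (f u) (g v))
    case sR p u v => exact Ind.rel (ConvRel.sR p (f u) (g v))

end KMod

end Conv

/-! ### Intertwiners and R-matrices -/

section RMatrix

variable {k : Type u} [Field k] {I : Type v} (D : Datum k I) {β β₁ β₂ : I →₀ ℕ}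

open Classical in
/-- The intertwiner `φ_a = ∑_ν φ_a e(ν)` of `RC_β`. -/
def RC.phi (a : Fin (ht β - 1)) : RC D β :=
  ∑ ν : JSeq β,
    (if (ν.seq (lo a)).1 ≠ (ν.seq (hi a)).1 then RC.s D a
      else if ν.seq (lo a) = ν.seq (hi a) then
        sgn k (ν.seq (lo a)).2 • (RC.s D a * RC.x D (lo a) - RC.x D (lo a) * RC.s D a)
      else
        sgn k (ν.seq (lo a)).2 • (RC.s D a * RC.x D (lo a) + RC.x D (lo a) * RC.s D a)) * RC.e D ν

open Classical in
/-- The intertwiner `φ_a = ∑_ν φ_a e(ν)` of `R_β`. -/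
def KLR.phi (a : Fin (ht β - 1)) : KLR D β :=
  ∑ ν : ISeq β,
    (if ν.seq (lo a) ≠ ν.seq (hi a) then KLR.s D a
      else KLR.s D a * KLR.x D (lo a) - KLR.x D (lo a) * KLR.s D a) * KLR.e D ν

/-- The product `φ_{a_1} ⋯ φ_{a_l}` along the reduced expression
`w[n, m] = (s_m ⋯ s_2 s_1) (s_{m+1} ⋯ s_3 s_2) ⋯ (s_{m+n-1} ⋯ s_{n+1} s_n)`,
where `n = |β₁|` and `m = |β₂|`, of the permutation with `w(p) = p + m` for `p ≤ n` and
`w(p) = p - n` for `p > n`. -/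
def wordProd {B : Type w} [Monoid B] (h : β₁ + β₂ = β) (φ : Fin (ht β - 1) → B) : B :=
  (List.ofFn fun i : Fin (ht β₁) => (List.ofFn fun j : Fin (ht β₂) =>
    φ ⟨i + (ht β₂ - 1 - j), by have := ht_add h; omega⟩).prod).prod

variable {D}

/-- `R` is the R-matrix `R_{M,N} : M ∘ N → N ∘ M`, the homomorphism with
`u ⊗ v ↦ (-1)^{p(u)p(v)} φ_{w[n,m]} (v ⊗ u)` for homogeneous `u`, `v`, where `m = |β₁|` and
`n = |β₂|`. -/
def SMod.IsRMatrix (h₁₂ : β₁ + β₂ = β) (h₂₁ : β₂ + β₁ = β) (M : SMod.{u, v, w₁} D β₁)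
    (N : SMod.{u, v, w₂} D β₂) (R : SMod.conv h₁₂ M N →ₗ[RC D β] SMod.conv h₂₁ N M) : Prop :=
  ∀ (i j : ZMod 2) (u : M.V) (v : N.V), u ∈ M.par i → v ∈ N.par j →
    R (SMod.tens h₁₂ M N u v) =
      sgn k (i * j) • (wordProd h₂₁ (RC.phi D) • SMod.tens h₂₁ N M v u)

/-- `R` is the R-matrix `R_{M,N} : M ∘ N → N ∘ M`, the homomorphism with
`u ⊗ v ↦ φ_{w[n,m]} (v ⊗ u)`, where `m = |β₁|` and `n = |β₂|`. -/
def KMod.IsRMatrix (h₁₂ : β₁ + β₂ = β) (h₂₁ : β₂ + β₁ = β) (M : KMod.{u, v, w₁} D β₁)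
    (N : KMod.{u, v, w₂} D β₂) (R : KMod.conv h₁₂ M N →ₗ[KLR D β] KMod.conv h₂₁ N M) : Prop :=
  ∀ (u : M.V) (v : N.V),
    R (KMod.tens h₁₂ M N u v) = wordProd h₂₁ (KLR.phi D) • KMod.tens h₂₁ N M v u

/-- `r = max {a | Im R ⊆ z^a Q}` and `ρ = (z^{-r} R)|_{z = 0}`, where `R : P → Q` is the homomorphism
with the property `isR`, `z` is an endomorphism of `Q`, and `evP : P → P₀`, `evQ : Q → Q₀` are the
specializations at `z = 0`: there is exactly one `R` with the property `isR`, exactly one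
homomorphism `T = z^{-r} R` with `z^r T = R`, and `ρ` is the only homomorphism induced by `T`. -/
def IsRenormalization {A : Type u} [Ring A] {P : Type w₁} {Q : Type w₂} {P₀ : Type w₃}
    {Q₀ : Type w₄} [AddCommGroup P] [Module A P] [AddCommGroup Q] [Module A Q] [AddCommGroup P₀] [Module A P₀]
    [AddCommGroup Q₀] [Module A Q₀] (isR : (P →ₗ[A] Q) → Prop) (z : Module.End A Q)
    (evP : P →ₗ[A] P₀) (evQ : Q →ₗ[A] Q₀) (r : ℕ) (ρ : P₀ →ₗ[A] Q₀) : Prop :=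
  ∃ R T : P →ₗ[A] Q,
    (isR R ∧ ∀ R', isR R' → R' = R) ∧
    IsGreatest {a : ℕ | LinearMap.range R ≤ LinearMap.range (z ^ a)} r ∧
    ((∀ m, (z ^ r) (T m) = R m) ∧ ∀ T' : P →ₗ[A] Q, (∀ m, (z ^ r) (T' m) = R m) → T' = T) ∧
    ((∀ m, ρ (evP m) = evQ (T m)) ∧ ∀ ρ' : P₀ →ₗ[A] Q₀, (∀ m, ρ' (evP m) = evQ (T m)) → ρ' = ρ)

section

variable [D.IsSymmetric] (h₁₂ : β₁ + β₂ = β) (h₂₁ : β₂ + β₁ = β)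

/-- `r = max {a | Im R_{M_z,N} ⊆ z^a (N ∘ M_z)}` and `ρ = r_{M,N} = z^{-r} R_{M_z,N}|_{z = 0}`. -/
def SMod.IsRenormL (M : SMod.{u, v, w₁} D β₁) (N : SMod.{u, v, w₂} D β₂) (r : ℕ)
    (ρ : SMod.conv h₁₂ M N →ₗ[RC D β] SMod.conv h₂₁ N M) : Prop :=
  IsRenormalization (SMod.IsRMatrix h₁₂ h₂₁ M.aff N)
    (SMod.convMap h₂₁ N N M.aff M.aff LinearMap.id (fun _ _ h => h) M.affZ)
    (SMod.convMap h₁₂ M.aff M N N M.affEv M.affEv_mem LinearMap.id)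
    (SMod.convMap h₂₁ N N M.aff M LinearMap.id (fun _ _ h => h) M.affEv) r ρ

/-- `s = max {b | Im R_{M,N_z} ⊆ z^b (N_z ∘ M)}` and `ρ = r'_{M,N} = z^{-s} R_{M,N_z}|_{z = 0}`. -/
def SMod.IsRenormR (M : SMod.{u, v, w₁} D β₁) (N : SMod.{u, v, w₂} D β₂) (s : ℕ)
    (ρ : SMod.conv h₁₂ M N →ₗ[RC D β] SMod.conv h₂₁ N M) : Prop :=
  IsRenormalization (SMod.IsRMatrix h₁₂ h₂₁ M N.aff)
    (SMod.convMap h₂₁ N.aff N.aff M M N.affZ N.affZ_mem LinearMap.id)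
    (SMod.convMap h₁₂ M M N.aff N LinearMap.id (fun _ _ h => h) N.affEv)
    (SMod.convMap h₂₁ N.aff N M M N.affEv N.affEv_mem LinearMap.id) s ρ

/-- `r = max {a | Im R_{M_z,N} ⊆ z^a (N ∘ M_z)}` and `ρ = r_{M,N} = z^{-r} R_{M_z,N}|_{z = 0}`. -/
def KMod.IsRenormL (M : KMod.{u, v, w₁} D β₁) (N : KMod.{u, v, w₂} D β₂) (r : ℕ)
    (ρ : KMod.conv h₁₂ M N →ₗ[KLR D β] KMod.conv h₂₁ N M) : Prop :=
  IsRenormalization (KMod.IsRMatrix h₁₂ h₂₁ M.aff N)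
    (KMod.convMap h₂₁ N N M.aff M.aff LinearMap.id M.affZ)
    (KMod.convMap h₁₂ M.aff M N N M.affEv LinearMap.id)
    (KMod.convMap h₂₁ N N M.aff M LinearMap.id M.affEv) r ρ

/-- `s = max {b | Im R_{M,N_z} ⊆ z^b (N_z ∘ M)}` and `ρ = r'_{M,N} = z^{-s} R_{M,N_z}|_{z = 0}`. -/
def KMod.IsRenormR (M : KMod.{u, v, w₁} D β₁) (N : KMod.{u, v, w₂} D β₂) (s : ℕ)
    (ρ : KMod.conv h₁₂ M N →ₗ[KLR D β] KMod.conv h₂₁ N M) : Prop :=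
  IsRenormalization (KMod.IsRMatrix h₁₂ h₂₁ M N.aff)
    (KMod.convMap h₂₁ N.aff N.aff M M N.affZ LinearMap.id)
    (KMod.convMap h₁₂ M M N.aff N LinearMap.id N.affEv)
    (KMod.convMap h₂₁ N.aff N M M N.affEv LinearMap.id) s ρ

end

end RMatrix

/-! ### The functor `F` -/

section Morita

variable {k : Type u} [Field k] {I : Type v} (D : Datum k I) (β : I →₀ ℕ)

/-- The idempotent `e†(β)`, the sum of the `e(ν)` with `ν ∈ (I × {0})^β`. -/
def edag : RC D β := ∑ ν : ISeq β, RC.e D ν.dag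

variable {D β}

theorem ISeq.dag_injective : Function.Injective (ISeq.dag (β := β)) := by
  intro ν μ h
  refine ISeq.ext (funext fun p => ?_)
  exact congrArg Prod.fst (congrFun (congrArg JSeq.seq h) p)

theorem edag_mul_e (ν : ISeq β) : edag D β * RC.e D ν.dag = RC.e D ν.dag := by
  classical
  rw [edag, Finset.sum_mul, Finset.sum_eq_single ν]
  · exact RC.e_mul_self _
  · intro μ _ h
    exact RC.e_mul_ne fun h' => h (ISeq.dag_injective h')
  · simp

theorem e_mul_edag (ν : ISeq β) : RC.e D ν.dag * edag D β = RC.e D ν.dag := by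
  classical
  rw [edag, Finset.mul_sum, Finset.sum_eq_single ν]
  · exact RC.e_mul_self _
  · intro μ _ h
    exact RC.e_mul_ne fun h' => h (ISeq.dag_injective h').symm
  · simp

theorem edag_mul_self : edag D β * edag D β = edag D β := by
  conv_lhs => enter [2]; rw [edag]
  rw [Finset.mul_sum]
  exact Finset.sum_congr rfl fun ν _ => edag_mul_e ν

/-- The elements `e(ν†)`, `x_p`, `σ_a` of `RC_β`. -/
def genF (D : Datum k I) : GenR β → RC D β
  | .e ν => RC.e D ν.dag
  | .x p => RC.x D p
  | .s a => RC.s D a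

theorem ISeq.swap_swap (a : Fin (ht β - 1)) (ν : ISeq β) : (ν.swap a).swap a = ν := by
  refine ISeq.ext (funext fun p => ?_)
  simp [ISeq.swap]

theorem edag_genF (g : GenR β) : edag D β * genF D g = genF D g * edag D β := by
  cases g with
  | e ν => exact (edag_mul_e ν).trans (e_mul_edag ν).symm
  | x p =>
    simp only [genF, edag, Finset.sum_mul, Finset.mul_sum, RC.x_e]
  | s a =>
    simp only [genF, edag, Finset.sum_mul, Finset.mul_sum, RC.s_e]
    refine Fintype.sum_equiv (Function.Involutive.toPerm (ISeq.swap a) (ISeq.swap_swap a)) _ _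
      fun ν => ?_
    change _ = RC.e D ((ν.swap a).dag.swap a) * RC.s D a
    have : (ν.swap a).dag.swap a = ν.dag := congrArg ISeq.dag (ν.swap_swap a)
    rw [this]

theorem genF_rel (a b : FreeAlgebra k (GenR β)) (h : RelR D β a b) :
    edag D β * FreeAlgebra.lift k (genF D) a = edag D β * FreeAlgebra.lift k (genF D) b := by
  have Le : ∀ ν : ISeq β, FreeAlgebra.lift k (genF D) (FreeR.e k ν) = RC.e D ν.dag := fun ν =>
    FreeAlgebra.lift_ι_apply _ _
  have Lx : ∀ p, FreeAlgebra.lift k (genF D) (FreeR.x k p) = RC.x D (β := β) p := fun p =>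
    FreeAlgebra.lift_ι_apply _ _
  have Ls : ∀ a, FreeAlgebra.lift k (genF D) (FreeR.s k a) = RC.s D (β := β) a := fun a =>
    FreeAlgebra.lift_ι_apply _ _
  have hne : ∀ i j : I, i ≠ j → ((i, 0) : I × ZMod 2) ≠ (j, 0) := fun i j h h' =>
    h (congrArg Prod.fst h')
  have hnc : ∀ i j : I, ((i, 0) : I × ZMod 2) ≠ cJ (j, 0) := fun i j h' =>
    absurd (congrArg Prod.snd h') (show ¬(0 : ZMod 2) = 1 - 0 by decide)
  cases h
  case sum_e =>
    simp only [map_sum, Le, map_one, mul_one]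
    exact edag_mul_self
  all_goals congr 1
  all_goals simp only [map_mul, map_sub, map_zero, D.map_Q, D.map_dQ, Le, Lx, Ls]
  case e_mul_self ν => exact RC.e_mul_self _
  case e_mul_ne μ ν h => exact RC.e_mul_ne fun h' => h (ISeq.dag_injective h')
  case x_e p ν => exact RC.x_e _ _
  case x_x p q => exact RC.x_x _ _
  case s_e a ν => exact RC.s_e _ _
  case s_x a p h1 h2 => simpa using RC.π_rel (RelC.s_x (D := D) a p h1 h2)
  case s_hi_eq a ν h =>
    simpa using RC.π_rel (RelC.s_hi_eq (D := D) a ν.dag (congrArg (·, 0) h))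
  case s_hi_ne a ν h =>
    simpa using RC.π_rel (RelC.s_hi_ne (D := D) a ν.dag (hne _ _ h) (hnc _ _))
  case s_lo_eq a ν h =>
    simpa using RC.π_rel (RelC.s_lo_eq (D := D) a ν.dag (congrArg (·, 0) h))
  case s_lo_ne a ν h =>
    simpa using RC.π_rel (RelC.s_lo_ne (D := D) a ν.dag (hne _ _ h) (hnc _ _))
  case s_sq a ν =>
    have := RC.π_rel (RelC.s_sq (D := D) a ν.dag)
    simp only [map_mul, D.map_Qt, RC.π_e, RC.π_x, RC.π_s] at this
    refine this.trans ?_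
    exact congrArg (· * RC.e D ν.dag) (D.Qt_zero _ _ _ _)
  case s_s a b h => simpa using RC.π_rel (RelC.s_s (D := D) a b h)
  case braid_eq a b ν hab h =>
    have := RC.π_rel (RelC.braid_eq (D := D) a b ν.dag hab (congrArg (·, 0) h))
    simp only [map_mul, map_sub, D.map_dQt, RC.π_e, RC.π_x, RC.π_s] at this
    refine this.trans ?_
    exact congrArg (· * RC.e D ν.dag) (D.dQt_zero _ _ _ _ _)
  case braid_ne a b ν hab h =>
    simpa using RC.π_rel (RelC.braid_ne (D := D) a b ν.dag hab (hne _ _ h) (hnc _ _))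

variable (D β)

/-- The elements of `RC_β` that commute with `e†(β)`. -/
def cent : Subalgebra k (RC D β) := Subalgebra.centralizer k {edag D β}

theorem genF_mem (g : GenR β) : genF D g ∈ cent D β := by
  rw [cent, Subalgebra.mem_centralizer_iff]
  rintro _ rfl
  exact edag_genF g

variable (V : Type w) [AddCommGroup V] [Module k V] [Module (RC D β) V]
  [IsScalarTower k (RC D β) V]

/-- The space `e†(β) V`. -/
def FSpace : Submodule k V := LinearMap.range (Algebra.lsmul k k V (edag D β))

variable {V}

theorem mem_FSpace {u : V} : u ∈ FSpace D β V ↔ edag D β • u = u := by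
  constructor
  · rintro ⟨v, rfl⟩
    change edag D β • edag D β • v = edag D β • v
    rw [smul_smul, edag_mul_self]
  · intro h
    exact ⟨u, h⟩

theorem cent_smul_mem (a : cent D β) {u : V} (hu : u ∈ FSpace D β V) :
    (a : RC D β) • u ∈ FSpace D β V := by
  rw [mem_FSpace] at hu ⊢
  have ha := (Subalgebra.mem_centralizer_iff k).1 a.2 (edag D β) rfl
  rw [smul_smul, ha, mul_smul, hu]

variable (V)

/-- The action on `e†(β) V` of the elements of `RC_β` that commute with `e†(β)`. -/
def res : cent D β →ₐ[k] Module.End k (FSpace D β V) where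
  toFun a := (Algebra.lsmul k k V (a : RC D β)).restrict fun _ hu => cent_smul_mem D β a hu
  map_one' := LinearMap.ext fun u => Subtype.ext (one_smul (RC D β) (u : V))
  map_mul' a b := LinearMap.ext fun u => Subtype.ext (mul_smul (a : RC D β) (b : RC D β) (u : V))
  map_zero' := LinearMap.ext fun u => Subtype.ext (zero_smul (RC D β) (u : V))
  map_add' a b := LinearMap.ext fun u => Subtype.ext (add_smul (a : RC D β) (b : RC D β) (u : V))
  commutes' r := LinearMap.ext fun u => Subtype.ext (algebraMap_smul (RC D β) r (u : V))

/-- The generators of `R_β` act on `e†(β) V` by `e(ν†)`, `x_p`, `σ_a`. -/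
def actGen (g : GenR β) : Module.End k (FSpace D β V) := res D β V ⟨genF D g, genF_mem D β g⟩

theorem lift_actGen (a : FreeAlgebra k (GenR β)) (u : FSpace D β V) :
    (FreeAlgebra.lift k (actGen D β V) a u : V) = FreeAlgebra.lift k (genF D) a • (u : V) := by
  have h1 : FreeAlgebra.lift k (actGen D β V) =
      (res D β V).comp (FreeAlgebra.lift k fun g => ⟨genF D g, genF_mem D β g⟩) := by
    refine FreeAlgebra.hom_ext (funext fun g => ?_)
    change FreeAlgebra.lift k (actGen D β V) (FreeAlgebra.ι k g) =
      res D β V (FreeAlgebra.lift k _ (FreeAlgebra.ι k g))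
    rw [FreeAlgebra.lift_ι_apply, FreeAlgebra.lift_ι_apply]
    rfl
  have h2 : FreeAlgebra.lift k (genF D) =
      (cent D β).val.comp (FreeAlgebra.lift k fun g => ⟨genF D g, genF_mem D β g⟩) := by
    refine FreeAlgebra.hom_ext (funext fun g => ?_)
    change FreeAlgebra.lift k (genF D) (FreeAlgebra.ι k g) =
      (cent D β).val (FreeAlgebra.lift k _ (FreeAlgebra.ι k g))
    rw [FreeAlgebra.lift_ι_apply, FreeAlgebra.lift_ι_apply]
    rfl
  rw [h1, h2]
  rfl

/-- The action of `R_β ≃ e†(β) RC_β e†(β)` on `e†(β) V`. -/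
def act : KLR D β →ₐ[k] Module.End k (FSpace D β V) :=
  KLR.lift (actGen D β V) fun a b h => by
    refine LinearMap.ext fun u => Subtype.ext ?_
    rw [lift_actGen, lift_actGen]
    have hu : (u : V) = edag D β • (u : V) := ((mem_FSpace D β).1 u.2).symm
    have hc : ∀ a : FreeAlgebra k (GenR β),
        edag D β * FreeAlgebra.lift k (genF D) a = FreeAlgebra.lift k (genF D) a * edag D β := by
      intro a
      induction a with
      | grade0 r => rw [AlgHom.commutes]; exact (Algebra.commutes r _).symm
      | grade1 g => rw [FreeAlgebra.lift_ι_apply]; exact edag_genF g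
      | mul a b iha ihb => rw [map_mul, ← mul_assoc, iha, mul_assoc, ihb, mul_assoc]
      | add a b iha ihb => rw [map_add, mul_add, iha, ihb, add_mul]
    rw [hu, smul_smul, smul_smul, ← hc, ← hc, genF_rel a b h]

/-- The `R_β`-module `F(V) = e†(β) V`. -/
def FMod : Type w := FSpace D β V

instance : AddCommGroup (FMod D β V) := inferInstanceAs (AddCommGroup (FSpace D β V))
instance : Module k (FMod D β V) := inferInstanceAs (Module k (FSpace D β V))
instance : Module (KLR D β) (FMod D β V) := Module.compHom (FSpace D β V) (act D β V).toRingHom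
instance : IsScalarTower k (KLR D β) (FMod D β V) where
  smul_assoc r a u := by
    change act D β V (r • a) u = r • act D β V a u
    rw [map_smul]; rfl

namespace FMod

/-- The inclusion of `e†(β) V` into `V`. -/
def incl : FMod D β V →ₗ[k] V := (FSpace D β V).subtype

theorem incl_injective : Function.Injective (incl D β V) := Subtype.val_injective

theorem edag_incl (u : FMod D β V) : edag D β • incl D β V u = incl D β V u :=
  (mem_FSpace D β).1 u.2

theorem incl_gen_smul (g : GenR β) (u : FMod D β V) :
    incl D β V (KLR.gen D g • u) = genF D g • incl D β V u := by
  change ((act D β V (KLR.gen D g)) u : V) = _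
  rw [act, KLR.lift_gen]
  rfl

variable {V}

/-- The element `e†(β) m` of `F(V)`. -/
def of (m : V) : FMod D β V := ⟨edag D β • m, m, rfl⟩

variable {D β}

section

variable {W : Type w₁} [AddCommGroup W] [Module k W] [Module (RC D β) W]
  [IsScalarTower k (RC D β) W] (f : V →ₗ[RC D β] W)

/-- The restriction `e†(β) V → e†(β) W` of a homomorphism `V → W`, as a `𝕜`-linear map. -/
def mapk : FMod D β V →ₗ[k] FMod D β W :=
  LinearMap.restrict (p := FSpace D β V) (q := FSpace D β W) (f.restrictScalars k) fun u hu => by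
    rw [mem_FSpace] at hu ⊢
    change edag D β • f u = f u
    rw [← map_smul, hu]

theorem incl_mapk (u : FMod D β V) : incl D β W (mapk f u) = f (incl D β V u) := rfl

/-- The homomorphism `F(f) : F(V) → F(W)` induced by a homomorphism `f : V → W`. -/
def map : FMod D β V →ₗ[KLR D β] FMod D β W :=
  KLR.linOfGen (V := FMod D β V) (W := FMod D β W) (mapk f) fun g u => by
    refine incl_injective D β W ?_
    rw [incl_gen_smul, incl_mapk, incl_mapk, incl_gen_smul, map_smul]

end

end FMod

variable {D β}

/-- The `R_β`-module `F(M) = e†(β) M`. -/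
def SMod.F (M : SMod.{u, v, w} D β) : KMod.{u, v, w} D β where
  V := FMod D β M.V

/-- The element `e†(β) m` of `F(M)`. -/
def SMod.toF (M : SMod.{u, v, w} D β) (m : M.V) : M.F.V := FMod.of D β m

/-- The inclusion of `F(M)` into `M`. -/
def SMod.inclF (M : SMod.{u, v, w} D β) : M.F.V →ₗ[k] M.V := FMod.incl D β M.V

theorem SMod.inclF_gen_smul (M : SMod.{u, v, w} D β) (g : GenR β) (u : M.F.V) :
    M.inclF (KLR.gen D g • u) = genF D g • M.inclF u := FMod.incl_gen_smul D β M.V g u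

theorem SMod.edag_inclF (M : SMod.{u, v, w} D β) (u : M.F.V) :
    edag D β • M.inclF u = M.inclF u := FMod.edag_incl D β M.V u

variable {β₁ β₂ : I →₀ ℕ} (h : β₁ + β₂ = β) (M : SMod.{u, v, w₁} D β₁)
  (N : SMod.{u, v, w₂} D β₂)

theorem edag_tens {u : M.V} {v : N.V} (hu : edag D β₁ • u = u) (hv : edag D β₂ • v = v) :
    edag D β • SMod.tens h M N u v = SMod.tens h M N u v := by
  have key : SMod.tens h M N u v =
      ∑ ν : ISeq β₁, ∑ η : ISeq β₂,
        RC.e D (JSeq.append h ν.dag η.dag) • SMod.tens h M N u v := by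
    conv_lhs => rw [← hu, ← hv]
    have h1 : ∀ ν : ISeq β₁, ∀ η : ISeq β₂,
        RC.e D (JSeq.append h ν.dag η.dag) • SMod.tens h M N u v =
          Ind.mk {t | SMod.ConvRel h M N t} ((RC.e D ν.dag • u) ⊗ₜ (RC.e D η.dag • v)) :=
      fun ν η => Ind.rel (SMod.ConvRel.e ν.dag η.dag u v)
    simp only [h1]
    rw [Finset.sum_comm]
    simp only [SMod.tens, edag, Finset.sum_smul, TensorProduct.sum_tmul, TensorProduct.tmul_sum,
      map_sum]
  conv_lhs => rw [key]
  simp only [Finset.smul_sum, smul_smul, ← ISeq.dag_append, edag_mul_e]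
  simp only [ISeq.dag_append]
  exact key.symm

/-- The bilinear map underlying the identification `F(M) ∘ F(N) → F(M ∘ N)`. -/
def tensF : M.F.V ⊗[k] N.F.V →ₗ[k] FMod D β (SMod.conv h M N) :=
  LinearMap.codRestrict (FSpace D β (SMod.conv h M N))
    (Ind.mk {t | SMod.ConvRel h M N t} ∘ₗ TensorProduct.map M.inclF N.inclF) fun t => by
      induction t with
      | zero => rw [map_zero]; exact Submodule.zero_mem _
      | tmul u v =>
        exact (mem_FSpace D β).2 (edag_tens h M N (M.edag_inclF u) (N.edag_inclF v))
      | add a b iha ihb => rw [map_add]; exact Submodule.add_mem _ iha ihb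

theorem incl_tensF (u : M.F.V) (v : N.F.V) :
    FMod.incl D β (SMod.conv h M N) (tensF h M N (u ⊗ₜ v)) =
      SMod.tens h M N (M.inclF u) (N.inclF v) := rfl

/-- The identification `F(M) ∘ F(N) → F(M ∘ N)`, `u ⊗ v ↦ u ⊗ v`. -/
def convF : KMod.conv h M.F N.F →ₗ[KLR D β] FMod D β (SMod.conv h M N) :=
  Ind.lift (tensF h M N) fun t ht => by
    cases ht <;>
      refine (map_sub (Ind.act (tensF h M N)) _ _).trans (sub_eq_zero.2 ?_) <;>
      refine FMod.incl_injective D β (SMod.conv h M N) ?_ <;>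
      simp only [Ind.act_tmul, one_smul] <;>
      refine (FMod.incl_gen_smul D β _ _ _).trans ?_ <;>
      rw [incl_tensF, incl_tensF]
    case e ν η u v =>
      refine Eq.trans ?_ ((Ind.rel (SMod.ConvRel.e ν.dag η.dag (M.inclF u) (N.inclF v))).trans ?_)
      · rw [← ISeq.dag_append]; rfl
      · exact congrArg₂ (SMod.tens h M N) (M.inclF_gen_smul (.e ν) u).symm
          (N.inclF_gen_smul (.e η) v).symm
    case xL p u v =>
      exact (Ind.rel (SMod.ConvRel.xL p (M.inclF u) (N.inclF v))).trans
        (congrArg (SMod.tens h M N · (N.inclF v)) (M.inclF_gen_smul (.x p) u).symm)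
    case xR p u v =>
      exact (Ind.rel (SMod.ConvRel.xR p (M.inclF u) (N.inclF v))).trans
        (congrArg (SMod.tens h M N (M.inclF u)) (N.inclF_gen_smul (.x p) v).symm)
    case sL a u v =>
      exact (Ind.rel (SMod.ConvRel.sL a (M.inclF u) (N.inclF v))).trans
        (congrArg (SMod.tens h M N · (N.inclF v)) (M.inclF_gen_smul (.s a) u).symm)
    case sR a u v =>
      exact (Ind.rel (SMod.ConvRel.sR a (M.inclF u) (N.inclF v))).trans
        (congrArg (SMod.tens h M N (M.inclF u)) (N.inclF_gen_smul (.s a) v).symm)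

theorem convF_tens (u : M.F.V) (v : N.F.V) :
    FMod.incl D β (SMod.conv h M N) (convF h M N (KMod.tens h M.F N.F u v)) =
      SMod.tens h M N (M.inclF u) (N.inclF v) :=
  congrArg (FMod.incl D β (SMod.conv h M N)) (Ind.lift_mk (tensF h M N) _ (u ⊗ₜ v))

end Morita

end QHC

end

noncomputable section

namespace QHC

/-! ### Shuffles -/

section Shuffles

theorem lo_lt_hi {n : ℕ} (a : Fin (n - 1)) : lo a < hi a := by
  simp [lo, hi, Fin.lt_def]

theorem lo_ne_hi {n : ℕ} (a : Fin (n - 1)) : lo a ≠ hi a := (lo_lt_hi a).ne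

theorem swap_lt_swap {n : ℕ} (a : Fin (n - 1)) {p q : Fin n} (h : p < q)
    (h' : ¬(p = lo a ∧ q = hi a)) :
    Equiv.swap (lo a) (hi a) p < Equiv.swap (lo a) (hi a) q := by
  simp only [Equiv.swap_apply_def, lo, hi, Fin.ext_iff, Fin.lt_def] at *
  split_ifs <;> simp_all <;> omega

/-- A bijection from `N` positions to `n₁ + n₂` strands that preserves the order of the first `n₁`
strands and the order of the last `n₂` strands. -/
@[ext]
structure Shuffle (n₁ n₂ N : ℕ) where
  equiv : Fin N ≃ Fin n₁ ⊕ Fin n₂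
  monoL : ∀ {p q i j}, equiv p = .inl i → equiv q = .inl j → p < q → i < j
  monoR : ∀ {p q i j}, equiv p = .inr i → equiv q = .inr j → p < q → i < j

namespace Shuffle

variable {n₁ n₂ N : ℕ}

/-- The strands at the positions `a` and `a + 1` belong to different factors. -/
def Mixed (w : Shuffle n₁ n₂ N) (a : Fin (N - 1)) : Prop :=
  (w.equiv (lo a)).isLeft ≠ (w.equiv (hi a)).isLeft

open Classical in
/-- Exchange the strands at the positions `a` and `a + 1` if they belong to different factors. -/
def sw (a : Fin (N - 1)) (w : Shuffle n₁ n₂ N) : Shuffle n₁ n₂ N :=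
  if h : w.Mixed a then
    { equiv := (Equiv.swap (lo a) (hi a)).trans w.equiv
      monoL := fun {p q i j} hp hq hpq => by
        refine w.monoL hp hq (swap_lt_swap a hpq ?_)
        rintro ⟨rfl, rfl⟩
        simp only [Equiv.trans_apply, Equiv.swap_apply_left, Equiv.swap_apply_right] at hp hq
        simp [Mixed, hp, hq] at h
      monoR := fun {p q i j} hp hq hpq => by
        refine w.monoR hp hq (swap_lt_swap a hpq ?_)
        rintro ⟨rfl, rfl⟩
        simp only [Equiv.trans_apply, Equiv.swap_apply_left, Equiv.swap_apply_right] at hp hq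
        simp [Mixed, hp, hq] at h }
  else w

variable {w : Shuffle n₁ n₂ N} {a b : Fin (N - 1)}

theorem sw_equiv (h : w.Mixed a) : (w.sw a).equiv = (Equiv.swap (lo a) (hi a)).trans w.equiv := by
  rw [sw, dif_pos h]

theorem sw_apply (h : w.Mixed a) (p : Fin N) :
    (w.sw a).equiv p = w.equiv (Equiv.swap (lo a) (hi a) p) := by
  rw [sw_equiv h]; rfl

theorem sw_lo (h : w.Mixed a) : (w.sw a).equiv (lo a) = w.equiv (hi a) := by
  rw [sw_apply h, Equiv.swap_apply_left]

theorem sw_hi (h : w.Mixed a) : (w.sw a).equiv (hi a) = w.equiv (lo a) := by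
  rw [sw_apply h, Equiv.swap_apply_right]

theorem sw_of_ne (h : w.Mixed a) {p : Fin N} (h1 : p ≠ lo a) (h2 : p ≠ hi a) :
    (w.sw a).equiv p = w.equiv p := by
  rw [sw_apply h, Equiv.swap_apply_of_ne_of_ne h1 h2]

theorem sw_of_not (h : ¬w.Mixed a) : w.sw a = w := by
  rw [sw, dif_neg h]

theorem Mixed.sw (h : w.Mixed a) : (w.sw a).Mixed a := by
  rw [Mixed, sw_lo h, sw_hi h]; exact Ne.symm h

theorem sw_sw (w : Shuffle n₁ n₂ N) (a : Fin (N - 1)) : (w.sw a).sw a = w := by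
  by_cases h : w.Mixed a
  · ext p
    rw [sw_apply h.sw, sw_apply h, Equiv.swap_apply_self]
  · rw [sw_of_not h, sw_of_not h]

theorem mixed_LR {i j} (h1 : w.equiv (lo a) = .inl i) (h2 : w.equiv (hi a) = .inr j) :
    w.Mixed a := by simp [Mixed, h1, h2]

theorem mixed_RL {i j} (h1 : w.equiv (lo a) = .inr j) (h2 : w.equiv (hi a) = .inl i) :
    w.Mixed a := by simp [Mixed, h1, h2]

theorem lo_ne_of_far (h : (a : ℕ) + 1 < b ∨ (b : ℕ) + 1 < a) :
    lo b ≠ lo a ∧ lo b ≠ hi a ∧ hi b ≠ lo a ∧ hi b ≠ hi a := by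
  simp only [lo, hi, ne_eq, Fin.mk.injEq]; omega

theorem sw_lo_far (h : w.Mixed a) (hab : (a : ℕ) + 1 < b ∨ (b : ℕ) + 1 < a) :
    (w.sw a).equiv (lo b) = w.equiv (lo b) :=
  sw_of_ne h (lo_ne_of_far hab).1 (lo_ne_of_far hab).2.1

theorem sw_hi_far (h : w.Mixed a) (hab : (a : ℕ) + 1 < b ∨ (b : ℕ) + 1 < a) :
    (w.sw a).equiv (hi b) = w.equiv (hi b) :=
  sw_of_ne h (lo_ne_of_far hab).2.2.1 (lo_ne_of_far hab).2.2.2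

theorem mixed_sw_far (h : w.Mixed a) (hab : (a : ℕ) + 1 < b ∨ (b : ℕ) + 1 < a) :
    (w.sw a).Mixed b ↔ w.Mixed b := by
  rw [Mixed, Mixed, sw_lo_far h hab, sw_hi_far h hab]

theorem sw_comm (ha : w.Mixed a) (hb : w.Mixed b) (hab : (a : ℕ) + 1 < b ∨ (b : ℕ) + 1 < a) :
    (w.sw a).sw b = (w.sw b).sw a := by
  ext p
  rw [sw_apply ((mixed_sw_far ha hab).2 hb), sw_apply ha,
    sw_apply ((mixed_sw_far hb hab.symm).2 ha), sw_apply hb]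
  obtain ⟨h1, h2, h3, h4⟩ := lo_ne_of_far hab
  congr 1
  have : Equiv.Perm.Disjoint (Equiv.swap (lo a) (hi a)) (Equiv.swap (lo b) (hi b)) := by
    intro x
    by_cases hx : x = lo a ∨ x = hi a
    · right
      rcases hx with rfl | rfl
      · exact Equiv.swap_apply_of_ne_of_ne h1.symm h3.symm
      · exact Equiv.swap_apply_of_ne_of_ne h2.symm h4.symm
    · left
      push Not at hx
      exact Equiv.swap_apply_of_ne_of_ne hx.1 hx.2
  exact congrArg (· p) this.commute.eq

theorem consecutive_left {i j} (h1 : w.equiv (lo a) = .inl i) (h2 : w.equiv (hi a) = .inl j) :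
    ∃ b : Fin (n₁ - 1), i = lo b ∧ j = hi b := by
  have hij : i < j := w.monoL h1 h2 (lo_lt_hi a)
  have hj : (j : ℕ) = i + 1 := by
    by_contra hne
    have hlt : (i : ℕ) + 1 < j := by have := Fin.lt_def.1 hij; omega
    set l : Fin n₁ := ⟨i + 1, by omega⟩
    set p := w.equiv.symm (.inl l)
    have hp : w.equiv p = .inl l := Equiv.apply_symm_apply _ _
    rcases lt_trichotomy p (lo a) with h | h | h
    · have := w.monoL hp h1 h
      simp [l, Fin.lt_def] at this
    · rw [h, h1] at hp
      have := Sum.inl_injective hp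
      simp [l, Fin.ext_iff] at this
    · rcases lt_trichotomy p (hi a) with h' | h' | h'
      · simp [lo, hi, Fin.lt_def] at h h'; omega
      · rw [h', h2] at hp
        have := Sum.inl_injective hp
        simp [l, Fin.ext_iff] at this; omega
      · have := w.monoL h2 hp h'
        simp [l, Fin.lt_def] at this; omega
  exact ⟨⟨i, by omega⟩, rfl, Fin.ext hj⟩

/-- Exchange the roles of the two factors. -/
def flip (w : Shuffle n₁ n₂ N) : Shuffle n₂ n₁ N where
  equiv := w.equiv.trans (Equiv.sumComm _ _)
  monoL {p q i j} hp hq h := by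
    refine w.monoR (i := i) (j := j) ?_ ?_ h
    · simpa using congrArg Sum.swap hp
    · simpa using congrArg Sum.swap hq
  monoR {p q i j} hp hq h := by
    refine w.monoL (i := i) (j := j) ?_ ?_ h
    · simpa using congrArg Sum.swap hp
    · simpa using congrArg Sum.swap hq

theorem flip_inr {p : Fin N} {i} (h : w.equiv p = .inr i) : w.flip.equiv p = .inl i := by
  simp [flip, h]

theorem consecutive_right {i j} (h1 : w.equiv (lo a) = .inr i) (h2 : w.equiv (hi a) = .inr j) :
    ∃ b : Fin (n₂ - 1), i = lo b ∧ j = hi b :=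
  consecutive_left (w := w.flip) (flip_inr h1) (flip_inr h2)

/-- The shuffle that puts the first `n₁` strands before the last `n₂` strands. -/
def base (h : n₁ + n₂ = N) : Shuffle n₁ n₂ N where
  equiv := (finCongr h.symm).trans finSumFinEquiv.symm
  monoL {p q i j} hp hq hpq := by
    simp only [Equiv.trans_apply, Equiv.symm_apply_eq, finSumFinEquiv_apply_left] at hp hq
    have h1 := Fin.ext_iff.1 hp
    have h2 := Fin.ext_iff.1 hq
    have h3 := Fin.lt_def.1 hpq
    simp only [finCongr_apply, Fin.val_cast, Fin.val_castAdd] at h1 h2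
    exact Fin.lt_def.2 (by omega)
  monoR {p q i j} hp hq hpq := by
    simp only [Equiv.trans_apply, Equiv.symm_apply_eq, finSumFinEquiv_apply_right] at hp hq
    have h1 := Fin.ext_iff.1 hp
    have h2 := Fin.ext_iff.1 hq
    have h3 := Fin.lt_def.1 hpq
    simp only [finCongr_apply, Fin.val_cast, Fin.val_natAdd] at h1 h2
    exact Fin.lt_def.2 (by omega)

theorem base_left (h : n₁ + n₂ = N) (i : Fin n₁) (hi : (i : ℕ) < N) :
    (base h).equiv ⟨i, hi⟩ = .inl i := by
  simp only [base, Equiv.trans_apply, Equiv.symm_apply_eq, finSumFinEquiv_apply_left]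
  ext; simp

theorem base_right (h : n₁ + n₂ = N) (i : Fin n₂) (hi : n₁ + (i : ℕ) < N) :
    (base h).equiv ⟨n₁ + i, hi⟩ = .inr i := by
  simp only [base, Equiv.trans_apply, Equiv.symm_apply_eq, finSumFinEquiv_apply_right]
  ext; simp

theorem base_isLeft (h : n₁ + n₂ = N) (p : Fin N) :
    ((base h).equiv p).isLeft = true ↔ (p : ℕ) < n₁ := by
  by_cases hp : (p : ℕ) < n₁
  · have := base_left h ⟨p, hp⟩ p.2
    simp only [Fin.eta] at this
    simp [this, hp]
  · have := base_right h ⟨p - n₁, by omega⟩ (by simp; omega)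
    simp only [show n₁ + ((p : ℕ) - n₁) = p by omega, Fin.eta] at this
    simp [this, hp]

/-- The sum of the positions of the first `n₁` strands. -/
def len (w : Shuffle n₁ n₂ N) : ℕ := ∑ i, (w.equiv.symm (.inl i) : ℕ)

theorem len_sw {i j} (h1 : w.equiv (lo a) = .inl i) (h2 : w.equiv (hi a) = .inr j) :
    (w.sw a).len = w.len + 1 := by
  have hm := mixed_LR h1 h2
  have key : ∀ l, ((w.sw a).equiv.symm (.inl l) : ℕ) =
      (w.equiv.symm (.inl l) : ℕ) + if l = i then 1 else 0 := by
    intro l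
    rw [sw_equiv hm]
    simp only [Equiv.symm_trans_apply, Equiv.symm_swap]
    split_ifs with hl
    · subst hl
      rw [← h1, Equiv.symm_apply_apply, Equiv.swap_apply_left]
      simp [lo, hi]
    · rw [Equiv.swap_apply_of_ne_of_ne, add_zero]
      · rw [Ne, Equiv.symm_apply_eq, h1]
        exact fun h => hl (Sum.inl_injective h)
      · rw [Ne, Equiv.symm_apply_eq, h2]
        exact Sum.inl_ne_inr
  simp only [len, key, Finset.sum_add_distrib]
  simp

theorem hi_eq_lo {a b : Fin (N - 1)} (h : (b : ℕ) = a + 1) : hi a = lo b := by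
  simp [lo, hi, h]

/-- `Path h s w b`: the element `b` is the product of the `s a` along a sequence of crossings that leads
from the base shuffle to `w` and moves one of the first `n₁` strands to the right at each step. -/
inductive Path {B : Type*} [Monoid B] (h : n₁ + n₂ = N) (s : Fin (N - 1) → B) :
    Shuffle n₁ n₂ N → B → Prop
  | base : Path h s (base h) 1
  | up {w : Shuffle n₁ n₂ N} {b : B} (a : Fin (N - 1)) {i j} : Path h s w b →
      w.equiv (lo a) = .inl i → w.equiv (hi a) = .inr j → Path h s (w.sw a) (s a * b)

theorem base_not_descent (h : n₁ + n₂ = N) {i j} (h1 : (base h).equiv (lo a) = .inr j)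
    (h2 : (base h).equiv (hi a) = .inl i) : False := by
  have h3 := (base_isLeft h (hi a)).1 (by rw [h2]; rfl)
  have h4 := (base_isLeft h (lo a)).2 (lt_trans (lo_lt_hi a) h3)
  rw [h1] at h4
  exact absurd h4 (by simp)

variable {B : Type*} [Monoid B] {h : n₁ + n₂ = N} {s : Fin (N - 1) → B}

theorem Path.descent (hs : ∀ a b : Fin (N - 1), (a : ℕ) + 1 < b → s a * s b = s b * s a)
    {x : B} (hw : Path h s w x) {i j} (h1 : w.equiv (lo a) = .inr j)
    (h2 : w.equiv (hi a) = .inl i) : ∃ y, Path h s (w.sw a) y ∧ x = s a * y := by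
  induction hw generalizing i j with
  | base => exact (base_not_descent h h1 h2).elim
  | @up w b c i' j' hw h3 h4 ih =>
    have hm := mixed_LR h3 h4
    rcases lt_trichotomy (a : ℕ) c with hac | hac | hac
    · rcases Nat.lt_or_ge ((a : ℕ) + 1) c with hac' | hac'
      · have far : (c : ℕ) + 1 < a ∨ (a : ℕ) + 1 < c := Or.inr hac'
        rw [sw_lo_far hm far] at h1
        rw [sw_hi_far hm far] at h2
        obtain ⟨y, hy, rfl⟩ := ih h1 h2
        have hma := mixed_RL h1 h2
        refine ⟨s c * y, ?_, ?_⟩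
        · rw [sw_comm hm hma far]
          refine Path.up (i := i') (j := j') c hy ?_ ?_
          · rw [sw_lo_far hma far.symm, h3]
          · rw [sw_hi_far hma far.symm, h4]
        · rw [← mul_assoc, ← mul_assoc, hs a c hac']
      · have : hi a = lo c := hi_eq_lo (by omega)
        rw [this, sw_lo hm, h4] at h2
        exact absurd h2 (by simp)
    · obtain rfl : a = c := Fin.ext hac
      exact ⟨b, by rwa [sw_sw], rfl⟩
    · rcases Nat.lt_or_ge ((c : ℕ) + 1) a with hac' | hac'
      · have far : (c : ℕ) + 1 < a ∨ (a : ℕ) + 1 < c := Or.inl hac'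
        rw [sw_lo_far hm far] at h1
        rw [sw_hi_far hm far] at h2
        obtain ⟨y, hy, rfl⟩ := ih h1 h2
        have hma := mixed_RL h1 h2
        refine ⟨s c * y, ?_, ?_⟩
        · rw [sw_comm hm hma far]
          refine Path.up (i := i') (j := j') c hy ?_ ?_
          · rw [sw_lo_far hma far.symm, h3]
          · rw [sw_hi_far hma far.symm, h4]
        · rw [← mul_assoc, ← mul_assoc, hs c a hac']
      · have : hi c = lo a := hi_eq_lo (by omega)
        rw [← this, sw_hi hm, h3] at h1
        exact absurd h1 (by simp)

theorem Path.unique (hs : ∀ a b : Fin (N - 1), (a : ℕ) + 1 < b → s a * s b = s b * s a)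
    {x y : B} (hx : Path h s w x) (hy : Path h s w y) : x = y := by
  induction hx generalizing y with
  | base =>
    generalize hb : Shuffle.base h = w at hy
    cases hy with
    | base => rfl
    | @up w b a i j hw h1 h2 =>
      have hm := mixed_LR h1 h2
      exact (base_not_descent h (a := a) (by rw [hb, sw_lo hm, h2]) (by rw [hb, sw_hi hm, h1])).elim
  | @up w b a i j hw h1 h2 ih =>
    have hm := mixed_LR h1 h2
    obtain ⟨y', hy', rfl⟩ := hy.descent hs (a := a) (by rw [sw_lo hm, h2]) (by rw [sw_hi hm, h1])
    rw [sw_sw] at hy'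
    rw [ih hy']

end Shuffle

end Shuffles

/-! ### Polynomials and twisted commutation -/

section TwistedPoly

variable {k : Type u} [Field k] {B : Type w} [Ring B] [Algebra k B]

theorem mul_pow_of_twisted {S X Y E : B} (h : S * X = Y * S + E) (hXY : Commute X Y)
    (hE : Commute E X) (r : ℕ) :
    S * X ^ r = Y ^ r * S + (∑ l ∈ Finset.range r, X ^ l * Y ^ (r - 1 - l)) * E := by
  induction r with
  | zero => simp
  | succ r ih =>
    have h1 : ∑ l ∈ Finset.range (r + 1), X ^ l * Y ^ (r + 1 - 1 - l) =
        (∑ l ∈ Finset.range r, X ^ l * Y ^ (r - 1 - l)) * X + Y ^ r := by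
      rw [Finset.sum_range_succ', Finset.sum_mul]
      simp only [pow_zero, one_mul, Nat.add_sub_cancel, Nat.sub_zero]
      congr 1
      refine Finset.sum_congr rfl fun l hl => ?_
      rw [pow_succ, mul_assoc, mul_assoc, (hXY.pow_right _).eq]
      congr 3
      omega
    rw [pow_succ, ← mul_assoc, ih, add_mul, mul_assoc, h, mul_assoc _ E, hE.eq, h1, mul_add,
      add_mul, ← mul_assoc, ← pow_succ, mul_assoc _ X]
    abel

theorem mul_polyEval {S X Y E Z : B} (h : S * X = Y * S + E) (hXY : Commute X Y)
    (hE : Commute E X) (hZ : Commute S Z) (hEZ : Commute E Z) (c : ℕ → ℕ → k) (d₁ d₂ : ℕ) :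
    S * polyEval c d₁ d₂ X Z = polyEval c d₁ d₂ Y Z * S + polyDiff c d₁ d₂ X Y Z * E := by
  simp only [polyEval, polyDiff, Finset.mul_sum, Finset.sum_mul, ← Finset.sum_add_distrib]
  refine Finset.sum_congr rfl fun r _ => Finset.sum_congr rfl fun s _ => ?_
  rw [mul_smul_comm, ← mul_assoc, mul_pow_of_twisted h hXY hE, add_mul, mul_assoc,
    (hZ.pow_right s).eq, mul_assoc _ E, (hEZ.pow_right s).eq, ← mul_assoc, ← mul_assoc, smul_add,
    smul_mul_assoc, smul_mul_assoc, ← Finset.sum_mul]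

theorem polyDiff_symm {W X Y : B} (h : Commute W X) (c : ℕ → ℕ → k) (d₁ d₂ : ℕ) :
    polyDiff c d₁ d₂ W X Y = polyDiff c d₁ d₂ X W Y := by
  simp only [polyDiff]
  refine Finset.sum_congr rfl fun r _ => Finset.sum_congr rfl fun s _ => ?_
  rw [← Finset.sum_range_reflect]
  congr 2
  refine Finset.sum_congr rfl fun l hl => ?_
  rw [(h.pow_pow _ _).eq]
  congr 2
  have := Finset.mem_range.1 hl
  omega

theorem polyDiff_mul_sub {W X Y : B} (h₁ : Commute W X) (h₂ : Commute W Y) (h₃ : Commute X Y)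
    (c : ℕ → ℕ → k) (d₁ d₂ : ℕ) :
    polyDiff c d₁ d₂ W X Y * (W - X) = polyEval c d₁ d₂ W Y - polyEval c d₁ d₂ X Y := by
  obtain ⟨φ, hφ⟩ := exists_hom (k := k) ![W, X, Y] (by
    intro i j
    fin_cases i <;> fin_cases j <;> simp [h₁.eq, h₂.eq, h₃.eq])
  have h0 : φ (MvPolynomial.X 0) = W := hφ 0
  have h1 : φ (MvPolynomial.X 1) = X := hφ 1
  have h2 : φ (MvPolynomial.X 2) = Y := hφ 2
  have := congrArg φ (polyDiff_mul c d₁ d₂ (MvPolynomial.X 0 : MvPolynomial (Fin 3) k)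
    (MvPolynomial.X 1) (MvPolynomial.X 2))
  simpa only [map_mul, map_sub, map_polyEval, map_polyDiff, h0, h1, h2] using this

theorem polyEval_mem (A : Subalgebra k B) {X Y : B} (hX : X ∈ A) (hY : Y ∈ A) (c : ℕ → ℕ → k)
    (d₁ d₂ : ℕ) : polyEval c d₁ d₂ X Y ∈ A :=
  A.sum_mem fun _ _ => A.sum_mem fun _ _ =>
    A.smul_mem (A.mul_mem (A.pow_mem hX _) (A.pow_mem hY _)) _

theorem polyDiff_mem (A : Subalgebra k B) {W X Y : B} (hW : W ∈ A) (hX : X ∈ A) (hY : Y ∈ A)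
    (c : ℕ → ℕ → k) (d₁ d₂ : ℕ) : polyDiff c d₁ d₂ W X Y ∈ A :=
  A.sum_mem fun _ _ => A.sum_mem fun _ _ => A.smul_mem (A.mul_mem (A.sum_mem fun _ _ =>
    A.mul_mem (A.pow_mem hW _) (A.pow_mem hX _)) (A.pow_mem hY _)) _

variable {I : Type v} (D : Datum k I)

theorem Datum.q_self (i : I) (r s : ℕ) : D.q i i r s = 0 := by simp [Datum.q]

theorem Datum.Q_self (i : I) (X Y : B) : D.Q i i X Y = 0 := by
  simp [Datum.Q, polyEval, D.q_self]

theorem Datum.dQ_self (i : I) (W X Y : B) : D.dQ i i W X Y = 0 := by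
  simp [Datum.dQ, polyDiff, D.q_self]

theorem Datum.S_symm {i j : I} {r s : ℕ} (h : D.S i j r s) : D.S j i s r :=
  ⟨h.2.1, h.1, by rw [add_comm, h.2.2, mul_comm]⟩

theorem Datum.q_symm (i j : I) (r s : ℕ) : D.q i j r s = D.q j i s r := by
  unfold Datum.q
  by_cases h : i ≠ j ∧ D.S i j r s
  · rw [if_pos h, if_pos ⟨h.1.symm, D.S_symm h.2⟩]
    exact D.t_symm i j h.1 r s h.2.1 h.2.2.1 h.2.2.2
  · rw [if_neg h, if_neg fun h' => h ⟨h'.1.symm, D.S_symm h'.2⟩]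

theorem Datum.Q_symm {X Y : B} (h : Commute X Y) (i j : I) : D.Q i j X Y = D.Q j i Y X := by
  simp only [Datum.Q, polyEval]
  rw [Finset.sum_comm]
  refine Finset.sum_congr rfl fun s _ => Finset.sum_congr rfl fun r _ => ?_
  rw [D.q_symm, (h.pow_pow _ _).eq]

end TwistedPoly

/-! ### Relations of the quiver Hecke algebra -/

namespace KLR

variable {k : Type u} [Field k] {I : Type v} {D : Datum k I} {β : I →₀ ℕ}

theorem e_mul_ne {μ ν : ISeq β} (h : μ ≠ ν) : e D μ * e D ν = 0 := by
  simpa using π_rel (RelR.e_mul_ne (D := D) μ ν h)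
theorem x_e (p : Fin (ht β)) (ν : ISeq β) : x D p * e D ν = e D ν * x D p := by
  simpa using π_rel (RelR.x_e (D := D) p ν)
theorem s_e (a : Fin (ht β - 1)) (ν : ISeq β) : s D a * e D ν = e D (ν.swap a) * s D a := by
  simpa using π_rel (RelR.s_e (D := D) a ν)
theorem s_x {a : Fin (ht β - 1)} {p : Fin (ht β)} (h1 : p ≠ lo a) (h2 : p ≠ hi a) :
    s D a * x D p = x D p * s D a := by
  simpa using π_rel (RelR.s_x (D := D) a p h1 h2)
theorem s_s {a b : Fin (ht β - 1)} (h : (a : ℕ) + 1 < b) : s D a * s D b = s D b * s D a := by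
  simpa using π_rel (RelR.s_s (D := D) a b h)
theorem s_sq_e (a : Fin (ht β - 1)) (ν : ISeq β) : s D a * s D a * e D ν =
    D.Q (ν.seq (lo a)) (ν.seq (hi a)) (x D (lo a)) (x D (hi a)) * e D ν := by
  simpa [D.map_Q] using π_rel (RelR.s_sq (D := D) a ν)

theorem e_mul_e [DecidableEq (ISeq β)] (μ ν : ISeq β) :
    e D μ * e D ν = if μ = ν then e D ν else 0 := by
  split_ifs with h
  · rw [h, e_mul_self]
  · exact e_mul_ne h

theorem ext_e {B : Type*} [Ring B] [Algebra k B] (ι : KLR D β →ₐ[k] B) {a b : B}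
    (h : ∀ ν, a * ι (e D ν) = b * ι (e D ν)) : a = b := by
  have : ∀ a : B, a = ∑ ν : ISeq β, a * ι (e D ν) := by
    intro a; rw [← Finset.mul_sum, ← map_sum, sum_e, map_one, mul_one]
  rw [this a, this b]
  exact Finset.sum_congr rfl fun ν _ => h ν

theorem sum_mul_e (f : ISeq β → KLR D β) (ν : ISeq β) : (∑ μ, f μ * e D μ) * e D ν = f ν * e D ν := by
  classical
  rw [Finset.sum_mul, Finset.sum_eq_single ν]
  · rw [mul_assoc, e_mul_self]
  · intro μ _ h
    rw [mul_assoc, e_mul_ne h, mul_zero]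
  · simp

open Classical in
/-- The sum of the `e(ν)` with `ν_a = ν_{a+1}`. -/
def eqn (D : Datum k I) (a : Fin (ht β - 1)) : KLR D β :=
  ∑ ν : ISeq β, (if ν.seq (lo a) = ν.seq (hi a) then 1 else 0) * e D ν

open Classical in
theorem eqn_mul_e (a : Fin (ht β - 1)) (ν : ISeq β) :
    eqn D a * e D ν = (if ν.seq (lo a) = ν.seq (hi a) then 1 else 0) * e D ν := sum_mul_e _ ν

theorem s_x_hi (a : Fin (ht β - 1)) : s D a * x D (hi a) = x D (lo a) * s D a + eqn D a := by
  refine ext_e (AlgHom.id k _) fun ν => ?_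
  simp only [AlgHom.coe_id, id]
  rw [add_mul, eqn_mul_e, ← sub_eq_iff_eq_add', ← sub_mul]
  split_ifs with h
  · simpa using π_rel (RelR.s_hi_eq (D := D) a ν h)
  · simpa using π_rel (RelR.s_hi_ne (D := D) a ν h)

theorem x_hi_s (a : Fin (ht β - 1)) : x D (hi a) * s D a = s D a * x D (lo a) + eqn D a := by
  refine ext_e (AlgHom.id k _) fun ν => ?_
  simp only [AlgHom.coe_id, id]
  rw [add_mul, eqn_mul_e, ← sub_eq_iff_eq_add', ← sub_mul]
  split_ifs with h
  · simpa using π_rel (RelR.s_lo_eq (D := D) a ν h)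
  · simpa using π_rel (RelR.s_lo_ne (D := D) a ν h)

open Classical in
theorem braid (a b : Fin (ht β - 1)) (h : (b : ℕ) = a + 1) :
    s D b * s D a * s D b = s D a * s D b * s D a +
      ∑ ν : ISeq β, (if ν.seq (lo a) = ν.seq (hi b) then
        D.dQ (ν.seq (lo a)) (ν.seq (hi a)) (x D (hi b)) (x D (lo a)) (x D (hi a)) else 0) *
          e D ν := by
  refine ext_e (AlgHom.id k _) fun ν => ?_
  simp only [AlgHom.coe_id, id]
  rw [add_mul, sum_mul_e, ← sub_eq_iff_eq_add', ← sub_mul]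
  split_ifs with h'
  · simpa [D.map_dQ] using π_rel (RelR.braid_eq (D := D) a b ν h h')
  · simpa using π_rel (RelR.braid_ne (D := D) a b ν h h')

end KLR

/-! ### A crossing inside one factor and a strand of the other factor -/

/-- The identities between a crossing `S` of two strands `p`, `q` of one factor and the coefficients
of the crossings of `p`, `q` with a strand of the other factor. -/
structure Braiding {C B : Type*} [CommRing C] [Ring B] (ι : C →+* B) (S : B)
    (hp hq up uq vp vq E F : C) : Prop where
  S_hq : S * ι hq = ι hp * S - ι (hp * hq)
  S_hp : S * ι hp = ι hq * S + ι (hp * hq)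
  S_uq : S * ι uq = ι up * S + ι E
  S_up : S * ι up = ι uq * S - ι E
  S_vq : S * ι vq = ι vp * S + ι F
  S_vp : S * ι vp = ι vq * S - ι F
  up_hp : up * hp = 0
  uq_hq : uq * hq = 0
  vp_hp : vp * hp = 0
  vq_hq : vq * hq = 0
  hp_E : hp * E = 0
  hq_F : hq * F = 0

namespace Braiding

variable {C B : Type*} [CommRing C] [Ring B] {ι : C →+* B} {S : B}
  {hp hq up uq vp vq E F : C} (H : Braiding ι S hp hq up uq vp vq E F)

theorem mul_mul_of {a a' b b' r s : C} (ha : S * ι a = ι a' * S + ι r)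
    (hb : S * ι b = ι b' * S + ι s) :
    S * ι (a * b) = ι (a' * b') * S + ι (a' * s + r * b) := by
  rw [map_mul, ← mul_assoc, ha, add_mul, mul_assoc, hb, mul_add]
  simp only [map_mul, map_add]
  noncomm_ring

theorem mul_add_of {a a' b b' r s : C} (ha : S * ι a = ι a' * S + ι r)
    (hb : S * ι b = ι b' * S + ι s) :
    S * ι (a + b) = ι (a' + b') * S + ι (r + s) := by
  rw [map_add, mul_add, ha, hb]
  simp only [map_add]
  noncomm_ring

include H

theorem hq' : S * ι hq = ι hp * S + ι (-(hp * hq)) := by rw [H.S_hq, map_neg, sub_eq_add_neg]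
theorem up' : S * ι up = ι uq * S + ι (-E) := by rw [H.S_up, map_neg, sub_eq_add_neg]
theorem vp' : S * ι vp = ι vq * S + ι (-F) := by rw [H.S_vp, map_neg, sub_eq_add_neg]

theorem gp : S * ι (up + hp) = ι (uq + hq) * S + ι (-E + hp * hq) := mul_add_of H.up' H.S_hp
theorem gq : S * ι (uq + hq) = ι (up + hp) * S + ι (E + -(hp * hq)) := mul_add_of H.S_uq H.hq'
theorem neg_hp : S * ι (-hp) = ι (-hq) * S + ι (-(hp * hq)) := by
  simp only [map_neg, mul_neg, H.S_hp]; noncomm_ring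
theorem neg_hq : S * ι (-hq) = ι (-hp) * S + ι (hp * hq) := by
  simp only [map_neg, mul_neg, H.S_hq]; noncomm_ring
theorem gp' : S * ι (vp + -hp) = ι (vq + -hq) * S + ι (-F + -(hp * hq)) := mul_add_of H.vp' H.neg_hp
theorem gq' : S * ι (vq + -hq) = ι (vp + -hp) * S + ι (F + hp * hq) := mul_add_of H.S_vq H.neg_hq

theorem gp_gq : S * ι (up + hp) * ι (uq + hq) = ι (up + hp) * ι (uq + hq) * S := by
  have h := mul_mul_of H.gp H.gq
  rw [mul_assoc, ← map_mul, h]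
  have e1 : (uq + hq) * (E + -(hp * hq)) + (-E + hp * hq) * (uq + hq) = 0 := by ring
  rw [e1, map_zero, add_zero, mul_comm (uq + hq), map_mul]

theorem gp'_gq' : S * ι (vq + -hq) * ι (vp + -hp) = ι (vq + -hq) * ι (vp + -hp) * S := by
  have h := mul_mul_of H.gq' H.gp'
  rw [mul_assoc, ← map_mul, h]
  have e1 : (vp + -hp) * (-F + -(hp * hq)) + (F + hp * hq) * (vp + -hp) = 0 := by ring
  rw [e1, map_zero, add_zero, mul_comm (vp + -hp), map_mul]

theorem pqr_mid : ι hq * ι hp * ι (uq + hq) + ι (uq + hq) * S * ι hq = ι hp * ι (uq + hq) * S := by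
  rw [mul_assoc _ S, H.hq', mul_add, ← mul_assoc, ← map_mul, ← map_mul, ← map_mul, ← map_mul,
    ← map_mul, add_left_comm, ← map_add, mul_comm (uq + hq) hp]
  have : hq * hp * (uq + hq) + (uq + hq) * -(hp * hq) = 0 := by ring
  rw [this, map_zero, add_zero]

theorem pqr_end : ι hq * S * ι hq + S * ι hq * S - ι (vq + -hq) * ι hp * ι (uq + hq) =
    ι hp * (S * S - ι (uq * vq)) := by
  rw [mul_assoc _ S, H.hq']
  have e : (vq + -hq) * hp * (uq + hq) = hp * (uq * vq) - hp * hq * hq := by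
    linear_combination hp * H.vq_hq - hp * H.uq_hq
  rw [← map_mul, ← map_mul, e]
  simp only [map_mul, map_sub, map_neg]
  have c : ι hq * ι hp = ι hp * ι hq := by rw [← map_mul, mul_comm, map_mul]
  have c' : ι hq * (ι hp * S) = ι hp * (ι hq * S) := by rw [← mul_assoc, c, mul_assoc]
  have c'' : ι hq * (ι hp * ι hq) = ι hp * (ι hq * ι hq) := by rw [← mul_assoc, c, mul_assoc]
  simp only [mul_add, add_mul, mul_sub, mul_neg, neg_mul, mul_assoc, c', c'']
  abel

theorem prq_left : S * ι (up + hp) * ι hq = ι hp * S * ι (up + hp) - ι (up + hp) * ι hq * ι hp := by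
  have h := mul_mul_of H.hq' H.gp
  rw [mul_assoc, ← map_mul, mul_comm (up + hp) hq, h, mul_assoc (ι hp), H.gp, mul_add (ι hp),
    ← mul_assoc (ι hp)]
  simp only [← map_mul]
  rw [add_sub_assoc, ← map_sub]
  congr 2
  ring

theorem prq_right :
    ι hq * S * ι (vq + -hq) + ι (vq + -hq) * ι hp * ι hq = S * ι (vq + -hq) * ι hp := by
  have h := mul_mul_of H.S_hp H.gq'
  rw [mul_assoc S, ← map_mul, mul_comm _ hp, h, mul_assoc (ι hq), H.gq', mul_add (ι hq),
    ← mul_assoc (ι hq)]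
  simp only [← map_mul]
  rw [add_assoc, ← map_add]
  congr 2
  ring

theorem prq_mid : ι (uq + hq) * S * ι (vq + -hq) - ι (vp + -hp) * S * ι (up + hp) -
    ι hq * ι hp * ι hq - ι hp * ι hq * ι hp = ι (uq * F + vp * E) := by
  rw [mul_assoc _ S, mul_assoc _ S, H.gq', H.gp, mul_add, mul_add, ← mul_assoc, ← mul_assoc]
  simp only [← map_mul]
  rw [mul_comm (uq + hq) (vp + -hp), add_sub_add_left_eq_sub]
  simp only [← map_sub]
  congr 1
  linear_combination hp * H.uq_hq - hq * H.vp_hp + H.hq_F - H.hp_E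

theorem rpq_mid :
    ι hq * ι (vp + -hp) * S = ι (vp + -hp) * S * ι hp - ι hp * ι hq * ι (vp + -hp) := by
  rw [mul_assoc _ S, H.S_hp, mul_add, ← mul_assoc]
  simp only [← map_mul]
  rw [add_sub_assoc, ← map_sub, mul_comm hq]
  have : (vp + -hp) * (hp * hq) - hp * hq * (vp + -hp) = 0 := by ring
  rw [this, map_zero, add_zero]

theorem rpq_end : S * ι hp * S - ι (up + hp) * ι hq * ι (vp + -hp) - ι hp * S * ι hp =
    ι hq * (S * S - ι (up * vp)) := by
  rw [mul_assoc _ S, H.S_hp]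
  have e : (up + hp) * hq * (vp + -hp) = hq * (up * vp) - hp * hp * hq := by
    linear_combination hq * H.vp_hp - hq * H.up_hp
  rw [← map_mul, ← map_mul, e]
  simp only [map_mul, map_sub]
  have c : ι hq * ι hp = ι hp * ι hq := by rw [← map_mul, mul_comm, map_mul]
  simp only [mul_add, add_mul, mul_sub, mul_assoc]
  abel

end Braiding

/-! ### Commuting actions of two quiver Hecke algebras -/

section Pairs

variable {k : Type u} [Field k] {I : Type v}

@[simp] theorem ISeq.swap_lo {β : I →₀ ℕ} (ν : ISeq β) (a : Fin (ht β - 1)) :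
    (ν.swap a).seq (lo a) = ν.seq (hi a) := by simp [ISeq.swap]

@[simp] theorem ISeq.swap_hi {β : I →₀ ℕ} (ν : ISeq β) (a : Fin (ht β - 1)) :
    (ν.swap a).seq (hi a) = ν.seq (lo a) := by simp [ISeq.swap]

theorem ISeq.swap_of_ne {β : I →₀ ℕ} (ν : ISeq β) {a : Fin (ht β - 1)} {p : Fin (ht β)}
    (h1 : p ≠ lo a) (h2 : p ≠ hi a) : (ν.swap a).seq p = ν.seq p := by
  simp [ISeq.swap, Equiv.swap_apply_of_ne_of_ne h1 h2]

/-- Commuting homomorphisms from two quiver Hecke algebras to an algebra in which the differences of a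
polynomial generator of the first and a polynomial generator of the second are invertible. -/
structure Pair (D : Datum k I) (β₁ β₂ : I →₀ ℕ) (B : Type w) [Ring B] [Algebra k B] where
  L : KLR D β₁ →ₐ[k] B
  R : KLR D β₂ →ₐ[k] B
  comm : ∀ a b, L a * R b = R b * L a
  d : Fin (ht β₁) → Fin (ht β₂) → B
  d_mul : ∀ i j, d i j * (L (KLR.x D i) - R (KLR.x D j)) = 1
  mul_d : ∀ i j, (L (KLR.x D i) - R (KLR.x D j)) * d i j = 1

namespace Pair

variable {D : Datum k I} {β₁ β₂ : I →₀ ℕ} {B : Type w} [Ring B] [Algebra k B]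
  (P : Pair D β₁ β₂ B)

/-- Exchange the roles of the two homomorphisms. -/
@[simps]
def flip : Pair D β₂ β₁ B where
  L := P.R
  R := P.L
  comm a b := (P.comm b a).symm
  d j i := -P.d i j
  d_mul j i := by rw [neg_mul, ← mul_neg, neg_sub, P.d_mul]
  mul_d j i := by rw [mul_neg, ← neg_mul, neg_sub, P.mul_d]

/-- The image of `x_i` in the first algebra. -/
def x (i : Fin (ht β₁)) : B := P.L (KLR.x D i)
/-- The image of `x_j` in the second algebra. -/
def y (j : Fin (ht β₂)) : B := P.R (KLR.x D j)
/-- The image of `σ_a` in the first algebra. -/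
def S (a : Fin (ht β₁ - 1)) : B := P.L (KLR.s D a)
/-- The image of `e(ν) ⊗ e(η)`. -/
def eps (ν : ISeq β₁) (η : ISeq β₂) : B := P.L (KLR.e D ν) * P.R (KLR.e D η)

/-- `∑ f(ν, η) e(ν) ⊗ e(η)`. -/
def diag (f : ISeq β₁ → ISeq β₂ → B) : B := ∑ ν, ∑ η, f ν η * P.eps ν η

theorem eps_mul_self (ν : ISeq β₁) (η : ISeq β₂) : P.eps ν η * P.eps ν η = P.eps ν η := by
  unfold eps
  rw [mul_assoc, ← mul_assoc (P.R _), ← P.comm, mul_assoc, ← map_mul, ← mul_assoc, ← map_mul,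
    KLR.e_mul_self, KLR.e_mul_self]

theorem eps_mul_ne {ν ν' : ISeq β₁} {η η' : ISeq β₂} (h : ν ≠ ν' ∨ η ≠ η') :
    P.eps ν η * P.eps ν' η' = 0 := by
  unfold eps
  rw [mul_assoc, ← mul_assoc (P.R _), ← P.comm, mul_assoc, ← map_mul, ← mul_assoc, ← map_mul]
  rcases h with h | h
  · rw [KLR.e_mul_ne h, map_zero, zero_mul]
  · rw [KLR.e_mul_ne h, map_zero, mul_zero]

theorem diag_mul_eps (f : ISeq β₁ → ISeq β₂ → B) (ν : ISeq β₁) (η : ISeq β₂) :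
    P.diag f * P.eps ν η = f ν η * P.eps ν η := by
  classical
  rw [diag, Finset.sum_mul, Finset.sum_eq_single ν]
  · rw [Finset.sum_mul, Finset.sum_eq_single η]
    · rw [mul_assoc, eps_mul_self]
    · intro η' _ h
      rw [mul_assoc, P.eps_mul_ne (Or.inr h), mul_zero]
    · simp
  · intro ν' _ h
    rw [Finset.sum_mul]
    refine Finset.sum_eq_zero fun η' _ => ?_
    rw [mul_assoc, P.eps_mul_ne (Or.inl h), mul_zero]
  · simp

theorem sum_eps : ∑ ν, ∑ η, P.eps ν η = 1 := by
  simp only [eps, ← Finset.mul_sum, ← map_sum, KLR.sum_e, map_one, mul_one]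

theorem ext_eps {a b : B} (h : ∀ ν η, a * P.eps ν η = b * P.eps ν η) : a = b := by
  have : ∀ a : B, a = ∑ ν, ∑ η, a * P.eps ν η := fun a => by
    simp only [← Finset.mul_sum, P.sum_eps, mul_one]
  rw [this a, this b]
  exact Finset.sum_congr rfl fun ν _ => Finset.sum_congr rfl fun η _ => h ν η

/-- The generating set of the commutative part. -/
def cenSet : Set B := Set.range P.x ∪ Set.range P.y ∪ Set.range (fun νη : _ × _ => P.eps νη.1 νη.2)

/-- The commutative subalgebra of the elements that commute with everything that commutes with the
`x_i`, the `x_j` and the idempotents. -/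
def cen : Subalgebra k B := Subalgebra.centralizer k (Subalgebra.centralizer k P.cenSet : Set B)

theorem x_eps (i : Fin (ht β₁)) (ν : ISeq β₁) (η : ISeq β₂) :
    P.x i * P.eps ν η = P.eps ν η * P.x i := by
  unfold x eps
  rw [← mul_assoc, ← map_mul, KLR.x_e, map_mul, mul_assoc, P.comm, mul_assoc]

theorem flip_eps (ν : ISeq β₁) (η : ISeq β₂) : P.flip.eps η ν = P.eps ν η := (P.comm _ _).symm

@[simp] theorem flip_x (j : Fin (ht β₂)) : P.flip.x j = P.y j := rfl

theorem y_eps (j : Fin (ht β₂)) (ν : ISeq β₁) (η : ISeq β₂) :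
    P.y j * P.eps ν η = P.eps ν η * P.y j := by
  rw [← flip_eps, ← flip_x, x_eps]

theorem x_x (i i' : Fin (ht β₁)) : P.x i * P.x i' = P.x i' * P.x i := by
  unfold x; rw [← map_mul, KLR.x_x, map_mul]

theorem y_y (i i' : Fin (ht β₂)) : P.y i * P.y i' = P.y i' * P.y i := P.flip.x_x i i'

theorem eps_eps (ν ν' : ISeq β₁) (η η' : ISeq β₂) :
    P.eps ν η * P.eps ν' η' = P.eps ν' η' * P.eps ν η := by
  by_cases h : ν = ν' ∧ η = η'
  · rw [h.1, h.2]
  · rw [P.eps_mul_ne (by tauto), P.eps_mul_ne (by rw [ne_comm, ne_comm (a := η')]; tauto)]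

theorem cenSet_comm {a b : B} (ha : a ∈ P.cenSet) (hb : b ∈ P.cenSet) : a * b = b * a := by
  rcases ha with (⟨i, rfl⟩ | ⟨i, rfl⟩) | ⟨i, rfl⟩ <;> rcases hb with (⟨j, rfl⟩ | ⟨j, rfl⟩) | ⟨j, rfl⟩
  · exact P.x_x _ _
  · exact P.comm _ _
  · exact P.x_eps _ _ _
  · exact (P.comm _ _).symm
  · exact P.y_y _ _
  · exact P.y_eps _ _ _
  · exact (P.x_eps _ _ _).symm
  · exact (P.y_eps _ _ _).symm
  · exact P.eps_eps _ _ _ _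

theorem mem_cen_iff {a : B} : a ∈ P.cen ↔ ∀ b, (∀ c ∈ P.cenSet, c * b = b * c) → b * a = a * b := by
  simp only [cen, Subalgebra.mem_centralizer_iff, SetLike.mem_coe]

theorem cenSet_subset : P.cenSet ⊆ P.cen := fun a ha =>
  P.mem_cen_iff.2 fun _ hb => (hb a ha).symm

theorem cen_comm {a b : B} (ha : a ∈ P.cen) (hb : b ∈ P.cen) : a * b = b * a := by
  refine P.mem_cen_iff.1 hb a fun c hc => ?_
  exact P.mem_cen_iff.1 ha c fun c' hc' => P.cenSet_comm hc' hc

instance : CommRing P.cen :=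
  { (inferInstance : Ring P.cen) with
    mul_comm := fun a b => Subtype.ext (P.cen_comm a.2 b.2) }

theorem x_mem (i) : P.x i ∈ P.cen := P.cenSet_subset (Or.inl (Or.inl ⟨i, rfl⟩))
theorem y_mem (j) : P.y j ∈ P.cen := P.cenSet_subset (Or.inl (Or.inr ⟨j, rfl⟩))
theorem eps_mem (ν η) : P.eps ν η ∈ P.cen := P.cenSet_subset (Or.inr ⟨(ν, η), rfl⟩)

theorem d_mem (i j) : P.d i j ∈ P.cen := by
  refine P.mem_cen_iff.2 fun b hb => ?_
  have h : b * (P.x i - P.y j) = (P.x i - P.y j) * b := by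
    rw [mul_sub, sub_mul, hb _ (Or.inl (Or.inl ⟨i, rfl⟩)), hb _ (Or.inl (Or.inr ⟨j, rfl⟩))]
  calc b * P.d i j = P.d i j * (P.x i - P.y j) * b * P.d i j := by
        rw [x, y, P.d_mul, one_mul]
    _ = P.d i j * b := by
        rw [mul_assoc (P.d i j), ← h, mul_assoc, mul_assoc, x, y, P.mul_d, mul_one]

theorem diag_mem {f : ISeq β₁ → ISeq β₂ → B} (hf : ∀ ν η, f ν η ∈ P.cen) : P.diag f ∈ P.cen :=
  P.cen.sum_mem fun ν _ => P.cen.sum_mem fun η _ => P.cen.mul_mem (hf ν η) (P.eps_mem ν η)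

theorem flip_diag {f : ISeq β₁ → ISeq β₂ → B} {g : ISeq β₂ → ISeq β₁ → B}
    (h : ∀ ν η, g η ν = f ν η) : P.flip.diag g = P.diag f := by
  unfold diag
  rw [Finset.sum_comm]
  simp only [h, flip_eps]

open Classical in
/-- The idempotent on which the strands `i` and `j` have the same colour. -/
def δ (i : Fin (ht β₁)) (j : Fin (ht β₂)) : B :=
  P.diag fun ν η => if ν.seq i = η.seq j then 1 else 0

/-- The operator `𝒬(x_i, x_j)` for the strands `i` and `j`. -/
def q (i : Fin (ht β₁)) (j : Fin (ht β₂)) : B :=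
  P.diag fun ν η => D.Q (ν.seq i) (η.seq j) (P.x i) (P.y j)

open Classical in
/-- The divided difference of `𝒬` for the crossing of the strands `a`, `a + 1` over the strand `j`. -/
def dd (a : Fin (ht β₁ - 1)) (j : Fin (ht β₂)) : B :=
  P.diag fun ν η => if ν.seq (lo a) = ν.seq (hi a) then
    D.dQ (ν.seq (lo a)) (η.seq j) (P.x (hi a)) (P.x (lo a)) (P.y j) else 0

/-- The operator `δ_{ij} (x_i - x_j)⁻¹`. -/
def h (i : Fin (ht β₁)) (j : Fin (ht β₂)) : B := P.δ i j * P.d i j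

theorem commute_x_y (i j) : Commute (P.x i) (P.y j) := P.comm _ _

theorem Q_mem (i j) (s t : I) : D.Q s t (P.x i) (P.y j) ∈ P.cen :=
  polyEval_mem _ (P.x_mem i) (P.y_mem j) _ _ _

theorem flip_δ (i j) : P.flip.δ j i = P.δ i j := by
  refine P.flip_diag fun ν η => ?_
  by_cases h : ν.seq i = η.seq j
  · rw [if_pos h, if_pos h.symm]
  · rw [if_neg h, if_neg (Ne.symm h)]

theorem flip_q (i j) : P.flip.q j i = P.q i j :=
  P.flip_diag fun _ _ => D.Q_symm (P.commute_x_y i j).symm _ _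

theorem flip_h (i j) : P.flip.h j i = -P.h i j := by
  rw [h, h, flip_δ, flip_d, mul_neg]

open Classical in
theorem δ_mul_eps (i j) (ν : ISeq β₁) (η : ISeq β₂) :
    P.δ i j * P.eps ν η = (if ν.seq i = η.seq j then 1 else 0) * P.eps ν η := P.diag_mul_eps _ ν η

theorem q_mul_eps (i j) (ν : ISeq β₁) (η : ISeq β₂) :
    P.q i j * P.eps ν η = D.Q (ν.seq i) (η.seq j) (P.x i) (P.y j) * P.eps ν η :=
  P.diag_mul_eps _ ν η

open Classical in
theorem dd_mul_eps (a j) (ν : ISeq β₁) (η : ISeq β₂) :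
    P.dd a j * P.eps ν η = (if ν.seq (lo a) = ν.seq (hi a) then
      D.dQ (ν.seq (lo a)) (η.seq j) (P.x (hi a)) (P.x (lo a)) (P.y j) else 0) * P.eps ν η :=
  P.diag_mul_eps _ ν η

theorem δ_mem (i j) : P.δ i j ∈ P.cen := P.diag_mem fun ν η => by
  split_ifs
  · exact P.cen.one_mem
  · exact P.cen.zero_mem

theorem q_mem (i j) : P.q i j ∈ P.cen := P.diag_mem fun _ _ => P.Q_mem _ _ _ _

theorem dd_mem (a j) : P.dd a j ∈ P.cen := P.diag_mem fun ν η => by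
  split_ifs
  · exact polyDiff_mem _ (P.x_mem _) (P.x_mem _) (P.y_mem j) _ _ _
  · exact P.cen.zero_mem

theorem h_mem (i j) : P.h i j ∈ P.cen := P.cen.mul_mem (P.δ_mem i j) (P.d_mem i j)

open Classical in
theorem h_mul_eps (i j) (ν : ISeq β₁) (η : ISeq β₂) :
    P.h i j * P.eps ν η = (if ν.seq i = η.seq j then P.d i j else 0) * P.eps ν η := by
  rw [h, P.cen_comm (P.δ_mem i j) (P.d_mem i j), mul_assoc, δ_mul_eps]
  split_ifs <;> simp

theorem δ_h (i j) : P.δ i j * P.h i j = P.h i j := by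
  refine P.ext_eps fun ν η => ?_
  rw [P.cen_comm (P.δ_mem i j) (P.h_mem i j), mul_assoc, δ_mul_eps]
  split_ifs with h
  · rw [one_mul]
  · rw [h_mul_eps, if_neg h]; simp

theorem q_δ (i j) : P.q i j * P.δ i j = 0 := by
  refine P.ext_eps fun ν η => ?_
  rw [mul_assoc, δ_mul_eps]
  split_ifs with h
  · rw [one_mul, q_mul_eps, h, D.Q_self]
  · simp

theorem q_h (i j) : P.q i j * P.h i j = 0 := by
  rw [h, ← mul_assoc, q_δ, zero_mul]

/-- The image of the idempotent on which the strands `a` and `a + 1` have the same colour. -/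
def eqn (a : Fin (ht β₁ - 1)) : B := P.L (KLR.eqn D a)

open Classical in
theorem eqn_mul_eps (a) (ν : ISeq β₁) (η : ISeq β₂) :
    P.eqn a * P.eps ν η = (if ν.seq (lo a) = ν.seq (hi a) then 1 else 0) * P.eps ν η := by
  rw [eqn, eps, ← mul_assoc, ← map_mul, KLR.eqn_mul_e]
  split_ifs <;> simp

theorem eqn_mem (a) : P.eqn a ∈ P.cen := by
  have : P.eqn a = P.diag fun ν η => P.eqn a * P.eps ν η := by
    refine P.ext_eps fun ν η => ?_
    rw [diag_mul_eps, mul_assoc, eps_mul_self]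
  rw [this]
  refine P.diag_mem fun ν η => ?_
  rw [eqn_mul_eps]
  split_ifs
  · exact P.cen.mul_mem P.cen.one_mem (P.eps_mem ν η)
  · exact P.cen.mul_mem P.cen.zero_mem (P.eps_mem ν η)

theorem S_eps (a) (ν : ISeq β₁) (η : ISeq β₂) :
    P.S a * P.eps ν η = P.eps (ν.swap a) η * P.S a := by
  rw [S, eps, ← mul_assoc, ← map_mul, KLR.s_e, map_mul, mul_assoc, P.comm, ← mul_assoc, eps]

theorem S_x_hi (a) : P.S a * P.x (hi a) = P.x (lo a) * P.S a + P.eqn a := by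
  simp only [S, x, eqn, ← map_mul, ← map_add, KLR.s_x_hi]

theorem x_hi_S (a) : P.x (hi a) * P.S a = P.S a * P.x (lo a) + P.eqn a := by
  simp only [S, x, eqn, ← map_mul, ← map_add, KLR.x_hi_s]

theorem S_x {a} {i} (h1 : i ≠ lo a) (h2 : i ≠ hi a) : P.S a * P.x i = P.x i * P.S a := by
  simp only [S, x, ← map_mul, KLR.s_x h1 h2]

theorem S_y (a j) : P.S a * P.y j = P.y j * P.S a := P.comm _ _

theorem S_diag (a) {f g : ISeq β₁ → ISeq β₂ → B}
    (hfg : ∀ ν η, P.S a * f ν η * P.eps ν η = g (ν.swap a) η * P.S a * P.eps ν η) :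
    P.S a * P.diag f = P.diag g * P.S a := by
  refine P.ext_eps fun ν η => ?_
  rw [mul_assoc, diag_mul_eps, ← mul_assoc, hfg, mul_assoc, mul_assoc, S_eps, ← mul_assoc,
    ← mul_assoc, diag_mul_eps]

theorem S_δ_of {a} {i i' j} (h : ∀ ν : ISeq β₁, ν.seq i = (ν.swap a).seq i') :
    P.S a * P.δ i j = P.δ i' j * P.S a := by
  refine P.S_diag a fun ν η => ?_
  rw [h]
  split_ifs <;> simp

theorem S_δ_hi (a j) : P.S a * P.δ (hi a) j = P.δ (lo a) j * P.S a := P.S_δ_of (by simp)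
theorem S_δ_lo (a j) : P.S a * P.δ (lo a) j = P.δ (hi a) j * P.S a := P.S_δ_of (by simp)
theorem S_δ {a i} (j) (h1 : i ≠ lo a) (h2 : i ≠ hi a) :
    P.S a * P.δ i j = P.δ i j * P.S a := P.S_δ_of fun ν => (ν.swap_of_ne h1 h2).symm

theorem S_d {a i} (j) (h1 : i ≠ lo a) (h2 : i ≠ hi a) : P.S a * P.d i j = P.d i j * P.S a := by
  have h : P.S a * (P.x i - P.y j) = (P.x i - P.y j) * P.S a := by
    rw [mul_sub, sub_mul, P.S_x h1 h2, P.S_y]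
  calc P.S a * P.d i j = P.d i j * ((P.x i - P.y j) * P.S a) * P.d i j := by
        rw [← mul_assoc, x, y, P.d_mul, one_mul]
    _ = P.d i j * P.S a := by
        rw [← h, mul_assoc, mul_assoc, x, y, P.mul_d, mul_one]

theorem S_h {a i} (j) (h1 : i ≠ lo a) (h2 : i ≠ hi a) : P.S a * P.h i j = P.h i j * P.S a := by
  rw [h, ← mul_assoc, P.S_δ j h1 h2, mul_assoc, P.S_d j h1 h2, mul_assoc]

theorem S_q {a i} (j) (h1 : i ≠ lo a) (h2 : i ≠ hi a) : P.S a * P.q i j = P.q i j * P.S a := by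
  refine P.S_diag a fun ν η => ?_
  rw [ν.swap_of_ne h1 h2]
  have := mul_polyEval (E := (0 : B)) (Z := P.y j)
    (show P.S a * P.x i = P.x i * P.S a + 0 by rw [P.S_x h1 h2, add_zero]) rfl
    (Commute.zero_left _) (P.S_y a j) (Commute.zero_left _) (D.q (ν.seq i) (η.seq j))
    (-D.A (ν.seq i) (η.seq j)).toNat (-D.A (η.seq j) (ν.seq i)).toNat
  rw [mul_zero, add_zero] at this
  rw [Datum.Q, this]

theorem δ_δ (a j) : P.δ (lo a) j * P.eqn a = P.δ (lo a) j * P.δ (hi a) j ∧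
    P.δ (hi a) j * P.eqn a = P.δ (lo a) j * P.δ (hi a) j := by
  classical
  have key : ∀ (X : B) (s t : Prop) [Decidable s] [Decidable t] ν η, X * P.eps ν η =
      (if s then 1 else 0) * P.eps ν η → X * ((if t then 1 else 0) * P.eps ν η) =
      if s ∧ t then P.eps ν η else 0 := by
    intro X s t _ _ ν η h
    by_cases ht : t <;> by_cases hs : s <;> simp [ht, hs, h]
  constructor <;>
  · refine P.ext_eps fun ν η => ?_
    rw [mul_assoc, mul_assoc, eqn_mul_eps, δ_mul_eps, key _ _ _ _ _ (P.δ_mul_eps _ _ _ _),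
      key _ _ _ _ _ (P.δ_mul_eps _ _ _ _)]
    refine if_congr ?_ rfl rfl
    constructor <;> rintro ⟨h1, h2⟩ <;> simp_all

theorem S_h_hi (a j) : P.S a * P.h (hi a) j =
    P.h (lo a) j * P.S a - P.h (lo a) j * P.h (hi a) j := by
  have h1 : P.S a * (P.x (hi a) - P.y j) = (P.x (lo a) - P.y j) * P.S a + P.eqn a := by
    rw [mul_sub, sub_mul, P.S_x_hi, P.S_y]; abel
  have h2 : P.d (lo a) j * P.S a = P.S a * P.d (hi a) j + P.d (lo a) j * P.eqn a * P.d (hi a) j := by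
    calc P.d (lo a) j * P.S a
        = P.d (lo a) j * (P.S a * (P.x (hi a) - P.y j)) * P.d (hi a) j := by
          rw [mul_assoc, mul_assoc, x, y, P.mul_d, mul_one]
      _ = _ := by
          rw [h1, mul_add, ← mul_assoc, x, y, P.d_mul, one_mul, add_mul]
  have h3 : P.δ (lo a) j * (P.d (lo a) j * P.eqn a * P.d (hi a) j) = P.h (lo a) j * P.h (hi a) j := by
    rw [P.cen_comm (P.d_mem _ _) (P.eqn_mem a), ← mul_assoc, ← mul_assoc, (P.δ_δ a j).1, h, h,
      mul_assoc (P.δ (lo a) j) (P.δ (hi a) j), P.cen_comm (P.δ_mem (hi a) j) (P.d_mem (lo a) j)]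
    simp only [mul_assoc]
  rw [← h3, h, ← mul_assoc, P.S_δ_hi, h, mul_assoc, mul_assoc, ← mul_sub, h2, add_sub_cancel_right]

theorem S_h_lo (a j) : P.S a * P.h (lo a) j =
    P.h (hi a) j * P.S a + P.h (lo a) j * P.h (hi a) j := by
  have h1 : (P.x (hi a) - P.y j) * P.S a = P.S a * (P.x (lo a) - P.y j) + P.eqn a := by
    rw [mul_sub, sub_mul, P.x_hi_S, P.S_y]; abel
  have h2 : P.S a * P.d (lo a) j = P.d (hi a) j * P.S a + P.d (hi a) j * P.eqn a * P.d (lo a) j := by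
    calc P.S a * P.d (lo a) j
        = P.d (hi a) j * ((P.x (hi a) - P.y j) * P.S a) * P.d (lo a) j := by
          rw [← mul_assoc, x, y, P.d_mul, one_mul]
      _ = _ := by
          rw [h1, mul_add, ← mul_assoc, add_mul, mul_assoc _ (P.x (lo a) - P.y j), x, y, P.mul_d,
            mul_one]
  have h3 : P.δ (hi a) j * (P.d (hi a) j * P.eqn a * P.d (lo a) j) = P.h (lo a) j * P.h (hi a) j := by
    rw [P.cen_comm (P.d_mem _ _) (P.eqn_mem a), ← mul_assoc, ← mul_assoc, (P.δ_δ a j).2, h, h,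
      mul_assoc _ (P.d (hi a) j), P.cen_comm (P.d_mem (hi a) j) (P.d_mem (lo a) j),
      mul_assoc (P.δ (lo a) j) (P.δ (hi a) j), ← mul_assoc (P.δ (hi a) j),
      P.cen_comm (P.δ_mem (hi a) j) (P.d_mem (lo a) j)]
    simp only [mul_assoc]
  rw [← h3, h, ← mul_assoc, P.S_δ_lo, h, mul_assoc, mul_assoc, ← mul_add, h2]

theorem S_q_hi (a j) : P.S a * P.q (hi a) j = P.q (lo a) j * P.S a + P.dd a j := by
  refine P.ext_eps fun ν η => ?_
  rw [mul_assoc, q_mul_eps, add_mul, dd_mul_eps, mul_assoc, S_eps, ← mul_assoc, ← mul_assoc,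
    q_mul_eps, ISeq.swap_lo, mul_assoc _ (P.eps _ _), ← S_eps, ← mul_assoc]
  have := mul_polyEval (Z := P.y j) (P.S_x_hi a) (P.x_x _ _)
    (P.cen_comm (P.eqn_mem a) (P.x_mem _)) (P.S_y a j) (P.cen_comm (P.eqn_mem a) (P.y_mem j))
    (D.q (ν.seq (hi a)) (η.seq j))
    (-D.A (ν.seq (hi a)) (η.seq j)).toNat (-D.A (η.seq j) (ν.seq (hi a))).toNat
  rw [Datum.Q, this, add_mul, mul_assoc _ (P.eqn a), eqn_mul_eps]
  congr 1
  split_ifs with h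
  · rw [one_mul, h]; rfl
  · simp

theorem S_q_lo (a j) : P.S a * P.q (lo a) j = P.q (hi a) j * P.S a - P.dd a j := by
  refine P.ext_eps fun ν η => ?_
  rw [mul_assoc, q_mul_eps, sub_mul, dd_mul_eps, mul_assoc, S_eps, ← mul_assoc, ← mul_assoc,
    q_mul_eps, ISeq.swap_hi, mul_assoc _ (P.eps _ _), ← S_eps, ← mul_assoc]
  have := mul_polyEval (Z := P.y j) (E := -P.eqn a)
    (show P.S a * P.x (lo a) = P.x (hi a) * P.S a + -P.eqn a by rw [P.x_hi_S]; abel) (P.x_x _ _)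
    (P.cen_comm (P.cen.neg_mem (P.eqn_mem a)) (P.x_mem _)) (P.S_y a j)
    (P.cen_comm (P.cen.neg_mem (P.eqn_mem a)) (P.y_mem j))
    (D.q (ν.seq (lo a)) (η.seq j))
    (-D.A (ν.seq (lo a)) (η.seq j)).toNat (-D.A (η.seq j) (ν.seq (lo a))).toNat
  rw [Datum.Q, this, add_mul, mul_assoc _ (-P.eqn a), neg_mul, eqn_mul_eps, mul_neg, ← sub_eq_add_neg]
  congr 1
  split_ifs with h
  · rw [one_mul, polyDiff_symm (P.x_x _ _)]; rfl
  · simp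

theorem h_dd (a i j) (hi' : i = lo a ∨ i = hi a) : P.h i j * P.dd a j = 0 := by
  refine P.ext_eps fun ν η => ?_
  rw [P.cen_comm (P.h_mem _ _) (P.dd_mem _ _), mul_assoc, h_mul_eps, zero_mul]
  split_ifs with h
  · rw [← mul_assoc, P.cen_comm (P.dd_mem _ _) (P.d_mem _ _), mul_assoc, dd_mul_eps]
    split_ifs with h'
    · have : ν.seq (lo a) = η.seq j := by
        rcases hi' with rfl | rfl
        · exact h
        · rw [h', h]
      rw [this, D.dQ_self]; simp
    · simp
  · simp

/-- The operator `h` as an element of the commutative subalgebra. -/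
abbrev hC (i : Fin (ht β₁)) (j : Fin (ht β₂)) : P.cen := ⟨P.h i j, P.h_mem i j⟩
/-- The operator `1 - δ` as an element of the commutative subalgebra. -/
abbrev uC (i : Fin (ht β₁)) (j : Fin (ht β₂)) : P.cen := ⟨1 - P.δ i j, P.cen.sub_mem P.cen.one_mem (P.δ_mem i j)⟩
/-- The operator `q` as an element of the commutative subalgebra. -/
abbrev qC (i : Fin (ht β₁)) (j : Fin (ht β₂)) : P.cen := ⟨P.q i j, P.q_mem i j⟩
/-- The operator `dd` as an element of the commutative subalgebra. -/
abbrev ddC (a : Fin (ht β₁ - 1)) (j : Fin (ht β₂)) : P.cen := ⟨P.dd a j, P.dd_mem a j⟩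

theorem u_h (i j) : (1 - P.δ i j) * P.h i j = 0 := by rw [sub_mul, one_mul, δ_h, sub_self]

theorem u_q (i j) : (1 - P.δ i j) * P.q i j = P.q i j := by
  rw [sub_mul, one_mul, P.cen_comm (P.δ_mem i j) (P.q_mem i j), q_δ, sub_zero]

theorem braiding (a j) : Braiding (P.cen.val : P.cen →+* B) (P.S a) (P.hC (lo a) j) (P.hC (hi a) j)
    (P.uC (lo a) j) (P.uC (hi a) j) (P.qC (lo a) j) (P.qC (hi a) j) 0 (P.ddC a j) where
  S_hq := P.S_h_hi a j
  S_hp := P.S_h_lo a j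
  S_uq := by
    change P.S a * (1 - P.δ _ j) = (1 - P.δ _ j) * P.S a + 0
    rw [mul_sub, P.S_δ_hi, sub_mul, mul_one, one_mul, add_zero]
  S_up := by
    change P.S a * (1 - P.δ _ j) = (1 - P.δ _ j) * P.S a - 0
    rw [mul_sub, P.S_δ_lo, sub_mul, mul_one, one_mul, sub_zero]
  S_vq := P.S_q_hi a j
  S_vp := P.S_q_lo a j
  up_hp := Subtype.ext (P.u_h _ _)
  uq_hq := Subtype.ext (P.u_h _ _)
  vp_hp := Subtype.ext (P.q_h _ _)
  vq_hq := Subtype.ext (P.q_h _ _)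
  hp_E := mul_zero _
  hq_F := Subtype.ext (P.h_dd a _ j (Or.inr rfl))

theorem braiding' (a j) : Braiding (P.cen.val : P.cen →+* B) (P.S a) (P.hC (lo a) j) (P.hC (hi a) j)
    (P.qC (lo a) j) (P.qC (hi a) j) (P.uC (lo a) j) (P.uC (hi a) j) (P.ddC a j) 0 where
  S_hq := P.S_h_hi a j
  S_hp := P.S_h_lo a j
  S_uq := P.S_q_hi a j
  S_up := P.S_q_lo a j
  S_vq := (P.braiding a j).S_uq
  S_vp := (P.braiding a j).S_up
  up_hp := Subtype.ext (P.q_h _ _)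
  uq_hq := Subtype.ext (P.q_h _ _)
  vp_hp := Subtype.ext (P.u_h _ _)
  vq_hq := Subtype.ext (P.u_h _ _)
  hp_E := Subtype.ext (P.h_dd a _ j (Or.inl rfl))
  hq_F := mul_zero _

theorem S_sq_eps (a) (ν : ISeq β₁) (η : ISeq β₂) : P.S a * P.S a * P.eps ν η =
    D.Q (ν.seq (lo a)) (ν.seq (hi a)) (P.x (lo a)) (P.x (hi a)) * P.eps ν η := by
  have := congrArg P.L (KLR.s_sq_e (D := D) a ν)
  simp only [map_mul, D.map_Q] at this
  rw [eps, ← mul_assoc, ← mul_assoc]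
  exact congrArg (· * P.R (KLR.e D η)) this

theorem d_mul_sub_of {X T : B} {i j} (h : T * (P.x i - P.y j) = X) (hT : T ∈ P.cen) :
    P.d i j * X = T := by
  have h' : T * (P.x i - P.y j) = (P.x i - P.y j) * T :=
    P.cen_comm hT (P.cen.sub_mem (P.x_mem i) (P.y_mem j))
  rw [← h, h', ← mul_assoc, x, y, P.d_mul, one_mul]

open Classical in
theorem h_lo_braid (a j) (ν : ISeq β₁) (η : ISeq β₂) :
    P.h (lo a) j * (P.S a * P.S a - P.q (hi a) j) * P.eps ν η =
      (if ν.seq (lo a) = η.seq j then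
        D.dQ (ν.seq (lo a)) (ν.seq (hi a)) (P.y j) (P.x (lo a)) (P.x (hi a)) else 0) *
          P.eps ν η := by
  have hQ : D.Q (ν.seq (lo a)) (ν.seq (hi a)) (P.x (lo a)) (P.x (hi a)) ∈ P.cen :=
    polyEval_mem _ (P.x_mem _) (P.x_mem _) _ _ _
  rw [mul_assoc, sub_mul, S_sq_eps, q_mul_eps, ← sub_mul,
    P.cen_comm (P.cen.sub_mem hQ (P.Q_mem _ _ _ _)) (P.eps_mem _ _), ← mul_assoc, h_mul_eps]
  split_ifs with h
  · rw [mul_assoc, P.cen_comm (P.eps_mem _ _) (P.cen.sub_mem hQ (P.Q_mem _ _ _ _)), ← mul_assoc]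
    congr 1
    refine P.d_mul_sub_of ?_
      (polyDiff_mem _ (P.y_mem _) (P.x_mem _) (P.x_mem _) _ _ _)
    rw [D.Q_symm (P.commute_x_y _ _), ← h, ← neg_sub (P.y j), mul_neg, Datum.dQ,
      polyDiff_mul_sub (P.commute_x_y _ _).symm (P.commute_x_y _ _).symm (P.x_x _ _), neg_sub]
    rfl
  · simp

open Classical in
theorem h_hi_braid (a j) (ν : ISeq β₁) (η : ISeq β₂) :
    P.h (hi a) j * (P.S a * P.S a - P.q (lo a) j) * P.eps ν η =
      (if η.seq j = ν.seq (hi a) then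
        D.dQ (η.seq j) (ν.seq (lo a)) (P.x (hi a)) (P.y j) (P.x (lo a)) else 0) *
          P.eps ν η := by
  have hQ : D.Q (ν.seq (lo a)) (ν.seq (hi a)) (P.x (lo a)) (P.x (hi a)) ∈ P.cen :=
    polyEval_mem _ (P.x_mem _) (P.x_mem _) _ _ _
  rw [mul_assoc, sub_mul, S_sq_eps, q_mul_eps, ← sub_mul,
    P.cen_comm (P.cen.sub_mem hQ (P.Q_mem _ _ _ _)) (P.eps_mem _ _), ← mul_assoc, h_mul_eps]
  simp only [eq_comm (a := η.seq j)]
  split_ifs with h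
  · rw [mul_assoc, P.cen_comm (P.eps_mem _ _) (P.cen.sub_mem hQ (P.Q_mem _ _ _ _)), ← mul_assoc]
    congr 1
    refine P.d_mul_sub_of ?_
      (polyDiff_mem _ (P.x_mem _) (P.y_mem _) (P.x_mem _) _ _ _)
    rw [D.Q_symm (P.commute_x_y _ _), D.Q_symm (P.x_x _ _), h, Datum.dQ,
      polyDiff_mul_sub (P.commute_x_y _ _) (P.x_x _ _) (P.commute_x_y _ _).symm]
    rfl
  · simp

end Pair

end Pairs

/-! ### The generic shuffle module -/

section ShuffleModule

variable {k : Type u} [Field k] {I : Type v}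

theorem Shuffle.cases {n₁ n₂ N : ℕ} (w : Shuffle n₁ n₂ N) (a : Fin (N - 1)) :
    (∃ i j, w.equiv (lo a) = .inl i ∧ w.equiv (hi a) = .inr j) ∨
    (∃ i j, w.equiv (lo a) = .inr j ∧ w.equiv (hi a) = .inl i) ∨
    (∃ b, w.equiv (lo a) = .inl (lo b) ∧ w.equiv (hi a) = .inl (hi b)) ∨
    (∃ b, w.equiv (lo a) = .inr (lo b) ∧ w.equiv (hi a) = .inr (hi b)) := by
  rcases h1 : w.equiv (lo a) with i | i <;> rcases h2 : w.equiv (hi a) with j | j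
  · obtain ⟨b, rfl, rfl⟩ := Shuffle.consecutive_left h1 h2
    exact Or.inr (Or.inr (Or.inl ⟨b, rfl, rfl⟩))
  · exact Or.inl ⟨i, j, rfl, rfl⟩
  · exact Or.inr (Or.inl ⟨j, i, rfl, rfl⟩)
  · obtain ⟨b, rfl, rfl⟩ := Shuffle.consecutive_right h1 h2
    exact Or.inr (Or.inr (Or.inr ⟨b, rfl, rfl⟩))

open Classical in
/-- The idempotent `e(f)` if `f ∈ I^β`, and `0` otherwise. -/
def KLR.eF (D : Datum k I) {β : I →₀ ℕ} (f : Fin (ht β) → I) : KLR D β :=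
  if h : ∑ p, Finsupp.single (f p) 1 = β then KLR.e D ⟨f, h⟩ else 0

theorem KLR.eF_seq {D : Datum k I} {β : I →₀ ℕ} (ν : ISeq β) : KLR.eF D ν.seq = KLR.e D ν := by
  rw [KLR.eF, dif_pos ν.sum_eq]

namespace Pair

section Colours

variable {D : Datum k I} {β₁ β₂ : I →₀ ℕ} {B : Type w} [Ring B] [Algebra k B]
  (P : Pair D β₁ β₂ B)

/-- The idempotent of the colouring `c` of the strands. -/
def col (c : Fin (ht β₁) ⊕ Fin (ht β₂) → I) : B :=
  P.L (KLR.eF D (c ∘ .inl)) * P.R (KLR.eF D (c ∘ .inr))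

theorem col_elim (ν : ISeq β₁) (η : ISeq β₂) : P.col (Sum.elim ν.seq η.seq) = P.eps ν η := by
  rw [col, Sum.elim_comp_inl, Sum.elim_comp_inr, KLR.eF_seq, KLR.eF_seq, eps]

theorem col_cases (c : Fin (ht β₁) ⊕ Fin (ht β₂) → I) :
    (∃ (ν : ISeq β₁) (η : ISeq β₂), c = Sum.elim ν.seq η.seq) ∨
      (P.col c = 0 ∧ ∀ (ν : ISeq β₁) (η : ISeq β₂), c ≠ Sum.elim ν.seq η.seq) := by
  by_cases h1 : ∑ p, Finsupp.single ((c ∘ Sum.inl) p) 1 = β₁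
  · by_cases h2 : ∑ p, Finsupp.single ((c ∘ Sum.inr) p) 1 = β₂
    · exact Or.inl ⟨⟨_, h1⟩, ⟨_, h2⟩, (Sum.elim_comp_inl_inr c).symm⟩
    · refine Or.inr ⟨by rw [col, KLR.eF, KLR.eF, dif_neg h2, map_zero, mul_zero], ?_⟩
      rintro ν η rfl
      exact h2 (by simpa using η.sum_eq)
  · refine Or.inr ⟨by rw [col, KLR.eF, dif_neg h1, map_zero, zero_mul], ?_⟩
    rintro ν η rfl
    exact h1 (by simpa using ν.sum_eq)

open Classical in
theorem col_mul_eps (c : Fin (ht β₁) ⊕ Fin (ht β₂) → I) (ν : ISeq β₁) (η : ISeq β₂) :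
    P.col c * P.eps ν η = (if c = Sum.elim ν.seq η.seq then 1 else 0) * P.eps ν η := by
  rcases P.col_cases c with ⟨ν', η', rfl⟩ | ⟨h, h'⟩
  · rw [col_elim]
    by_cases h : ν' = ν ∧ η' = η
    · rw [h.1, h.2, eps_mul_self]; simp
    · rw [if_neg, P.eps_mul_ne (by tauto), zero_mul]
      intro h'
      refine h ⟨ISeq.ext ?_, ISeq.ext ?_⟩
      · simpa using congrArg (· ∘ Sum.inl) h'
      · simpa using congrArg (· ∘ Sum.inr) h'
  · rw [h, if_neg (h' ν η)]

theorem col_mem (c : Fin (ht β₁) ⊕ Fin (ht β₂) → I) : P.col c ∈ P.cen := by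
  rcases P.col_cases c with ⟨ν', η', rfl⟩ | ⟨h, h'⟩
  · rw [col_elim]; exact P.eps_mem _ _
  · rw [h]; exact P.cen.zero_mem

theorem col_mul_col (c c' : Fin (ht β₁) ⊕ Fin (ht β₂) → I) (h : c ≠ c') :
    P.col c * P.col c' = 0 := by
  rcases P.col_cases c' with ⟨ν', η', rfl⟩ | ⟨h1, -⟩
  · rw [col_elim, col_mul_eps, if_neg h, zero_mul]
  · rw [h1, mul_zero]

theorem col_mul_self (c : Fin (ht β₁) ⊕ Fin (ht β₂) → I) : P.col c * P.col c = P.col c := by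
  rcases P.col_cases c with ⟨ν', η', rfl⟩ | ⟨h1, -⟩
  · rw [col_elim, eps_mul_self]
  · rw [h1, mul_zero]

theorem flip_col (c : Fin (ht β₁) ⊕ Fin (ht β₂) → I) : P.flip.col (c ∘ Sum.swap) = P.col c :=
  (P.comm _ _).symm

theorem S_col (a : Fin (ht β₁ - 1)) (c : Fin (ht β₁) ⊕ Fin (ht β₂) → I) :
    P.S a * P.col c = P.col (c ∘ Equiv.swap (.inl (lo a)) (.inl (hi a))) * P.S a := by
  classical
  refine P.ext_eps fun ν η => ?_
  rw [mul_assoc, col_mul_eps, mul_assoc, S_eps, ← mul_assoc, ← mul_assoc, col_mul_eps]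
  have : c ∘ Equiv.swap (.inl (lo a)) (.inl (hi a)) = Sum.elim (ν.swap a).seq η.seq ↔
      c = Sum.elim ν.seq η.seq := by
    have e : Sum.elim (ν.swap a).seq η.seq =
        Sum.elim ν.seq η.seq ∘ Equiv.swap (.inl (lo a)) (.inl (hi a)) := by
      funext s
      rcases s with i | j
      · by_cases h1 : i = lo a
        · subst h1; simp
        · by_cases h2 : i = hi a
          · subst h2; simp
          · rw [Function.comp_apply, Equiv.swap_apply_of_ne_of_ne (by simpa) (by simpa)]
            exact ν.swap_of_ne h1 h2
      · rw [Function.comp_apply, Equiv.swap_apply_of_ne_of_ne (by simp) (by simp)]; rfl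
    rw [e]
    exact (Equiv.surjective _).injective_comp_right.eq_iff
  simp only [this]
  split_ifs
  · rw [mul_one, one_mul, S_eps]
  · simp

/-- The polynomial generator of a strand. -/
def X (s : Fin (ht β₁) ⊕ Fin (ht β₂)) : B := Sum.elim P.x P.y s

theorem X_mem (s) : P.X s ∈ P.cen := by
  rcases s with i | j
  · exact P.x_mem i
  · exact P.y_mem j

open Classical in
/-- The idempotent on which two strands have the same colour. -/
def eqs (s t : Fin (ht β₁) ⊕ Fin (ht β₂)) : B :=
  P.diag fun ν η => if Sum.elim ν.seq η.seq s = Sum.elim ν.seq η.seq t then 1 else 0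

/-- The coefficient of the exchange of two strands. -/
def G : Fin (ht β₁) ⊕ Fin (ht β₂) → Fin (ht β₁) ⊕ Fin (ht β₂) → B
  | .inl i, .inr j => 1 - P.δ i j + P.h i j
  | .inr j, .inl i => P.q i j + -P.h i j
  | _, _ => 0

/-- The part of the action of a crossing that does not exchange strands of different factors. -/
def H : Fin (ht β₁) ⊕ Fin (ht β₂) → Fin (ht β₁) ⊕ Fin (ht β₂) → B
  | .inl i, .inr j => -P.h i j
  | .inr j, .inl i => P.h i j
  | .inl i, .inl _ => if h : (i : ℕ) < ht β₁ - 1 then P.S ⟨i, h⟩ else 0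
  | .inr j, .inr _ => if h : (j : ℕ) < ht β₂ - 1 then P.flip.S ⟨j, h⟩ else 0

theorem H_ll (a : Fin (ht β₁ - 1)) : P.H (.inl (lo a)) (.inl (hi a)) = P.S a := dif_pos a.2
theorem H_rr (a : Fin (ht β₂ - 1)) : P.H (.inr (lo a)) (.inr (hi a)) = P.flip.S a := dif_pos a.2

theorem G_mem (s t) : P.G s t ∈ P.cen := by
  rcases s with i | i <;> rcases t with j | j
  · exact P.cen.zero_mem
  · exact P.cen.add_mem (P.cen.sub_mem P.cen.one_mem (P.δ_mem _ _)) (P.h_mem _ _)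
  · exact P.cen.add_mem (P.q_mem _ _) (P.cen.neg_mem (P.h_mem _ _))
  · exact P.cen.zero_mem

end Colours

variable {D : Datum k I} {β₁ β₂ β : I →₀ ℕ} {V : Type w} [AddCommGroup V] [Module k V]
  (P : Pair D β₁ β₂ (Module.End k V))

/-- Shuffles of the strands of `β₁` and `β₂`. -/
abbrev Sh (β₁ β₂ β : I →₀ ℕ) : Type := Shuffle (ht β₁) (ht β₂) (ht β)

/-- The diagonal operators on `⊕_w V`. -/
def diagA (k : Type u) [Field k] (ι : Type*) (V : Type w) [AddCommGroup V] [Module k V] :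
    (ι → Module.End k V) →ₐ[k] Module.End k (ι →₀ V) where
  toFun f := Finsupp.lsum k fun w => Finsupp.lsingle w ∘ₗ f w
  map_one' := by ext; simp
  map_mul' f g := by ext; simp
  map_zero' := by ext; simp
  map_add' f g := by ext; simp
  commutes' r := by
    refine Finsupp.lhom_ext' fun w => LinearMap.ext fun v => ?_
    simp [Algebra.algebraMap_eq_smul_one]

theorem diagA_single {ι : Type*} (f : ι → Module.End k V) (w : ι) (v : V) :
    diagA k ι V f (Finsupp.single w v) = Finsupp.single w (f w v) := by
  simp [diagA]

/-- The action of `σ_a` on `⊕_w V`. -/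
def sigma (a : Fin (ht β - 1)) : Module.End k (Sh β₁ β₂ β →₀ V) :=
  Finsupp.lsum k fun w =>
    Finsupp.lsingle (w.sw a) ∘ₗ P.G (w.equiv (lo a)) (w.equiv (hi a)) +
      Finsupp.lsingle w ∘ₗ P.H (w.equiv (lo a)) (w.equiv (hi a))

variable {P} {a b : Fin (ht β - 1)} {w : Sh β₁ β₂ β}

theorem sigma_single (v : V) : P.sigma a (Finsupp.single w v) =
    Finsupp.single (w.sw a) (P.G (w.equiv (lo a)) (w.equiv (hi a)) v) +
      Finsupp.single w (P.H (w.equiv (lo a)) (w.equiv (hi a)) v) := by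
  simp [sigma]

theorem sigma_lr {i j} (h1 : w.equiv (lo a) = .inl i) (h2 : w.equiv (hi a) = .inr j) (v : V) :
    P.sigma a (Finsupp.single w v) =
      Finsupp.single (w.sw a) ((1 - P.δ i j + P.h i j) v) - Finsupp.single w (P.h i j v) := by
  rw [sigma_single, h1, h2, sub_eq_add_neg, ← Finsupp.single_neg]; rfl

theorem sigma_rl {i j} (h1 : w.equiv (lo a) = .inr j) (h2 : w.equiv (hi a) = .inl i) (v : V) :
    P.sigma a (Finsupp.single w v) =
      Finsupp.single (w.sw a) ((P.q i j + -P.h i j) v) + Finsupp.single w (P.h i j v) := by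
  rw [sigma_single, h1, h2]; rfl

theorem sigma_ll {c} (h1 : w.equiv (lo a) = .inl (lo c)) (h2 : w.equiv (hi a) = .inl (hi c))
    (v : V) : P.sigma a (Finsupp.single w v) = Finsupp.single w (P.S c v) := by
  rw [sigma_single, h1, h2, H_ll]
  simp [G]

theorem sigma_rr {c} (h1 : w.equiv (lo a) = .inr (lo c)) (h2 : w.equiv (hi a) = .inr (hi c))
    (v : V) : P.sigma a (Finsupp.single w v) = Finsupp.single w (P.flip.S c v) := by
  rw [sigma_single, h1, h2, H_rr]
  simp [G]

variable (P)

/-- The action of the generators of `R_β` on `⊕_w V`. -/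
def genW (β : I →₀ ℕ) : GenR β → Module.End k (Sh β₁ β₂ β →₀ V)
  | .e ν => diagA k _ V fun w => P.col (ν.seq ∘ w.equiv.symm)
  | .x p => diagA k _ V fun w => P.X (w.equiv p)
  | .s a => P.sigma a

variable {P}

theorem genW_e (ν : ISeq β) (v : V) : P.genW β (.e ν) (Finsupp.single w v) =
    Finsupp.single w (P.col (ν.seq ∘ w.equiv.symm) v) := diagA_single _ _ _

theorem genW_x (p : Fin (ht β)) (v : V) : P.genW β (.x p) (Finsupp.single w v) =
    Finsupp.single w (P.X (w.equiv p) v) := diagA_single _ _ _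

theorem genW_s (a : Fin (ht β - 1)) : P.genW β (.s a) = P.sigma a := rfl

theorem ext_single {W : Type*} [AddCommGroup W] [Module k W] {T T' : (Sh β₁ β₂ β →₀ V) →ₗ[k] W}
    (h : ∀ w v, T (Finsupp.single w v) = T' (Finsupp.single w v)) : T = T' :=
  Finsupp.lhom_ext' fun w => LinearMap.ext fun v => h w v

theorem apply_eq {f g : Module.End k V} (h : f = g) (v : V) : f v = g v := by rw [h]

theorem ext_col {T T' : Module.End k (Sh β₁ β₂ β →₀ V)} {ν : ISeq β}
    (h : ∀ (w : Sh β₁ β₂ β) (μ : ISeq β₁) (η : ISeq β₂),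
      (∀ p, ν.seq p = Sum.elim μ.seq η.seq (w.equiv p)) → ∀ v : V,
        T (Finsupp.single w (P.eps μ η v)) = T' (Finsupp.single w (P.eps μ η v))) :
    T * P.genW β (.e ν) = T' * P.genW β (.e ν) := by
  refine ext_single fun w v => ?_
  rw [Module.End.mul_apply, Module.End.mul_apply, genW_e]
  rcases P.col_cases (ν.seq ∘ w.equiv.symm) with ⟨μ, η, hc⟩ | ⟨h0, -⟩
  · rw [hc, col_elim]
    refine h w μ η (fun p => ?_) v
    rw [← hc]; simp
  · rw [h0]; simp

theorem genW_x_poly_Q (s t : I) (p q : Fin (ht β)) (v : V) :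
    D.Q s t (P.genW β (.x p)) (P.genW β (.x q)) (Finsupp.single w v) =
      Finsupp.single w (D.Q s t (P.X (w.equiv p)) (P.X (w.equiv q)) v) := by
  change D.Q s t (diagA k _ V _) (diagA k _ V _) _ = _
  rw [← D.map_Q, diagA_single]
  congr 2
  exact D.map_Q (Pi.evalAlgHom k (fun _ : Sh β₁ β₂ β => Module.End k V) w) s t _ _

theorem genW_x_poly_dQ (s t : I) (p q r : Fin (ht β)) (v : V) :
    D.dQ s t (P.genW β (.x p)) (P.genW β (.x q)) (P.genW β (.x r)) (Finsupp.single w v) =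
      Finsupp.single w (D.dQ s t (P.X (w.equiv p)) (P.X (w.equiv q)) (P.X (w.equiv r)) v) := by
  change D.dQ s t (diagA k _ V _) (diagA k _ V _) (diagA k _ V _) _ = _
  rw [← D.map_dQ, diagA_single]
  congr 2
  exact D.map_dQ (Pi.evalAlgHom k (fun _ : Sh β₁ β₂ β => Module.End k V) w) s t _ _ _

theorem eqs_lr (i j) : P.eqs (.inl i) (.inr j) = P.δ i j := rfl

theorem eqs_symm (s t) : P.eqs s t = P.eqs t s := by
  classical
  refine P.ext_eps fun ν η => ?_
  rw [eqs, eqs, diag_mul_eps, diag_mul_eps]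
  congr 1
  exact if_congr eq_comm rfl rfl

theorem eqs_ll (c) : P.eqs (.inl (lo c)) (.inl (hi c)) = P.eqn c := by
  refine P.ext_eps fun ν η => ?_
  rw [eqs, diag_mul_eps, eqn_mul_eps]
  rfl

theorem eqs_rr (c) : P.eqs (.inr (lo c)) (.inr (hi c)) = P.flip.eqn c := by
  refine P.ext_eps fun ν η => ?_
  rw [eqs, diag_mul_eps, ← flip_eps, eqn_mul_eps]
  rfl

theorem sub_h (i j) : (P.x i - P.y j) * P.h i j = P.δ i j := by
  rw [h, P.cen_comm (P.δ_mem i j) (P.d_mem i j), ← mul_assoc, x, y, P.mul_d, one_mul]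

theorem sigma_x_hi (v : V) :
    P.sigma a (Finsupp.single w (P.X (w.equiv (hi a)) v)) =
      P.genW β (.x (lo a)) (P.sigma a (Finsupp.single w v)) +
        Finsupp.single w (P.eqs (w.equiv (lo a)) (w.equiv (hi a)) v) := by
  rcases w.cases a with ⟨i, j, h1, h2⟩ | ⟨i, j, h1, h2⟩ | ⟨c, h1, h2⟩ | ⟨c, h1, h2⟩
  · have hm := Shuffle.mixed_LR h1 h2
    rw [sigma_lr h1 h2, sigma_lr h1 h2, map_sub, genW_x, genW_x, Shuffle.sw_lo hm, h1, h2, eqs_lr]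
    have c1 := P.cen_comm (P.G_mem (.inl i) (.inr j)) (P.X_mem (.inr j))
    have c2 := P.cen_comm (P.h_mem i j) (P.X_mem (.inr j))
    have e1 := apply_eq c1 v
    have e2 := apply_eq c2 v
    simp only [Module.End.mul_apply] at e1 e2
    rw [show (1 - P.δ i j + P.h i j) = P.G (.inl i) (.inr j) from rfl, e1, e2, ← sub_h]
    simp only [Module.End.mul_apply, LinearMap.sub_apply, Finsupp.single_sub]
    simp only [X, Sum.elim_inl, Sum.elim_inr]
    abel
  · have hm := Shuffle.mixed_RL h1 h2
    rw [sigma_rl h1 h2, sigma_rl h1 h2, map_add, genW_x, genW_x, Shuffle.sw_lo hm, h1, h2, eqs_symm,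
      eqs_lr, ← sub_h]
    have c1 := P.cen_comm (P.G_mem (.inr j) (.inl i)) (P.X_mem (.inl i))
    have c2 := P.cen_comm (P.h_mem i j) (P.X_mem (.inl i))
    have e1 := apply_eq c1 v
    have e2 := apply_eq c2 v
    simp only [Module.End.mul_apply] at e1 e2
    rw [show (P.q i j + -P.h i j) = P.G (.inr j) (.inl i) from rfl, e1, e2]
    simp only [Module.End.mul_apply, LinearMap.sub_apply, Finsupp.single_sub]
    simp only [X, Sum.elim_inl, Sum.elim_inr]
    abel
  · rw [sigma_ll h1 h2, sigma_ll h1 h2, genW_x, h1, h2, eqs_ll, ← Finsupp.single_add]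
    exact congrArg _ (apply_eq (P.S_x_hi c) v)
  · rw [sigma_rr h1 h2, sigma_rr h1 h2, genW_x, h1, h2, eqs_rr, ← Finsupp.single_add]
    exact congrArg _ (apply_eq (P.flip.S_x_hi c) v)

theorem x_hi_sigma (v : V) :
    P.genW β (.x (hi a)) (P.sigma a (Finsupp.single w v)) =
      P.sigma a (Finsupp.single w (P.X (w.equiv (lo a)) v)) +
        Finsupp.single w (P.eqs (w.equiv (lo a)) (w.equiv (hi a)) v) := by
  rcases w.cases a with ⟨i, j, h1, h2⟩ | ⟨i, j, h1, h2⟩ | ⟨c, h1, h2⟩ | ⟨c, h1, h2⟩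
  · have hm := Shuffle.mixed_LR h1 h2
    rw [sigma_lr h1 h2, sigma_lr h1 h2, map_sub, genW_x, genW_x, Shuffle.sw_hi hm, h1, h2, eqs_lr]
    have c1 := P.cen_comm (P.G_mem (.inl i) (.inr j)) (P.X_mem (.inl i))
    have c2 := P.cen_comm (P.h_mem i j) (P.X_mem (.inl i))
    have e1 := apply_eq c1 v
    have e2 := apply_eq c2 v
    simp only [Module.End.mul_apply] at e1 e2
    rw [show (1 - P.δ i j + P.h i j) = P.G (.inl i) (.inr j) from rfl, e1, e2, ← sub_h]
    simp only [Module.End.mul_apply, LinearMap.sub_apply, Finsupp.single_sub]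
    simp only [X, Sum.elim_inl, Sum.elim_inr]
    abel
  · have hm := Shuffle.mixed_RL h1 h2
    rw [sigma_rl h1 h2, sigma_rl h1 h2, map_add, genW_x, genW_x, Shuffle.sw_hi hm, h1, h2, eqs_symm,
      eqs_lr, ← sub_h]
    have c1 := P.cen_comm (P.G_mem (.inr j) (.inl i)) (P.X_mem (.inr j))
    have c2 := P.cen_comm (P.h_mem i j) (P.X_mem (.inr j))
    have e1 := apply_eq c1 v
    have e2 := apply_eq c2 v
    simp only [Module.End.mul_apply] at e1 e2
    rw [show (P.q i j + -P.h i j) = P.G (.inr j) (.inl i) from rfl, e1, e2]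
    simp only [Module.End.mul_apply, LinearMap.sub_apply, Finsupp.single_sub]
    simp only [X, Sum.elim_inl, Sum.elim_inr]
    abel
  · rw [sigma_ll h1 h2, sigma_ll h1 h2, genW_x, h1, h2, eqs_ll, ← Finsupp.single_add]
    exact congrArg _ (apply_eq (P.x_hi_S c) v)
  · rw [sigma_rr h1 h2, sigma_rr h1 h2, genW_x, h1, h2, eqs_rr, ← Finsupp.single_add]
    exact congrArg _ (apply_eq (P.flip.x_hi_S c) v)

end Pair

end ShuffleModule

section ShuffleModule

variable {k : Type u} [Field k] {I : Type v}

theorem Braiding.apply {V : Type*} {W : Type*} [AddCommGroup V] [Module k V] [AddCommGroup W] [Module k W]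
    {C : Type*} [CommRing C] {ι : C →+* Module.End k V} {S : Module.End k V}
    {hp hq up uq vp vq E F : C} (H : Braiding ι S hp hq up uq vp vq E F)
    {σa σb : Module.End k W} {l₀ l₁ l₂ : V →ₗ[k] W}
    (b₀ : ∀ v, σb (l₀ v) = l₁ (ι (uq + hq) v) - l₀ (ι hq v))
    (b₁ : ∀ v, σb (l₁ v) = l₀ (ι (vq + -hq) v) + l₁ (ι hq v))
    (b₂ : ∀ v, σb (l₂ v) = l₂ (S v))
    (a₀ : ∀ v, σa (l₀ v) = l₀ (S v))
    (a₁ : ∀ v, σa (l₁ v) = l₂ (ι (up + hp) v) - l₁ (ι hp v))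
    (a₂ : ∀ v, σa (l₂ v) = l₁ (ι (vp + -hp) v) + l₂ (ι hp v)) :
    (∀ v, σb (σa (σb (l₀ v))) = σa (σb (σa (l₀ v))) + l₀ ((ι hp * (S * S - ι (uq * vq))) v)) ∧
    (∀ v, σb (σa (σb (l₁ v))) = σa (σb (σa (l₁ v))) + l₁ (ι (uq * F + vp * E) v)) ∧
    (∀ v, σb (σa (σb (l₂ v))) = σa (σb (σa (l₂ v))) + l₂ ((ι hq * (S * S - ι (up * vp))) v)) := by
  have e1 := H.gp_gq
  have e2 := H.pqr_mid
  have e3 := H.pqr_end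
  have f1 := H.prq_left
  have f2 := H.prq_right
  have f3 := H.prq_mid
  have g1 := H.gp'_gq'
  have g2 := H.rpq_mid
  have g3 := H.rpq_end
  rw [← e3, ← f3, ← g3]
  clear e3 f3 g3 H
  generalize ι (up + hp) = gp at *
  generalize ι (uq + hq) = gq at *
  generalize ι (vp + -hp) = gp' at *
  generalize ι (vq + -hq) = gq' at *
  generalize ι hp = hp at *
  generalize ι hq = hq at *
  refine ⟨fun v => ?_, fun v => ?_, fun v => ?_⟩
  · have e1 := congrArg l₂ (DFunLike.congr_fun e1 v)
    have e2 := congrArg l₁ (DFunLike.congr_fun e2 v)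
    simp only [Module.End.mul_apply, LinearMap.add_apply, map_add] at e1 e2
    simp only [b₀, b₁, b₂, a₀, a₁, map_sub, map_add, Module.End.mul_apply, LinearMap.add_apply,
      LinearMap.sub_apply]
    rw [← e1, ← e2]
    abel
  · have e1 := congrArg l₂ (DFunLike.congr_fun f1 v)
    have e2 := congrArg l₀ (DFunLike.congr_fun f2 v)
    simp only [Module.End.mul_apply, LinearMap.add_apply, LinearMap.sub_apply, map_add, map_sub] at e1 e2
    simp only [b₀, b₁, b₂, a₀, a₁, a₂, map_sub, map_add, Module.End.mul_apply,
      LinearMap.sub_apply]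
    rw [e1, ← e2]
    abel
  · have e1 := congrArg l₀ (DFunLike.congr_fun g1 v)
    have e2 := congrArg l₁ (DFunLike.congr_fun g2 v)
    simp only [Module.End.mul_apply, LinearMap.sub_apply, map_sub] at e1 e2
    simp only [b₁, b₂, a₀, a₁, a₂, map_sub, map_add, Module.End.mul_apply,
      LinearMap.sub_apply]
    rw [e1, e2]
    abel

namespace Shuffle

variable {n₁ n₂ N : ℕ} {w : Shuffle n₁ n₂ N} {a b : Fin (N - 1)}

theorem sw_apply_far (hab : (a : ℕ) + 1 < b ∨ (b : ℕ) + 1 < a) :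
    (w.sw a).equiv (lo b) = w.equiv (lo b) ∧ (w.sw a).equiv (hi b) = w.equiv (hi b) := by
  by_cases h : w.Mixed a
  · exact ⟨sw_lo_far h hab, sw_hi_far h hab⟩
  · rw [sw_of_not h]; exact ⟨rfl, rfl⟩

theorem sw_comm_far (hab : (a : ℕ) + 1 < b ∨ (b : ℕ) + 1 < a) :
    (w.sw a).sw b = (w.sw b).sw a := by
  by_cases ha : w.Mixed a <;> by_cases hb : w.Mixed b
  · exact sw_comm ha hb hab
  · rw [sw_of_not hb, sw_of_not (fun h => hb ((mixed_sw_far ha hab).1 h))]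
  · rw [sw_of_not ha, sw_of_not (fun h => ha ((mixed_sw_far hb hab.symm).1 h))]
  · rw [sw_of_not ha, sw_of_not hb, sw_of_not ha]

theorem comp_swap_symm {X : Type*} (f : Fin N → X) (w : Shuffle n₁ n₂ N) (a : Fin (N - 1)) :
    (fun p => f (Equiv.swap (lo a) (hi a) p)) ∘ w.equiv.symm =
      (f ∘ w.equiv.symm) ∘ Equiv.swap (w.equiv (lo a)) (w.equiv (hi a)) := by
  funext s
  simp only [Function.comp_apply]
  congr 1
  rw [Equiv.swap_apply_def, Equiv.swap_apply_def]
  simp only [Equiv.symm_apply_eq]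
  split_ifs <;> simp

theorem comp_swap_sw_symm {X : Type*} (f : Fin N → X) (h : w.Mixed a) :
    (fun p => f (Equiv.swap (lo a) (hi a) p)) ∘ (w.sw a).equiv.symm = f ∘ w.equiv.symm := by
  rw [sw_equiv h]
  funext s
  simp

end Shuffle

namespace Pair

variable {D : Datum k I} {β₁ β₂ β : I →₀ ℕ} {V : Type w} [AddCommGroup V] [Module k V]
  {P : Pair D β₁ β₂ (Module.End k V)} {a b : Fin (ht β - 1)} {w : Sh β₁ β₂ β}

theorem h_col {B : Type*} [Ring B] [Algebra k B] (P : Pair D β₁ β₂ B) (i j) (c : Fin (ht β₁) ⊕ Fin (ht β₂) → I) :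
    P.h i j * P.col c = P.col (c ∘ Equiv.swap (.inl i) (.inr j)) * P.h i j := by
  classical
  refine P.ext_eps fun ν η => ?_
  rw [mul_assoc, col_mul_eps, P.cen_comm (P.col_mem _) (P.h_mem _ _), mul_assoc, col_mul_eps]
  by_cases h : ν.seq i = η.seq j
  · have e : Sum.elim ν.seq η.seq = Sum.elim ν.seq η.seq ∘ Equiv.swap (.inl i) (.inr j) := by
      funext s
      rw [Function.comp_apply, Equiv.swap_apply_def]
      split_ifs with h1 h2
      · subst h1; exact h
      · subst h2; exact h.symm
      · rfl
    have : c ∘ Equiv.swap (.inl i) (.inr j) = Sum.elim ν.seq η.seq ↔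
        c = Sum.elim ν.seq η.seq := by
      rw [e, (Equiv.surjective _).injective_comp_right.eq_iff, ← e]
    simp only [this]
  · have h0 : P.h i j * P.eps ν η = 0 := by rw [h_mul_eps, if_neg h, zero_mul]
    split_ifs <;> simp [h0]

theorem sigma_e (ν : ISeq β) :
    P.sigma a * P.genW β (.e ν) = P.genW β (.e (ν.swap a)) * P.sigma a := by
  refine ext_single fun w v => ?_
  rw [Module.End.mul_apply, Module.End.mul_apply, genW_e]
  have key := w.comp_swap_symm ν.seq a
  rcases w.cases a with ⟨i, j, h1, h2⟩ | ⟨i, j, h1, h2⟩ | ⟨c, h1, h2⟩ | ⟨c, h1, h2⟩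
  · have hm := Shuffle.mixed_LR h1 h2
    have key' := w.comp_swap_sw_symm ν.seq hm
    rw [sigma_lr h1 h2, sigma_lr h1 h2, map_sub, genW_e, genW_e]
    simp only [ISeq.swap]
    rw [key, key', h1, h2]
    congr 2
    · exact apply_eq (P.cen_comm (P.G_mem (.inl i) (.inr j)) (P.col_mem _)) v
    · exact apply_eq (P.h_col i j _) v
  · have hm := Shuffle.mixed_RL h1 h2
    have key' := w.comp_swap_sw_symm ν.seq hm
    rw [sigma_rl h1 h2, sigma_rl h1 h2, map_add, genW_e, genW_e]
    simp only [ISeq.swap]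
    rw [key, key', h1, h2, Equiv.swap_comm]
    congr 2
    · exact apply_eq (P.cen_comm (P.G_mem (.inr j) (.inl i)) (P.col_mem _)) v
    · exact apply_eq (P.h_col i j _) v
  · rw [sigma_ll h1 h2, sigma_ll h1 h2, genW_e]
    simp only [ISeq.swap]
    rw [key, h1, h2]
    congr 1
    exact apply_eq (P.S_col c _) v
  · rw [sigma_rr h1 h2, sigma_rr h1 h2, genW_e]
    simp only [ISeq.swap]
    rw [key, h1, h2]
    congr 1
    rw [← flip_col, ← flip_col P (_ ∘ Equiv.swap _ _)]
    refine (apply_eq (P.flip.S_col c _) v).trans ?_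
    refine congrArg (fun c' => P.flip.col c' (P.flip.S c v)) (funext fun s => ?_)
    simp only [Function.comp_apply]
    congr 1
    rcases s with s | s <;> simp [Equiv.swap_apply_def] <;> split_ifs <;> simp

theorem sigma_x {p : Fin (ht β)} (h1 : p ≠ lo a) (h2 : p ≠ hi a) :
    P.sigma a * P.genW β (.x p) = P.genW β (.x p) * P.sigma a := by
  refine ext_single fun w v => ?_
  rw [Module.End.mul_apply, Module.End.mul_apply, genW_x]
  have hp : ∀ {q}, p ≠ q → w.equiv p ≠ w.equiv q := fun h h' => h (w.equiv.injective h')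
  rcases w.cases a with ⟨i, j, h3, h4⟩ | ⟨i, j, h3, h4⟩ | ⟨c, h3, h4⟩ | ⟨c, h3, h4⟩
  · have hm := Shuffle.mixed_LR h3 h4
    rw [sigma_lr h3 h4, sigma_lr h3 h4, map_sub, genW_x, genW_x, Shuffle.sw_of_ne hm h1 h2]
    congr 2
    · exact apply_eq (P.cen_comm (P.G_mem (.inl i) (.inr j)) (P.X_mem _)) v
    · exact apply_eq (P.cen_comm (P.h_mem i j) (P.X_mem _)) v
  · have hm := Shuffle.mixed_RL h3 h4
    rw [sigma_rl h3 h4, sigma_rl h3 h4, map_add, genW_x, genW_x, Shuffle.sw_of_ne hm h1 h2]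
    congr 2
    · exact apply_eq (P.cen_comm (P.G_mem (.inr j) (.inl i)) (P.X_mem _)) v
    · exact apply_eq (P.cen_comm (P.h_mem i j) (P.X_mem _)) v
  · have h5 := hp h1
    have h6 := hp h2
    rw [sigma_ll h3 h4, sigma_ll h3 h4, genW_x]
    congr 1
    rw [h3] at h5; rw [h4] at h6
    generalize w.equiv p = s at h5 h6 ⊢
    rcases s with i | i
    · exact apply_eq (P.S_x (fun h => h5 (congrArg _ h)) (fun h => h6 (congrArg _ h))) v
    · exact apply_eq (P.S_y c i) v
  · have h5 := hp h1
    have h6 := hp h2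
    rw [sigma_rr h3 h4, sigma_rr h3 h4, genW_x]
    congr 1
    rw [h3] at h5; rw [h4] at h6
    generalize w.equiv p = s at h5 h6 ⊢
    rcases s with i | i
    · exact apply_eq (P.flip.S_y c i) v
    · exact apply_eq (P.flip.S_x (fun h => h5 (congrArg _ h)) (fun h => h6 (congrArg _ h))) v

/-- The operator `𝒬(X_s, X_t)` for the strands `s` and `t`. -/
def Qs (P : Pair D β₁ β₂ (Module.End k V)) (s t : Fin (ht β₁) ⊕ Fin (ht β₂)) : Module.End k V :=
  P.diag fun ν η => D.Q (Sum.elim ν.seq η.seq s) (Sum.elim ν.seq η.seq t) (P.X s) (P.X t)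

theorem sigma_sigma (v : V) : P.sigma a (P.sigma a (Finsupp.single w v)) =
    Finsupp.single w (P.Qs (w.equiv (lo a)) (w.equiv (hi a)) v) := by
  rcases w.cases a with ⟨i, j, h1, h2⟩ | ⟨i, j, h1, h2⟩ | ⟨c, h1, h2⟩ | ⟨c, h1, h2⟩
  · have hm := Shuffle.mixed_LR h1 h2
    rw [sigma_lr h1 h2, map_sub, sigma_lr h1 h2, sigma_rl (by rw [Shuffle.sw_lo hm, h2])
      (by rw [Shuffle.sw_hi hm, h1]), Shuffle.sw_sw, h1, h2]
    have e1 : P.Qs (.inl i) (.inr j) = (P.q i j + -P.h i j) * (1 - P.δ i j + P.h i j) +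
        P.h i j * P.h i j := by
      have h1 := congrArg Subtype.val (show (P.qC i j + -P.hC i j) * (P.uC i j + P.hC i j) +
        P.hC i j * P.hC i j = P.uC i j * P.qC i j + P.qC i j * P.hC i j - P.uC i j * P.hC i j by ring)
      refine Eq.trans ?_ h1.symm
      change P.q i j = (1 - P.δ i j) * P.q i j + P.q i j * P.h i j - (1 - P.δ i j) * P.h i j
      rw [u_q, q_h, u_h, add_zero, sub_zero]
    have e2 : P.h i j * (1 - P.δ i j + P.h i j) = (1 - P.δ i j + P.h i j) * P.h i j :=
      P.cen_comm (P.h_mem i j) (P.G_mem (.inl i) (.inr j))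
    have e2 := apply_eq e2 v
    rw [Module.End.mul_apply, Module.End.mul_apply] at e2
    have e3 : ((P.q i j + -P.h i j) * (1 - P.δ i j + P.h i j) + P.h i j * P.h i j) v =
      (P.q i j + -P.h i j) ((1 - P.δ i j + P.h i j) v) + P.h i j (P.h i j v) := rfl
    rw [e1, e3, Finsupp.single_add, e2]
    abel
  · have hm := Shuffle.mixed_RL h1 h2
    rw [sigma_rl h1 h2, map_add, sigma_rl h1 h2, sigma_lr (by rw [Shuffle.sw_lo hm, h2])
      (by rw [Shuffle.sw_hi hm, h1]), Shuffle.sw_sw, h1, h2]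
    have e1 : P.Qs (.inr j) (.inl i) = (1 - P.δ i j + P.h i j) * (P.q i j + -P.h i j) +
        P.h i j * P.h i j := by
      have h1 := congrArg Subtype.val (show (P.uC i j + P.hC i j) * (P.qC i j + -P.hC i j) +
        P.hC i j * P.hC i j = P.uC i j * P.qC i j + P.qC i j * P.hC i j - P.uC i j * P.hC i j by ring)
      refine Eq.trans ?_ h1.symm
      change _ = (1 - P.δ i j) * P.q i j + P.q i j * P.h i j - (1 - P.δ i j) * P.h i j
      rw [u_q, q_h, u_h, add_zero, sub_zero, ← flip_q]
      refine P.ext_eps fun ν η => ?_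
      rw [Qs, diag_mul_eps, ← flip_eps, q_mul_eps]
      rfl
    have e2 : P.h i j * (P.q i j + -P.h i j) = (P.q i j + -P.h i j) * P.h i j :=
      P.cen_comm (P.h_mem i j) (P.G_mem (.inr j) (.inl i))
    have e2 := apply_eq e2 v
    rw [Module.End.mul_apply, Module.End.mul_apply] at e2
    have e3 : ((1 - P.δ i j + P.h i j) * (P.q i j + -P.h i j) + P.h i j * P.h i j) v =
      (1 - P.δ i j + P.h i j) ((P.q i j + -P.h i j) v) + P.h i j (P.h i j v) := rfl
    rw [e1, e3, Finsupp.single_add, e2]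
    abel
  · rw [sigma_ll h1 h2, sigma_ll h1 h2, h1, h2]
    have : P.Qs (.inl (lo c)) (.inl (hi c)) = P.S c * P.S c := by
      refine P.ext_eps fun ν η => ?_
      rw [S_sq_eps, Qs, diag_mul_eps]; rfl
    rw [this]; rfl
  · rw [sigma_rr h1 h2, sigma_rr h1 h2, h1, h2]
    have : P.Qs (.inr (lo c)) (.inr (hi c)) = P.flip.S c * P.flip.S c := by
      refine P.ext_eps fun ν η => ?_
      rw [← flip_eps, S_sq_eps, flip_eps, Qs, diag_mul_eps]; rfl
    rw [this]; rfl

theorem flip_S_h {c} {i j} (h1 : j ≠ lo c) (h2 : j ≠ hi c) :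
    P.flip.S c * P.h i j = P.h i j * P.flip.S c := by
  have := P.flip.S_h i h1 h2
  rw [flip_h, mul_neg, neg_mul, neg_inj] at this
  exact this

theorem S_G {c} {s t} (h1 : s ≠ .inl (lo c)) (h2 : s ≠ .inl (hi c)) (h3 : t ≠ .inl (lo c))
    (h4 : t ≠ .inl (hi c)) : P.S c * P.G s t = P.G s t * P.S c := by
  rcases s with i | i <;> rcases t with j | j <;> simp only [ne_eq, Sum.inl.injEq] at h1 h2 h3 h4 <;>
    simp only [G, mul_zero, zero_mul]
  · rw [mul_add, add_mul, mul_sub, sub_mul, P.S_δ j h1 h2, P.S_h j h1 h2, mul_one, one_mul]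
  · rw [mul_add, add_mul, mul_neg, neg_mul, P.S_q i h3 h4, P.S_h i h3 h4]

theorem flip_S_G {c} {s t} (h1 : s ≠ .inr (lo c)) (h2 : s ≠ .inr (hi c)) (h3 : t ≠ .inr (lo c))
    (h4 : t ≠ .inr (hi c)) : P.flip.S c * P.G s t = P.G s t * P.flip.S c := by
  rcases s with i | i <;> rcases t with j | j <;> simp only [ne_eq, Sum.inr.injEq] at h1 h2 h3 h4 <;>
    simp only [G, mul_zero, zero_mul]
  · rw [mul_add, add_mul, mul_sub, sub_mul, flip_S_h h3 h4, ← flip_δ, P.flip.S_δ i h3 h4,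
      mul_one, one_mul]
  · rw [mul_add, add_mul, mul_neg, neg_mul, flip_S_h h1 h2, ← flip_q, P.flip.S_q j h1 h2]

theorem S_S_comm {c c'} (h1 : (lo c : Fin (ht β₁)) ≠ lo c') (h2 : (lo c : Fin (ht β₁)) ≠ hi c')
    (h3 : (hi c : Fin (ht β₁)) ≠ lo c') : P.S c * P.S c' = P.S c' * P.S c := by
  have hne1 : (c : ℕ) ≠ c' := fun h => h1 (by simp [lo, h])
  have hne2 : (c : ℕ) ≠ c' + 1 := fun h => h2 (by simp [lo, hi, h])
  have hne3 : (c : ℕ) + 1 ≠ c' := fun h => h3 (by simp [lo, hi, h])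
  rcases lt_or_gt_of_ne hne1 with h | h
  · simp only [S, ← map_mul, KLR.s_s (show (c : ℕ) + 1 < c' by omega)]
  · simp only [S, ← map_mul, KLR.s_s (show (c' : ℕ) + 1 < c by omega)]

theorem H_comm (hab : (a : ℕ) + 1 < b) :
    P.H (w.equiv (lo a)) (w.equiv (hi a)) * P.H (w.equiv (lo b)) (w.equiv (hi b)) =
      P.H (w.equiv (lo b)) (w.equiv (hi b)) * P.H (w.equiv (lo a)) (w.equiv (hi a)) := by
  obtain ⟨n1, n2, n3, n4⟩ := Shuffle.lo_ne_of_far (N := ht β) (Or.inl hab)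
  have hp : ∀ {p q}, p ≠ q → w.equiv p ≠ w.equiv q := fun h h' => h (w.equiv.injective h')
  have m1 := hp n1
  have m2 := hp n2
  have m3 := hp n3
  have m4 := hp n4
  rcases w.cases a with ⟨i, j, h1, h2⟩ | ⟨i, j, h1, h2⟩ | ⟨c, h1, h2⟩ | ⟨c, h1, h2⟩ <;>
  rcases w.cases b with ⟨i', j', h3, h4⟩ | ⟨i', j', h3, h4⟩ | ⟨c', h3, h4⟩ | ⟨c', h3, h4⟩ <;>
  rw [h1, h3] at m1 <;> rw [h2, h3] at m2 <;> rw [h1, h4] at m3 <;> rw [h2, h4] at m4 <;>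
  rw [h1, h2, h3, h4] <;> (try simp only [H_ll, H_rr]) <;>
  (try simp only [ne_eq, Sum.inl.injEq, Sum.inr.injEq] at m1) <;>
  (try simp only [ne_eq, Sum.inl.injEq, Sum.inr.injEq] at m2) <;>
  (try simp only [ne_eq, Sum.inl.injEq, Sum.inr.injEq] at m3) <;>
  (try simp only [ne_eq, Sum.inl.injEq, Sum.inr.injEq] at m4) <;>
  (try simp only [H, mul_neg, neg_mul, neg_inj])
  · exact P.cen_comm (P.h_mem _ _) (P.h_mem _ _)
  · exact P.cen_comm (P.h_mem _ _) (P.h_mem _ _)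
  · exact (P.S_h _ (Ne.symm m1) (Ne.symm m3)).symm
  · exact (flip_S_h (Ne.symm m2) (Ne.symm m4)).symm
  · exact P.cen_comm (P.h_mem _ _) (P.h_mem _ _)
  · exact P.cen_comm (P.h_mem _ _) (P.h_mem _ _)
  · exact (P.S_h _ (Ne.symm m2) (Ne.symm m4)).symm
  · exact (flip_S_h (Ne.symm m1) (Ne.symm m3)).symm
  · exact P.S_h _ m1 m2
  · exact P.S_h _ m3 m4
  · exact S_S_comm (Ne.symm m1) (Ne.symm m3) (Ne.symm m2)
  · exact P.comm _ _
  · exact flip_S_h m3 m4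
  · exact flip_S_h m1 m2
  · exact (P.comm _ _).symm
  · exact S_S_comm (P := P.flip) (Ne.symm m1) (Ne.symm m3) (Ne.symm m2)

theorem G_H_comm (hab : (a : ℕ) + 1 < b ∨ (b : ℕ) + 1 < a) :
    P.G (w.equiv (lo a)) (w.equiv (hi a)) * P.H (w.equiv (lo b)) (w.equiv (hi b)) =
      P.H (w.equiv (lo b)) (w.equiv (hi b)) * P.G (w.equiv (lo a)) (w.equiv (hi a)) := by
  obtain ⟨n1, n2, n3, n4⟩ := Shuffle.lo_ne_of_far (N := ht β) hab
  have hp : ∀ {p q}, p ≠ q → w.equiv p ≠ w.equiv q := fun h h' => h (w.equiv.injective h')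
  have m1 := hp n1
  have m2 := hp n2
  have m3 := hp n3
  have m4 := hp n4
  rcases w.cases b with ⟨i', j', h3, h4⟩ | ⟨i', j', h3, h4⟩ | ⟨c', h3, h4⟩ | ⟨c', h3, h4⟩ <;>
  rw [h3] at m1 m2 ⊢ <;> rw [h4] at m3 m4 ⊢
  · exact P.cen_comm (P.G_mem _ _) (P.cen.neg_mem (P.h_mem _ _))
  · exact P.cen_comm (P.G_mem _ _) (P.h_mem _ _)
  · rw [H_ll, S_G (Ne.symm m1) (Ne.symm m3) (Ne.symm m2) (Ne.symm m4)]
  · rw [H_rr, flip_S_G (Ne.symm m1) (Ne.symm m3) (Ne.symm m2) (Ne.symm m4)]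

theorem sigma_comm (hab : (a : ℕ) + 1 < b) :
    P.sigma a * P.sigma b = P.sigma (β := β) b * P.sigma a := by
  refine ext_single fun w v => ?_
  have f1 := w.sw_apply_far (Or.inl hab)
  have f2 := w.sw_apply_far (Or.inr hab)
  have e1 := apply_eq (H_comm (P := P) (w := w) hab) v
  have e2 := apply_eq (G_H_comm (P := P) (w := w) (Or.inl hab)) v
  have e3 := apply_eq (G_H_comm (P := P) (w := w) (Or.inr hab)) v
  have e4 := apply_eq (P.cen_comm (P.G_mem (w.equiv (lo a)) (w.equiv (hi a)))
    (P.G_mem (w.equiv (lo b)) (w.equiv (hi b)))) v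
  simp only [Module.End.mul_apply] at e1 e2 e3 e4 ⊢
  simp only [sigma_single, map_add, f1.1, f1.2, f2.1, f2.2, e1, e2, e3, e4,
    w.sw_comm_far (Or.inl hab)]
  abel

end Pair

end ShuffleModule

section ShuffleModule

variable {k : Type u} [Field k] {I : Type v}

namespace Pair

variable {D : Datum k I} {β₁ β₂ β : I →₀ ℕ} {V : Type w} [AddCommGroup V] [Module k V]
  {P : Pair D β₁ β₂ (Module.End k V)} {a b : Fin (ht β - 1)} {w : Sh β₁ β₂ β}

open Classical in
/-- The right hand side of the braid relation for the strands `s`, `t`, `r`. -/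
def Dq (P : Pair D β₁ β₂ (Module.End k V)) (s t r : Fin (ht β₁) ⊕ Fin (ht β₂)) : Module.End k V :=
  P.diag fun ν η => if Sum.elim ν.seq η.seq s = Sum.elim ν.seq η.seq r then
    D.dQ (Sum.elim ν.seq η.seq s) (Sum.elim ν.seq η.seq t) (P.X r) (P.X s) (P.X t) else 0

theorem flip_Dq (s t r) : P.flip.Dq s t r = P.Dq s.swap t.swap r.swap := by
  refine P.flip_diag fun ν η => ?_
  rcases s with s | s <;> rcases t with t | t <;> rcases r with r | r <;> rfl

theorem u_dd {a : Fin (ht β₁ - 1)} {i j} (hi' : i = lo a ∨ i = hi a) :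
    (1 - P.δ i j) * P.dd a j = P.dd a j := by
  rw [sub_mul, one_mul, ← sub_h, mul_assoc, P.h_dd a i j hi', mul_zero, sub_zero]

theorem Dq_lo (c j) : P.h (lo c) j * (P.S c * P.S c - P.q (hi c) j) =
    P.Dq (.inl (lo c)) (.inl (hi c)) (.inr j) := by
  refine P.ext_eps fun ν η => ?_
  rw [h_lo_braid, Dq, diag_mul_eps]; rfl

theorem Dq_hi (c j) : P.h (hi c) j * (P.S c * P.S c - P.q (lo c) j) =
    P.Dq (.inr j) (.inl (lo c)) (.inl (hi c)) := by
  refine P.ext_eps fun ν η => ?_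
  rw [h_hi_braid, Dq, diag_mul_eps]; rfl

theorem Dq_mid (c j) : P.dd c j = P.Dq (.inl (lo c)) (.inr j) (.inl (hi c)) := by
  refine P.ext_eps fun ν η => ?_
  rw [dd_mul_eps, Dq, diag_mul_eps]; rfl

/-- The braid relation on the summand of the shuffle `w`. -/
def BraidAt (P : Pair D β₁ β₂ (Module.End k V)) (a b : Fin (ht β - 1)) (w : Sh β₁ β₂ β) : Prop :=
  ∀ v, P.sigma b (P.sigma a (P.sigma b (Finsupp.single w v))) =
    P.sigma a (P.sigma b (P.sigma a (Finsupp.single w v))) +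
      Finsupp.single w (P.Dq (w.equiv (lo a)) (w.equiv (hi a)) (w.equiv (hi b)) v)

theorem _root_.QHC.Shuffle.sw_three (hab : (b : ℕ) = a + 1) (hm : w.Mixed b)
    (hm' : (w.sw b).Mixed a) :
    (w.sw b).equiv (lo a) = w.equiv (lo a) ∧ (w.sw b).equiv (hi a) = w.equiv (hi b) ∧
    (w.sw b).equiv (hi b) = w.equiv (hi a) ∧
    ((w.sw b).sw a).equiv (lo a) = w.equiv (hi b) ∧
    ((w.sw b).sw a).equiv (hi a) = w.equiv (lo a) ∧
    ((w.sw b).sw a).equiv (hi b) = w.equiv (hi a) := by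
  have h := Shuffle.hi_eq_lo hab
  have n1 : (lo a : Fin (ht β)) ≠ lo b := by rw [← h]; exact lo_ne_hi a
  have n2 : (lo a : Fin (ht β)) ≠ hi b := by simp [lo, hi, hab]; omega
  have n3 : (hi b : Fin (ht β)) ≠ hi a := by rw [h]; exact (lo_ne_hi b).symm
  have e1 := Shuffle.sw_of_ne hm n1 n2
  have e2 : (w.sw b).equiv (hi a) = w.equiv (hi b) := by rw [h, Shuffle.sw_lo hm]
  have e3 : (w.sw b).equiv (hi b) = w.equiv (hi a) := by rw [h, Shuffle.sw_hi hm]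
  refine ⟨e1, e2, e3, ?_, ?_, ?_⟩
  · rw [Shuffle.sw_lo hm', e2]
  · rw [Shuffle.sw_hi hm', e1]
  · rw [Shuffle.sw_of_ne hm' n2.symm n3, e3]

theorem _root_.QHC.Shuffle.sw_three' (hab : (b : ℕ) = a + 1) (hm : w.Mixed a)
    (hm' : (w.sw a).Mixed b) :
    ((w.sw a).sw b).equiv (lo a) = w.equiv (hi a) ∧
    ((w.sw a).sw b).equiv (hi a) = w.equiv (hi b) ∧
    ((w.sw a).sw b).equiv (hi b) = w.equiv (lo a) := by
  have h := Shuffle.hi_eq_lo hab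
  have n1 : (lo a : Fin (ht β)) ≠ lo b := by rw [← h]; exact lo_ne_hi a
  have n2 : (lo a : Fin (ht β)) ≠ hi b := by simp [lo, hi, hab]; omega
  have n3 : (hi b : Fin (ht β)) ≠ hi a := by rw [h]; exact (lo_ne_hi b).symm
  refine ⟨?_, ?_, ?_⟩
  · rw [Shuffle.sw_of_ne hm' n1 n2, Shuffle.sw_lo hm]
  · rw [h, Shuffle.sw_lo hm', Shuffle.sw_of_ne hm n2.symm n3]
  · rw [Shuffle.sw_hi hm', ← h, Shuffle.sw_hi hm]

theorem braidAt_llr (hab : (b : ℕ) = a + 1) {c j} (h1 : w.equiv (lo a) = .inl (lo c))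
    (h2 : w.equiv (hi a) = .inl (hi c)) (h3 : w.equiv (hi b) = .inr j) :
    P.BraidAt a b w ∧ P.BraidAt a b (w.sw b) ∧ P.BraidAt a b ((w.sw b).sw a) := by
  have h := Shuffle.hi_eq_lo hab
  have hm : w.Mixed b := Shuffle.mixed_LR (by rw [← h]; exact h2) h3
  have hm' : (w.sw b).Mixed a := Shuffle.mixed_LR (i := lo c) (j := j)
    (by rw [Shuffle.sw_of_ne hm (by rw [← h]; exact lo_ne_hi a) (by simp [lo, hi, hab]; omega), h1])
    (by rw [h, Shuffle.sw_lo hm, h3])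
  obtain ⟨e1, e2, e3, e4, e5, e6⟩ := Shuffle.sw_three hab hm hm'
  obtain ⟨k1, k2, k3⟩ := (P.braiding c j).apply (σa := P.sigma a) (σb := P.sigma b)
    (l₀ := Finsupp.lsingle w) (l₁ := Finsupp.lsingle (w.sw b))
    (l₂ := Finsupp.lsingle ((w.sw b).sw a))
    (fun v => sigma_lr (by rw [← h, h2]) h3 v)
    (fun v => (sigma_rl (by rw [← h, e2, h3]) (by rw [e3, h2]) v).trans (by rw [Shuffle.sw_sw]; rfl))
    (fun v => sigma_ll (by rw [← h, e5, h1]) (by rw [e6, h2]) v)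
    (fun v => sigma_ll h1 h2 v)
    (fun v => sigma_lr (by rw [e1, h1]) (by rw [e2, h3]) v)
    (fun v => (sigma_rl (by rw [e4, h3]) (by rw [e5, h1]) v).trans (by rw [Shuffle.sw_sw]; rfl))
  refine ⟨fun v => (k1 v).trans ?_, fun v => (k2 v).trans ?_, fun v => (k3 v).trans ?_⟩
  · rw [h1, h2, h3, ← Dq_lo, ← P.u_q (hi c) j]; rfl
  · rw [e1, e2, e3, h1, h2, h3, ← Dq_mid]
    have : (1 - P.δ (hi c) j) * P.dd c j + P.q (lo c) j * 0 = P.dd c j := by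
      rw [mul_zero, add_zero, u_dd (Or.inr rfl)]
    exact congrArg (fun T => _ + Finsupp.single (w.sw b) (T v)) this
  · rw [e4, e5, e6, h1, h2, h3, ← Dq_hi, ← P.u_q (lo c) j]; rfl

theorem braidAt_rrl (hab : (b : ℕ) = a + 1) {c i} (h1 : w.equiv (lo a) = .inr (lo c))
    (h2 : w.equiv (hi a) = .inr (hi c)) (h3 : w.equiv (hi b) = .inl i) :
    P.BraidAt a b w ∧ P.BraidAt a b (w.sw b) ∧ P.BraidAt a b ((w.sw b).sw a) := by
  have h := Shuffle.hi_eq_lo hab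
  have hm : w.Mixed b := Shuffle.mixed_RL (by rw [← h]; exact h2) h3
  have hm' : (w.sw b).Mixed a := Shuffle.mixed_RL (i := i) (j := lo c)
    (by rw [Shuffle.sw_of_ne hm (by rw [← h]; exact lo_ne_hi a) (by simp [lo, hi, hab]; omega), h1])
    (by rw [h, Shuffle.sw_lo hm, h3])
  obtain ⟨e1, e2, e3, e4, e5, e6⟩ := Shuffle.sw_three hab hm hm'
  have hq : ∀ c', P.q i c' + -P.h i c' = P.flip.q c' i + P.flip.h c' i := fun c' => by
    rw [← flip_q, flip_h]
  have hu : ∀ c', 1 - P.δ i c' + P.h i c' = 1 - P.flip.δ c' i + -P.flip.h c' i := fun c' => by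
    rw [← flip_δ, flip_h, neg_neg]
  have hh : ∀ c', P.h i c' = -P.flip.h c' i := fun c' => by rw [flip_h, neg_neg]
  have rl : ∀ {w : Sh β₁ β₂ β} {a c'}, w.equiv (lo a) = .inr c' → w.equiv (hi a) = .inl i →
      ∀ v, P.sigma a (Finsupp.single w v) = Finsupp.single (w.sw a) ((P.flip.q c' i + P.flip.h c' i) v) -
        Finsupp.single w (P.flip.h c' i v) := fun g1 g2 v => by
    rw [sigma_rl g1 g2, hq, hh, sub_eq_add_neg, ← Finsupp.single_neg]; rfl
  have lr : ∀ {w : Sh β₁ β₂ β} {a c'}, w.equiv (lo a) = .inl i → w.equiv (hi a) = .inr c' →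
      ∀ v, P.sigma a (Finsupp.single w v) =
        Finsupp.single (w.sw a) ((1 - P.flip.δ c' i + -P.flip.h c' i) v) +
        Finsupp.single w (P.flip.h c' i v) := fun g1 g2 v => by
    rw [sigma_lr g1 g2, hu, hh, sub_eq_add_neg, ← Finsupp.single_neg]
    congr 2
    exact neg_neg _
  obtain ⟨k1, k2, k3⟩ := (P.flip.braiding' c i).apply (σa := P.sigma a) (σb := P.sigma b)
    (l₀ := Finsupp.lsingle w) (l₁ := Finsupp.lsingle (w.sw b))
    (l₂ := Finsupp.lsingle ((w.sw b).sw a))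
    (fun v => rl (by rw [← h, h2]) h3 v)
    (fun v => (lr (by rw [← h, e2, h3]) (by rw [e3, h2]) v).trans (by rw [Shuffle.sw_sw]; rfl))
    (fun v => sigma_rr (by rw [← h, e5, h1]) (by rw [e6, h2]) v)
    (fun v => sigma_rr h1 h2 v)
    (fun v => rl (by rw [e1, h1]) (by rw [e2, h3]) v)
    (fun v => (lr (by rw [e4, h3]) (by rw [e5, h1]) v).trans (by rw [Shuffle.sw_sw]; rfl))
  refine ⟨fun v => (k1 v).trans ?_, fun v => (k2 v).trans ?_, fun v => (k3 v).trans ?_⟩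
  · rw [h1, h2, h3]
    have := (P.flip.Dq_lo c i).trans (flip_Dq _ _ _)
    rw [← P.flip.u_q, P.flip.cen_comm (P.flip.cen.sub_mem P.flip.cen.one_mem (P.flip.δ_mem _ _))
      (P.flip.q_mem _ _)] at this
    exact congrArg (fun T => _ + Finsupp.single w (T v)) this
  · rw [e1, e2, e3, h1, h2, h3]
    have : P.flip.q (hi c) i * 0 + (1 - P.flip.δ (lo c) i) * P.flip.dd c i =
        P.Dq (.inr (lo c)) (.inl i) (.inr (hi c)) := by
      rw [mul_zero, zero_add, u_dd (Or.inl rfl)]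
      exact (P.flip.Dq_mid c i).trans (flip_Dq _ _ _)
    exact congrArg (fun T => _ + Finsupp.single (w.sw b) (T v)) this
  · rw [e4, e5, e6, h1, h2, h3]
    have := (P.flip.Dq_hi c i).trans (flip_Dq _ _ _)
    rw [← P.flip.u_q, P.flip.cen_comm (P.flip.cen.sub_mem P.flip.cen.one_mem (P.flip.δ_mem _ _))
      (P.flip.q_mem _ _)] at this
    exact congrArg (fun T => _ + Finsupp.single ((w.sw b).sw a) (T v)) this

theorem S_braid {c c' : Fin (ht β₁ - 1)} (hc : (c' : ℕ) = c + 1) :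
    P.S c' * P.S c * P.S c' = P.S c * P.S c' * P.S c +
      P.Dq (.inl (lo c)) (.inl (hi c)) (.inl (hi c')) := by
  classical
  have := congrArg P.L (KLR.braid (D := D) c c' hc)
  simp only [map_add, map_mul, map_sum] at this
  refine this.trans (congrArg _ ?_)
  refine P.ext_eps fun ν η => ?_
  rw [Dq, diag_mul_eps, eps, ← mul_assoc, ← mul_assoc, Finset.sum_mul, Finset.sum_eq_single ν]
  · rw [mul_assoc (P.L _), ← map_mul, KLR.e_mul_self]
    congr 2
    simp only [Sum.elim_inl, X]
    rw [apply_ite P.L, D.map_dQ, map_zero]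
    rfl
  · intro μ _ h
    rw [mul_assoc, ← map_mul, KLR.e_mul_ne h, map_zero, mul_zero]
  · simp

theorem braidAt (hab : (b : ℕ) = a + 1) : P.BraidAt a b w := by
  have h := Shuffle.hi_eq_lo hab
  have n1 : (lo a : Fin (ht β)) ≠ lo b := by rw [← h]; exact lo_ne_hi a
  have n2 : (lo a : Fin (ht β)) ≠ hi b := by simp [lo, hi, hab]; omega
  have n3 : (hi b : Fin (ht β)) ≠ hi a := by rw [h]; exact (lo_ne_hi b).symm
  rcases w.cases a with ⟨i, j, h1, h2⟩ | ⟨i, j, h1, h2⟩ | ⟨c, h1, h2⟩ | ⟨c, h1, h2⟩ <;>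
  rcases w.cases b with ⟨i', j', h3, h4⟩ | ⟨i', j', h3, h4⟩ | ⟨c', h3, h4⟩ | ⟨c', h3, h4⟩ <;>
  rw [← h, h2] at h3 <;> try simp only [reduceCtorEq] at h3
  · have hm := Shuffle.mixed_RL (w := w) (by rw [← h]; exact h2) h4
    have e1 : (w.sw b).equiv (lo a) = .inl i := by rw [Shuffle.sw_of_ne hm n1 n2, h1]
    have e2 : (w.sw b).equiv (hi a) = .inl i' := by rw [h, Shuffle.sw_lo hm, h4]
    have e3 : (w.sw b).equiv (hi b) = .inr j := by rw [Shuffle.sw_hi hm, ← h, h2]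
    obtain ⟨c, rfl, rfl⟩ := Shuffle.consecutive_left e1 e2
    have := (braidAt_llr (P := P) hab e1 e2 e3).2.1
    rwa [Shuffle.sw_sw] at this
  · have hm := Shuffle.mixed_LR h1 h2
    have hm' : (w.sw a).Mixed b := Shuffle.mixed_LR (i := i) (j := hi c')
      (by rw [← h, Shuffle.sw_hi hm, h1]) (by rw [Shuffle.sw_of_ne hm n2.symm n3, h4])
    obtain ⟨e1, e2, e3⟩ := Shuffle.sw_three' hab hm hm'
    rw [h2, h3] at e1
    rw [h4] at e2
    have := (braidAt_rrl (P := P) hab e1 e2 (e3.trans h1)).2.2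
    rwa [Shuffle.sw_sw, Shuffle.sw_sw] at this
  · have hm := Shuffle.mixed_LR (w := w) (by rw [← h]; exact h2) h4
    have e1 : (w.sw b).equiv (lo a) = .inr j := by rw [Shuffle.sw_of_ne hm n1 n2, h1]
    have e2 : (w.sw b).equiv (hi a) = .inr j' := by rw [h, Shuffle.sw_lo hm, h4]
    have e3 : (w.sw b).equiv (hi b) = .inl i := by rw [Shuffle.sw_hi hm, ← h, h2]
    obtain ⟨c, rfl, rfl⟩ := Shuffle.consecutive_right e1 e2
    have := (braidAt_rrl (P := P) hab e1 e2 e3).2.1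
    rwa [Shuffle.sw_sw] at this
  · have hm := Shuffle.mixed_RL h1 h2
    have hm' : (w.sw a).Mixed b := Shuffle.mixed_RL (j := j) (i := hi c')
      (by rw [← h, Shuffle.sw_hi hm, h1]) (by rw [Shuffle.sw_of_ne hm n2.symm n3, h4])
    obtain ⟨e1, e2, e3⟩ := Shuffle.sw_three' hab hm hm'
    rw [h2, h3] at e1
    rw [h4] at e2
    have := (braidAt_llr (P := P) hab e1 e2 (e3.trans h1)).2.2
    rwa [Shuffle.sw_sw, Shuffle.sw_sw] at this
  · exact (braidAt_llr (P := P) hab h1 h2 h4).1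
  · intro v
    have hc := Sum.inl_injective h3
    have hc' : (c' : ℕ) = c + 1 := (Fin.ext_iff.1 hc).symm
    have g2 : w.equiv (lo b) = .inl (lo c') := by rw [← h, h2, h3]
    simp only [sigma_ll h1 h2, sigma_ll g2 h4]
    rw [← Finsupp.single_add, h1, h2, h4]
    exact congrArg _ (apply_eq (P.S_braid hc') v)
  · exact (braidAt_rrl (P := P) hab h1 h2 h4).1
  · intro v
    have hc := Sum.inr_injective h3
    have hc' : (c' : ℕ) = c + 1 := (Fin.ext_iff.1 hc).symm
    have g2 : w.equiv (lo b) = .inr (lo c') := by rw [← h, h2, h3]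
    simp only [sigma_rr h1 h2, sigma_rr g2 h4]
    rw [← Finsupp.single_add, h1, h2, h4]
    have := P.flip.S_braid hc'
    rw [flip_Dq] at this
    exact congrArg _ (apply_eq this v)

theorem sum_col (hβ : β₁ + β₂ = β) : ∑ ν : ISeq β, P.col (ν.seq ∘ w.equiv.symm) = 1 := by
  classical
  refine P.ext_eps fun μ η => ?_
  have hs : ∑ p, Finsupp.single ((Sum.elim μ.seq η.seq ∘ w.equiv) p) 1 = β := by
    rw [Function.comp_def, Equiv.sum_comp w.equiv (fun s => Finsupp.single (Sum.elim μ.seq η.seq s) 1),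
      Fintype.sum_sum_type]
    simp only [Sum.elim_inl, Sum.elim_inr]
    rw [μ.sum_eq, η.sum_eq, hβ]
  rw [Finset.sum_mul, Finset.sum_eq_single (⟨_, hs⟩ : ISeq β)]
  · rw [col_mul_eps, if_pos (by funext s; simp)]
  · intro ν _ hν
    rw [col_mul_eps, if_neg, zero_mul]
    intro h'
    refine hν (ISeq.ext ?_)
    change ν.seq = Sum.elim μ.seq η.seq ∘ w.equiv
    rw [← h']
    funext s; simp
  · simp

variable (β P) in
/-- The generators of `R_β` act on `⊕_w V` by operators that satisfy the defining relations. -/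
theorem genW_rel (hβ : β₁ + β₂ = β) (a b : FreeAlgebra k (GenR β)) (h : RelR D β a b) :
    FreeAlgebra.lift k (P.genW β) a = FreeAlgebra.lift k (P.genW β) b := by
  have Le : ∀ ν, FreeAlgebra.lift k (P.genW β) (FreeR.e k ν) = P.genW β (.e ν) := fun ν =>
    FreeAlgebra.lift_ι_apply _ _
  have Lx : ∀ p, FreeAlgebra.lift k (P.genW β) (FreeR.x k p) = P.genW β (.x p) :=
    fun p => FreeAlgebra.lift_ι_apply _ _
  have Ls : ∀ a, FreeAlgebra.lift k (P.genW β) (FreeR.s k a) = P.sigma a := fun a =>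
    FreeAlgebra.lift_ι_apply _ _
  cases h <;> simp only [map_mul, map_sub, map_sum, map_one, map_zero, D.map_Q, D.map_dQ, Le, Lx, Ls]
  case e_mul_self ν =>
    refine ext_single fun w v => ?_
    rw [Module.End.mul_apply, genW_e, genW_e]
    exact congrArg _ (apply_eq (P.col_mul_self _) v)
  case e_mul_ne μ ν h =>
    refine ext_single fun w v => ?_
    rw [Module.End.mul_apply, genW_e, genW_e, ← Module.End.mul_apply, col_mul_col]
    · simp
    · intro h'
      exact h (ISeq.ext (w.equiv.symm.surjective.injective_comp_right h'))
  case sum_e =>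
    refine ext_single fun w v => ?_
    simp only [LinearMap.sum_apply, genW_e, ← Finsupp.single_finsetSum, Module.End.one_apply]
    rw [← LinearMap.sum_apply, sum_col hβ]
    rfl
  case x_e p ν =>
    refine ext_single fun w v => ?_
    simp only [Module.End.mul_apply, genW_e, genW_x]
    exact congrArg _ (apply_eq (P.cen_comm (P.X_mem _) (P.col_mem _)) v)
  case x_x p q =>
    refine ext_single fun w v => ?_
    simp only [Module.End.mul_apply, genW_x]
    exact congrArg _ (apply_eq (P.cen_comm (P.X_mem _) (P.X_mem _)) v)
  case s_e a ν => exact sigma_e ν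
  case s_x a p h1 h2 => exact sigma_x h1 h2
  case s_hi_eq a ν h =>
    conv_rhs => rw [← one_mul (P.genW β (.e ν))]
    refine ext_col fun w μ η hc v => ?_
    rw [LinearMap.sub_apply, sub_eq_iff_eq_add', Module.End.mul_apply, Module.End.mul_apply, genW_x]
    refine (sigma_x_hi _).trans ?_
    congr 1
    have : P.eqs (w.equiv (lo a)) (w.equiv (hi a)) * P.eps μ η = _ * P.eps μ η :=
      P.diag_mul_eps _ μ η
    rw [← hc, ← hc, if_pos h] at this
    exact (congrArg _ (apply_eq this v)).trans (by rw [one_mul]; rfl)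
  case s_hi_ne a ν h =>
    rw [← zero_mul (P.genW β (.e ν))]
    refine ext_col fun w μ η hc v => ?_
    rw [LinearMap.sub_apply, sub_eq_iff_eq_add', Module.End.mul_apply, Module.End.mul_apply, genW_x]
    refine (sigma_x_hi _).trans ?_
    congr 1
    have : P.eqs (w.equiv (lo a)) (w.equiv (hi a)) * P.eps μ η = _ * P.eps μ η :=
      P.diag_mul_eps _ μ η
    rw [← hc, ← hc, if_neg h] at this
    exact (congrArg _ (apply_eq this v)).trans (by simp)
  case s_lo_eq a ν h =>
    conv_rhs => rw [← one_mul (P.genW β (.e ν))]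
    refine ext_col fun w μ η hc v => ?_
    rw [LinearMap.sub_apply, sub_eq_iff_eq_add', Module.End.mul_apply, Module.End.mul_apply, genW_x]
    refine (x_hi_sigma _).trans ?_
    congr 1
    have : P.eqs (w.equiv (lo a)) (w.equiv (hi a)) * P.eps μ η = _ * P.eps μ η :=
      P.diag_mul_eps _ μ η
    rw [← hc, ← hc, if_pos h] at this
    exact (congrArg _ (apply_eq this v)).trans (by rw [one_mul]; rfl)
  case s_lo_ne a ν h =>
    rw [← zero_mul (P.genW β (.e ν))]
    refine ext_col fun w μ η hc v => ?_
    rw [LinearMap.sub_apply, sub_eq_iff_eq_add', Module.End.mul_apply, Module.End.mul_apply, genW_x]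
    refine (x_hi_sigma _).trans ?_
    congr 1
    have : P.eqs (w.equiv (lo a)) (w.equiv (hi a)) * P.eps μ η = _ * P.eps μ η :=
      P.diag_mul_eps _ μ η
    rw [← hc, ← hc, if_neg h] at this
    exact (congrArg _ (apply_eq this v)).trans (by simp)
  case s_sq a ν =>
    refine ext_col fun w μ η hc v => ?_
    rw [Module.End.mul_apply, sigma_sigma, genW_x_poly_Q]
    have := P.diag_mul_eps (fun ν η => D.Q (Sum.elim ν.seq η.seq (w.equiv (lo a)))
      (Sum.elim ν.seq η.seq (w.equiv (hi a))) (P.X (w.equiv (lo a))) (P.X (w.equiv (hi a)))) μ η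
    rw [← hc, ← hc] at this
    exact congrArg _ (apply_eq this v)
  case s_s a b h => exact sigma_comm h
  case braid_eq a b ν hab h =>
    refine ext_col fun w μ η hc v => ?_
    rw [LinearMap.sub_apply, sub_eq_iff_eq_add']
    refine (braidAt (P := P) (w := w) hab _).trans ?_
    rw [genW_x_poly_dQ]
    congr 1
    have : P.Dq (w.equiv (lo a)) (w.equiv (hi a)) (w.equiv (hi b)) * P.eps μ η = _ * P.eps μ η :=
      P.diag_mul_eps _ μ η
    rw [← hc, ← hc, ← hc, if_pos h] at this
    exact congrArg _ (apply_eq this v)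
  case braid_ne a b ν hab h =>
    rw [← zero_mul (P.genW β (.e ν))]
    refine ext_col fun w μ η hc v => ?_
    rw [LinearMap.sub_apply, sub_eq_iff_eq_add']
    refine (braidAt (P := P) (w := w) hab _).trans ?_
    congr 1
    have : P.Dq (w.equiv (lo a)) (w.equiv (hi a)) (w.equiv (hi b)) * P.eps μ η = 0 := by
      rw [Dq, diag_mul_eps, ← hc, ← hc, ← hc, if_neg h, zero_mul]
    rw [← Module.End.mul_apply, this]
    simp

/-- The action of `R_β` on `⊕_w V`. -/
def actW (P : Pair D β₁ β₂ (Module.End k V)) (hβ : β₁ + β₂ = β) :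
    KLR D β →ₐ[k] Module.End k (Sh β₁ β₂ β →₀ V) := KLR.lift (P.genW β) (genW_rel β P hβ)

theorem actW_gen (hβ : β₁ + β₂ = β) (g : GenR β) : P.actW hβ (KLR.gen D g) = P.genW β g :=
  KLR.lift_gen _ _ g

end Pair

end ShuffleModule

/-! ### A spanning set of an induced module -/

namespace Shuffle

variable {n₁ n₂ N : ℕ} {w : Shuffle n₁ n₂ N} {a : Fin (N - 1)}

theorem len_sw_of_not (h : ¬w.Mixed a) : (w.sw a).len = w.len := by rw [sw_of_not h]

theorem len_sw_rl {i j} (h1 : w.equiv (lo a) = .inr j) (h2 : w.equiv (hi a) = .inl i) :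
    (w.sw a).len + 1 = w.len := by
  have hm := mixed_RL h1 h2
  rw [← len_sw (w := w.sw a) (a := a) ((sw_lo hm).trans h2) ((sw_hi hm).trans h1), sw_sw]

theorem len_sw_le (w : Shuffle n₁ n₂ N) (a : Fin (N - 1)) : (w.sw a).len ≤ w.len + 1 := by
  rcases w.cases a with ⟨i, j, h1, h2⟩ | ⟨i, j, h1, h2⟩ | ⟨c, h1, h2⟩ | ⟨c, h1, h2⟩
  · exact (len_sw h1 h2).le
  · have := len_sw_rl h1 h2; omega
  · rw [len_sw_of_not (by simp [Mixed, h1, h2])]; omega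
  · rw [len_sw_of_not (by simp [Mixed, h1, h2])]; omega

end Shuffle

section Spanning

variable {k : Type u} [Field k] {I : Type v} {D : Datum k I} {β₁ β₂ β : I →₀ ℕ}

/-- The elements of an algebra that map a subspace of a module to itself. -/
def stab (A : Type*) {M : Type*} [Ring A] [Algebra k A] [AddCommGroup M] [Module k M] [Module A M]
    [IsScalarTower k A M] (F : Submodule k M) : Subalgebra k A where
  carrier := {a | ∀ m ∈ F, a • m ∈ F}
  mul_mem' ha hb m hm := by rw [mul_smul]; exact ha _ (hb m hm)
  add_mem' ha hb m hm := by rw [add_smul]; exact F.add_mem (ha m hm) (hb m hm)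
  algebraMap_mem' r m hm := by rw [algebraMap_smul]; exact F.smul_mem r hm

namespace Filt

variable (D) {M : Type w} [AddCommGroup M] [Module k M] [Module (KLR D β) M]
  (hβ : ht β₁ + ht β₂ = ht β) (T : Submodule k M)

/-- The span of the `b t` for `t ∈ T` and the elements `b` of the paths to the shuffles of length at most
`l`. -/
def F (l : ℕ) : Submodule k M :=
  Submodule.span k {m | ∃ (w : Pair.Sh β₁ β₂ β) (b : KLR D β) (t : M),
    Shuffle.Path hβ (KLR.s D) w b ∧ w.len ≤ l ∧ t ∈ T ∧ m = b • t}

variable {D hβ T}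

theorem F_mono {l l' : ℕ} (h : l ≤ l') : F D hβ T l ≤ F D hβ T l' :=
  Submodule.span_mono fun _ ⟨w, b, t, h1, h2, h3⟩ => ⟨w, b, t, h1, h2.trans h, h3⟩

theorem mem_F {w : Pair.Sh β₁ β₂ β} {b : KLR D β} {t : M} (hw : Shuffle.Path hβ (KLR.s D) w b) (ht : t ∈ T) {l : ℕ}
    (hl : w.len ≤ l) : b • t ∈ F D hβ T l := Submodule.subset_span ⟨w, b, t, hw, hl, ht, rfl⟩

variable [IsScalarTower k (KLR D β) M]

theorem smul_mem_F {a : KLR D β} {l : ℕ} {F' : Submodule k M}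
    (h : ∀ (w : Pair.Sh β₁ β₂ β) (b : KLR D β) (t : M), Shuffle.Path hβ (KLR.s D) w b → w.len ≤ l → t ∈ T →
      a • b • t ∈ F') {m : M} (hm : m ∈ F D hβ T l) : a • m ∈ F' := by
  have : F D hβ T l ≤ Submodule.comap (Algebra.lsmul k k M a) F' := by
    refine Submodule.span_le.2 ?_
    rintro _ ⟨w, b, t, h1, h2, h3, rfl⟩
    exact h w b t h1 h2 h3
  exact this hm

variable (D hβ T) in
/-- The stability properties of the summand of a shuffle. -/
def Stable (l : ℕ) : Prop :=
  ∀ (w : Pair.Sh β₁ β₂ β) (b : KLR D β) (t : M), Shuffle.Path hβ (KLR.s D) w b → w.len = l → t ∈ T →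
    (∀ p : Fin (ht β), KLR.x D p • b • t ∈ F D hβ T l) ∧ (∀ ν : ISeq β, KLR.e D ν • b • t ∈ F D hβ T l) ∧
    (∀ a : Fin (ht β - 1), ¬w.Mixed a → KLR.s D a • b • t ∈ F D hβ T l) ∧
    (∀ a : Fin (ht β - 1), KLR.s D a • b • t ∈ F D hβ T (l + 1))

theorem Stable.of_lt {l : ℕ} (h : ∀ l' < l, Stable D hβ T l') {l' : ℕ} (hl : l' < l) {m : M}
    (hm : m ∈ F D hβ T l') : (∀ p : Fin (ht β), KLR.x D p • m ∈ F D hβ T l') ∧ (∀ ν : ISeq β, KLR.e D ν • m ∈ F D hβ T l') ∧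
    (∀ a : Fin (ht β - 1), KLR.s D a • m ∈ F D hβ T (l' + 1)) := by
  refine ⟨fun p => smul_mem_F (fun w b t h1 h2 h3 => ?_) hm,
    fun ν => smul_mem_F (fun w b t h1 h2 h3 => ?_) hm,
    fun a => smul_mem_F (fun w b t h1 h2 h3 => ?_) hm⟩
  · exact F_mono h2 ((h _ (h2.trans_lt hl) w b t h1 rfl h3).1 p)
  · exact F_mono h2 ((h _ (h2.trans_lt hl) w b t h1 rfl h3).2.1 ν)
  · exact F_mono (Nat.succ_le_succ h2) ((h _ (h2.trans_lt hl) w b t h1 rfl h3).2.2.2 a)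

theorem braid_mem {F : Submodule k M} (hx : ∀ p : Fin (ht β), KLR.x D p ∈ stab (KLR D β) F) (he : ∀ ν : ISeq β, KLR.e D ν ∈ stab (KLR D β) F)
    {a b : Fin (ht β - 1)} (hab : (b : ℕ) = a + 1) :
    KLR.s D b * KLR.s D a * KLR.s D b - KLR.s D a * KLR.s D b * KLR.s D a ∈ stab (KLR D β) F := by
  rw [KLR.braid a b hab, add_sub_cancel_left]
  refine (stab (KLR D β) F).sum_mem fun ν _ => (stab (KLR D β) F).mul_mem ?_ (he ν)
  split_ifs
  · exact polyDiff_mem _ (hx _) (hx _) (hx _) _ _ _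
  · exact (stab (KLR D β) F).zero_mem

theorem sq_mem {F : Submodule k M} (hx : ∀ p : Fin (ht β), KLR.x D p ∈ stab (KLR D β) F) (he : ∀ ν : ISeq β, KLR.e D ν ∈ stab (KLR D β) F)
    (a : Fin (ht β - 1)) : KLR.s D a * KLR.s D a ∈ stab (KLR D β) F := by
  rw [← mul_one (KLR.s D a * KLR.s D a), ← KLR.sum_e, Finset.mul_sum]
  refine (stab (KLR D β) F).sum_mem fun ν _ => ?_
  rw [KLR.s_sq_e]
  exact (stab (KLR D β) F).mul_mem (polyEval_mem _ (hx _) (hx _) _ _ _) (he ν)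

theorem eqn_mem {F : Submodule k M} (he : ∀ ν : ISeq β, KLR.e D ν ∈ stab (KLR D β) F) (a : Fin (ht β - 1)) :
    KLR.eqn D a ∈ stab (KLR D β) F := by
  refine (stab (KLR D β) F).sum_mem fun ν _ => (stab (KLR D β) F).mul_mem ?_ (he ν)
  split_ifs
  · exact (stab (KLR D β) F).one_mem
  · exact (stab (KLR D β) F).zero_mem

theorem stable (hx : ∀ p : Fin (ht β), ∀ t ∈ T, KLR.x D p • t ∈ T) (he : ∀ ν : ISeq β, ∀ t ∈ T, KLR.e D ν • t ∈ T)
    (hs : ∀ a : Fin (ht β - 1), ¬(Shuffle.base hβ).Mixed a → ∀ t ∈ T, KLR.s D a • t ∈ T) (l : ℕ) :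
    Stable D hβ T l := by
  induction l using Nat.strong_induction_on with
  | _ l ih =>
  intro w b t hw hl htT
  have one : ∀ t ∈ T, t ∈ F D hβ T (Shuffle.base hβ).len := fun t ht => by
    have := mem_F (D := D) (Shuffle.Path.base (h := hβ) (s := KLR.s D)) ht le_rfl
    rwa [one_smul] at this
  have hcomm : ∀ a b : Fin (ht β - 1), (a : ℕ) + 1 < b →
    KLR.s D a * KLR.s D b = KLR.s D b * KLR.s D a := fun a b h => KLR.s_s h
  have lx : ∀ l' < l, ∀ p : Fin (ht β), KLR.x D p ∈ stab (KLR D β) (F D hβ T l') := fun l' h' p m hm =>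
    (Stable.of_lt ih h' hm).1 p
  have le : ∀ l' < l, ∀ ν : ISeq β, KLR.e D ν ∈ stab (KLR D β) (F D hβ T l') := fun l' h' ν m hm =>
    (Stable.of_lt ih h' hm).2.1 ν
  have ls : ∀ l' < l, ∀ a : Fin (ht β - 1), ∀ m ∈ F D hβ T l', KLR.s D a • m ∈ F D hβ T (l' + 1) := fun l' h' a m hm =>
    (Stable.of_lt ih h' hm).2.2 a
  have hX : ∀ p : Fin (ht β), KLR.x D p • b • t ∈ F D hβ T l := by
    intro p
    cases hw with
    | base => rw [one_smul, ← hl]; exact one _ (hx p t htT)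
    | @up w b a i j hw h1 h2 =>
      have hlen := Shuffle.len_sw h1 h2
      obtain rfl : w.len + 1 = l := by omega
      have hb := mem_F hw htT le_rfl
      have hq : KLR.eqn D a • b • t ∈ F D hβ T (w.len + 1) :=
        F_mono (Nat.le_succ _) (eqn_mem (le _ (Nat.lt_succ_self _)) a _ hb)
      have hsx : ∀ q, KLR.s D a • KLR.x D q • b • t ∈ F D hβ T (w.len + 1) := fun q =>
        ls _ (Nat.lt_succ_self _) a _ (lx _ (Nat.lt_succ_self _) q _ hb)
      rw [mul_smul, smul_smul]
      by_cases hp : p = lo a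
      · rw [hp, ← sub_eq_of_eq_add (KLR.s_x_hi (D := D) a), sub_smul, mul_smul]
        exact Submodule.sub_mem _ (hsx _) hq
      · by_cases hp' : p = hi a
        · rw [hp', KLR.x_hi_s, add_smul, mul_smul]
          exact Submodule.add_mem _ (hsx _) hq
        · rw [← KLR.s_x hp hp', mul_smul]
          exact hsx _
  have hE : ∀ ν : ISeq β, KLR.e D ν • b • t ∈ F D hβ T l := by
    intro ν
    cases hw with
    | base => rw [one_smul, ← hl]; exact one _ (he ν t htT)
    | @up w b a i j hw h1 h2 =>
      have hlen := Shuffle.len_sw h1 h2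
      obtain rfl : w.len + 1 = l := by omega
      have := KLR.s_e (D := D) a (ν.swap a)
      rw [ISeq.swap_swap] at this
      rw [mul_smul, smul_smul, ← this, mul_smul]
      exact ls _ (Nat.lt_succ_self _) a _ (le _ (Nat.lt_succ_self _) _ _ (mem_F hw htT le_rfl))
  have hS : ∀ a : Fin (ht β - 1), ¬w.Mixed a → KLR.s D a • b • t ∈ F D hβ T l := by
    intro a ha
    cases hw with
    | base => rw [one_smul, ← hl]; exact one _ (hs a ha t htT)
    | @up w b c i j hw h1 h2 =>
      have hlen := Shuffle.len_sw h1 h2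
      have hm := Shuffle.mixed_LR h1 h2
      obtain rfl : w.len + 1 = l := by omega
      rw [mul_smul]
      have key : ∀ b' : KLR D β, ∀ w' : Pair.Sh β₁ β₂ β, Shuffle.Path hβ (KLR.s D) w' b' →
          w'.len + 1 = w.len → b = KLR.s D a * b' → ¬w'.Mixed c →
          ((c : ℕ) = a + 1 ∨ (a : ℕ) = c + 1) →
          KLR.s D a • KLR.s D c • b • t ∈ F D hβ T (w.len + 1) := by
        rintro b' w' hw' hl' rfl hc hac
        have hb := mem_F hw' htT le_rfl
        have h1 : KLR.s D c • KLR.s D a • KLR.s D c • b' • t ∈ F D hβ T (w'.len + 1 + 1) :=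
          ls _ (by omega) _ _ (ls _ (by omega) _ _ ((ih _ (by omega) _ _ _ hw' rfl htT).2.2.1 c hc))
        have h2 : (KLR.s D a * KLR.s D c * KLR.s D a - KLR.s D c * KLR.s D a * KLR.s D c) • b' • t ∈
            F D hβ T w'.len := by
          rcases hac with hac | hac
          · have := braid_mem (lx w'.len (by omega)) (le w'.len (by omega)) hac _ hb
            rw [← neg_sub, neg_smul]
            exact Submodule.neg_mem _ this
          · exact braid_mem (lx w'.len (by omega)) (le w'.len (by omega)) hac _ hb
        rw [hl'] at h1
        have h3 := Submodule.add_mem _ h1 (F_mono (by omega : w'.len ≤ w.len + 1) h2)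
        simp only [smul_smul, sub_mul, sub_smul, ← mul_assoc] at h3 ⊢
        rwa [add_sub_cancel] at h3
      rcases lt_trichotomy (a : ℕ) c with hac | hac | hac
      · rcases Nat.lt_or_ge ((a : ℕ) + 1) c with hac' | hac'
        · rw [smul_smul, hcomm a c hac', mul_smul]
          refine ls _ (Nat.lt_succ_self _) _ _ ((ih _ (Nat.lt_succ_self _) _ _ _ hw rfl htT).2.2.1 a ?_)
          rwa [← Shuffle.mixed_sw_far hm (Or.inr hac')]
        · have hac'' : (c : ℕ) = a + 1 := by omega
          have e := Shuffle.hi_eq_lo hac''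
          have n1 : (lo a : Fin (ht β)) ≠ lo c := by rw [← e]; exact lo_ne_hi a
          have n2 : (lo a : Fin (ht β)) ≠ hi c := by simp [lo, hi, hac'']; omega
          have g1 : (w.sw c).equiv (lo a) = w.equiv (lo a) := Shuffle.sw_of_ne hm n1 n2
          have g2 : (w.sw c).equiv (hi a) = .inr j := by rw [e, Shuffle.sw_lo hm, h2]
          obtain ⟨i', hi'⟩ : ∃ i', w.equiv (lo a) = .inr i' := by
            rw [Shuffle.Mixed, g1, g2, not_not] at ha
            rcases h : w.equiv (lo a) with i' | i'
            · rw [h] at ha; simp at ha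
            · exact ⟨i', rfl⟩
          rw [← e] at h1
          obtain ⟨y, hy, hby⟩ := hw.descent hcomm hi' h1
          refine key y _ hy (Shuffle.len_sw_rl hi' h1) hby ?_ (Or.inl hac'')
          have hm' := Shuffle.mixed_RL hi' h1
          rw [Shuffle.Mixed, ← e, Shuffle.sw_hi hm', hi', Shuffle.sw_of_ne hm' n2.symm, h2]
          · simp
          · rw [e]; exact (lo_ne_hi c).symm
      · obtain rfl : a = c := Fin.ext hac
        exact (ha hm.sw).elim
      · rcases Nat.lt_or_ge ((c : ℕ) + 1) a with hac' | hac'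
        · rw [smul_smul, ← hcomm c a hac', mul_smul]
          refine ls _ (Nat.lt_succ_self _) _ _ ((ih _ (Nat.lt_succ_self _) _ _ _ hw rfl htT).2.2.1 a ?_)
          rwa [← Shuffle.mixed_sw_far hm (Or.inl hac')]
        · have hac'' : (a : ℕ) = c + 1 := by omega
          have e := Shuffle.hi_eq_lo hac''
          have n1 : (hi a : Fin (ht β)) ≠ hi c := by rw [e]; exact (lo_ne_hi a).symm
          have n2 : (lo c : Fin (ht β)) ≠ hi a := by simp [lo, hi, hac'']; omega
          have g1 : (w.sw c).equiv (hi a) = w.equiv (hi a) := Shuffle.sw_of_ne hm n2.symm n1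
          have g2 : (w.sw c).equiv (lo a) = .inl i := by rw [← e, Shuffle.sw_hi hm, h1]
          obtain ⟨i', hi'⟩ : ∃ i', w.equiv (hi a) = .inl i' := by
            rw [Shuffle.Mixed, g1, g2, not_not] at ha
            rcases h : w.equiv (hi a) with i' | i'
            · exact ⟨i', rfl⟩
            · rw [h] at ha; simp at ha
          rw [e] at h2
          obtain ⟨y, hy, hby⟩ := hw.descent hcomm h2 hi'
          refine key y _ hy (Shuffle.len_sw_rl h2 hi') hby ?_ (Or.inr hac'')
          have hm' := Shuffle.mixed_RL h2 hi'
          rw [Shuffle.Mixed, e, Shuffle.sw_lo hm', hi', Shuffle.sw_of_ne hm' _ n2, h1]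
          · simp
          · rw [← e]; exact lo_ne_hi c
  refine ⟨hX, hE, hS, fun a => ?_⟩
  rcases w.cases a with ⟨i, j, h1, h2⟩ | ⟨i, j, h1, h2⟩ | ⟨c, h1, h2⟩ | ⟨c, h1, h2⟩
  · rw [smul_smul]
    exact mem_F (Shuffle.Path.up a hw h1 h2) htT (by rw [Shuffle.len_sw h1 h2, hl])
  · obtain ⟨y, hy, rfl⟩ := hw.descent hcomm h1 h2
    have hlen := Shuffle.len_sw_rl h1 h2
    rw [smul_smul, ← mul_assoc, mul_smul]
    refine F_mono (show (w.sw a).len ≤ l + 1 by omega) ?_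
    have hlt : (w.sw a).len < l := by omega
    exact sq_mem (lx _ hlt) (le _ hlt) a _ (mem_F hy htT le_rfl)
  · exact F_mono (Nat.le_succ l) (hS a (by simp [Shuffle.Mixed, h1, h2]))
  · exact F_mono (Nat.le_succ l) (hS a (by simp [Shuffle.Mixed, h1, h2]))

end Filt

end Spanning

/-! ### The structure of a convolution product of `R`-modules -/

section PBW

variable {k : Type u} [Field k] {I : Type v} {D : Datum k I} {β₁ β₂ β : I →₀ ℕ}

theorem Ind.induction_on {A : Type v} [Ring A] [Algebra k A] {W : Type w} [AddCommGroup W] [Module k W]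
    {r : Set (A ⊗[k] W)} (F : Submodule k (Ind r)) (h : ∀ (a : A) (w : W), a • Ind.mk r w ∈ F) (x : Ind r) :
    x ∈ F := by
  obtain ⟨t, rfl⟩ := Submodule.mkQ_surjective _ x
  induction t with
  | zero => rw [map_zero]; exact F.zero_mem
  | tmul a w => exact (Ind.proj_tmul r a w) ▸ h a w
  | add a b iha ihb => rw [map_add]; exact F.add_mem iha ihb

theorem Ind.hom_ext {A : Type v} [Ring A] [Algebra k A] {W : Type w} [AddCommGroup W] [Module k W]
    {r : Set (A ⊗[k] W)} {N : Type w₁} [AddCommGroup N] [Module k N] [Module A N] [IsScalarTower k A N]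
    {f g : Ind r →ₗ[A] N} (h : ∀ w, f (Ind.mk r w) = g (Ind.mk r w)) : f = g := by
  refine LinearMap.ext fun x => ?_
  refine Ind.induction_on (LinearMap.eqLocus (f.restrictScalars k) (g.restrictScalars k)) (fun a w => ?_) x
  change f (a • Ind.mk r w) = g (a • Ind.mk r w)
  rw [map_smul, map_smul, h]

theorem KLR.mem_subalgebra (S : Subalgebra k (KLR D β)) (h : ∀ g, KLR.gen D g ∈ S) (a : KLR D β) : a ∈ S := by
  induction a using KLR.induction with
  | h0 r => exact S.algebraMap_mem r
  | hg g => exact h g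
  | hm a b iha ihb => exact S.mul_mem iha ihb
  | ha a b iha ihb => exact S.add_mem iha ihb

/-- An embedding of `A ⊗ B` in a space on which `R_{β₁}` and `R_{β₂}` act in such a way that the differences
of their polynomial generators are invertible. -/
structure Model (A : KMod.{u, v, w₁} D β₁) (B : KMod.{u, v, w₂} D β₂) (V : Type w) [AddCommGroup V]
    [Module k V] where
  P : Pair D β₁ β₂ (Module.End k V)
  ξ : A.V ⊗[k] B.V →ₗ[k] V
  inj : Function.Injective ξ
  mapL : ∀ (a : KLR D β₁) (u : A.V) (v : B.V), ξ ((a • u) ⊗ₜ v) = P.L a (ξ (u ⊗ₜ v))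
  mapR : ∀ (a : KLR D β₂) (u : A.V) (v : B.V), ξ (u ⊗ₜ (a • v)) = P.R a (ξ (u ⊗ₜ v))

/-- The `R_β`-module `⊕_w V`. -/
def Pair.W {V : Type w} [AddCommGroup V] [Module k V] (P : Pair D β₁ β₂ (Module.End k V)) (hβ : β₁ + β₂ = β) :
    KMod.{u, v, w} D β where
  V := Pair.Sh β₁ β₂ β →₀ V
  mod := Module.compHom (Pair.Sh β₁ β₂ β →₀ V) (P.actW hβ).toRingHom
  tower := by
    let _ := Module.compHom (Pair.Sh β₁ β₂ β →₀ V) (P.actW hβ).toRingHom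
    refine ⟨fun r a m => ?_⟩
    change P.actW hβ (r • a) m = r • P.actW hβ a m
    rw [map_smul]; rfl

theorem base_lo_left (hβ : β₁ + β₂ = β) (a) : (Shuffle.base (ht_add hβ)).equiv (inL hβ a) = .inl a :=
  Shuffle.base_left _ _ _

theorem base_lo_right (hβ : β₁ + β₂ = β) (a) : (Shuffle.base (ht_add hβ)).equiv (inR hβ a) = .inr a :=
  Shuffle.base_right _ _ _

theorem lo_crL (hβ : β₁ + β₂ = β) (a : Fin (ht β₁ - 1)) : lo (crL hβ a) = inL hβ (lo a) := rfl
theorem hi_crL (hβ : β₁ + β₂ = β) (a : Fin (ht β₁ - 1)) : hi (crL hβ a) = inL hβ (hi a) := rfl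
theorem lo_crR (hβ : β₁ + β₂ = β) (a : Fin (ht β₂ - 1)) : lo (crR hβ a) = inR hβ (lo a) := rfl
theorem hi_crR (hβ : β₁ + β₂ = β) (a : Fin (ht β₂ - 1)) : hi (crR hβ a) = inR hβ (hi a) :=
  Fin.ext (by simp [hi, crR, inR, add_assoc])

theorem append_comp_base (hβ : β₁ + β₂ = β) (ν : ISeq β₁) (η : ISeq β₂) :
    (ISeq.append hβ ν η).seq ∘ (Shuffle.base (ht_add hβ)).equiv.symm = Sum.elim ν.seq η.seq := by
  funext s
  rcases s with i | i <;>
    simp [ISeq.append, concat, Shuffle.base]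

namespace Model

variable {A : KMod.{u, v, w₁} D β₁} {B : KMod.{u, v, w₂} D β₂} {V : Type w} [AddCommGroup V] [Module k V]

theorem W_smul (P : Pair D β₁ β₂ (Module.End k V)) (hβ : β₁ + β₂ = β) (g : GenR β) (x : (P.W hβ).V) :
    KLR.gen D g • x = P.genW β g x :=
  LinearMap.congr_fun (P.actW_gen hβ g) x

variable (Mo : Model A B V) (hβ : β₁ + β₂ = β)

/-- `t ↦ ξ t` in the summand of the base shuffle. -/
def base : A.V ⊗[k] B.V →ₗ[k] (Mo.P.W hβ).V :=
  (Finsupp.lsingle (Shuffle.base (ht_add hβ)) : V →ₗ[k] (Pair.Sh β₁ β₂ β →₀ V)) ∘ₗ Mo.ξ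

/-- The homomorphism `A ∘ B → ⊕_w V`. -/
def Ψ : KMod.conv hβ A B →ₗ[KLR D β] (Mo.P.W hβ).V :=
  Ind.lift (Mo.base hβ) fun t ht => by
    cases ht <;>
      refine (map_sub (Ind.act (Mo.base hβ)) _ _).trans (sub_eq_zero.2 ?_) <;>
      simp only [Ind.act_tmul, one_smul] <;>
      refine (W_smul Mo.P hβ _ _).trans ?_
    case e ν η u v =>
      refine (Pair.genW_e _ _).trans ?_
      rw [append_comp_base, Pair.col_elim, Pair.eps]
      change Finsupp.single _ (Mo.P.L (KLR.e D ν) (Mo.P.R (KLR.e D η) _)) = Finsupp.single _ _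
      rw [← Mo.mapR, ← Mo.mapL]
    case xL p u v =>
      refine (Pair.genW_x _ _).trans ?_
      rw [base_lo_left]
      exact congrArg (Finsupp.single _) (Mo.mapL _ _ _).symm
    case xR p u v =>
      refine (Pair.genW_x _ _).trans ?_
      rw [base_lo_right]
      exact congrArg (Finsupp.single _) (Mo.mapR _ _ _).symm
    case sL a u v =>
      refine (Pair.sigma_ll (c := a) (by rw [lo_crL, base_lo_left])
        (by rw [hi_crL, base_lo_left]) _).trans ?_
      exact congrArg (Finsupp.single _) (Mo.mapL _ _ _).symm
    case sR a u v =>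
      refine (Pair.sigma_rr (c := a) (by rw [lo_crR, base_lo_right])
        (by rw [hi_crR, base_lo_right]) _).trans ?_
      exact congrArg (Finsupp.single _) (Mo.mapR _ _ _).symm

theorem Ψ_mk (t : A.V ⊗[k] B.V) :
    Mo.Ψ hβ (Ind.mk _ t) = (Finsupp.single (Shuffle.base (ht_add hβ)) (Mo.ξ t) : Pair.Sh β₁ β₂ β →₀ V) :=
  Ind.lift_mk _ _ t

end Model

section Reach

variable (A : KMod.{u, v, w₁} D β₁) (B : KMod.{u, v, w₂} D β₂) (hβ : β₁ + β₂ = β)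

variable (D) in
/-- The shuffles that are reached from the base shuffle by a path. -/
abbrev Reach : Type _ := {w : Pair.Sh β₁ β₂ β // ∃ b, Shuffle.Path (ht_add hβ) (KLR.s D) w b}

variable {hβ}

/-- The product of the `σ_a` along a path. -/
def Reach.word (w : Reach D hβ) : KLR D β := w.2.choose

theorem Reach.path (w : Reach D hβ) : Shuffle.Path (ht_add hβ) (KLR.s D) w.1 w.word := w.2.choose_spec

theorem Reach.word_eq {w : Pair.Sh β₁ β₂ β} {b : KLR D β} (h : Shuffle.Path (ht_add hβ) (KLR.s D) w b) :
    Reach.word (hβ := hβ) ⟨w, b, h⟩ = b :=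
  Shuffle.Path.unique (fun _ _ => KLR.s_s) (Reach.path _) h

variable (hβ)

/-- `(t_w)_w ↦ ∑_w σ_w t_w`. -/
def KMod.Θ : (Reach D hβ →₀ A.V ⊗[k] B.V) →ₗ[k] KMod.conv hβ A B :=
  Finsupp.lsum k fun w => Algebra.lsmul k k (KMod.conv hβ A B) w.word ∘ₗ Ind.mk _

theorem KMod.Θ_single (w : Reach D hβ) (t : A.V ⊗[k] B.V) :
    KMod.Θ A B hβ (Finsupp.single w t) = w.word • Ind.mk _ t := by
  simp [KMod.Θ]

/-- The subspace `A ⊗ B` of `A ∘ B`. -/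
def KMod.T : Submodule k (KMod.conv hβ A B) := LinearMap.range (Ind.mk _)

theorem KMod.T_mem {x : KLR D β} (h : ∀ u v, x • KMod.tens hβ A B u v ∈ KMod.T A B hβ) :
    ∀ t ∈ KMod.T A B hβ, x • t ∈ KMod.T A B hβ := by
  rintro _ ⟨t, rfl⟩
  induction t with
  | zero => rw [map_zero, smul_zero]; exact Submodule.zero_mem _
  | tmul u v => exact h u v
  | add a b iha ihb => rw [map_add, smul_add]; exact Submodule.add_mem _ iha ihb

theorem KMod.e_tens (ν : ISeq β₁) (η : ISeq β₂) (u : A.V) (v : B.V) :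
    KLR.e D (ISeq.append hβ ν η) • KMod.tens hβ A B u v =
      KMod.tens hβ A B (KLR.e D ν • u) (KLR.e D η • v) := Ind.rel (KMod.ConvRel.e ν η u v)

theorem KMod.x_left (p) (u : A.V) (v : B.V) :
    KLR.x D (inL hβ p) • KMod.tens hβ A B u v = KMod.tens hβ A B (KLR.x D p • u) v :=
  Ind.rel (KMod.ConvRel.xL p u v)

theorem KMod.x_right (p) (u : A.V) (v : B.V) :
    KLR.x D (inR hβ p) • KMod.tens hβ A B u v = KMod.tens hβ A B u (KLR.x D p • v) :=
  Ind.rel (KMod.ConvRel.xR p u v)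

theorem KMod.s_left (a) (u : A.V) (v : B.V) :
    KLR.s D (crL hβ a) • KMod.tens hβ A B u v = KMod.tens hβ A B (KLR.s D a • u) v :=
  Ind.rel (KMod.ConvRel.sL a u v)

theorem KMod.s_right (a) (u : A.V) (v : B.V) :
    KLR.s D (crR hβ a) • KMod.tens hβ A B u v = KMod.tens hβ A B u (KLR.s D a • v) :=
  Ind.rel (KMod.ConvRel.sR a u v)

theorem KMod.sum_e_tens (u : A.V) (v : B.V) :
    ∑ ν : ISeq β₁, ∑ η : ISeq β₂, KLR.e D (ISeq.append hβ ν η) • KMod.tens hβ A B u v =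
      KMod.tens hβ A B u v := by
  simp only [e_tens]
  conv_rhs => rw [← one_smul (KLR D β₁) u, ← one_smul (KLR D β₂) v, ← KLR.sum_e, ← KLR.sum_e]
  rw [Finset.sum_comm]
  simp only [KMod.tens, Finset.sum_smul, TensorProduct.sum_tmul, TensorProduct.tmul_sum, map_sum]

theorem KMod.mk_mem_T (t : A.V ⊗[k] B.V) : Ind.mk {t | KMod.ConvRel hβ A B t} t ∈ KMod.T A B hβ := ⟨t, rfl⟩

theorem pos_cases (hβ : β₁ + β₂ = β) (p : Fin (ht β)) : (∃ i, p = inL hβ i) ∨ ∃ j, p = inR hβ j := by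
  have := ht_add hβ
  by_cases h : (p : ℕ) < ht β₁
  · exact Or.inl ⟨⟨p, h⟩, rfl⟩
  · exact Or.inr ⟨⟨p - ht β₁, by omega⟩, Fin.ext (by simp [inR]; omega)⟩

theorem KMod.Θ_surjective : Function.Surjective (KMod.Θ A B hβ) := by
  have hx : ∀ p : Fin (ht β), ∀ t ∈ KMod.T A B hβ, KLR.x D p • t ∈ KMod.T A B hβ := by
    intro p
    refine KMod.T_mem A B hβ fun u v => ?_
    rcases pos_cases hβ p with ⟨i, rfl⟩ | ⟨i, rfl⟩
    · rw [x_left]; exact mk_mem_T _ _ _ _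
    · rw [x_right]; exact mk_mem_T _ _ _ _
  have he : ∀ ν : ISeq β, ∀ t ∈ KMod.T A B hβ, KLR.e D ν • t ∈ KMod.T A B hβ := by
    classical
    intro ν
    refine KMod.T_mem A B hβ fun u v => ?_
    rw [← sum_e_tens, Finset.smul_sum]
    refine Submodule.sum_mem _ fun μ _ => ?_
    rw [Finset.smul_sum]
    refine Submodule.sum_mem _ fun η _ => ?_
    rw [smul_smul, KLR.e_mul_e]
    split_ifs with h
    · rw [e_tens]; exact mk_mem_T _ _ _ _
    · rw [zero_smul]; exact Submodule.zero_mem _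
  have hs : ∀ a : Fin (ht β - 1), ¬(Shuffle.base (ht_add hβ)).Mixed a → ∀ t ∈ KMod.T A B hβ,
      KLR.s D a • t ∈ KMod.T A B hβ := by
    intro a ha
    refine KMod.T_mem A B hβ fun u v => ?_
    rcases (Shuffle.base (ht_add hβ)).cases a with ⟨i, j, h1, h2⟩ | ⟨i, j, h1, h2⟩ | ⟨c, h1, h2⟩ | ⟨c, h1, h2⟩
    · exact (ha (Shuffle.mixed_LR h1 h2)).elim
    · exact (ha (Shuffle.mixed_RL h1 h2)).elim
    · have : lo a = lo (crL hβ c) := (Shuffle.base (ht_add hβ)).equiv.injective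
        (h1.trans (base_lo_left hβ (lo c)).symm)
      obtain rfl : a = crL hβ c := Fin.ext (by simpa [lo] using Fin.ext_iff.1 this)
      rw [s_left]; exact mk_mem_T _ _ _ _
    · have : lo a = lo (crR hβ c) := (Shuffle.base (ht_add hβ)).equiv.injective
        (h1.trans (base_lo_right hβ (lo c)).symm)
      obtain rfl : a = crR hβ c := Fin.ext (by simpa [lo] using Fin.ext_iff.1 this)
      rw [s_right]; exact mk_mem_T _ _ _ _
  have hF : ∀ l, Filt.F D (ht_add hβ) (KMod.T A B hβ) l ≤ LinearMap.range (KMod.Θ A B hβ) := by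
    intro l
    refine Submodule.span_le.2 ?_
    rintro _ ⟨w, b, _, hw, -, ⟨t, rfl⟩, rfl⟩
    exact ⟨Finsupp.single ⟨w, b, hw⟩ t, by rw [Θ_single, Reach.word_eq hw]⟩
  have hstab : ∀ a : KLR D β, a ∈ stab (KLR D β) (LinearMap.range (KMod.Θ A B hβ)) := by
    refine KLR.mem_subalgebra _ fun g => ?_
    rintro _ ⟨t, rfl⟩
    induction t using Finsupp.induction_linear with
    | zero => rw [map_zero, smul_zero]; exact Submodule.zero_mem _
    | add f g ihf ihg => rw [map_add, smul_add]; exact Submodule.add_mem _ ihf ihg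
    | single w t =>
      rw [Θ_single]
      have := Filt.stable hx he hs w.1.len w.1 w.word _ w.path rfl (mk_mem_T A B hβ t)
      cases g with
      | e ν => exact hF _ (this.2.1 ν)
      | x p => exact hF _ (this.1 p)
      | s a => exact hF _ (this.2.2.2 a)
  intro x
  refine Ind.induction_on (LinearMap.range (KMod.Θ A B hβ)) (fun a t => hstab a _ ?_) x
  refine ⟨Finsupp.single ⟨_, 1, Shuffle.Path.base⟩ t, ?_⟩
  rw [Θ_single, Reach.word_eq Shuffle.Path.base, one_smul]

end Reach

section Triangular

variable {V : Type w} [AddCommGroup V] [Module k V]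

/-- The elements of `⊕_w V` supported on shuffles of length less than `l`. -/
def Low (β₁ β₂ β : I →₀ ℕ) (k : Type u) [Field k] (V : Type w) [AddCommGroup V] [Module k V] (l : ℕ) :
    Submodule k (Pair.Sh β₁ β₂ β →₀ V) where
  carrier := {f | ∀ w, l ≤ w.len → f w = 0}
  add_mem' hf hg w hw := by rw [Finsupp.add_apply, hf w hw, hg w hw, add_zero]
  zero_mem' _ _ := rfl
  smul_mem' r f hf w hw := by rw [Finsupp.smul_apply, hf w hw, smul_zero]

theorem single_mem_Low {w : Pair.Sh β₁ β₂ β} {v : V} {l : ℕ} (h : w.len < l) :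
    Finsupp.single w v ∈ Low β₁ β₂ β k V l := by
  classical
  intro w' hw'
  rw [Finsupp.single_apply, if_neg]
  rintro rfl
  omega

theorem sigma_mem_Low {P : Pair D β₁ β₂ (Module.End k V)} {a : Fin (ht β - 1)} {l : ℕ}
    {f : Pair.Sh β₁ β₂ β →₀ V} (hf : f ∈ Low β₁ β₂ β k V l) : P.sigma a f ∈ Low β₁ β₂ β k V (l + 1) := by
  rw [← Finsupp.sum_single f, map_finsuppSum]
  refine Submodule.sum_mem _ fun w hw => ?_
  have hl : w.len < l := by
    by_contra h
    exact Finsupp.mem_support_iff.1 hw (hf w (not_lt.1 h))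
  change P.sigma a (Finsupp.single w (f w)) ∈ _
  rw [Pair.sigma_single]
  refine Submodule.add_mem _ (single_mem_Low ?_) (single_mem_Low (by omega))
  have := w.len_sw_le a
  omega

theorem G_lr_injective (P : Pair D β₁ β₂ (Module.End k V)) (i j) :
    Function.Injective (⇑(1 - P.δ i j + P.h i j : Module.End k V)) := by
  have key : (1 - P.δ i j + P.δ i j * (P.x i - P.y j)) * (1 - P.δ i j + P.h i j) = 1 := by
    have hδ : P.δ i j * P.δ i j = P.δ i j := P.ext_eps fun ν₁ ν₂ => by
      rw [mul_assoc, P.δ_mul_eps]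
      split_ifs <;> simp [P.δ_mul_eps, *]
    have e1 : P.δ i j * (P.x i - P.y j) * P.h i j = P.δ i j := by
      rw [mul_assoc, P.sub_h, hδ]
    have e2 : P.δ i j * (P.x i - P.y j) * P.δ i j = P.δ i j * (P.x i - P.y j) := by
      rw [P.cen_comm (P.cen.mul_mem (P.δ_mem i j) (P.cen.sub_mem (P.x_mem i) (P.y_mem j))) (P.δ_mem i j),
        ← mul_assoc, hδ]
    have e3 := P.δ_h i j
    rw [add_mul, mul_add, mul_add, e1, mul_sub, mul_one, sub_mul, sub_mul, one_mul, one_mul, hδ, e3,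
      mul_sub, mul_one, e2]
    abel
  intro v v' h
  rw [← Module.End.one_apply (R := k) v, ← Module.End.one_apply (R := k) v', ← key, Module.End.mul_apply,
    Module.End.mul_apply, h]

theorem Path_leading (P : Pair D β₁ β₂ (Module.End k V)) (hβ : β₁ + β₂ = β) {w : Pair.Sh β₁ β₂ β}
    {b : KLR D β} (hw : Shuffle.Path (ht_add hβ) (KLR.s D) w b) :
    ∃ g : Module.End k V, Function.Injective g ∧ ∀ v,
      P.actW hβ b (Finsupp.single (Shuffle.base (ht_add hβ)) v) - Finsupp.single w (g v) ∈
        Low β₁ β₂ β k V w.len := by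
  induction hw with
  | base =>
    refine ⟨1, fun _ _ h => h, fun v => ?_⟩
    rw [map_one, Module.End.one_apply, Module.End.one_apply, sub_self]
    exact Submodule.zero_mem _
  | @up w b a i j hw h1 h2 ih =>
    obtain ⟨g, hg, h⟩ := ih
    refine ⟨(1 - P.δ i j + P.h i j) * g, (G_lr_injective P i j).comp hg, fun v => ?_⟩
    have := sigma_mem_Low (P := P) (a := a) (h v)
    rw [map_sub, Pair.sigma_lr h1 h2] at this
    rw [map_mul, Module.End.mul_apply, KLR.s, P.actW_gen, Pair.genW_s, Shuffle.len_sw h1 h2]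
    have h3 := Submodule.sub_mem _ this (single_mem_Low (k := k) (w := w) (v := P.h i j (g v)) (Nat.lt_succ_self _))
    convert h3 using 1
    rw [Module.End.mul_apply]
    abel

variable {A : KMod.{u, v, w₁} D β₁} {B : KMod.{u, v, w₂} D β₂} (Mo : Model A B V) (hβ : β₁ + β₂ = β)

theorem Model.Ψ_Θ_injective : Function.Injective (Mo.Ψ hβ ∘ KMod.Θ A B hβ) := by
  have key : ∀ t, Mo.Ψ hβ (KMod.Θ A B hβ t) = 0 → t = 0 := by
    intro t ht
    by_contra h0
    obtain ⟨w, hw, hmax⟩ := Finset.exists_max_image t.support (fun w => w.1.len)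
      (Finsupp.support_nonempty_iff.2 h0)
    refine Finsupp.mem_support_iff.1 hw ?_
    have hΨ : ∀ w' : Reach D hβ, ∀ s, Mo.Ψ hβ (KMod.Θ A B hβ (Finsupp.single w' s)) =
        (Mo.P.actW hβ w'.word (Finsupp.single (Shuffle.base (ht_add hβ)) (Mo.ξ s)) :
          Pair.Sh β₁ β₂ β →₀ V) := by
      intro w' s
      rw [KMod.Θ_single, map_smul, Model.Ψ_mk]
      rfl
    let ev : (Mo.P.W hβ).V →ₗ[k] V := Finsupp.lapply w.1
    obtain ⟨g, hg, hlow⟩ := Path_leading Mo.P hβ w.path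
    have h1 : ∀ w' ∈ t.support, w' ≠ w →
        ev (Mo.Ψ hβ (KMod.Θ A B hβ (Finsupp.single w' (t w')))) = 0 := by
      classical
      intro w' hw' hne
      obtain ⟨g', -, hlow'⟩ := Path_leading Mo.P hβ w'.path
      rw [hΨ]
      have := hlow' (Mo.ξ (t w')) w.1 (hmax w' hw')
      rw [Finsupp.sub_apply, Finsupp.single_apply, if_neg fun h => hne (Subtype.ext h), sub_zero] at this
      exact this
    have h2 : ev (Mo.Ψ hβ (KMod.Θ A B hβ (Finsupp.single w (t w)))) = g (Mo.ξ (t w)) := by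
      rw [hΨ]
      have := hlow (Mo.ξ (t w)) w.1 le_rfl
      rw [Finsupp.sub_apply, Finsupp.single_eq_same, sub_eq_zero] at this
      exact this
    have h3 : ev (Mo.Ψ hβ (KMod.Θ A B hβ t)) = g (Mo.ξ (t w)) := by
      conv_lhs => rw [← Finsupp.sum_single t]
      rw [Finsupp.sum, map_sum, map_sum, map_sum, Finset.sum_eq_single w h1 fun h => (h hw).elim, h2]
    rw [ht, map_zero] at h3
    refine Mo.inj (hg ?_)
    rw [← h3, map_zero, map_zero]
  intro x y h
  rw [← sub_eq_zero]
  refine key _ ?_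
  rw [map_sub, map_sub, sub_eq_zero]
  exact h

theorem Model.Ψ_injective : Function.Injective (Mo.Ψ hβ) := by
  intro x y h
  obtain ⟨s, rfl⟩ := KMod.Θ_surjective A B hβ x
  obtain ⟨t, rfl⟩ := KMod.Θ_surjective A B hβ y
  rw [Mo.Ψ_Θ_injective hβ h]

theorem Model.Θ_injective {A : KMod.{u, v, w₁} D β₁} {B : KMod.{u, v, w₂} D β₂} (Mo : Model A B V)
    (hβ : β₁ + β₂ = β) : Function.Injective (KMod.Θ A B hβ) :=
  (Mo.Ψ_Θ_injective hβ).of_comp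

end Triangular

end PBW

/-! ### Laurent series in `z⁻¹` -/

section Laurent

variable {k : Type u} [Field k] {V : Type w} [AddCommGroup V] [Module k V]

/-- The space `V((z⁻¹))` of the Laurent series in `z⁻¹` with coefficients in `V`. -/
def Lau (k : Type u) [Field k] (V : Type w) [AddCommGroup V] [Module k V] : Submodule k (ℤ → V) where
  carrier := {f | ∃ n, ∀ m, n ≤ m → f m = 0}
  add_mem' := by
    rintro f g ⟨n, hn⟩ ⟨n', hn'⟩
    refine ⟨max n n', fun m hm => ?_⟩
    rw [Pi.add_apply, hn m (le_trans (le_max_left _ _) hm), hn' m (le_trans (le_max_right _ _) hm), add_zero]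
  zero_mem' := ⟨0, fun _ _ => rfl⟩
  smul_mem' r f := by
    rintro ⟨n, hn⟩
    exact ⟨n, fun m hm => by rw [Pi.smul_apply, hn m hm, smul_zero]⟩

namespace Lau

variable (k V) in
/-- Multiplication by `z`. -/
def z : Module.End k (Lau k V) where
  toFun f := ⟨fun m => f.1 (m - 1), by
    obtain ⟨n, hn⟩ := f.2
    exact ⟨n + 1, fun m hm => hn _ (by omega)⟩⟩
  map_add' _ _ := rfl
  map_smul' _ _ := rfl

variable (k V) in
/-- The coefficientwise action of the endomorphisms of `V`. -/
def ext : Module.End k V →ₐ[k] Module.End k (Lau k V) where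
  toFun a :=
    { toFun f := ⟨fun m => a (f.1 m), by
        obtain ⟨n, hn⟩ := f.2
        exact ⟨n, fun m hm => (congrArg a (hn m hm)).trans (map_zero a)⟩⟩
      map_add' f g := Subtype.ext (funext fun m => map_add a _ _)
      map_smul' r f := Subtype.ext (funext fun m => map_smul a _ _) }
  map_one' := rfl
  map_mul' _ _ := rfl
  map_zero' := rfl
  map_add' _ _ := rfl
  commutes' _ := rfl

theorem z_ext (a : Module.End k V) : z k V * ext k V a = ext k V a * z k V := rfl

theorem z_add_ext_injective (a : Module.End k V) : Function.Injective (z k V + ext k V a) := by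
  rw [← LinearMap.ker_eq_bot, LinearMap.ker_eq_bot']
  intro f hf
  obtain ⟨n, hn⟩ := f.2
  have h : ∀ m, f.1 (m - 1) + a (f.1 m) = 0 := fun m => congrFun (congrArg Subtype.val hf) m
  have h' : ∀ j : ℕ, f.1 (n - j) = 0 := by
    intro j
    induction j with
    | zero => exact hn _ (by simp)
    | succ j ih =>
      have := h (n - j)
      rw [ih, map_zero, add_zero] at this
      rw [← this, sub_sub, Nat.cast_succ]
  refine Subtype.ext (funext fun m => ?_)
  by_cases hm : n ≤ m
  · exact hn m hm
  · have := h' (n - m).toNat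
    rwa [Int.toNat_of_nonneg (by omega), sub_sub_cancel] at this

theorem z_add_ext_surjective (a : Module.End k V) : Function.Surjective (z k V + ext k V a) := by
  intro g
  obtain ⟨n, hn⟩ := g.2
  let F : ℕ → V := fun j => Nat.rec 0 (fun j v => g.1 (n - 1 - j) - a v) j
  refine ⟨⟨fun m => F (n - 1 - m).toNat, n - 1, fun m hm => ?_⟩, Subtype.ext (funext fun m => ?_)⟩
  · change F (n - 1 - m).toNat = 0
    rw [Int.toNat_of_nonpos (by omega)]
    rfl
  · change F (n - 1 - (m - 1)).toNat + a (F (n - 1 - m).toNat) = g.1 m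
    by_cases hm : n ≤ m
    · rw [hn m hm, Int.toNat_of_nonpos (by omega), Int.toNat_of_nonpos (by omega)]
      exact (zero_add _).trans (map_zero a)
    · have h1 : (n - 1 - (m - 1)).toNat = (n - 1 - m).toNat + 1 := by omega
      rw [h1]
      change g.1 (n - 1 - ((n - 1 - m).toNat : ℤ)) - a (F (n - 1 - m).toNat) + _ = _
      rw [sub_add_cancel, Int.toNat_of_nonneg (by omega), sub_sub_cancel]

/-- The inverse of `z + a`. -/
def inv (a : Module.End k V) : Module.End k (Lau k V) :=
  (LinearEquiv.ofBijective (z k V + ext k V a) ⟨z_add_ext_injective a, z_add_ext_surjective a⟩).symm.toLinearMap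

theorem mul_inv (a : Module.End k V) : (z k V + ext k V a) * inv a = 1 :=
  LinearMap.ext fun x => LinearEquiv.apply_symm_apply
    (LinearEquiv.ofBijective (z k V + ext k V a) ⟨z_add_ext_injective a, z_add_ext_surjective a⟩) x

theorem inv_mul (a : Module.End k V) : inv a * (z k V + ext k V a) = 1 :=
  LinearMap.ext fun x => LinearEquiv.symm_apply_apply
    (LinearEquiv.ofBijective (z k V + ext k V a) ⟨z_add_ext_injective a, z_add_ext_surjective a⟩) x

variable (k V) in
/-- The coefficient of `z^n` of an element of `V[z]`. -/
def coeff (n : ℕ) : Aff k V →ₗ[k] V :=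
  TensorProduct.lift ((LinearMap.lsmul k V).comp (Polynomial.lcoeff k n))

theorem coeff_tmul (n : ℕ) (p : Polynomial k) (v : V) : coeff k V n (p ⊗ₜ v) = p.coeff n • v := rfl

theorem exists_bound (t : Aff k V) : ∃ n, ∀ m, n ≤ m → coeff k V m t = 0 := by
  induction t using TensorProduct.induction_on with
  | zero => exact ⟨0, fun _ _ => map_zero _⟩
  | tmul p v =>
    refine ⟨p.natDegree + 1, fun m hm => ?_⟩
    rw [coeff_tmul, Polynomial.coeff_eq_zero_of_natDegree_lt (by omega), zero_smul]
  | add a b iha ihb =>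
    obtain ⟨n, hn⟩ := iha
    obtain ⟨n', hn'⟩ := ihb
    refine ⟨max n n', fun m hm => ?_⟩
    rw [map_add, hn m (le_trans (le_max_left _ _) hm), hn' m (le_trans (le_max_right _ _) hm), add_zero]

theorem sum_coeff {t : Aff k V} {n : ℕ} (h : ∀ m, n ≤ m → coeff k V m t = 0) :
    t = ∑ m ∈ Finset.range n, Aff.tmul (Polynomial.X ^ m) (coeff k V m t) := by
  have key : ∀ t : Aff k V, ∃ N, ∀ n, N ≤ n → t = ∑ m ∈ Finset.range n, Aff.tmul (Polynomial.X ^ m) (coeff k V m t) := by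
    intro t
    induction t using TensorProduct.induction_on with
    | zero => exact ⟨0, fun _ _ => by simp⟩
    | tmul p v =>
      refine ⟨p.natDegree + 1, fun n hn => ?_⟩
      conv_lhs => rw [p.as_sum_range' n (by omega)]
      rw [TensorProduct.sum_tmul]
      refine Finset.sum_congr rfl fun m _ => ?_
      rw [coeff_tmul, ← Polynomial.smul_X_eq_monomial, TensorProduct.smul_tmul]
    | add a b iha ihb =>
      obtain ⟨n, hn⟩ := iha
      obtain ⟨n', hn'⟩ := ihb
      refine ⟨max n n', fun m hm => ?_⟩
      simp only [map_add, TensorProduct.tmul_add, Finset.sum_add_distrib]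
      rw [← hn m (le_trans (le_max_left _ _) hm), ← hn' m (le_trans (le_max_right _ _) hm)]
  obtain ⟨N, hN⟩ := key t
  conv_lhs => rw [hN (max N n) (le_max_left _ _)]
  refine (Finset.sum_subset (Finset.range_subset_range.2 (le_max_right _ _)) fun m _ hm => ?_).symm
  rw [h m (by simpa using hm), Aff.tmul, TensorProduct.tmul_zero]

theorem ext_coeff {t t' : Aff k V} (h : ∀ n, coeff k V n t = coeff k V n t') : t = t' := by
  obtain ⟨n, hn⟩ := exists_bound t
  rw [sum_coeff hn, sum_coeff (t := t') (n := n) fun m hm => by rw [← h, hn m hm]]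
  exact Finset.sum_congr rfl fun m _ => by rw [h]

theorem coeff_z (n : ℕ) (t : Aff k V) : coeff k V (n + 1) (Aff.z V t) = coeff k V n t :=
  LinearMap.congr_fun (f := coeff k V (n + 1) ∘ₗ Aff.z V) (g := coeff k V n)
    (Aff.hom_ext fun p u => by simp [Aff.z_tmul, coeff_tmul]) t

theorem coeff_zero_z (t : Aff k V) : coeff k V 0 (Aff.z V t) = 0 :=
  LinearMap.congr_fun (f := coeff k V 0 ∘ₗ Aff.z V) (g := 0)
    (Aff.hom_ext fun p u => by simp [Aff.z_tmul, coeff_tmul]) t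

theorem coeff_ext (n : ℕ) (a : Module.End k V) (t : Aff k V) :
    coeff k V n (Aff.ext V a t) = a (coeff k V n t) :=
  LinearMap.congr_fun (f := coeff k V n ∘ₗ Aff.ext V a) (g := a ∘ₗ coeff k V n)
    (Aff.hom_ext fun p u => by simp [Aff.ext_tmul, coeff_tmul]) t

theorem Aff_z_injective : Function.Injective (Aff.z V : Aff k V → Aff k V) := by
  intro t t' h
  refine ext_coeff fun n => ?_
  rw [← coeff_z, h, coeff_z]

theorem coeff_z_pow {n a : ℕ} (h : n < a) (t : Aff k V) : coeff k V n ((Aff.z V ^ a) t) = 0 := by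
  induction a generalizing n t with
  | zero => omega
  | succ a ih =>
    rw [pow_succ', Module.End.mul_apply]
    cases n with
    | zero => exact coeff_zero_z _
    | succ n => rw [coeff_z]; exact ih (by omega) t

theorem Aff_z_separated {t : Aff k V} (h : ∀ a, t ∈ LinearMap.range (Aff.z V ^ a)) : t = 0 := by
  refine ext_coeff fun n => ?_
  obtain ⟨s, rfl⟩ := h (n + 1)
  rw [coeff_z_pow (Nat.lt_succ_self n), map_zero]

variable (k V) in
/-- The inclusion of `V[z]` in `V((z⁻¹))`. -/
def ofAff : Aff k V →ₗ[k] Lau k V where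
  toFun t := ⟨fun m => if 0 ≤ m then coeff k V m.toNat t else 0, by
    obtain ⟨n, hn⟩ := exists_bound t
    refine ⟨n, fun m hm => ?_⟩
    exact (if_pos (by omega : (0 : ℤ) ≤ m)).trans (hn _ (by omega))⟩
  map_add' a b := Subtype.ext (funext fun m => by
    simp only [Submodule.coe_add, Pi.add_apply]
    split_ifs
    · exact map_add _ _ _
    · rw [add_zero])
  map_smul' r b := Subtype.ext (funext fun m => by
    simp only [RingHom.id_apply, Submodule.coe_smul, Pi.smul_apply]
    split_ifs
    · exact map_smul _ _ _
    · rw [smul_zero])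

theorem ofAff_injective : Function.Injective (ofAff k V) := by
  intro t t' h
  refine ext_coeff fun n => ?_
  have := congrFun (congrArg Subtype.val h) (n : ℤ)
  simpa [ofAff] using this

theorem ofAff_z (t : Aff k V) : ofAff k V (Aff.z V t) = z k V (ofAff k V t) := by
  refine Subtype.ext (funext fun m => ?_)
  change (if _ then _ else _) = (if _ then _ else _)
  rcases lt_trichotomy m 0 with h | rfl | h
  · rw [if_neg (by omega), if_neg (by omega)]
  · rw [if_pos le_rfl, if_neg (by omega)]
    exact coeff_zero_z t
  · rw [if_pos h.le, if_pos (by omega), show m.toNat = (m - 1).toNat + 1 by omega, coeff_z]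

theorem ofAff_ext (a : Module.End k V) (t : Aff k V) :
    ofAff k V (Aff.ext V a t) = ext k V a (ofAff k V t) := by
  refine Subtype.ext (funext fun m => ?_)
  change (if _ then _ else _) = a (if _ then _ else _)
  split_ifs
  · exact coeff_ext _ _ _
  · exact (map_zero a).symm

end Lau

end Laurent

section LaurentPairs

variable {k : Type u} [Field k] {I : Type v} {D : Datum k I} {β₁ β₂ β : I →₀ ℕ}
  {V : Type w} [AddCommGroup V] [Module k V]

variable (A : KMod.{u, v, w₁} D β₁) (B : KMod.{u, v, w₂} D β₂)

/-- The action of `R_{β₁}` on `A ⊗ B`. -/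
def KMod.actL : KLR D β₁ →ₐ[k] Module.End k (A.V ⊗[k] B.V) :=
  (Module.End.rTensorAlgHom k A.V B.V).comp (Algebra.lsmul k k A.V)

/-- The action of `R_{β₂}` on `A ⊗ B`. -/
def KMod.actR : KLR D β₂ →ₐ[k] Module.End k (A.V ⊗[k] B.V) :=
  (Module.End.lTensorAlgHom k B.V A.V).comp (Algebra.lsmul k k B.V)

theorem KMod.actL_actR (a b) : KMod.actL A B a * KMod.actR A B b = KMod.actR A B b * KMod.actL A B a :=
  TensorProduct.ext' fun _ _ => rfl

/-- A map to a module over the endomorphisms of a space that intertwines the generators intertwines. -/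
theorem KMod.intertwine_of_gen {E : Type w} [AddCommGroup E] [Module k E] (f : A.V →ₗ[k] E)
    (ρ : KLR D β₁ →ₐ[k] Module.End k E) (h : ∀ g u, f (KLR.gen D g • u) = ρ (KLR.gen D g) (f u)) (a : KLR D β₁) :
    ∀ u, f (a • u) = ρ a (f u) := by
  induction a using KLR.induction with
  | h0 r => intro u; rw [algebraMap_smul, map_smul, AlgHom.commutes]; rfl
  | hg g => exact h g
  | hm a b iha ihb => intro u; rw [mul_smul, iha, ihb, map_mul]; rfl
  | ha a b iha ihb => intro u; rw [add_smul, map_add, iha, ihb, map_add]; rfl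

theorem KMod.leftComm_ext (a : Module.End k B.V) (u : A.V) (v : Aff k B.V) :
    TensorProduct.leftComm k A.V (Polynomial k) B.V (u ⊗ₜ Aff.ext B.V a v) =
      Aff.ext _ (Module.End.lTensorAlgHom k B.V A.V a)
        (TensorProduct.leftComm k A.V (Polynomial k) B.V (u ⊗ₜ v)) := by
  induction v using TensorProduct.induction_on with
  | zero => simp
  | tmul p v => rfl
  | add a b iha ihb => simp only [TensorProduct.tmul_add, map_add, iha, ihb]

theorem KMod.leftComm_z (u : A.V) (v : Aff k B.V) :
    TensorProduct.leftComm k A.V (Polynomial k) B.V (u ⊗ₜ Aff.z B.V v) =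
      Aff.z _ (TensorProduct.leftComm k A.V (Polynomial k) B.V (u ⊗ₜ v)) := by
  induction v using TensorProduct.induction_on with
  | zero => simp
  | tmul p v => rfl
  | add a b iha ihb => simp only [TensorProduct.tmul_add, map_add, iha, ihb]

theorem KMod.leftComm_smul (a : KLR D β₁) (u : A.V) (v : Aff k B.V) :
    TensorProduct.leftComm k A.V (Polynomial k) B.V ((a • u) ⊗ₜ v) =
      Aff.ext _ (KMod.actL A B a)
        (TensorProduct.leftComm k A.V (Polynomial k) B.V (u ⊗ₜ v)) := by
  induction v using TensorProduct.induction_on with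
  | zero => simp
  | tmul p v => rfl
  | add a b iha ihb => simp only [TensorProduct.tmul_add, map_add, iha, ihb]

theorem KMod.assoc_ext (a : Module.End k A.V) (u : Aff k A.V) (v : B.V) :
    TensorProduct.assoc k (Polynomial k) A.V B.V (Aff.ext A.V a u ⊗ₜ v) =
      Aff.ext _ (Module.End.rTensorAlgHom k A.V B.V a)
        (TensorProduct.assoc k (Polynomial k) A.V B.V (u ⊗ₜ v)) := by
  induction u using TensorProduct.induction_on with
  | zero => simp
  | tmul p v => rfl
  | add a b iha ihb => simp only [TensorProduct.add_tmul, map_add, iha, ihb]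

theorem KMod.assoc_z (u : Aff k A.V) (v : B.V) :
    TensorProduct.assoc k (Polynomial k) A.V B.V (Aff.z A.V u ⊗ₜ v) =
      Aff.z _ (TensorProduct.assoc k (Polynomial k) A.V B.V (u ⊗ₜ v)) := by
  induction u using TensorProduct.induction_on with
  | zero => simp
  | tmul p v => rfl
  | add a b iha ihb => simp only [TensorProduct.add_tmul, map_add, iha, ihb]

theorem KMod.assoc_smul (a : KLR D β₂) (u : Aff k A.V) (v : B.V) :
    TensorProduct.assoc k (Polynomial k) A.V B.V (u ⊗ₜ (a • v)) =
      Aff.ext _ (KMod.actR A B a)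
        (TensorProduct.assoc k (Polynomial k) A.V B.V (u ⊗ₜ v)) := by
  induction u using TensorProduct.induction_on with
  | zero => simp
  | tmul p v => rfl
  | add a b iha ihb => simp only [TensorProduct.add_tmul, map_add, iha, ihb]

variable [D.IsSymmetric]

/-- The action on `V((z⁻¹))` obtained from an action on `V` by the shift by `z`. -/
def Lau.shift (R : KLR D β₂ →ₐ[k] Module.End k V) : KLR D β₂ →ₐ[k] Module.End k (Lau k V) :=
  KLR.shift ((Lau.ext k V).comp R) (z := Lau.z k V) fun _ => Lau.z_ext _

theorem Lau.shift_gen (R : KLR D β₂ →ₐ[k] Module.End k V) (g : GenR β₂) :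
    Lau.shift R (KLR.gen D g) = KLR.shiftGen ((Lau.ext k V).comp R) (Lau.z k V) g :=
  KLR.shift_gen _ _ g

theorem Lau.ext_shift (L : KLR D β₁ →ₐ[k] Module.End k V) (R : KLR D β₂ →ₐ[k] Module.End k V)
    (hc : ∀ a b, L a * R b = R b * L a) (a : KLR D β₁) (b : KLR D β₂) :
    Lau.ext k V (L a) * Lau.shift R b = Lau.shift R b * Lau.ext k V (L a) := by
  have h : b ∈ (Subalgebra.centralizer k {Lau.ext k V (L a)}).comap (Lau.shift R) := by
    refine KLR.mem_subalgebra _ (fun g => ?_) b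
    rw [Subalgebra.mem_comap, Subalgebra.mem_centralizer_iff, Lau.shift_gen]
    rintro _ rfl
    have h1 : ∀ b, Lau.ext k V (L a) * Lau.ext k V (R b) = Lau.ext k V (R b) * Lau.ext k V (L a) :=
      fun b => by rw [← map_mul, hc, map_mul]
    cases g with
    | e ν => exact h1 _
    | s a => exact h1 _
    | x p => exact (mul_add _ _ _).trans ((congrArg₂ _ (h1 _) (Lau.z_ext _).symm).trans (add_mul _ _ _).symm)
  exact (Subalgebra.mem_centralizer_iff k).1 h _ rfl

theorem Lau.ext_sub_shift (L : KLR D β₁ →ₐ[k] Module.End k V) (R : KLR D β₂ →ₐ[k] Module.End k V) (i j) :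
    Lau.ext k V (L (KLR.x D i)) - Lau.shift R (KLR.x D j) =
      -(Lau.z k V + Lau.ext k V (R (KLR.x D j) - L (KLR.x D i))) := by
  have : Lau.shift R (KLR.x D j) = Lau.ext k V (R (KLR.x D j)) + Lau.z k V := Lau.shift_gen _ _
  rw [this, map_sub]
  abel

theorem Lau.neg_mul_neg {a b : Module.End k (Lau k V)} (h : a * b = 1) : -a * -b = 1 := by
  refine LinearMap.ext fun f => ?_
  change -(a (-(b f))) = f
  rw [map_neg, neg_neg]
  exact LinearMap.congr_fun h f

/-- The actions on `V((z⁻¹))` obtained from commuting actions on `V` by the shift of the second one by `z`. -/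
def Lau.pair (L : KLR D β₁ →ₐ[k] Module.End k V) (R : KLR D β₂ →ₐ[k] Module.End k V)
    (hc : ∀ a b, L a * R b = R b * L a) : Pair D β₁ β₂ (Module.End k (Lau k V)) where
  L := (Lau.ext k V).comp L
  R := Lau.shift R
  comm := Lau.ext_shift L R hc
  d i j := -Lau.inv (R (KLR.x D j) - L (KLR.x D i))
  d_mul i j := by rw [AlgHom.comp_apply, Lau.ext_sub_shift]; exact Lau.neg_mul_neg (Lau.inv_mul _)
  mul_d i j := by rw [AlgHom.comp_apply, Lau.ext_sub_shift]; exact Lau.neg_mul_neg (Lau.mul_inv _)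

/-- `A ⊗ B[z] → (A ⊗ B)((z⁻¹))`. -/
def KMod.ofAffRight : A.V ⊗[k] B.aff.V →ₗ[k] Lau k (A.V ⊗[k] B.V) :=
  Lau.ofAff k _ ∘ₗ (TensorProduct.leftComm k A.V (Polynomial k) B.V).toLinearMap

/-- `A[z] ⊗ B → (A ⊗ B)((z⁻¹))`. -/
def KMod.ofAffLeft : A.aff.V ⊗[k] B.V →ₗ[k] Lau k (A.V ⊗[k] B.V) :=
  Lau.ofAff k _ ∘ₗ (TensorProduct.assoc k (Polynomial k) A.V B.V).toLinearMap

/-- The model of `A ⊗ B[z]`. -/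
def Model.affRight : Model A B.aff (Lau k (A.V ⊗[k] B.V)) where
  P := Lau.pair (KMod.actL A B) (KMod.actR A B) (KMod.actL_actR A B)
  ξ := KMod.ofAffRight A B
  inj := Lau.ofAff_injective.comp (LinearEquiv.injective _)
  mapL a u v := (congrArg (Lau.ofAff k _) (KMod.leftComm_smul A B a u v)).trans (Lau.ofAff_ext _ _)
  mapR a u v := by
    refine KMod.intertwine_of_gen B.aff (KMod.ofAffRight A B ∘ₗ TensorProduct.mk k A.V B.aff.V u)
      (Lau.shift (KMod.actR A B)) (fun g v => ?_) a v
    have h1 : ∀ b : KLR D β₂, KMod.ofAffRight A B (u ⊗ₜ (B.affExt b v : Aff k B.V)) =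
        Lau.ext k _ (KMod.actR A B b) (KMod.ofAffRight A B (u ⊗ₜ v)) := fun b =>
      (congrArg (Lau.ofAff k _) (KMod.leftComm_ext A B _ u v)).trans (Lau.ofAff_ext _ _)
    rw [KMod.aff_gen_smul, Lau.shift_gen]
    cases g with
    | e ν => exact h1 _
    | s a => exact h1 _
    | x p =>
      refine (map_add _ _ _).trans (congrArg₂ (· + ·) (h1 _) ?_)
      exact (congrArg (Lau.ofAff k _) (KMod.leftComm_z A B u v)).trans (Lau.ofAff_z _)

/-- The model of `A[z] ⊗ B`. -/
def Model.affLeft : Model A.aff B (Lau k (A.V ⊗[k] B.V)) where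
  P := (Lau.pair (KMod.actR A B) (KMod.actL A B) fun a b => (KMod.actL_actR A B b a).symm).flip
  ξ := KMod.ofAffLeft A B
  inj := Lau.ofAff_injective.comp (LinearEquiv.injective _)
  mapL a u v := by
    refine KMod.intertwine_of_gen A.aff (KMod.ofAffLeft A B ∘ₗ (TensorProduct.mk k A.aff.V B.V).flip v)
      (Lau.shift (KMod.actL A B)) (fun g u => ?_) a u
    have h1 : ∀ b : KLR D β₁, KMod.ofAffLeft A B ((A.affExt b u : Aff k A.V) ⊗ₜ v) =
        Lau.ext k _ (KMod.actL A B b) (KMod.ofAffLeft A B (u ⊗ₜ v)) := fun b =>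
      (congrArg (Lau.ofAff k _) (KMod.assoc_ext A B _ u v)).trans (Lau.ofAff_ext _ _)
    rw [KMod.aff_gen_smul, Lau.shift_gen]
    cases g with
    | e ν => exact h1 _
    | s a => exact h1 _
    | x p =>
      refine (map_add _ _ _).trans (congrArg₂ (· + ·) (h1 _) ?_)
      exact (congrArg (Lau.ofAff k _) (KMod.assoc_z A B u v)).trans (Lau.ofAff_z _)
  mapR a u v := (congrArg (Lau.ofAff k _) (KMod.assoc_smul A B a u v)).trans (Lau.ofAff_ext _ _)

end LaurentPairs

/-! ### The R-matrices of `R`-modules -/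

section Words

theorem ofFn_prod_smul_induct {G X : Type*} [Monoid G] [MulAction G X] {n : ℕ} (f : Fin n → G)
    (P : ℕ → X → Prop) (h : ∀ (i : Fin n) x, P (i + 1) x → P i (f i • x)) {x : X} (hx : P n x) :
    P 0 ((List.ofFn f).prod • x) := by
  induction n generalizing P with
  | zero => simpa using hx
  | succ n ih =>
    rw [List.ofFn_succ, List.prod_cons, mul_smul]
    exact h 0 _ (ih (fun i => f i.succ) (fun i => P (i + 1)) (fun i x hx => h i.succ x hx) hx)

variable {I : Type v} {β₁ β₂ β : I →₀ ℕ}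

theorem wordProd_smul_induct {G X : Type*} [Monoid G] [MulAction G X] (h : β₁ + β₂ = β)
    (φ : Fin (ht β - 1) → G) (P : ℕ → ℕ → X → Prop)
    (carry : ∀ (i : Fin (ht β₁)) x, P (i + 1) (ht β₂) x → P i 0 x)
    (step : ∀ (i : Fin (ht β₁)) (j : Fin (ht β₂)) (a : Fin (ht β - 1)) x, (a : ℕ) = i + j → P i j x →
      P i (j + 1) (φ a • x)) {x : X} (hx : P (ht β₁) (ht β₂) x) : P 0 (ht β₂) (wordProd h φ • x) := by
  refine ofFn_prod_smul_induct _ (fun i => P i (ht β₂)) (fun i x hx => ?_) hx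
  refine ofFn_prod_smul_induct _ (fun j => P i (ht β₂ - j)) (fun j x hx => ?_) ?_
  · have h1 : ht β₂ - (j + 1) = ht β₂ - 1 - j := by omega
    have h2 : ht β₂ - j = ht β₂ - 1 - j + 1 := by omega
    simp only [h2]
    exact step i ⟨ht β₂ - 1 - j, by omega⟩ _ x rfl (h1 ▸ hx)
  · rw [Nat.sub_self]
    exact carry i x hx

/-- The shuffles that occur along the reduced expression for the exchange of the two factors: the strand `i`
of the first factor has crossed `j` strands of the second one. -/
def Shuffle.At {n₁ n₂ N : ℕ} (i j : ℕ) (w : Shuffle n₁ n₂ N) : Prop :=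
  (∀ p : Fin n₁, (w.equiv.symm (.inl p) : ℕ) = if (p : ℕ) < i then (p : ℕ) else if (p : ℕ) = i then p + j else p + n₂) ∧
  ∀ q : Fin n₂, (w.equiv.symm (.inr q) : ℕ) = if (q : ℕ) < j then (q : ℕ) + i else q + i + 1

namespace Shuffle.At

variable {n₁ n₂ N : ℕ} {w : Shuffle n₁ n₂ N}

theorem carry {i : ℕ} (h : At (i + 1) n₂ w) : At i 0 w := by
  refine ⟨fun p => (h.1 p).trans ?_, fun q => (h.2 q).trans ?_⟩
  · split_ifs <;> omega
  · rw [if_pos q.2, if_neg (by omega)]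
    omega

theorem base (h : n₁ + n₂ = N) : At n₁ n₂ (Shuffle.base h) := by
  refine ⟨fun p => ?_, fun q => ?_⟩
  · rw [if_pos p.2, ← Shuffle.base_left h p (by omega), Equiv.symm_apply_apply]
  · rw [if_pos q.2, ← Shuffle.base_right h q (by omega), Equiv.symm_apply_apply]
    exact add_comm _ _

theorem lo_eq {i : Fin n₁} {j : Fin n₂} (h : At i j w) {a : Fin (N - 1)} (ha : (a : ℕ) = i + j) :
    w.equiv (lo a) = .inl i := by
  rw [← Equiv.eq_symm_apply]
  refine Fin.ext ?_
  rw [h.1]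
  simp [lo, ha]

theorem hi_eq {i : Fin n₁} {j : Fin n₂} (h : At i j w) {a : Fin (N - 1)} (ha : (a : ℕ) = i + j) :
    w.equiv (hi a) = .inr j := by
  rw [← Equiv.eq_symm_apply]
  refine Fin.ext ?_
  rw [h.2]
  simp [hi, ha]
  omega

theorem step {i : Fin n₁} {j : Fin n₂} (h : At i j w) {a : Fin (N - 1)} (ha : (a : ℕ) = i + j) :
    At i (j + 1) (w.sw a) := by
  have hm := Shuffle.mixed_LR (h.lo_eq ha) (h.hi_eq ha)
  have key : ∀ s, (w.sw a).equiv.symm s = Equiv.swap (lo a) (hi a) (w.equiv.symm s) := by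
    intro s
    rw [Shuffle.sw_equiv hm]
    simp
  refine ⟨fun p => ?_, fun q => ?_⟩
  · rw [key]
    by_cases hp : p = i
    · subst hp
      rw [← h.lo_eq ha, Equiv.symm_apply_apply, Equiv.swap_apply_left]
      simp [hi, ha, add_assoc]
    · have hp' : (p : ℕ) ≠ i := fun h => hp (Fin.ext h)
      rw [Equiv.swap_apply_of_ne_of_ne, h.1, if_neg hp', if_neg hp']
      · rw [Ne, Equiv.symm_apply_eq, h.lo_eq ha]
        exact fun h => hp (Sum.inl_injective h)
      · rw [Ne, Equiv.symm_apply_eq, h.hi_eq ha]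
        exact Sum.inl_ne_inr
  · rw [key]
    by_cases hq : q = j
    · subst hq
      rw [← h.hi_eq ha, Equiv.symm_apply_apply, Equiv.swap_apply_right]
      simp [lo, ha, add_comm]
    · have hq' : (q : ℕ) ≠ j := fun h => hq (Fin.ext h)
      rw [Equiv.swap_apply_of_ne_of_ne, h.2]
      · split_ifs <;> omega
      · rw [Ne, Equiv.symm_apply_eq, h.lo_eq ha]
        exact Sum.inr_ne_inl
      · rw [Ne, Equiv.symm_apply_eq, h.hi_eq ha]
        exact fun h => hq (Sum.inr_injective h)

end Shuffle.At

end Words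

section RMatrixKLR

variable {k : Type u} [Field k] {I : Type v} {D : Datum k I} {β₁ β₂ β : I →₀ ℕ}

theorem ISeq.append_inL (h : β₁ + β₂ = β) (ν : ISeq β₁) (η : ISeq β₂) (p : Fin (ht β₁)) :
    (ISeq.append h ν η).seq (inL h p) = ν.seq p := by
  have := congrFun (append_comp_base h ν η) (.inl p)
  rwa [Function.comp_apply, ← base_lo_left h, Equiv.symm_apply_apply, base_lo_left] at this

theorem ISeq.append_inR (h : β₁ + β₂ = β) (ν : ISeq β₁) (η : ISeq β₂) (p : Fin (ht β₂)) :
    (ISeq.append h ν η).seq (inR h p) = η.seq p := by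
  have := congrFun (append_comp_base h ν η) (.inr p)
  rwa [Function.comp_apply, ← base_lo_right h, Equiv.symm_apply_apply, base_lo_right] at this

theorem KLR.phi_mul_e (a : Fin (ht β - 1)) (ν : ISeq β) [Decidable (ν.seq (lo a) ≠ ν.seq (hi a))] :
    KLR.phi D a * KLR.e D ν = (if ν.seq (lo a) ≠ ν.seq (hi a) then KLR.s D a
      else KLR.s D a * KLR.x D (lo a) - KLR.x D (lo a) * KLR.s D a) * KLR.e D ν := by
  classical
  rw [KLR.phi, Finset.sum_mul, Finset.sum_eq_single ν]
  · rw [mul_assoc, KLR.e_mul_self]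
    congr
  · intro μ _ h
    rw [mul_assoc, KLR.e_mul_ne h, mul_zero]
  · simp

section

variable {V : Type w} [AddCommGroup V] [Module k V] (P : Pair D β₁ β₂ (Module.End k V)) (hβ : β₁ + β₂ = β)

theorem Pair.actW_phi {a : Fin (ht β - 1)} {w : Pair.Sh β₁ β₂ β} {i j} (h1 : w.equiv (lo a) = .inl i)
    (h2 : w.equiv (hi a) = .inr j) (v : V) :
    P.actW hβ (KLR.phi D a) (Finsupp.single w v) = Finsupp.single (w.sw a) v := by
  classical
  have key : ∀ (ν : ISeq β₁) (η : ISeq β₂) (v : V),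
      P.actW hβ (KLR.phi D a) (Finsupp.single w (P.eps ν η v)) = Finsupp.single (w.sw a) (P.eps ν η v) := by
    intro ν η v
    let f : Fin (ht β) → I := Sum.elim ν.seq η.seq ∘ w.equiv
    have hf : ∑ p, Finsupp.single (f p) 1 = β := by
      refine (Equiv.sum_comp w.equiv (fun s => (Finsupp.single (Sum.elim ν.seq η.seq s) 1 : I →₀ ℕ))).trans ?_
      rw [Fintype.sum_sum_type]
      exact (congrArg₂ _ ν.sum_eq η.sum_eq).trans hβ
    let μ : ISeq β := ⟨f, hf⟩
    have e1 : Finsupp.single w (P.eps ν η v) =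
        P.actW hβ (KLR.e D μ) (Finsupp.single w (P.eps ν η v)) := by
      rw [KLR.e, P.actW_gen, Pair.genW_e]
      have : μ.seq ∘ w.equiv.symm = Sum.elim ν.seq η.seq := by
        funext s; simp [μ, f]
      rw [this, Pair.col_elim, ← Module.End.mul_apply, Pair.eps_mul_self]
    have hlo : μ.seq (lo a) = ν.seq i := by simp [μ, f, h1]
    have hhi : μ.seq (hi a) = η.seq j := by simp [μ, f, h2]
    conv_lhs => rw [e1]
    rw [← Module.End.mul_apply, ← map_mul, KLR.phi_mul_e, map_mul, Module.End.mul_apply, ← e1]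
    have hδ : P.δ i j (P.eps ν η v) = if ν.seq i = η.seq j then P.eps ν η v else 0 := by
      rw [← Module.End.mul_apply, Pair.δ_mul_eps]
      split_ifs <;> simp
    rw [hlo, hhi]
    by_cases hc : ν.seq i = η.seq j
    · rw [if_neg (not_not.2 hc), map_sub, map_mul, map_mul, KLR.s, KLR.x, P.actW_gen, P.actW_gen, Pair.genW_s,
        LinearMap.sub_apply, Module.End.mul_apply, Module.End.mul_apply, Pair.genW_x, h1]
      rw [if_pos hc] at hδ
      have hm := Shuffle.mixed_LR h1 h2
      rw [Pair.sigma_lr h1 h2, Pair.sigma_lr h1 h2, map_sub, Pair.genW_x, Pair.genW_x, Shuffle.sw_lo hm, h1, h2]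
      generalize P.eps ν η v = v' at hδ ⊢
      have c1 := Pair.apply_eq (P.cen_comm (P.G_mem (.inl i) (.inr j)) (P.X_mem (.inr j))) v'
      have c2 := Pair.apply_eq (P.cen_comm (P.h_mem i j) (P.X_mem (.inl i))) v'
      have c3 := Pair.apply_eq (P.cen_comm (P.G_mem (.inl i) (.inr j)) (P.cen.sub_mem (P.x_mem i) (P.y_mem j))) v'
      have c4 := Pair.apply_eq (P.sub_h i j) v'
      simp only [Module.End.mul_apply, Pair.X, Sum.elim_inl, Sum.elim_inr] at c1 c2 c3 c4
      simp only [Pair.X, Sum.elim_inl, Sum.elim_inr]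
      change Finsupp.single _ (P.G (.inl i) (.inr j) _) - _ -
        (Finsupp.single _ (P.y j (P.G (.inl i) (.inr j) v')) - _) = _
      rw [← c1, c2]
      rw [sub_sub_sub_cancel_right, ← Finsupp.single_sub, ← map_sub]
      have c5 : P.G (.inl i) (.inr j) v' = P.h i j v' := by
        change v' - P.δ i j v' + P.h i j v' = _
        rw [hδ, sub_self, zero_add]
      rw [c5, LinearMap.sub_apply] at c3
      rw [c3, c4, hδ]
    · rw [if_pos hc, KLR.s, P.actW_gen, Pair.genW_s, Pair.sigma_lr h1 h2]
      rw [if_neg hc] at hδ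
      have hh : P.h i j (P.eps ν η v) = 0 := by
        rw [Pair.h, P.cen_comm (P.δ_mem i j) (P.d_mem i j), Module.End.mul_apply, hδ, map_zero]
      rw [hh, Finsupp.single_zero, sub_zero]
      change Finsupp.single _ (_ - P.δ i j _ + P.h i j _) = _
      rw [hδ, hh, sub_zero, add_zero]
      rfl
  have hv : v = ∑ ν, ∑ η, P.eps ν η v := by
    conv_lhs => rw [← Module.End.one_apply (R := k) v, ← P.sum_eps]
    simp only [LinearMap.sum_apply]
  rw [hv]
  simp only [← Finsupp.lsingle_apply (R := k), map_sum]
  simp only [Finsupp.lsingle_apply, key]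

/-- The image of the base shuffle under the intertwiner that exchanges the two factors. -/
theorem Pair.actW_wordProd : ∃ w : Pair.Sh β₁ β₂ β, (∀ p, w.equiv.symm (.inl p) = (⟨p + ht β₂, by
      have := ht_add hβ; omega⟩ : Fin (ht β))) ∧
      (∀ q, w.equiv.symm (.inr q) = (⟨q, by have := ht_add hβ; omega⟩ : Fin (ht β))) ∧
      ∀ v, P.actW hβ (wordProd hβ (KLR.phi D)) (Finsupp.single (Shuffle.base (ht_add hβ)) v) =
        Finsupp.single w v := by
  have := wordProd_smul_induct (G := KLR D β) (X := KLR D β) hβ (KLR.phi D)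
    (fun i j b => ∃ w : Pair.Sh β₁ β₂ β, Shuffle.At i j w ∧ ∀ v,
      P.actW hβ b (Finsupp.single (Shuffle.base (ht_add hβ)) v) = Finsupp.single w v)
    (fun i x ⟨w, hw, h⟩ => ⟨w, hw.carry, h⟩)
    (fun i j a x ha ⟨w, hw, h⟩ => ⟨w.sw a, hw.step ha, fun v => by
      rw [smul_eq_mul, map_mul, Module.End.mul_apply, h, P.actW_phi hβ (hw.lo_eq ha) (hw.hi_eq ha)]⟩)
    (x := 1) ⟨_, Shuffle.At.base _, fun v => by rw [map_one]; rfl⟩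
  obtain ⟨w, hw, h⟩ := this
  refine ⟨w, fun p => Fin.ext ?_, fun q => Fin.ext ?_, fun v => by simpa using h v⟩
  · rw [hw.1]
    simp only [not_lt_zero, if_false]
    split_ifs <;> rfl
  · rw [hw.2, if_pos q.2]
    rfl

theorem genW_e_append (h₁₂ : β₂ + β₁ = β) {w : Pair.Sh β₁ β₂ β}
    (hL : ∀ p, w.equiv.symm (.inl p) = inR h₁₂ p) (hR : ∀ q, w.equiv.symm (.inr q) = inL h₁₂ q)
    (ν : ISeq β₂) (η : ISeq β₁) (v : V) :
    P.genW β (.e (ISeq.append h₁₂ ν η)) (Finsupp.single w v) = Finsupp.single w (P.eps η ν v) := by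
  rw [Pair.genW_e]
  have : (ISeq.append h₁₂ ν η).seq ∘ w.equiv.symm = Sum.elim η.seq ν.seq := by
    funext s
    rcases s with p | q
    · rw [Function.comp_apply, hL, ISeq.append_inR]; rfl
    · rw [Function.comp_apply, hR, ISeq.append_inL]; rfl
  rw [this, Pair.col_elim]

end

end RMatrixKLR

section Renorm

theorem exists_renormalization {A : Type u} [Ring A] {P : Type w₁} {Q : Type w₂} {P₀ : Type w₃}
    {Q₀ : Type w₄} [AddCommGroup P] [Module A P] [AddCommGroup Q] [Module A Q] [AddCommGroup P₀] [Module A P₀]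
    [AddCommGroup Q₀] [Module A Q₀] {isR : (P →ₗ[A] Q) → Prop} {R : P →ₗ[A] Q} (hR : isR R)
    (hu : ∀ R', isR R' → R' = R) (hne : R ≠ 0) {z : Module.End A Q} (hz : Function.Injective z)
    (hsep : ∀ x, (∀ a, x ∈ LinearMap.range (z ^ a)) → x = 0) {zP : Module.End A P}
    (hzP : ∀ m, R (zP m) = z (R m)) {evP : P →ₗ[A] P₀} (hsurj : Function.Surjective evP)
    (hker : LinearMap.ker evP ≤ LinearMap.range zP) {evQ : Q →ₗ[A] Q₀} (hev : ∀ x, evQ (z x) = 0) :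
    ∃ r ρ, IsRenormalization isR z evP evQ r ρ := by
  have hpow : ∀ a : ℕ, Function.Injective ⇑(z ^ a : Module.End A Q) := fun a => by
    rw [Module.End.coe_pow]; exact hz.iterate a
  have hmono : ∀ a b, a ≤ b → LinearMap.range (z ^ b) ≤ LinearMap.range (z ^ a) := by
    rintro a b hab _ ⟨x, rfl⟩
    exact ⟨(z ^ (b - a)) x, by rw [← Module.End.mul_apply, ← pow_add, Nat.add_sub_cancel' hab]⟩
  obtain ⟨N, hN⟩ : ∃ N, ¬LinearMap.range R ≤ LinearMap.range (z ^ N) := by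
    by_contra! h
    exact hne (LinearMap.ext fun m => hsep _ fun a => h a ⟨m, rfl⟩)
  have hbdd : BddAbove {a : ℕ | LinearMap.range R ≤ LinearMap.range (z ^ a)} := by
    refine ⟨N, fun a ha => ?_⟩
    by_contra! h
    exact hN (ha.trans (hmono _ _ h.le))
  have hnonempty : {a : ℕ | LinearMap.range R ≤ LinearMap.range (z ^ a)}.Nonempty :=
    ⟨0, fun x _ => ⟨x, rfl⟩⟩
  set r := sSup {a : ℕ | LinearMap.range R ≤ LinearMap.range (z ^ a)}
  have hr : LinearMap.range R ≤ LinearMap.range (z ^ r) := Nat.sSup_mem hnonempty hbdd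
  let T : P →ₗ[A] Q := (LinearEquiv.ofInjective (z ^ r) (hpow r)).symm.toLinearMap ∘ₗ
    R.codRestrict (LinearMap.range (z ^ r)) fun m => hr ⟨m, rfl⟩
  have hT : ∀ m, (z ^ r) (T m) = R m := fun m =>
    congrArg Subtype.val ((LinearEquiv.ofInjective (z ^ r) (hpow r)).apply_symm_apply _)
  have hTz : ∀ m, T (zP m) = z (T m) := fun m => hpow r (by
    rw [hT, hzP, ← hT, ← Module.End.mul_apply, ← Module.End.mul_apply, ← pow_succ, ← pow_succ'])
  have hk : LinearMap.ker evP ≤ LinearMap.ker (evQ ∘ₗ T) := by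
    intro m hm
    obtain ⟨m', rfl⟩ := hker hm
    rw [LinearMap.mem_ker, LinearMap.comp_apply, hTz, hev]
  let ρ : P₀ →ₗ[A] Q₀ := (LinearMap.ker evP).liftQ (evQ ∘ₗ T) hk ∘ₗ
    (evP.quotKerEquivOfSurjective hsurj).symm.toLinearMap
  have hρ : ∀ m, ρ (evP m) = evQ (T m) := by
    intro m
    have : (evP.quotKerEquivOfSurjective hsurj).symm (evP m) = Submodule.Quotient.mk m :=
      (LinearEquiv.symm_apply_eq _).2 rfl
    change (LinearMap.ker evP).liftQ (evQ ∘ₗ T) hk ((evP.quotKerEquivOfSurjective hsurj).symm (evP m)) = _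
    rw [this]
    rfl
  refine ⟨r, ρ, R, T, ⟨hR, hu⟩, ⟨hr, fun a ha => le_csSup hbdd ha⟩, ⟨hT, fun T' h => ?_⟩, hρ, fun ρ' h => ?_⟩
  · exact LinearMap.ext fun m => hpow r ((h m).trans (hT m).symm)
  · refine LinearMap.ext fun m => ?_
    obtain ⟨m, rfl⟩ := hsurj m
    rw [h, hρ]

end Renorm

section RMatrixKLR

variable {k : Type u} [Field k] {I : Type v} {D : Datum k I} {β₁ β₂ β : I →₀ ℕ}
  {A : KMod.{u, v, w₁} D β₁} {B : KMod.{u, v, w₂} D β₂} (h₁₂ : β₁ + β₂ = β) (h₂₁ : β₂ + β₁ = β)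

theorem KMod.IsRMatrix.unique {R R' : KMod.conv h₁₂ A B →ₗ[KLR D β] KMod.conv h₂₁ B A}
    (hR : KMod.IsRMatrix h₁₂ h₂₁ A B R) (hR' : KMod.IsRMatrix h₁₂ h₂₁ A B R') : R' = R := by
  refine Ind.hom_ext fun t => ?_
  induction t with
  | zero => simp
  | tmul u v => exact (hR' u v).trans (hR u v).symm
  | add a b iha ihb => rw [map_add, map_add, map_add, iha, ihb]

/-- `u ⊗ v ↦ φ (v ⊗ u)`. -/
def KMod.preR (A : KMod.{u, v, w₁} D β₁) (B : KMod.{u, v, w₂} D β₂) : A.V ⊗[k] B.V →ₗ[k] KMod.conv h₂₁ B A :=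
  Algebra.lsmul k k (KMod.conv h₂₁ B A) (wordProd h₂₁ (KLR.phi D)) ∘ₗ Ind.mk _ ∘ₗ
    (TensorProduct.comm k A.V B.V).toLinearMap

variable {V : Type w} [AddCommGroup V] [Module k V]

theorem KMod.Ψ_preR (Mo : Model B A V) : ∃ w : Pair.Sh β₂ β₁ β,
    (∀ p, w.equiv.symm (.inl p) = inR h₁₂ p) ∧ (∀ q, w.equiv.symm (.inr q) = inL h₁₂ q) ∧
    ∀ u v, Mo.Ψ h₂₁ (KMod.preR h₂₁ A B (u ⊗ₜ v)) =
      (Finsupp.single w (Mo.ξ (v ⊗ₜ u)) : Pair.Sh β₂ β₁ β →₀ V) := by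
  obtain ⟨w, hL, hR, h⟩ := Mo.P.actW_wordProd h₂₁
  refine ⟨w, fun p => (hL p).trans (Fin.ext (add_comm _ _)), hR, fun u v => ?_⟩
  rw [← h]
  change Mo.Ψ h₂₁ (wordProd h₂₁ (KLR.phi D) • Ind.mk _ (v ⊗ₜ u)) = _
  rw [map_smul, Model.Ψ_mk]
  rfl

theorem KMod.exists_isRMatrix (Mo : Model B A V) : ∃ R, KMod.IsRMatrix h₁₂ h₂₁ A B R := by
  obtain ⟨w, hL, hR, h⟩ := KMod.Ψ_preR h₁₂ h₂₁ Mo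
  refine ⟨Ind.lift (KMod.preR h₂₁ A B) fun t ht => Mo.Ψ_injective h₂₁ ?_, fun u v => Ind.lift_mk _ _ _⟩
  have hL' : ∀ q, w.equiv (inL h₁₂ q) = .inr q := fun q => by rw [← hR, Equiv.apply_symm_apply]
  have hR' : ∀ p, w.equiv (inR h₁₂ p) = .inl p := fun p => by rw [← hL, Equiv.apply_symm_apply]
  rw [map_zero]
  cases ht <;>
    refine ((congrArg _ (map_sub (Ind.act (KMod.preR h₂₁ A B)) _ _)).trans (map_sub (Mo.Ψ h₂₁) _ _)).trans
      (sub_eq_zero.2 ?_) <;>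
    rw [Ind.act_tmul, Ind.act_tmul, one_smul, map_smul, h, h] <;>
    refine (Model.W_smul Mo.P h₂₁ _ _).trans ?_
  case e ν η u v =>
    rw [genW_e_append Mo.P h₁₂ hL hR]
    refine congrArg (Finsupp.single w) ?_
    change Mo.P.L (KLR.e D η) (Mo.P.R (KLR.e D ν) _) = _
    rw [← Mo.mapR, ← Mo.mapL]
  case xL p u v =>
    rw [Pair.genW_x, hL']
    exact congrArg (Finsupp.single w) (Mo.mapR _ _ _).symm
  case xR p u v =>
    rw [Pair.genW_x, hR']
    exact congrArg (Finsupp.single w) (Mo.mapL _ _ _).symm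
  case sL a u v =>
    refine (Pair.sigma_rr (c := a) (by rw [lo_crL, hL']) (by rw [hi_crL, hL']) _).trans ?_
    exact congrArg (Finsupp.single w) (Mo.mapR _ _ _).symm
  case sR a u v =>
    refine (Pair.sigma_ll (c := a) (by rw [lo_crR, hR']) (by rw [hi_crR, hR']) _).trans ?_
    exact congrArg (Finsupp.single w) (Mo.mapL _ _ _).symm

theorem tmul_ne_zero {V : Type w₁} [AddCommGroup V] [Module k V] {W : Type w₂} [AddCommGroup W] [Module k W]
    {u : V} {v : W} (hu : u ≠ 0) (hv : v ≠ 0) : u ⊗ₜ[k] v ≠ 0 := by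
  intro h
  obtain ⟨f, hf⟩ := not_forall.1 (mt (Module.forall_dual_apply_eq_zero_iff k u).1 hu)
  obtain ⟨g, hg⟩ := not_forall.1 (mt (Module.forall_dual_apply_eq_zero_iff k v).1 hv)
  have := congrArg (LinearMap.mul' k k ∘ₗ TensorProduct.map f g) h
  rw [map_zero] at this
  exact mul_ne_zero hf hg this

theorem KMod.IsRMatrix.ne_zero (Mo : Model B A V) {R} (hR : KMod.IsRMatrix h₁₂ h₂₁ A B R) {u : A.V} {v : B.V}
    (hu : u ≠ 0) (hv : v ≠ 0) : R ≠ 0 := by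
  obtain ⟨w, -, -, h⟩ := KMod.Ψ_preR h₁₂ h₂₁ Mo
  rintro rfl
  have h1 : KMod.preR h₂₁ A B (u ⊗ₜ v) = 0 := (hR u v).symm
  have h2 := h u v
  rw [h1, map_zero] at h2
  have h3 := Finsupp.single_eq_zero.1 h2.symm
  exact tmul_ne_zero hv hu (Mo.inj (h3.trans (map_zero _).symm))

end RMatrixKLR

/-! ### Renormalized R-matrices of `R`-modules -/

section Specialization

variable {k : Type u} [Field k] {I : Type v} {D : Datum k I} {β₁ β₂ β : I →₀ ℕ}

theorem Aff.exists_sub {V : Type w} [AddCommGroup V] [Module k V] (m : Aff k V) :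
    ∃ c, m - Aff.tmul 1 (Aff.ev V m) = Aff.z V c := by
  induction m using TensorProduct.induction_on with
  | zero => exact ⟨0, by rw [map_zero, map_zero, Aff.tmul, TensorProduct.tmul_zero, sub_zero]⟩
  | tmul p u =>
    refine ⟨Aff.tmul p.divX u, ?_⟩
    rw [Aff.ev_tmul, Aff.z_tmul, Aff.tmul, Aff.tmul, ← TensorProduct.smul_tmul, ← TensorProduct.sub_tmul]
    congr 1
    rw [← Polynomial.coeff_zero_eq_eval_zero, Polynomial.smul_eq_C_mul, mul_one, sub_eq_iff_eq_add,
      Polynomial.X_mul_divX_add]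
  | add a b iha ihb =>
    obtain ⟨c, hc⟩ := iha
    obtain ⟨c', hc'⟩ := ihb
    refine ⟨c + c', ?_⟩
    rw [map_add (Aff.z V) c c', ← hc, ← hc', map_add, Aff.tmul, TensorProduct.tmul_add]
    abel

namespace KMod

theorem convMap_mk (hβ : β₁ + β₂ = β) {A : KMod.{u, v, w₁} D β₁} {A' : KMod.{u, v, w₃} D β₁}
    {B : KMod.{u, v, w₂} D β₂} {B' : KMod.{u, v, w₄} D β₂} (f : A.V →ₗ[KLR D β₁] A'.V)
    (g : B.V →ₗ[KLR D β₂] B'.V) (t : A.V ⊗[k] B.V) :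
    convMap hβ A A' B B' f g (Ind.mk _ t) =
      Ind.mk _ (TensorProduct.map (f.restrictScalars k) (g.restrictScalars k) t) :=
  Ind.lift_mk _ _ t

theorem convMap_tens (hβ : β₁ + β₂ = β) {A : KMod.{u, v, w₁} D β₁} {A' : KMod.{u, v, w₃} D β₁}
    {B : KMod.{u, v, w₂} D β₂} {B' : KMod.{u, v, w₄} D β₂} (f : A.V →ₗ[KLR D β₁] A'.V)
    (g : B.V →ₗ[KLR D β₂] B'.V) (u : A.V) (v : B.V) :
    convMap hβ A A' B B' f g (tens hβ A B u v) = tens hβ A' B' (f u) (g v) := convMap_mk hβ f g _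

theorem conv_hom_ext {hβ : β₁ + β₂ = β} {A : KMod.{u, v, w₁} D β₁} {B : KMod.{u, v, w₂} D β₂}
    {N : Type w} [AddCommGroup N] [Module k N] [Module (KLR D β) N] [IsScalarTower k (KLR D β) N]
    {f g : conv hβ A B →ₗ[KLR D β] N} (h : ∀ u v, f (tens hβ A B u v) = g (tens hβ A B u v)) : f = g := by
  refine Ind.hom_ext fun t => ?_
  induction t with
  | zero => simp
  | tmul u v => exact h u v
  | add a b iha ihb => rw [map_add, map_add, map_add, iha, ihb]

section Separated

variable (hβ : β₁ + β₂ = β) {A : KMod.{u, v, w₁} D β₁} {B : KMod.{u, v, w₂} D β₂}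
  (f : A.V →ₗ[KLR D β₁] A.V) (g : B.V →ₗ[KLR D β₂] B.V)

theorem convMap_Θ (t : Reach D hβ →₀ A.V ⊗[k] B.V) :
    convMap hβ A A B B f g (Θ A B hβ t) =
      Θ A B hβ (Finsupp.mapRange.linearMap (TensorProduct.map (f.restrictScalars k) (g.restrictScalars k)) t) := by
  induction t using Finsupp.induction_linear with
  | zero => simp
  | add a b iha ihb => rw [map_add, map_add, iha, ihb, ← map_add, ← map_add]
  | single w t =>
    rw [Finsupp.mapRange.linearMap_apply, Finsupp.mapRange_single, Θ_single, Θ_single, map_smul, convMap_mk]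

variable {V : Type w} [AddCommGroup V] [Module k V] (Mo : Model A B V)
include Mo

theorem convMap_injective (h : Function.Injective (TensorProduct.map (f.restrictScalars k) (g.restrictScalars k))) :
    Function.Injective (convMap hβ A A B B f g) := by
  intro x y hxy
  obtain ⟨s, rfl⟩ := Θ_surjective A B hβ x
  obtain ⟨t, rfl⟩ := Θ_surjective A B hβ y
  rw [convMap_Θ, convMap_Θ] at hxy
  congr 1
  exact Finsupp.mapRange_injective _ (map_zero _) h (Mo.Θ_injective hβ hxy)

theorem convMap_separated (h : ∀ t, (∀ a : ℕ, t ∈ LinearMap.range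
    ((TensorProduct.map (f.restrictScalars k) (g.restrictScalars k)) ^ a)) → t = 0) (x : conv hβ A B)
    (hx : ∀ a : ℕ, x ∈ LinearMap.range ((convMap hβ A A B B f g : Module.End (KLR D β) (conv hβ A B)) ^ a)) :
    x = 0 := by
  have key : ∀ (a : ℕ) t, ((convMap hβ A A B B f g : Module.End (KLR D β) (conv hβ A B)) ^ a) (Θ A B hβ t) =
      Θ A B hβ (Finsupp.mapRange.linearMap
        ((TensorProduct.map (f.restrictScalars k) (g.restrictScalars k)) ^ a) t) := by
    intro a
    induction a with
    | zero =>
      intro t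
      exact congrArg (Θ A B hβ) (Finsupp.ext fun w => rfl)
    | succ a ih =>
      intro t
      rw [pow_succ', Module.End.mul_apply, ih, convMap_Θ, pow_succ']
      exact congrArg (Θ A B hβ) (Finsupp.ext fun w => rfl)
  obtain ⟨s, rfl⟩ := Θ_surjective A B hβ x
  suffices s = 0 by rw [this, map_zero]
  ext1 w
  refine h _ fun a => ?_
  obtain ⟨y, hy⟩ := hx a
  obtain ⟨t, rfl⟩ := Θ_surjective A B hβ y
  rw [key] at hy
  rw [← Mo.Θ_injective hβ hy]
  exact ⟨t w, by simp⟩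

end Separated

theorem ker_convMap_le (hβ : β₁ + β₂ = β) {A : KMod.{u, v, w₁} D β₁} {A' : KMod.{u, v, w₃} D β₁}
    {B : KMod.{u, v, w₂} D β₂} {B' : KMod.{u, v, w₄} D β₂} (f : A.V →ₗ[KLR D β₁] A'.V)
    (g : B.V →ₗ[KLR D β₂] B'.V) (z : Module.End (KLR D β) (conv hβ A B)) (i : A'.V →ₗ[k] A.V)
    (j : B'.V →ₗ[k] B.V)
    (h : ∀ u v, tens hβ A B u v - tens hβ A B (i (f u)) (j (g v)) ∈ LinearMap.range z)
    (he : ∀ (ν : ISeq β₁) (η : ISeq β₂) u v, tens hβ A B (KLR.e D ν • i u) (KLR.e D η • j v) =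
      tens hβ A B (i (KLR.e D ν • u)) (j (KLR.e D η • v)))
    (hi : ∀ (a : GenR β₁) u v, tens hβ A B (KLR.gen D a • i u) (j v) - tens hβ A B (i (KLR.gen D a • u)) (j v) ∈ LinearMap.range z)
    (hj : ∀ (a : GenR β₂) u v, tens hβ A B (i u) (KLR.gen D a • j v) - tens hβ A B (i u) (j (KLR.gen D a • v)) ∈ LinearMap.range z) :
    LinearMap.ker (convMap hβ A A' B B' f g) ≤ LinearMap.range z := by
  have hq : ∀ {x y : conv hβ A B}, x - y ∈ LinearMap.range z →
      (LinearMap.range z).mkQ x = (LinearMap.range z).mkQ y := fun h => (Submodule.Quotient.eq _).2 h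
  let b : A'.V ⊗[k] B'.V →ₗ[k] conv hβ A B ⧸ LinearMap.range z :=
    (LinearMap.range z).mkQ.restrictScalars k ∘ₗ Ind.mk _ ∘ₗ TensorProduct.map i j
  have hb : ∀ u v, b (u ⊗ₜ v) = (LinearMap.range z).mkQ (tens hβ A B (i u) (j v)) := fun _ _ => rfl
  let E : conv hβ A' B' →ₗ[KLR D β] conv hβ A B ⧸ LinearMap.range z := Ind.lift b fun t ht => by
    cases ht <;>
      refine (map_sub (Ind.act b) _ _).trans (sub_eq_zero.2 ?_) <;>
      rw [Ind.act_tmul, Ind.act_tmul, one_smul, hb, hb, ← map_smul]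
    case e ν η u v => rw [e_tens, he]
    case xL p u v => rw [x_left]; exact hq (hi _ _ _)
    case xR p u v => rw [x_right]; exact hq (hj _ _ _)
    case sL p u v => rw [s_left]; exact hq (hi _ _ _)
    case sR p u v => rw [s_right]; exact hq (hj _ _ _)
  have hE : E ∘ₗ convMap hβ A A' B B' f g = (LinearMap.range z).mkQ := by
    refine conv_hom_ext fun u v => ?_
    rw [LinearMap.comp_apply, convMap_tens, hq (h u v)]
    exact (Ind.lift_mk b _ _).trans (hb _ _)
  intro x hx
  have := LinearMap.congr_fun hE x
  rw [LinearMap.comp_apply, LinearMap.mem_ker.1 hx, map_zero] at this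
  exact (Submodule.Quotient.mk_eq_zero _).1 this.symm

theorem convMap_surjective (hβ : β₁ + β₂ = β) {A : KMod.{u, v, w₁} D β₁} {A' : KMod.{u, v, w₃} D β₁}
    {B : KMod.{u, v, w₂} D β₂} {B' : KMod.{u, v, w₄} D β₂} {f : A.V →ₗ[KLR D β₁] A'.V}
    {g : B.V →ₗ[KLR D β₂] B'.V} (hf : Function.Surjective f) (hg : Function.Surjective g) :
    Function.Surjective (convMap hβ A A' B B' f g) := by
  intro x
  refine Ind.induction_on ((LinearMap.range (convMap hβ A A' B B' f g)).restrictScalars k) (fun a t => ?_) x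
  refine (LinearMap.range (convMap hβ A A' B B' f g)).smul_mem a ?_
  induction t with
  | zero => rw [map_zero]; exact Submodule.zero_mem _
  | tmul u v =>
    obtain ⟨u, rfl⟩ := hf u
    obtain ⟨v, rfl⟩ := hg v
    exact ⟨tens hβ A B u v, convMap_tens hβ f g u v⟩
  | add a b iha ihb => rw [map_add]; exact Submodule.add_mem _ iha ihb

theorem convMap_comp_eq_zero (hβ : β₁ + β₂ = β) {A : KMod.{u, v, w₁} D β₁} {A' : KMod.{u, v, w₃} D β₁}
    {B : KMod.{u, v, w₂} D β₂} {B' : KMod.{u, v, w₄} D β₂} {f : A.V →ₗ[KLR D β₁] A'.V}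
    {g : B.V →ₗ[KLR D β₂] B'.V} {f' : A.V →ₗ[KLR D β₁] A.V} {g' : B.V →ₗ[KLR D β₂] B.V}
    (h : (∀ u, f (f' u) = 0) ∨ ∀ v, g (g' v) = 0) (x : conv hβ A B) :
    convMap hβ A A' B B' f g (convMap hβ A A B B f' g' x) = 0 := by
  have : convMap hβ A A' B B' f g ∘ₗ convMap hβ A A B B f' g' = 0 := by
    refine conv_hom_ext fun u v => ?_
    rw [LinearMap.comp_apply, convMap_tens, convMap_tens, LinearMap.zero_apply]
    rcases h with h | h
    · rw [h, tens, TensorProduct.zero_tmul, map_zero]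
    · rw [h, tens, TensorProduct.tmul_zero, map_zero]
  exact LinearMap.congr_fun this x

theorem IsRMatrix.convMap {h₁₂ : β₁ + β₂ = β} {h₂₁ : β₂ + β₁ = β} {A : KMod.{u, v, w₁} D β₁}
    {B : KMod.{u, v, w₂} D β₂} {R} (hR : IsRMatrix h₁₂ h₂₁ A B R) (f : A.V →ₗ[KLR D β₁] A.V)
    (g : B.V →ₗ[KLR D β₂] B.V) (x : conv h₁₂ A B) :
    R (KMod.convMap h₁₂ A A B B f g x) = KMod.convMap h₂₁ B B A A g f (R x) := by
  have : R ∘ₗ KMod.convMap h₁₂ A A B B f g = KMod.convMap h₂₁ B B A A g f ∘ₗ R := by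
    refine conv_hom_ext fun u v => ?_
    rw [LinearMap.comp_apply, LinearMap.comp_apply, convMap_tens, hR, hR, map_smul, convMap_tens]
  exact LinearMap.congr_fun this x

variable [D.IsSymmetric]

section Affine

variable (M : KMod.{u, v, w} D β)

/-- `u ↦ 1 ⊗ u`. -/
def affOne : M.V →ₗ[k] M.aff.V := TensorProduct.mk k (Polynomial k) M.V 1

theorem affEv_affOne (u : M.V) : M.affEv (M.affOne u) = u :=
  (Aff.ev_tmul _ _).trans (by rw [Polynomial.eval_one, one_smul])

theorem affEv_affZ (u : M.aff.V) : M.affEv (M.affZ u) = 0 := LinearMap.congr_fun Aff.ev_z u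

theorem e_affOne (ν : ISeq β) (u : M.V) : KLR.e D ν • M.affOne u = M.affOne (KLR.e D ν • u) :=
  M.aff_gen_smul (.e ν) _

theorem gen_affOne (g : GenR β) (u : M.V) :
    ∃ c, KLR.gen D g • M.affOne u - M.affOne (KLR.gen D g • u) = M.affZ c := by
  rw [M.aff_gen_smul]
  cases g with
  | e ν => exact ⟨0, by rw [map_zero]; exact sub_self _⟩
  | s a => exact ⟨0, by rw [map_zero]; exact sub_self _⟩
  | x p => exact ⟨M.affOne u,
      add_sub_cancel_left (Aff.tmul 1 (KLR.x D p • u)) (Aff.z M.V (Aff.tmul 1 u))⟩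

theorem sub_affOne_affEv (m : M.aff.V) : ∃ c, m - M.affOne (M.affEv m) = M.affZ c := Aff.exists_sub m

end Affine

section Left

variable (h₁₂ : β₁ + β₂ = β) (h₂₁ : β₂ + β₁ = β) (M : KMod.{u, v, w₁} D β₁) (N : KMod.{u, v, w₂} D β₂)

theorem ker_affEv_left : LinearMap.ker (convMap h₁₂ M.aff M N N M.affEv LinearMap.id) ≤
    LinearMap.range (convMap h₁₂ M.aff M.aff N N M.affZ LinearMap.id) := by
  have key : ∀ c v, tens h₁₂ M.aff N (M.affZ c) v ∈
      LinearMap.range (convMap h₁₂ M.aff M.aff N N M.affZ LinearMap.id) := fun c v =>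
    ⟨tens h₁₂ M.aff N c v, convMap_tens _ _ _ _ _⟩
  have hsub : ∀ (u u' : M.aff.V) (v : N.V), tens h₁₂ M.aff N u v - tens h₁₂ M.aff N u' v =
      tens h₁₂ M.aff N (u - u') v := fun u u' v => by
    rw [tens, tens, tens, TensorProduct.sub_tmul, map_sub]
  refine ker_convMap_le h₁₂ _ _ _ M.affOne LinearMap.id (fun u v => ?_) (fun ν η u v => ?_) (fun a u v => ?_)
    (fun a u v => ?_)
  · obtain ⟨c, hc⟩ := M.sub_affOne_affEv u
    rw [LinearMap.id_apply, LinearMap.id_apply, hsub, hc]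
    exact key c v
  · rw [e_affOne]; rfl
  · obtain ⟨c, hc⟩ := M.gen_affOne a u
    rw [hsub, hc]
    exact key c _
  · rw [LinearMap.id_apply, LinearMap.id_apply, sub_self]
    exact Submodule.zero_mem _

theorem ker_affEv_right : LinearMap.ker (convMap h₁₂ M M N.aff N LinearMap.id N.affEv) ≤
    LinearMap.range (convMap h₁₂ M M N.aff N.aff LinearMap.id N.affZ) := by
  have key : ∀ u c, tens h₁₂ M N.aff u (N.affZ c) ∈
      LinearMap.range (convMap h₁₂ M M N.aff N.aff LinearMap.id N.affZ) := fun u c =>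
    ⟨tens h₁₂ M N.aff u c, convMap_tens _ _ _ _ _⟩
  have hsub : ∀ (u : M.V) (v v' : N.aff.V), tens h₁₂ M N.aff u v - tens h₁₂ M N.aff u v' =
      tens h₁₂ M N.aff u (v - v') := fun u v v' => by
    rw [tens, tens, tens, TensorProduct.tmul_sub, map_sub]
  refine ker_convMap_le h₁₂ _ _ _ LinearMap.id N.affOne (fun u v => ?_) (fun ν η u v => ?_) (fun a u v => ?_)
    (fun a u v => ?_)
  · obtain ⟨c, hc⟩ := N.sub_affOne_affEv v
    rw [LinearMap.id_apply, LinearMap.id_apply, hsub, hc]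
    exact key u c
  · rw [e_affOne]; rfl
  · rw [LinearMap.id_apply, LinearMap.id_apply, sub_self]
    exact Submodule.zero_mem _
  · obtain ⟨c, hc⟩ := N.gen_affOne a v
    rw [hsub, hc]
    exact key _ c

theorem affEv_surjective (M : KMod.{u, v, w} D β) : Function.Surjective M.affEv := fun u => ⟨_, M.affEv_affOne u⟩

theorem leftComm_map (t : N.V ⊗[k] M.aff.V) :
    TensorProduct.leftComm k N.V (Polynomial k) M.V (TensorProduct.map LinearMap.id (M.affZ.restrictScalars k) t) =
      Aff.z _ (TensorProduct.leftComm k N.V (Polynomial k) M.V t) :=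
  LinearMap.congr_fun (f := (TensorProduct.leftComm k N.V (Polynomial k) M.V).toLinearMap ∘ₗ
      TensorProduct.map LinearMap.id (M.affZ.restrictScalars k))
    (g := Aff.z (N.V ⊗[k] M.V) ∘ₗ (TensorProduct.leftComm k N.V (Polynomial k) M.V).toLinearMap)
    (TensorProduct.ext' (M := N.V) (N := M.aff.V) fun u v => leftComm_z N M u v) t

theorem assoc_map (t : N.aff.V ⊗[k] M.V) :
    TensorProduct.assoc k (Polynomial k) N.V M.V (TensorProduct.map (N.affZ.restrictScalars k) LinearMap.id t) =
      Aff.z _ (TensorProduct.assoc k (Polynomial k) N.V M.V t) :=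
  LinearMap.congr_fun (f := (TensorProduct.assoc k (Polynomial k) N.V M.V).toLinearMap ∘ₗ
      TensorProduct.map (N.affZ.restrictScalars k) LinearMap.id)
    (g := Aff.z (N.V ⊗[k] M.V) ∘ₗ (TensorProduct.assoc k (Polynomial k) N.V M.V).toLinearMap)
    (TensorProduct.ext' (M := N.aff.V) (N := M.V) fun u v => assoc_z N M u v) t

theorem Aff_conj_injective {V : Type w} [AddCommGroup V] [Module k V] {W : Type w₁} [AddCommGroup W] [Module k W]
    (e : W ≃ₗ[k] Aff k V) (f : Module.End k W) (h : ∀ t, e (f t) = Aff.z V (e t)) : Function.Injective f := by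
  intro x y hxy
  refine e.injective (Lau.Aff_z_injective ?_)
  rw [← h, ← h, hxy]

theorem Aff_conj_separated {V : Type w} [AddCommGroup V] [Module k V] {W : Type w₁} [AddCommGroup W] [Module k W]
    (e : W ≃ₗ[k] Aff k V) (f : Module.End k W) (h : ∀ t, e (f t) = Aff.z V (e t)) (t : W)
    (ht : ∀ a : ℕ, t ∈ LinearMap.range (f ^ a)) : t = 0 := by
  have key : ∀ (a : ℕ) t, e ((f ^ a) t) = (Aff.z V ^ a) (e t) := by
    intro a
    induction a with
    | zero => intro t; rfl
    | succ a ih => intro t; rw [pow_succ', pow_succ', Module.End.mul_apply, Module.End.mul_apply, h, ih]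
  refine e.injective ?_
  rw [map_zero]
  refine Lau.Aff_z_separated fun a => ?_
  obtain ⟨s, rfl⟩ := ht a
  exact ⟨e s, (key a s).symm⟩

theorem affZ_right_injective : Function.Injective (convMap h₂₁ N N M.aff M.aff LinearMap.id M.affZ) :=
  convMap_injective h₂₁ _ _ (Model.affRight N M) (Aff_conj_injective
    (TensorProduct.leftComm k N.V (Polynomial k) M.V) _ (leftComm_map M N))

theorem affZ_left_injective : Function.Injective (convMap h₂₁ N.aff N.aff M M N.affZ LinearMap.id) :=
  convMap_injective h₂₁ _ _ (Model.affLeft N M) (Aff_conj_injective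
    (TensorProduct.assoc k (Polynomial k) N.V M.V) _ (assoc_map M N))

theorem exists_isRenormL [Nontrivial M.V] [Nontrivial N.V] : ∃ r ρ, IsRenormL h₁₂ h₂₁ M N r ρ := by
  obtain ⟨R, hR⟩ := exists_isRMatrix h₁₂ h₂₁ (A := M.aff) (B := N) (Model.affRight N M)
  obtain ⟨u, hu⟩ := exists_ne (0 : M.V)
  obtain ⟨v, hv⟩ := exists_ne (0 : N.V)
  refine exists_renormalization hR (fun R' hR' => hR.unique h₁₂ h₂₁ hR') (hR.ne_zero h₁₂ h₂₁ (Model.affRight N M)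
    (u := M.affOne u) (v := v) (fun h => hu ?_) hv) (affZ_right_injective h₂₁ M N) ?_
    (fun m => hR.convMap M.affZ LinearMap.id m)
    (convMap_surjective h₁₂ M.affEv_surjective Function.surjective_id) (ker_affEv_left h₁₂ M N)
    (convMap_comp_eq_zero h₂₁ (Or.inr M.affEv_affZ))
  · rw [← M.affEv_affOne u, h, map_zero]
  · exact convMap_separated h₂₁ _ _ (Model.affRight N M) (Aff_conj_separated
      (TensorProduct.leftComm k N.V (Polynomial k) M.V) _ (leftComm_map M N))

theorem exists_isRenormR [Nontrivial M.V] [Nontrivial N.V] : ∃ r ρ, IsRenormR h₁₂ h₂₁ M N r ρ := by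
  obtain ⟨R, hR⟩ := exists_isRMatrix h₁₂ h₂₁ (A := M) (B := N.aff) (Model.affLeft N M)
  obtain ⟨u, hu⟩ := exists_ne (0 : M.V)
  obtain ⟨v, hv⟩ := exists_ne (0 : N.V)
  refine exists_renormalization hR (fun R' hR' => hR.unique h₁₂ h₂₁ hR') (hR.ne_zero h₁₂ h₂₁ (Model.affLeft N M)
    (u := u) (v := N.affOne v) hu (fun h => hv ?_)) (affZ_left_injective h₂₁ M N) ?_
    (fun m => hR.convMap LinearMap.id N.affZ m)
    (convMap_surjective h₁₂ Function.surjective_id N.affEv_surjective) (ker_affEv_right h₁₂ M N)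
    (convMap_comp_eq_zero h₂₁ (Or.inl N.affEv_affZ))
  · rw [← N.affEv_affOne v, h, map_zero]
  · exact convMap_separated h₂₁ _ _ (Model.affLeft N M) (Aff_conj_separated
      (TensorProduct.assoc k (Polynomial k) N.V M.V) _ (assoc_map M N))

end Left

end KMod

end Specialization

/-! ### Signs -/

section Signs

variable {k : Type u} [Field k] {I : Type v}

theorem zmod_two_cases (a : ZMod 2) : a = 0 ∨ a = 1 := by decide +revert

theorem sgn_add (a b : ZMod 2) : sgn k (a + b) = sgn k a * sgn k b := by
  have h : (1 : ZMod 2) + 1 = 0 := by decide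
  rcases zmod_two_cases a with rfl | rfl <;> rcases zmod_two_cases b with rfl | rfl <;>
    simp [sgn, h]

@[simp] theorem sgn_zero : sgn k 0 = 1 := by simp [sgn]

@[simp] theorem sgn_one : sgn k 1 = -1 := by simp [sgn]

theorem sgn_smul_sgn_smul {V : Type w} [AddCommGroup V] [Module k V] (a : ZMod 2) (v : V) :
    sgn k a • sgn k a • v = v := by
  rw [smul_smul, sgn_mul_self, one_smul]

theorem sgn_pow_mul_sgn_pow (a : ZMod 2) (r : ℕ) : sgn k a ^ r * sgn k a ^ r = 1 := by
  rw [← mul_pow, sgn_mul_self, one_pow]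

namespace Datum

variable (D : Datum k I) {B : Type w} [Ring B] [Algebra k B]

theorem Qt_smul (μ η : I × ZMod 2) (X Y : B) :
    D.Qt μ η (sgn k μ.2 • X) (sgn k η.2 • Y) = D.Q μ.1 η.1 X Y := by
  unfold Qt Q polyEval
  refine Finset.sum_congr rfl fun r _ => Finset.sum_congr rfl fun s _ => ?_
  rw [smul_pow, smul_pow, smul_mul_smul_comm, smul_smul, qt]
  congr 1
  linear_combination D.q μ.1 η.1 r s * sgn k η.2 ^ s * sgn k η.2 ^ s *
    sgn_pow_mul_sgn_pow (k := k) μ.2 r + D.q μ.1 η.1 r s * sgn_pow_mul_sgn_pow (k := k) η.2 s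

theorem dQt_smul (μ η : I × ZMod 2) (W X Y : B) :
    D.dQt μ η (sgn k μ.2 • W) (sgn k μ.2 • X) (sgn k η.2 • Y) =
      sgn k μ.2 • D.dQ μ.1 η.1 W X Y := by
  unfold dQt dQ polyDiff
  rw [Finset.smul_sum]
  refine Finset.sum_congr rfl fun r _ => ?_
  rw [Finset.smul_sum]
  refine Finset.sum_congr rfl fun s _ => ?_
  have h : ∑ l ∈ Finset.range r, (sgn k μ.2 • W) ^ l * (sgn k μ.2 • X) ^ (r - 1 - l) =
      sgn k μ.2 ^ (r - 1) • ∑ l ∈ Finset.range r, W ^ l * X ^ (r - 1 - l) := by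
    rw [Finset.smul_sum]
    refine Finset.sum_congr rfl fun l hl => ?_
    rw [smul_pow, smul_pow, smul_mul_smul_comm, ← pow_add]
    congr 2
    have := Finset.mem_range.1 hl
    omega
  rw [h, smul_pow, smul_mul_smul_comm, smul_smul, smul_smul, qt]
  rcases r with - | r
  · simp
  · congr 1
    rw [Nat.add_sub_cancel, pow_succ]
    linear_combination D.q μ.1 η.1 (r + 1) s * sgn k μ.2 * sgn k η.2 ^ s * sgn k η.2 ^ s *
      sgn_pow_mul_sgn_pow (k := k) μ.2 r +
      D.q μ.1 η.1 (r + 1) s * sgn k μ.2 * sgn_pow_mul_sgn_pow (k := k) η.2 s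

end Datum

/-- `∑_{q < p} S_q`. -/
def below {n : ℕ} (p : Fin n) (S : Fin n → ZMod 2) : ZMod 2 := ∑ q, if q < p then S q else 0

/-- `S` with `p`-th entry changed. -/
def toggle {n : ℕ} (p : Fin n) (S : Fin n → ZMod 2) : Fin n → ZMod 2 := S + Pi.single p 1

section

variable {n : ℕ}

theorem toggle_same (p : Fin n) (S : Fin n → ZMod 2) : toggle p S p = S p + 1 := by simp [toggle]

theorem toggle_ne {p q : Fin n} (h : q ≠ p) (S : Fin n → ZMod 2) : toggle p S q = S q := by
  simp [toggle, h]

theorem toggle_toggle (p : Fin n) (S : Fin n → ZMod 2) : toggle p (toggle p S) = S := by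
  have h : (1 : ZMod 2) + 1 = 0 := by decide
  rw [toggle, toggle, add_assoc, ← Pi.single_add, h, Pi.single_zero, add_zero]

theorem toggle_comm (p q : Fin n) (S : Fin n → ZMod 2) :
    toggle p (toggle q S) = toggle q (toggle p S) := add_right_comm _ _ _

theorem below_add (p : Fin n) (S T : Fin n → ZMod 2) : below p (S + T) = below p S + below p T := by
  rw [below, below, below, ← Finset.sum_add_distrib]
  refine Finset.sum_congr rfl fun q _ => ?_
  split_ifs <;> simp

theorem below_toggle (p q : Fin n) (S : Fin n → ZMod 2) :
    below p (toggle q S) = below p S + if q < p then 1 else 0 := by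
  rw [toggle, below_add]
  congr 1
  rw [below, Finset.sum_eq_single q]
  · simp
  · intro x _ hx
    simp [hx]
  · simp

theorem below_hi (a : Fin (n - 1)) (S : Fin n → ZMod 2) :
    below (hi a) S = below (lo a) S + S (lo a) := by
  have h : S (lo a) = ∑ q, if q = lo a then S q else 0 := by simp
  rw [below, below, h, ← Finset.sum_add_distrib]
  refine Finset.sum_congr rfl fun q _ => ?_
  have h1 : q < hi a ↔ q < lo a ∨ q = lo a := by
    simp only [Fin.lt_def, Fin.ext_iff, hi, lo]; omega
  have h2 : q = lo a → ¬q < lo a := fun h => by simp [h]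
  by_cases h3 : q = lo a
  · rw [if_pos (h1.2 (Or.inr h3)), if_neg (h2 h3), if_pos h3, zero_add]
  · simp [h1, h3]

theorem below_swap (a : Fin (n - 1)) {p : Fin n} (hp : p ≠ hi a) (S : Fin n → ZMod 2) :
    below p (S ∘ Equiv.swap (lo a) (hi a)) = below p S := by
  rw [below, below, ← Equiv.sum_comp (Equiv.swap (lo a) (hi a))]
  refine Finset.sum_congr rfl fun q _ => ?_
  have h : Equiv.swap (lo a) (hi a) q < p ↔ q < p := by
    by_cases h1 : q = lo a
    · rw [h1, Equiv.swap_apply_left]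
      simp only [Fin.lt_def, Fin.ext_iff, hi, lo, ne_eq] at hp ⊢; omega
    by_cases h2 : q = hi a
    · rw [h2, Equiv.swap_apply_right]
      simp only [Fin.lt_def, Fin.ext_iff, hi, lo, ne_eq] at hp ⊢; omega
    rw [Equiv.swap_apply_of_ne_of_ne h1 h2]
  simp only [h, Function.comp_apply, Equiv.swap_apply_self]

theorem toggle_comp (e : Equiv.Perm (Fin n)) (he : ∀ q, e (e q) = q) (p : Fin n)
    (S : Fin n → ZMod 2) : toggle p S ∘ e = toggle (e p) (S ∘ e) := by
  funext q
  by_cases h : q = e p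
  · subst h
    rw [Function.comp_apply, he, toggle_same, toggle_same, Function.comp_apply, he]
  · have h' : e q ≠ p := fun h1 => h (by rw [← h1, he])
    rw [Function.comp_apply, toggle_ne h', toggle_ne h, Function.comp_apply]

/-- `s_a S`. -/
def swapS (a : Fin (n - 1)) (S : Fin n → ZMod 2) : Fin n → ZMod 2 := S ∘ Equiv.swap (lo a) (hi a)

theorem swapS_lo (a : Fin (n - 1)) (S : Fin n → ZMod 2) : swapS a S (lo a) = S (hi a) := by
  simp [swapS]

theorem swapS_hi (a : Fin (n - 1)) (S : Fin n → ZMod 2) : swapS a S (hi a) = S (lo a) := by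
  simp [swapS]

theorem swapS_of_ne (a : Fin (n - 1)) (S : Fin n → ZMod 2) {p : Fin n} (h1 : p ≠ lo a)
    (h2 : p ≠ hi a) : swapS a S p = S p := by
  simp [swapS, Equiv.swap_apply_of_ne_of_ne h1 h2]

theorem swapS_swapS (a : Fin (n - 1)) (S : Fin n → ZMod 2) : swapS a (swapS a S) = S := by
  funext q; simp [swapS]

theorem swapS_toggle (a : Fin (n - 1)) (p : Fin n) (S : Fin n → ZMod 2) :
    swapS a (toggle p S) = toggle (Equiv.swap (lo a) (hi a) p) (swapS a S) :=
  toggle_comp _ (fun _ => Equiv.swap_apply_self _ _ _) p S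

theorem swapS_eq (a : Fin (n - 1)) {S : Fin n → ZMod 2} (h : S (lo a) = S (hi a)) :
    swapS a S = S := by
  funext q
  by_cases h1 : q = lo a
  · rw [h1, swapS_lo, h]
  by_cases h2 : q = hi a
  · rw [h2, swapS_hi, h]
  exact swapS_of_ne a S h1 h2

theorem swapS_conj (a : Fin (n - 1)) {S : Fin n → ZMod 2} (h : S (lo a) = S (hi a) + 1) :
    swapS a S = toggle (lo a) (toggle (hi a) S) := by
  have h' : S (hi a) = S (lo a) + 1 := by rw [h, add_assoc, show (1 : ZMod 2) + 1 = 0 by decide, add_zero]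
  funext q
  by_cases h1 : q = lo a
  · rw [h1, swapS_lo, toggle_same, toggle_ne (lo_ne_hi a), h']
  by_cases h2 : q = hi a
  · rw [h2, swapS_hi, toggle_ne (lo_ne_hi a).symm, toggle_same, h]
  rw [swapS_of_ne a S h1 h2, toggle_ne h1, toggle_ne h2]

/-- The exponent of the sign in `σ_a 𝔠^S = ± 𝔠^{s_a S} σ_a`. -/
def cross (a : Fin (n - 1)) (S : Fin n → ZMod 2) : ZMod 2 := S (lo a) * S (hi a)

theorem cross_swapS (a : Fin (n - 1)) (S : Fin n → ZMod 2) : cross a (swapS a S) = cross a S := by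
  rw [cross, swapS_lo, swapS_hi, mul_comm, cross]

theorem below_cross (a : Fin (n - 1)) (p : Fin n) (S : Fin n → ZMod 2) :
    below p S + cross a (toggle p S) =
      cross a S + below (Equiv.swap (lo a) (hi a) p) (swapS a S) := by
  have h2 : (2 : ZMod 2) = 0 := by decide
  by_cases h1 : p = lo a
  · subst h1
    rw [Equiv.swap_apply_left, below_hi, swapS_lo, swapS, below_swap a (lo_ne_hi a), cross, cross,
      toggle_same, toggle_ne (lo_ne_hi a).symm]
    ring
  by_cases h3 : p = hi a
  · subst h3
    rw [Equiv.swap_apply_right, below_hi, swapS, below_swap a (lo_ne_hi a), cross, cross,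
      toggle_same, toggle_ne (lo_ne_hi a)]
    linear_combination S (lo a) * h2
  rw [Equiv.swap_apply_of_ne_of_ne h1 h3, swapS, below_swap a h3, cross, cross,
    toggle_ne (Ne.symm h1), toggle_ne (Ne.symm h3), add_comm]

@[elab_as_elim]
theorem toggle_induction {P : (Fin n → ZMod 2) → Prop} (h0 : P 0)
    (h1 : ∀ p S, P S → P (toggle p S)) (S : Fin n → ZMod 2) : P S := by
  have key : ∀ (s : Finset (Fin n)) (S : Fin n → ZMod 2), (∀ p, p ∉ s → S p = 0) → P S := by
    intro s
    induction s using Finset.induction_on with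
    | empty =>
      intro S hS
      rwa [show S = 0 from funext fun p => hS p (Finset.notMem_empty p)]
    | insert a s _ ih =>
      intro S hS
      rcases zmod_two_cases (S a) with h | h
      · refine ih S fun p hp => ?_
        by_cases hpa : p = a
        · rw [hpa, h]
        · exact hS p (by simp [hpa, hp])
      · rw [← toggle_toggle a S]
        refine h1 a _ (ih _ fun p hp => ?_)
        by_cases hpa : p = a
        · rw [hpa, toggle_same, h]; decide
        · rw [toggle_ne hpa]; exact hS p (by simp [hpa, hp])
  exact key Finset.univ S fun p hp => absurd (Finset.mem_univ p) hp

end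

end Signs

/-! ### The `RC`-module with a given image under `F` -/

section Cl

variable {k : Type u} [Field k] {I : Type v} {D : Datum k I} {β : I →₀ ℕ}

/-- The direct sum of copies of `V` indexed by the sequences of parities. -/
def Cl (β : I →₀ ℕ) (V : Type w) [AddCommGroup V] : Type w := (Fin (ht β) → ZMod 2) →₀ V

variable (V : Type w) [AddCommGroup V] [Module k V]

instance : AddCommGroup (Cl β V) := inferInstanceAs (AddCommGroup (_ →₀ V))
instance : Module k (Cl β V) := inferInstanceAs (Module k (_ →₀ V))

namespace Cl

variable {V}

/-- The inclusion of a summand. -/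
def single (k : Type u) [Field k] [Module k V] (S : Fin (ht β) → ZMod 2) : V →ₗ[k] Cl β V :=
  Finsupp.lsingle S

/-- The linear map with given values on the summands. -/
def desc {W : Type w₁} [AddCommGroup W] [Module k W] (f : (Fin (ht β) → ZMod 2) → V →ₗ[k] W) :
    Cl β V →ₗ[k] W := Finsupp.lsum k f

theorem desc_single {W : Type w₁} [AddCommGroup W] [Module k W]
    (f : (Fin (ht β) → ZMod 2) → V →ₗ[k] W) (S : Fin (ht β) → ZMod 2) (v : V) :
    desc f (single k S v) = f S v := Finsupp.lsum_single _ _ _ _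

theorem hom_ext {W : Type w₁} [AddCommGroup W] [Module k W] {f g : Cl β V →ₗ[k] W}
    (h : ∀ S v, f (single k S v) = g (single k S v)) : f = g :=
  Finsupp.lhom_ext h

theorem single_injective (S : Fin (ht β) → ZMod 2) :
    Function.Injective (single (V := V) k S) := Finsupp.single_injective S

/-- The sequence `((ν_1, S_1), …, (ν_n, S_n))`. -/
def pair (ν : ISeq β) (S : Fin (ht β) → ZMod 2) : JSeq β := ⟨fun p => (ν.seq p, S p), ν.sum_eq⟩

/-- The first components. -/
def fst (μ : JSeq β) : ISeq β := ⟨fun p => (μ.seq p).1, μ.sum_eq⟩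

/-- The second components. -/
def snd (μ : JSeq β) : Fin (ht β) → ZMod 2 := fun p => (μ.seq p).2

theorem ext_fst_snd {μ ν : JSeq β} (h₁ : fst μ = fst ν) (h₂ : snd μ = snd ν) : μ = ν :=
  JSeq.ext (funext fun p => Prod.ext (congrFun (congrArg ISeq.seq h₁) p) (congrFun h₂ p))

/-- `J^β = I^β × {0, 1}^n`. -/
def pairEquiv : (ISeq β) × (Fin (ht β) → ZMod 2) ≃ JSeq β where
  toFun x := pair x.1 x.2
  invFun μ := (fst μ, snd μ)
  left_inv _ := rfl
  right_inv _ := rfl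

theorem fst_flip (p : Fin (ht β)) (μ : JSeq β) : fst (μ.flip p) = fst μ := by
  refine ISeq.ext (funext fun q => ?_)
  by_cases h : q = p
  · subst h; simp [fst, JSeq.flip, cJ]
  · simp [fst, JSeq.flip, h]

theorem cJ_snd (x : I × ZMod 2) : (cJ x).2 = x.2 + 1 := by
  change 1 - x.2 = x.2 + 1
  rcases zmod_two_cases x.2 with h | h <;> rw [h] <;> decide

theorem snd_flip (p : Fin (ht β)) (μ : JSeq β) : snd (μ.flip p) = toggle p (snd μ) := by
  funext q
  by_cases h : q = p
  · subst h; simp [snd, JSeq.flip, toggle_same, cJ_snd]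
  · simp [snd, JSeq.flip, h, toggle_ne]

theorem fst_swap (a : Fin (ht β - 1)) (μ : JSeq β) : fst (μ.swap a) = (fst μ).swap a := rfl

theorem snd_swap (a : Fin (ht β - 1)) (μ : JSeq β) : snd (μ.swap a) = swapS a (snd μ) := rfl

variable [Module (KLR D β) V] [IsScalarTower k (KLR D β) V]

variable (D V) in
/-- The action of the generators of `RC_β`. -/
def act : GenC β → Module.End k (Cl β V)
  | .e μ => desc fun S => if snd μ = S then
      single k S ∘ₗ Algebra.lsmul k k V (KLR.e D (fst μ)) else 0
  | .x p => desc fun S => single k S ∘ₗ (sgn k (S p) • Algebra.lsmul k k V (KLR.x D p))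
  | .s a => desc fun S => single k (swapS a S) ∘ₗ
      (sgn k (cross a S) • Algebra.lsmul k k V (KLR.s D a))
  | .c p => desc fun S => sgn k (below p S) • single k (toggle p S)

theorem act_e (μ : JSeq β) (v : V) :
    act D V (.e μ) (single k (snd μ) v) = single k (snd μ) (KLR.e D (fst μ) • v) := by
  refine (desc_single _ _ _).trans ?_
  rw [if_pos rfl]; rfl

theorem act_e_ne {μ : JSeq β} {S : Fin (ht β) → ZMod 2} (h : snd μ ≠ S) (v : V) :
    act D V (.e μ) (single k S v) = 0 := by
  refine (desc_single _ _ _).trans ?_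
  rw [if_neg h]; rfl

theorem act_x (p : Fin (ht β)) (S : Fin (ht β) → ZMod 2) (v : V) :
    act D V (.x p) (single k S v) = sgn k (S p) • single k S (KLR.x D p • v) :=
  (desc_single _ _ _).trans (map_smul (single k S) _ _)

theorem act_s (a : Fin (ht β - 1)) (S : Fin (ht β) → ZMod 2) (v : V) :
    act D V (.s a) (single k S v) = sgn k (cross a S) • single k (swapS a S) (KLR.s D a • v) :=
  (desc_single _ _ _).trans (map_smul (single k (swapS a S)) _ _)

theorem act_c (p : Fin (ht β)) (S : Fin (ht β) → ZMod 2) (v : V) :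
    act D V (.c p) (single k S v) = sgn k (below p S) • single k (toggle p S) v :=
  desc_single _ _ _

theorem act_sgn (g : GenC β) (a : ZMod 2) (y : Cl β V) :
    act D V g (sgn k a • y) = sgn k a • act D V g y := map_smul _ _ _

theorem ext_act_e {μ : JSeq β} {A B : Module.End k (Cl β V)}
    (h : ∀ v, A (single k (snd μ) (KLR.e D (fst μ) • v)) =
      B (single k (snd μ) (KLR.e D (fst μ) • v))) :
    A * act D V (.e μ) = B * act D V (.e μ) := by
  refine hom_ext fun S v => ?_
  rw [Module.End.mul_apply, Module.End.mul_apply]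
  by_cases hS : snd μ = S
  · subst hS; rw [act_e]; exact h v
  · rw [act_e_ne hS, map_zero, map_zero]

theorem sum_act_e : ∑ μ : JSeq β, act D V (.e μ) = 1 := by
  classical
  refine hom_ext fun S v => ?_
  rw [← Equiv.sum_comp pairEquiv, Fintype.sum_prod_type, LinearMap.sum_apply]
  have h : ∀ ν : ISeq β, (∑ T, act D V (.e (pairEquiv (ν, T)))) (single k S v) =
      single k S (KLR.e D ν • v) := by
    intro ν
    rw [LinearMap.sum_apply, Finset.sum_eq_single S]
    · exact act_e (pairEquiv (ν, S)) v
    · intro T _ hT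
      exact act_e_ne (μ := pairEquiv (ν, T)) hT v
    · simp
  rw [Finset.sum_congr rfl fun ν _ => h ν, ← map_sum, ← Finset.sum_smul, KLR.sum_e, one_smul]
  rfl

variable (k β V) in
/-- Diagonal operators. -/
def diag : ((Fin (ht β) → ZMod 2) → Module.End k V) →ₐ[k] Module.End k (Cl β V) :=
  Pair.diagA k (Fin (ht β) → ZMod 2) V

theorem diag_single (f : (Fin (ht β) → ZMod 2) → Module.End k V) (S : Fin (ht β) → ZMod 2) (v : V) :
    diag k β V f (single k S v) = single k S (f S v) := Pair.diagA_single _ _ _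

/-- `x_p` acts diagonally. -/
def diagX (p : Fin (ht β)) : (Fin (ht β) → ZMod 2) → Module.End k V :=
  fun S => sgn k (S p) • Algebra.lsmul k k V (KLR.x D p)

theorem act_x_eq (p : Fin (ht β)) :
    act D V (.x p) = diag k β V (diagX (D := D) p) := by
  refine hom_ext fun S v => ?_
  refine (act_x p S v).trans ((map_smul (single k S) _ _).symm.trans ?_)
  exact (diag_single (diagX p) S v).symm

theorem Qt_act (i j : I × ZMod 2) (p q : Fin (ht β)) (S : Fin (ht β) → ZMod 2) (hi : i.2 = S p)
    (hj : j.2 = S q) (v : V) :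
    D.Qt i j (act D V (.x p)) (act D V (.x q)) (single k S v) =
      single k S (D.Q i.1 j.1 (KLR.x D p) (KLR.x D q) • v) := by
  rw [act_x_eq, act_x_eq, ← D.map_Qt]
  refine (diag_single _ _ _).trans (congrArg (single k S) ?_)
  change (Pi.evalAlgHom k _ S (D.Qt i j (diagX (D := D) p) (diagX q))) v = _
  rw [D.map_Qt]
  change D.Qt (B := Module.End k V) i j (sgn k (S p) • _) (sgn k (S q) • _) v = _
  rw [← hi, ← hj, D.Qt_smul, ← D.map_Q]
  rfl

theorem dQt_act (i j : I × ZMod 2) (o p q : Fin (ht β)) (S : Fin (ht β) → ZMod 2) (ho : i.2 = S o)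
    (hi : i.2 = S p) (hj : j.2 = S q) (v : V) :
    D.dQt i j (act D V (.x o)) (act D V (.x p)) (act D V (.x q)) (single k S v) =
      sgn k i.2 • single k S (D.dQ i.1 j.1 (KLR.x D o) (KLR.x D p) (KLR.x D q) • v) := by
  rw [act_x_eq, act_x_eq, act_x_eq, ← D.map_dQt, ← map_smul]
  refine (diag_single _ _ _).trans (congrArg (single k S) ?_)
  change (Pi.evalAlgHom k _ S (D.dQt i j (diagX (D := D) o) (diagX p) (diagX q))) v = _
  rw [D.map_dQt]
  change D.dQt (B := Module.End k V) i j (sgn k (S o) • _) (sgn k (S p) • _) (sgn k (S q) • _) v = _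
  rw [← ho, ← hi, ← hj, D.dQt_smul, ← D.map_dQ]
  rfl

theorem dQt_act_neg (i j : I × ZMod 2) (o p q : Fin (ht β)) (S : Fin (ht β) → ZMod 2)
    (ho : i.2 = S o) (hi : i.2 = S p + 1) (hj : j.2 = S q) (v : V) :
    D.dQt i j (act D V (.x o)) (-act D V (.x p)) (act D V (.x q)) (single k S v) =
      sgn k i.2 • single k S (D.dQ i.1 j.1 (KLR.x D o) (KLR.x D p) (KLR.x D q) • v) := by
  rw [act_x_eq, act_x_eq, act_x_eq, ← map_neg, ← D.map_dQt, ← map_smul]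
  refine (diag_single _ _ _).trans (congrArg (single k S) ?_)
  change (Pi.evalAlgHom k _ S (D.dQt i j (diagX (D := D) o) (-diagX p) (diagX q))) v = _
  rw [D.map_dQt]
  change D.dQt (B := Module.End k V) i j (sgn k (S o) • _) (-(sgn k (S p) • _)) (sgn k (S q) • _) v = _
  rw [← neg_smul, show -sgn k (S p) = sgn k i.2 by rw [hi, sgn_add, sgn_one, mul_neg_one],
    ← ho, ← hj, D.dQt_smul, ← D.map_dQ]
  rfl

theorem braid_cross (a b : Fin (ht β - 1)) (hab : (b : ℕ) = a + 1) (S : Fin (ht β) → ZMod 2) :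
    swapS b (swapS a (swapS b S)) = swapS a (swapS b (swapS a S)) ∧
    cross b S + (cross a (swapS b S) + cross b (swapS a (swapS b S))) =
      S (lo a) * S (hi a) + S (hi a) * S (hi b) + S (lo a) * S (hi b) ∧
    cross a S + (cross b (swapS a S) + cross a (swapS b (swapS a S))) =
      S (lo a) * S (hi a) + S (hi a) * S (hi b) + S (lo a) * S (hi b) := by
  have h1 : lo b = hi a := by simp only [lo, hi, Fin.mk.injEq]; omega
  have h2 : lo a ≠ hi b := by simp only [lo, hi, ne_eq, Fin.mk.injEq]; omega
  have h3 : hi a ≠ hi b := by simp only [hi, ne_eq, Fin.mk.injEq]; omega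
  have h4 : lo a ≠ hi a := lo_ne_hi a
  refine ⟨?_, ?_, ?_⟩
  · funext q
    by_cases q1 : q = lo a
    · subst q1
      simp [swapS, h1, Equiv.swap_apply_of_ne_of_ne h4 h2, Equiv.swap_apply_of_ne_of_ne h2.symm h3.symm]
    by_cases q2 : q = hi a
    · subst q2
      simp [swapS, h1, Equiv.swap_apply_of_ne_of_ne h4 h2, Equiv.swap_apply_of_ne_of_ne h2.symm h3.symm]
    by_cases q3 : q = hi b
    · subst q3
      simp [swapS, h1, Equiv.swap_apply_of_ne_of_ne h4 h2, Equiv.swap_apply_of_ne_of_ne h2.symm h3.symm]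
    simp [swapS, h1, Equiv.swap_apply_of_ne_of_ne q1 q2, Equiv.swap_apply_of_ne_of_ne q2 q3]
  · simp only [cross, h1, swapS, Function.comp_apply, Equiv.swap_apply_left, Equiv.swap_apply_right,
      Equiv.swap_apply_of_ne_of_ne h4 h2, Equiv.swap_apply_of_ne_of_ne h2.symm h3.symm]
    ring
  · simp only [cross, h1, swapS, Function.comp_apply, Equiv.swap_apply_left, Equiv.swap_apply_right,
      Equiv.swap_apply_of_ne_of_ne h4 h2, Equiv.swap_apply_of_ne_of_ne h2.symm h3.symm]
    ring

theorem two_eq_zero : (2 : ZMod 2) = 0 := by decide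

theorem sgn_smul_single (a : ZMod 2) (S : Fin (ht β) → ZMod 2) {v v' : V} (b : ZMod 2)
    {S' : Fin (ht β) → ZMod 2} (ha : a = b) (hS : S = S') (hv : v = v') :
    sgn k a • single k S v = sgn k b • single k S' v' := by
  rw [ha, hS, hv]

theorem act_ss (a b : Fin (ht β - 1)) (S : Fin (ht β) → ZMod 2) (v : V) :
    act D V (.s a) (act D V (.s b) (single k S v)) =
      sgn k (cross b S + cross a (swapS b S)) •
        single k (swapS a (swapS b S)) (KLR.s D a • KLR.s D b • v) := by
  rw [act_s, act_sgn, act_s, smul_smul, ← sgn_add]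

theorem act_sss (a b c : Fin (ht β - 1)) (S : Fin (ht β) → ZMod 2) (v : V) :
    act D V (.s a) (act D V (.s b) (act D V (.s c) (single k S v))) =
      sgn k (cross c S + (cross b (swapS c S) + cross a (swapS b (swapS c S)))) •
        single k (swapS a (swapS b (swapS c S))) (KLR.s D a • KLR.s D b • KLR.s D c • v) := by
  rw [act_s, act_sgn, act_sgn, act_ss, smul_smul, ← sgn_add]

theorem act_braid (a b : Fin (ht β - 1)) (hab : (b : ℕ) = a + 1) (S : Fin (ht β) → ZMod 2) (v : V) :
    (act D V (.s b) * act D V (.s a) * act D V (.s b) -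
      act D V (.s a) * act D V (.s b) * act D V (.s a)) (single k S v) =
      sgn k (S (lo a) * S (hi a) + S (hi a) * S (hi b) + S (lo a) * S (hi b)) •
        single k (swapS a (swapS b (swapS a S)))
          ((KLR.s D b * KLR.s D a * KLR.s D b - KLR.s D a * KLR.s D b * KLR.s D a) • v) := by
  obtain ⟨h1, h2, h3⟩ := braid_cross a b hab S
  rw [LinearMap.sub_apply]
  simp only [Module.End.mul_apply]
  rw [act_sss, act_sss, h1, h2, h3, ← smul_sub, ← map_sub, sub_smul]
  simp only [mul_smul]

theorem act_sx (a : Fin (ht β - 1)) (p : Fin (ht β)) (S : Fin (ht β) → ZMod 2) (v : V) :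
    act D V (.s a) (act D V (.x p) (single k S v)) =
      sgn k (S p + cross a S) • single k (swapS a S) ((KLR.s D a * KLR.x D p) • v) := by
  rw [act_x, act_sgn, act_s, smul_smul, ← sgn_add, mul_smul]

theorem act_xs (a : Fin (ht β - 1)) (p : Fin (ht β)) (S : Fin (ht β) → ZMod 2) (v : V) :
    act D V (.x p) (act D V (.s a) (single k S v)) =
      sgn k (cross a S + swapS a S p) • single k (swapS a S) ((KLR.x D p * KLR.s D a) • v) := by
  rw [act_s, act_sgn, act_x, smul_smul, ← sgn_add, mul_smul]

theorem act_cc (p q : Fin (ht β)) (S : Fin (ht β) → ZMod 2) (v : V) :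
    act D V (.c p) (act D V (.c q) (single k S v)) =
      sgn k (below q S + below p (toggle q S)) • single k (toggle p (toggle q S)) v := by
  rw [act_c, act_sgn, act_c, smul_smul, ← sgn_add]

theorem act_c_lo_hi (a : Fin (ht β - 1)) (S : Fin (ht β) → ZMod 2) (v : V) :
    act D V (.c (lo a)) (act D V (.c (hi a)) (single k S v)) =
      sgn k (S (lo a)) • single k (toggle (lo a) (toggle (hi a) S)) v := by
  rw [act_cc, below_hi, below_toggle, if_neg (not_lt.2 (lo_lt_hi a).le), add_zero]
  refine sgn_smul_single _ _ _ ?_ rfl rfl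
  linear_combination below (lo a) S * two_eq_zero

/-- `σ_a x_{a+1} - x_a σ_a`. -/
theorem act_hi (a : Fin (ht β - 1)) (S : Fin (ht β) → ZMod 2) (v : V) :
    act D V (.s a) (act D V (.x (hi a)) (single k S v)) -
      act D V (.x (lo a)) (act D V (.s a) (single k S v)) =
      sgn k (S (hi a) + cross a S) • single k (swapS a S)
        ((KLR.s D a * KLR.x D (hi a) - KLR.x D (lo a) * KLR.s D a) • v) := by
  rw [act_sx, act_xs, swapS_lo, add_comm (cross a S), ← smul_sub, ← map_sub, sub_smul]

/-- `x_{a+1} σ_a - σ_a x_a`. -/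
theorem act_lo (a : Fin (ht β - 1)) (S : Fin (ht β) → ZMod 2) (v : V) :
    act D V (.x (hi a)) (act D V (.s a) (single k S v)) -
      act D V (.s a) (act D V (.x (lo a)) (single k S v)) =
      sgn k (S (lo a) + cross a S) • single k (swapS a S)
        ((KLR.x D (hi a) * KLR.s D a - KLR.s D a * KLR.x D (lo a)) • v) := by
  rw [act_sx, act_xs, swapS_hi, add_comm (cross a S), ← smul_sub, ← map_sub, sub_smul]

theorem zmod_two_sq (x : ZMod 2) : x * x = x := by
  rcases zmod_two_cases x with rfl | rfl <;> decide

theorem swapS_braid (a b : Fin (ht β - 1)) (hab : (b : ℕ) = a + 1) (S : Fin (ht β) → ZMod 2) :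
    swapS a (swapS b (swapS a S)) = S ∘ Equiv.swap (lo a) (hi b) := by
  have h1 : lo b = hi a := by simp only [lo, hi, Fin.mk.injEq]; omega
  have h2 : lo a ≠ hi b := by simp only [lo, hi, ne_eq, Fin.mk.injEq]; omega
  have h3 : hi a ≠ hi b := by simp only [hi, ne_eq, Fin.mk.injEq]; omega
  have h4 : lo a ≠ hi a := lo_ne_hi a
  funext q
  by_cases q1 : q = lo a
  · rw [q1, Function.comp_apply, Equiv.swap_apply_left, swapS_lo, ← h1, swapS_lo,
      swapS_of_ne a S h2.symm h3.symm]
  by_cases q3 : q = hi b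
  · rw [q3, Function.comp_apply, Equiv.swap_apply_right, swapS_of_ne a _ h2.symm h3.symm, swapS_hi,
      h1, swapS_hi]
  rw [Function.comp_apply, Equiv.swap_apply_of_ne_of_ne q1 q3]
  by_cases q2 : q = hi a
  · rw [q2, swapS_hi, swapS_of_ne b _ (by rw [h1]; exact h4) h2, swapS_lo]
  rw [swapS_of_ne a _ q1 q2, swapS_of_ne b _ (by rw [h1]; exact q2) q3, swapS_of_ne a _ q1 q2]

theorem ne_fst {x y : I × ZMod 2} (h1 : x ≠ y) (h2 : x ≠ cJ y) : x.1 ≠ y.1 := by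
  intro h
  rcases x with ⟨i, a⟩
  rcases y with ⟨j, b⟩
  obtain rfl : i = j := h
  have h3 : a = b ∨ a = 1 - b := by
    rcases zmod_two_cases a with rfl | rfl <;> rcases zmod_two_cases b with rfl | rfl <;> decide
  rcases h3 with rfl | rfl
  · exact h1 rfl
  · exact h2 rfl

theorem act_rel (a b : FreeAlgebra k (GenC β)) (h : RelC D β a b) :
    FreeAlgebra.lift k (act D V) a = FreeAlgebra.lift k (act D V) b := by
  have Le : ∀ ν : JSeq β, FreeAlgebra.lift k (act D V) (FreeC.e k ν) = act D V (.e ν) := fun ν =>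
    FreeAlgebra.lift_ι_apply _ _
  have Lx : ∀ p : Fin (ht β), FreeAlgebra.lift k (act D V) (FreeC.x k p) = act D V (.x p) :=
    fun p => FreeAlgebra.lift_ι_apply _ _
  have Ls : ∀ a : Fin (ht β - 1), FreeAlgebra.lift k (act D V) (FreeC.s k a) = act D V (.s a) := fun a =>
    FreeAlgebra.lift_ι_apply _ _
  have Lc : ∀ p : Fin (ht β), FreeAlgebra.lift k (act D V) (FreeC.c k p) = act D V (.c p) := fun p =>
    FreeAlgebra.lift_ι_apply _ _
  have cross_eq : ∀ (a : Fin (ht β - 1)) (S : Fin (ht β) → ZMod 2), S (lo a) = S (hi a) →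
      S (hi a) + cross a S = 0 := by
    intro a S h
    rw [cross, h]
    rcases zmod_two_cases (S (hi a)) with h | h <;> rw [h] <;> decide
  have cross_conj : ∀ (a : Fin (ht β - 1)) (S : Fin (ht β) → ZMod 2), S (lo a) = S (hi a) + 1 →
      cross a S = 0 := by
    intro a S h
    rw [cross, h]
    rcases zmod_two_cases (S (hi a)) with h | h <;> rw [h] <;> decide
  cases h
  case sum_e =>
    simp only [map_sum, map_one, Le]
    exact sum_act_e
  all_goals simp only [map_mul, map_sub, map_neg, map_zero, map_one, D.map_Qt, D.map_dQt, Le, Lx, Ls, Lc]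
  case e_mul_self ν =>
    refine (ext_act_e fun v => ?_).trans (one_mul _)
    rw [act_e, smul_smul, KLR.e_mul_self]; rfl
  case e_mul_ne μ ν h =>
    rw [← zero_mul (act D V (.e ν))]
    refine ext_act_e fun v => ?_
    by_cases h2 : snd μ = snd ν
    · rw [← h2, act_e, smul_smul, KLR.e_mul_ne (fun h1 => h (ext_fst_snd h1 h2)), zero_smul,
        map_zero]; rfl
    · rw [act_e_ne h2]; rfl
  case x_e p ν =>
    refine hom_ext fun S v => ?_
    rw [Module.End.mul_apply, Module.End.mul_apply, act_x, act_sgn]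
    by_cases h : snd ν = S
    · subst h; rw [act_e, act_e, act_x, smul_smul, smul_smul, KLR.x_e]
    · rw [act_e_ne h, act_e_ne h, map_zero, smul_zero]
  case c_e p ν =>
    refine hom_ext fun S v => ?_
    rw [Module.End.mul_apply, Module.End.mul_apply, act_c, act_sgn]
    by_cases h : snd ν = S
    · subst h; rw [act_e, act_c, ← snd_flip, act_e, fst_flip]
    · rw [act_e_ne h, act_e_ne, map_zero, smul_zero]
      rw [snd_flip]
      exact fun h' => h (by rw [← toggle_toggle p (snd ν), h', toggle_toggle])
  case s_e a ν =>
    refine hom_ext fun S v => ?_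
    rw [Module.End.mul_apply, Module.End.mul_apply, act_s, act_sgn]
    by_cases h : snd ν = S
    · subst h; rw [act_e, act_s, ← snd_swap, act_e, fst_swap, smul_smul, smul_smul, KLR.s_e]
    · rw [act_e_ne h, act_e_ne, map_zero, smul_zero]
      rw [snd_swap]
      exact fun h' => h (by rw [← swapS_swapS a (snd ν), h', swapS_swapS])
  case x_x p q =>
    refine hom_ext fun S v => ?_
    rw [Module.End.mul_apply, Module.End.mul_apply, act_x, act_x, act_sgn, act_sgn, act_x, act_x,
      smul_comm, smul_smul (KLR.x D p), smul_smul (KLR.x D q), KLR.x_x]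
  case c_sq p =>
    refine hom_ext fun S v => ?_
    rw [Module.End.mul_apply, act_cc, toggle_toggle, below_toggle, if_neg (lt_irrefl p), add_zero,
      ← two_mul, two_eq_zero, zero_mul, sgn_zero, one_smul]; rfl
  case c_c p q hpq =>
    refine hom_ext fun S v => ?_
    rw [Module.End.mul_apply, LinearMap.neg_apply, Module.End.mul_apply, act_cc, act_cc,
      ← neg_smul, ← mul_neg_one, ← sgn_one, ← sgn_add]
    refine sgn_smul_single _ _ _ ?_ (toggle_comm _ _ _) rfl
    rw [below_toggle, below_toggle]
    rcases lt_or_gt_of_ne hpq with h | h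
    · rw [if_pos h, if_neg (not_lt.2 h.le)]
      linear_combination (-1) * two_eq_zero
    · rw [if_pos h, if_neg (not_lt.2 h.le)]
      ring
  case c_x_self p =>
    refine hom_ext fun S v => ?_
    rw [Module.End.mul_apply, LinearMap.neg_apply, Module.End.mul_apply, act_x, act_c, act_sgn,
      act_sgn, act_c, act_x, toggle_same, smul_smul, smul_smul, ← neg_smul, ← mul_neg_one,
      ← sgn_one, ← sgn_add, ← sgn_add, ← sgn_add]
    refine sgn_smul_single _ _ _ ?_ rfl rfl
    linear_combination (-1) * two_eq_zero
  case c_x p q hpq =>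
    refine hom_ext fun S v => ?_
    rw [Module.End.mul_apply, Module.End.mul_apply, act_x, act_c, act_sgn,
      act_sgn, act_c, act_x, toggle_ne hpq.symm, smul_comm]
  case s_c a p =>
    refine hom_ext fun S v => ?_
    rw [Module.End.mul_apply, Module.End.mul_apply, act_s, act_c, act_sgn,
      act_sgn, act_c, act_s, smul_smul, smul_smul, ← sgn_add, ← sgn_add]
    exact sgn_smul_single _ _ _ (below_cross a p S) (swapS_toggle a p S) rfl
  case s_x a p h1 h2 =>
    refine hom_ext fun S v => ?_
    rw [Module.End.mul_apply, Module.End.mul_apply, act_sx, act_xs, swapS_of_ne a S h1 h2,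
      add_comm (S p), KLR.s_x h1 h2]
  case s_hi_eq a ν h =>
    refine (ext_act_e fun v => ?_).trans (one_mul _)
    have h2 : snd ν (lo a) = snd ν (hi a) := congrArg Prod.snd h
    have := KLR.π_rel (RelR.s_hi_eq (D := D) a (fst ν) (congrArg Prod.fst h))
    simp only [map_mul, map_sub, KLR.π_e, KLR.π_x, KLR.π_s] at this
    rw [LinearMap.sub_apply, Module.End.mul_apply, Module.End.mul_apply, act_hi, smul_smul, this,
      cross_eq a _ h2, sgn_zero, one_smul, swapS_eq a h2]; rfl
  case s_hi_conj a ν h =>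
    rw [← neg_mul]
    refine ext_act_e fun v => ?_
    have h2 : snd ν (lo a) = snd ν (hi a) + 1 := (congrArg Prod.snd h).trans (cJ_snd _)
    have := KLR.π_rel (RelR.s_hi_eq (D := D) a (fst ν) ((congrArg Prod.fst h).trans rfl))
    simp only [map_mul, map_sub, KLR.π_e, KLR.π_x, KLR.π_s] at this
    rw [LinearMap.sub_apply, Module.End.mul_apply, Module.End.mul_apply, act_hi, smul_smul, this,
      LinearMap.neg_apply, Module.End.mul_apply, act_c_lo_hi, h2, sgn_add (snd ν (hi a)) 1, sgn_one, mul_neg_one,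
      neg_smul, neg_neg, cross_conj a _ h2, add_zero, swapS_conj a h2]
  case s_hi_ne a ν h1 h2 =>
    rw [← zero_mul (act D V (.e ν))]
    refine ext_act_e fun v => ?_
    have := KLR.π_rel (RelR.s_hi_ne (D := D) a (fst ν) (ne_fst h1 h2))
    simp only [map_mul, map_sub, map_zero, KLR.π_e, KLR.π_x, KLR.π_s] at this
    rw [LinearMap.sub_apply, Module.End.mul_apply, Module.End.mul_apply, act_hi, smul_smul, this,
      zero_smul, map_zero, smul_zero]; rfl
  case s_lo_eq a ν h =>
    refine (ext_act_e fun v => ?_).trans (one_mul _)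
    have h2 : snd ν (lo a) = snd ν (hi a) := congrArg Prod.snd h
    have := KLR.π_rel (RelR.s_lo_eq (D := D) a (fst ν) (congrArg Prod.fst h))
    simp only [map_mul, map_sub, KLR.π_e, KLR.π_x, KLR.π_s] at this
    rw [LinearMap.sub_apply, Module.End.mul_apply, Module.End.mul_apply, act_lo, smul_smul, this, h2,
      cross_eq a _ h2, sgn_zero, one_smul, swapS_eq a h2]; rfl
  case s_lo_conj a ν h =>
    refine ext_act_e fun v => ?_
    have h2 : snd ν (lo a) = snd ν (hi a) + 1 := (congrArg Prod.snd h).trans (cJ_snd _)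
    have := KLR.π_rel (RelR.s_lo_eq (D := D) a (fst ν) ((congrArg Prod.fst h).trans rfl))
    simp only [map_mul, map_sub, KLR.π_e, KLR.π_x, KLR.π_s] at this
    rw [LinearMap.sub_apply, Module.End.mul_apply, Module.End.mul_apply, act_lo, smul_smul, this,
      Module.End.mul_apply, act_c_lo_hi, cross_conj a _ h2, add_zero, swapS_conj a h2]
  case s_lo_ne a ν h1 h2 =>
    rw [← zero_mul (act D V (.e ν))]
    refine ext_act_e fun v => ?_
    have := KLR.π_rel (RelR.s_lo_ne (D := D) a (fst ν) (ne_fst h1 h2))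
    simp only [map_mul, map_sub, map_zero, KLR.π_e, KLR.π_x, KLR.π_s] at this
    rw [LinearMap.sub_apply, Module.End.mul_apply, Module.End.mul_apply, act_lo, smul_smul, this,
      zero_smul, map_zero, smul_zero]; rfl
  case s_sq a ν =>
    refine ext_act_e fun v => ?_
    have := KLR.π_rel (RelR.s_sq (D := D) a (fst ν))
    simp only [map_mul, D.map_Q, KLR.π_e, KLR.π_x, KLR.π_s] at this
    rw [Module.End.mul_apply, act_ss, Qt_act _ _ _ _ _ rfl rfl, cross_swapS, swapS_swapS, sgn_add,
      sgn_mul_self, one_smul, smul_smul, smul_smul, this, smul_smul]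
    rfl
  case s_s a b hab =>
    refine hom_ext fun S v => ?_
    have h1 : lo a ≠ lo b ∧ lo a ≠ hi b ∧ hi a ≠ lo b ∧ hi a ≠ hi b := by
      simp only [lo, hi, ne_eq, Fin.mk.injEq]; omega
    obtain ⟨h1, h2, h3, h4⟩ := h1
    rw [Module.End.mul_apply, Module.End.mul_apply, act_ss, act_ss, smul_smul (KLR.s D a),
      smul_smul (KLR.s D b), KLR.s_s hab]
    refine sgn_smul_single _ _ _ ?_ ?_ rfl
    · simp only [cross, swapS_of_ne b S h1 h2, swapS_of_ne b S h3 h4, swapS_of_ne a S h1.symm h3.symm,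
        swapS_of_ne a S h2.symm h4.symm]
      ring
    · funext q
      by_cases q1 : q = lo a
      · rw [q1, swapS_lo, swapS_of_ne b _ h3 h4, swapS_of_ne b _ h1 h2, swapS_lo]
      by_cases q2 : q = hi a
      · rw [q2, swapS_hi, swapS_of_ne b _ h1 h2, swapS_of_ne b _ h3 h4, swapS_hi]
      rw [swapS_of_ne a _ q1 q2]
      by_cases q3 : q = lo b
      · rw [q3, swapS_lo, swapS_lo, swapS_of_ne a _ h2.symm h4.symm]
      by_cases q4 : q = hi b
      · rw [q4, swapS_hi, swapS_hi, swapS_of_ne a _ h1.symm h3.symm]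
      rw [swapS_of_ne b _ q3 q4, swapS_of_ne b _ q3 q4, swapS_of_ne a _ q1 q2]
  case braid_eq a b ν hab h =>
    refine ext_act_e fun v => ?_
    have h2 : snd ν (lo a) = snd ν (hi b) := congrArg Prod.snd h
    have := KLR.π_rel (RelR.braid_eq (D := D) a b (fst ν) hab (congrArg Prod.fst h))
    simp only [map_mul, map_sub, D.map_dQ, KLR.π_e, KLR.π_x, KLR.π_s] at this
    rw [act_braid a b hab, dQt_act _ _ _ _ _ _ h2 rfl rfl, smul_smul, this, smul_smul,
      swapS_braid a b hab]
    refine sgn_smul_single _ _ _ ?_ ?_ rfl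
    · change _ = snd ν (lo a)
      rw [← h2]
      rcases zmod_two_cases (snd ν (lo a)) with h | h <;> rw [h] <;>
        rcases zmod_two_cases (snd ν (hi a)) with h | h <;> rw [h] <;> decide
    · funext q
      by_cases q1 : q = lo a
      · rw [q1, Function.comp_apply, Equiv.swap_apply_left, h2]
      by_cases q2 : q = hi b
      · rw [q2, Function.comp_apply, Equiv.swap_apply_right, h2]
      rw [Function.comp_apply, Equiv.swap_apply_of_ne_of_ne q1 q2]
  case braid_conj a b ν hab h =>
    refine ext_act_e fun v => ?_
    have h1 : lo a < hi b := by simp only [lo, hi, Fin.mk_lt_mk]; omega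
    have h1' : lo b = hi a := by simp only [lo, hi, Fin.mk.injEq]; omega
    have h2 : snd ν (lo a) = snd ν (hi b) + 1 := (congrArg Prod.snd h).trans (cJ_snd _)
    have h2' : snd ν (hi b) = snd ν (lo a) + 1 := by
      rw [h2]; linear_combination (-1) * two_eq_zero
    have := KLR.π_rel (RelR.braid_eq (D := D) a b (fst ν) hab ((congrArg Prod.fst h).trans rfl))
    simp only [map_mul, map_sub, D.map_dQ, KLR.π_e, KLR.π_x, KLR.π_s] at this
    rw [act_braid a b hab, Module.End.mul_apply, Module.End.mul_apply, act_cc,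
      LinearMap.map_smul, dQt_act_neg _ _ _ _ _ _ _ _ _, smul_smul, this, smul_smul, smul_smul, ← sgn_add,
      swapS_braid a b hab]
    · refine sgn_smul_single _ _ _ ?_ ?_ rfl
      · change _ = _ + snd ν (lo a)
        rw [below_toggle, if_neg (not_lt.2 h1.le), below_hi b, h1', below_hi a, h2']
        generalize snd ν (lo a) = x
        generalize snd ν (hi a) = y
        generalize below (lo a) (snd ν) = z
        linear_combination (x * y - z) * two_eq_zero + zmod_two_sq x
      · funext q
        by_cases q1 : q = lo a
        · rw [q1, Function.comp_apply, Equiv.swap_apply_left, toggle_same, toggle_ne h1.ne, h2']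
        by_cases q2 : q = hi b
        · rw [q2, Function.comp_apply, Equiv.swap_apply_right, toggle_ne h1.ne', toggle_same, h2]
        rw [Function.comp_apply, Equiv.swap_apply_of_ne_of_ne q1 q2, toggle_ne q1, toggle_ne q2]
    · rw [toggle_ne h1.ne', toggle_same]; exact h2
    · rw [toggle_same, toggle_ne h1.ne, add_assoc, show (1 : ZMod 2) + 1 = 0 by decide, add_zero]; rfl
    · rw [toggle_ne (lo_ne_hi a).symm, toggle_ne]
      · rfl
      · simp only [hi, ne_eq, Fin.mk.injEq]; omega
  case braid_ne a b ν hab h1 h2 =>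
    rw [← zero_mul (act D V (.e ν))]
    refine ext_act_e fun v => ?_
    have := KLR.π_rel (RelR.braid_ne (D := D) a b (fst ν) hab (ne_fst h1 h2))
    simp only [map_mul, map_sub, map_zero, KLR.π_e, KLR.π_s] at this
    rw [act_braid a b hab, smul_smul, this, zero_smul, map_zero, smul_zero]; rfl

end Cl

end Cl

/-! ### Morita equivalence -/

section Clifford

variable {k : Type u} [Field k] {A : Type w} [Ring A] [Algebra k A]

/-- `∏ c_p^{S_p}`. -/
def clProd {n : ℕ} (c : Fin n → A) (S : Fin n → ZMod 2) : A :=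
  (List.ofFn fun p => c p ^ (S p).val).prod

theorem clProd_zero {n : ℕ} (c : Fin n → A) : clProd c 0 = 1 := by
  simp [clProd, List.ofFn_const]

theorem below_succ {n : ℕ} (p : Fin n) (S : Fin (n + 1) → ZMod 2) :
    below p.succ S = S 0 + below p (fun q => S q.succ) := by
  simp [below, Fin.sum_univ_succ]

variable (k) in
theorem mul_clProd {n : ℕ} (c : Fin n → A) (h1 : ∀ p, c p * c p = 1)
    (h2 : ∀ p q, p ≠ q → c p * c q = -(c q * c p)) (p : Fin n) (S : Fin n → ZMod 2) :
    c p * clProd c S = sgn k (below p S) • clProd c (toggle p S) := by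
  induction n with
  | zero => exact p.elim0
  | succ n ih =>
    have hS : ∀ S : Fin (n + 1) → ZMod 2, clProd c S =
        c 0 ^ (S 0).val * clProd (fun q => c q.succ) (fun q => S q.succ) := by
      intro S; simp [clProd, List.ofFn_succ]
    rw [hS, hS]
    induction p using Fin.cases with
    | zero =>
      have h3 : (fun q : Fin n => toggle 0 S q.succ) = fun q => S q.succ :=
        funext fun q => toggle_ne (Fin.succ_ne_zero q) S
      have h4 : below 0 S = 0 := by simp [below]
      rw [h3, h4, sgn_zero, one_smul, toggle_same, ← mul_assoc]
      congr 1
      rcases zmod_two_cases (S 0) with h | h <;> rw [h]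
      · simp [ZMod.val_one]
      · rw [show (1 : ZMod 2) + 1 = 0 by decide]
        simp [ZMod.val_one, h1]
    | succ p =>
      have h3 : (fun q : Fin n => toggle p.succ S q.succ) = toggle p fun q => S q.succ := by
        funext q
        by_cases h : q = p
        · rw [h, toggle_same, toggle_same]
        · rw [toggle_ne h, toggle_ne (fun h' => h (Fin.succ_injective _ h'))]
      have h4 := ih (fun q => c q.succ) (fun q => h1 _)
        (fun p q h => h2 _ _ fun h' => h (Fin.succ_injective _ h')) p (fun q => S q.succ)
      have h5 : c p.succ * c 0 ^ (S 0).val = sgn k (S 0) • (c 0 ^ (S 0).val * c p.succ) := by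
        rcases zmod_two_cases (S 0) with h | h <;> rw [h]
        · simp
        · simp [ZMod.val_one, h2 _ _ (Fin.succ_ne_zero p)]
      rw [h3, toggle_ne (Fin.succ_ne_zero p).symm, below_succ, sgn_add, ← mul_assoc, h5,
        smul_mul_assoc, mul_assoc, h4, mul_smul_comm, smul_smul]

end Clifford

section Morita

variable {k : Type u} [Field k] {I : Type v} {D : Datum k I} {β : I →₀ ℕ}

namespace RC

theorem c_sq (p : Fin (ht β)) : c D p * c D p = 1 := by
  simpa using π_rel (RelC.c_sq (D := D) p)
theorem c_c {p q : Fin (ht β)} (h : p ≠ q) : c D p * c D q = -(c D q * c D p) := by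
  simpa using π_rel (RelC.c_c (D := D) p q h)
theorem c_x_self (p : Fin (ht β)) : c D p * x D p = -(x D p * c D p) := by
  simpa using π_rel (RelC.c_x_self (D := D) p)
theorem c_x {p q : Fin (ht β)} (h : p ≠ q) : c D p * x D q = x D q * c D p := by
  simpa using π_rel (RelC.c_x (D := D) p q h)
theorem s_c (a : Fin (ht β - 1)) (p : Fin (ht β)) :
    s D a * c D p = c D (Equiv.swap (lo a) (hi a) p) * s D a := by
  simpa using π_rel (RelC.s_c (D := D) a p)

theorem flip_flip (p : Fin (ht β)) (ν : JSeq β) : (ν.flip p).flip p = ν :=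
  Cl.ext_fst_snd (by rw [Cl.fst_flip, Cl.fst_flip]) (by rw [Cl.snd_flip, Cl.snd_flip, toggle_toggle])

theorem e_c (p : Fin (ht β)) (ν : JSeq β) : e D ν * c D p = c D p * e D (ν.flip p) := by
  rw [c_e, flip_flip]

variable (D) in
/-- `∏ 𝔠_p^{S_p}`. -/
def C (S : Fin (ht β) → ZMod 2) : RC D β := clProd (c D) S

theorem C_zero : C D (β := β) 0 = 1 := clProd_zero _

theorem c_mul_C (p : Fin (ht β)) (S : Fin (ht β) → ZMod 2) :
    c D p * C D S = sgn k (below p S) • C D (toggle p S) :=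
  mul_clProd k (c D) c_sq (fun _ _ h => c_c h) p S

theorem C_toggle (p : Fin (ht β)) (S : Fin (ht β) → ZMod 2) :
    C D (toggle p S) = sgn k (below p S) • (c D p * C D S) := by
  rw [c_mul_C, sgn_smul_sgn_smul]

theorem x_mul_C (p : Fin (ht β)) (S : Fin (ht β) → ZMod 2) :
    x D p * C D S = sgn k (S p) • (C D S * x D p) := by
  induction S using toggle_induction with
  | h0 => rw [C_zero, Pi.zero_apply, sgn_zero, one_smul, one_mul, mul_one]
  | h1 q S ih =>
    rw [C_toggle, mul_smul_comm, smul_mul_assoc, smul_comm]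
    congr 1
    by_cases h : p = q
    · subst h
      rw [← mul_assoc, ← neg_neg (x D p * c D p), ← c_x_self, neg_mul, mul_assoc, ih, toggle_same,
        sgn_add, sgn_one, mul_neg_one, neg_smul, mul_smul_comm, mul_assoc]
    · rw [← mul_assoc, ← c_x (Ne.symm h), mul_assoc, ih, toggle_ne h, mul_smul_comm, mul_assoc]

theorem s_mul_C (a : Fin (ht β - 1)) (S : Fin (ht β) → ZMod 2) :
    s D a * C D S = sgn k (cross a S) • (C D (swapS a S) * s D a) := by
  induction S using toggle_induction with
  | h0 => rw [show swapS a (0 : Fin (ht β) → ZMod 2) = 0 from rfl, C_zero, cross, Pi.zero_apply,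
      zero_mul, sgn_zero, one_smul, one_mul, mul_one]
  | h1 q S ih =>
    rw [C_toggle, mul_smul_comm, ← mul_assoc, s_c, mul_assoc, ih, mul_smul_comm, ← mul_assoc,
      c_mul_C, ← swapS_toggle, smul_mul_assoc, smul_smul, smul_smul, ← sgn_add, ← sgn_add]
    congr 2
    linear_combination -below_cross a q S + below q S * Cl.two_eq_zero

theorem flip_pair (p : Fin (ht β)) (ν : ISeq β) (T : Fin (ht β) → ZMod 2) :
    (Cl.pair ν T).flip p = Cl.pair ν (toggle p T) :=
  Cl.ext_fst_snd (Cl.fst_flip _ _) (Cl.snd_flip _ _)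

theorem e_mul_C (ν : ISeq β) (T S : Fin (ht β) → ZMod 2) :
    e D (Cl.pair ν T) * C D S = C D S * e D (Cl.pair ν (T + S)) := by
  induction S using toggle_induction generalizing T with
  | h0 => rw [C_zero, one_mul, mul_one, add_zero]
  | h1 q S ih =>
    rw [C_toggle, mul_smul_comm, smul_mul_assoc, ← mul_assoc, e_c, flip_pair, mul_assoc, ih,
      ← mul_assoc, toggle, toggle, add_right_comm, add_assoc T]

theorem e_mul_edag_ne {ν : ISeq β} {T : Fin (ht β) → ZMod 2} (h : T ≠ 0) :
    e D (Cl.pair ν T) * edag D β = 0 := by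
  rw [edag, Finset.mul_sum]
  refine Finset.sum_eq_zero fun μ _ => e_mul_ne fun h' => h ?_
  exact congrArg Cl.snd h'

theorem e_dag_edag (ν : ISeq β) : e D (Cl.pair ν 0) * edag D β = e D (Cl.pair ν 0) :=
  e_mul_edag ν

end RC

section Modules

variable {V : Type w₁} [AddCommGroup V] [Module (RC D β) V] {W : Type w₂} [AddCommGroup W]
  [Module (RC D β) W]

theorem sum_e_smul (v : V) : ∑ μ : JSeq β, RC.e D μ • v = v := by
  rw [← Finset.sum_smul, RC.sum_e, one_smul]

theorem c_c_smul (p : Fin (ht β)) (v : V) : RC.c D p • RC.c D p • v = v := by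
  rw [smul_smul, RC.c_sq, one_smul]

variable (D β) in
theorem eq_top_of_edag [Module k V] [IsScalarTower k (RC D β) V] {U : Submodule k V} (h : ∀ v : V, edag D β • v = v → v ∈ U)
    (hc : ∀ (p : Fin (ht β)), ∀ v ∈ U, RC.c D p • v ∈ U) : U = ⊤ := by
  rw [eq_top_iff]
  intro v _
  have key : ∀ (T : Fin (ht β) → ZMod 2) (ν : ISeq β) (v : V), RC.e D (Cl.pair ν T) • v ∈ U := by
    intro T
    induction T using toggle_induction with
    | h0 =>
      intro ν v
      exact h _ (by rw [smul_smul]; exact congrArg (· • v) (edag_mul_e ν))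
    | h1 p T ih =>
      intro ν v
      have := hc p _ (ih ν (RC.c D p • v))
      rwa [smul_smul (RC.e D _), RC.e_c, RC.flip_pair, mul_smul, c_c_smul] at this
  rw [← sum_e_smul (D := D) (β := β) v]
  exact Submodule.sum_mem _ fun μ _ => key (Cl.snd μ) (Cl.fst μ) v

theorem eq_of_edag [Module k V] [IsScalarTower k (RC D β) V] {f g : V →ₗ[RC D β] W} (h : ∀ v, edag D β • v = v → f v = g v) :
    f = g := by
  have : (LinearMap.eqLocus f g).restrictScalars k = ⊤ :=
    eq_top_of_edag D β h fun p v hv => Submodule.smul_mem (LinearMap.eqLocus f g) _ hv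
  refine LinearMap.ext fun v => ?_
  exact (this ▸ Submodule.mem_top : v ∈ (LinearMap.eqLocus f g).restrictScalars k)

theorem surjective_of_edag [Module k W] [IsScalarTower k (RC D β) W] {f : V →ₗ[RC D β] W}
    (h : ∀ w, edag D β • w = w → w ∈ LinearMap.range f) : Function.Surjective f := by
  have : (LinearMap.range f).restrictScalars k = ⊤ :=
    eq_top_of_edag D β h fun p v hv => Submodule.smul_mem (LinearMap.range f) _ hv
  intro w
  exact (this ▸ Submodule.mem_top : w ∈ (LinearMap.range f).restrictScalars k)

theorem injective_of_edag {f : V →ₗ[RC D β] W} (h : ∀ v, edag D β • v = v → f v = 0 → v = 0) :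
    Function.Injective f := by
  have key : ∀ (T : Fin (ht β) → ZMod 2) (ν : ISeq β) (v : V), f v = 0 →
      RC.e D (Cl.pair ν T) • v = 0 := by
    intro T
    induction T using toggle_induction with
    | h0 =>
      intro ν v hv
      refine h _ ?_ (by rw [map_smul, hv, smul_zero])
      rw [smul_smul]; exact congrArg (· • v) (edag_mul_e ν)
    | h1 p T ih =>
      intro ν v hv
      have := ih ν (RC.c D p • v) (by rw [map_smul, hv, smul_zero])
      rw [smul_smul, RC.e_c, RC.flip_pair, mul_smul] at this
      rw [← c_c_smul (D := D) p (RC.e D _ • v), this, smul_zero]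
  rw [injective_iff_map_eq_zero]
  intro v hv
  rw [← sum_e_smul (D := D) (β := β) v]
  exact Finset.sum_eq_zero fun μ _ => key (Cl.snd μ) (Cl.fst μ) v hv

end Modules

namespace Cl

variable {V : Type w} [AddCommGroup V] [Module k V] [Module (KLR D β) V]
  [IsScalarTower k (KLR D β) V]

theorem add_self {n : ℕ} (S : Fin n → ZMod 2) : S + S = 0 :=
  funext fun p => by rw [Pi.add_apply, ← two_mul, two_eq_zero, zero_mul]; rfl

instance : Module (RC D β) (Cl β V) :=
  Module.compHom (Cl β V) (RC.lift (act D V) act_rel).toRingHom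

instance : IsScalarTower k (RC D β) (Cl β V) where
  smul_assoc r a u := by
    change RC.lift (act D V) act_rel (r • a) u = r • RC.lift (act D V) act_rel a u
    rw [map_smul]; rfl

theorem gen_smul (g : GenC β) (y : Cl β V) : RC.gen D g • y = act D V g y := by
  change RC.lift (act D V) act_rel (RC.gen D g) y = _
  rw [RC.lift_gen]

theorem edag_single_zero (v : V) : edag D β • single k (β := β) 0 v = single k 0 v := by
  rw [edag, Finset.sum_smul]
  refine (Finset.sum_congr rfl fun ν _ => (gen_smul (.e ν.dag) _).trans (act_e ν.dag v)).trans ?_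
  refine (map_sum (single k (0 : Fin (ht β) → ZMod 2)) (fun ν : ISeq β => KLR.e D ν • v) _).symm.trans ?_
  rw [← Finset.sum_smul, KLR.sum_e, one_smul]

theorem edag_single_ne {S : Fin (ht β) → ZMod 2} (hS : S ≠ 0) (v : V) :
    edag D β • single k S v = 0 := by
  rw [edag, Finset.sum_smul]
  exact Finset.sum_eq_zero fun ν _ => (gen_smul (.e ν.dag) _).trans
    (act_e_ne (μ := ν.dag) (fun h => hS h.symm) v)

variable (D) in
theorem exists_single_zero {y : Cl β V} (h : edag D β • y = y) : ∃ v, y = single k 0 v := by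
  have key : ∀ y : Cl β V, ∃ v, edag D β • y = single k 0 v := by
    intro y
    induction y using Finsupp.induction_linear with
    | zero => exact ⟨0, by rw [map_zero]; exact smul_zero (A := Cl β V) _⟩
    | add f g hf hg =>
      obtain ⟨a, ha⟩ := hf
      obtain ⟨b, hb⟩ := hg
      exact ⟨a + b, (smul_add (A := Cl β V) (edag D β) f g).trans (by rw [map_add, ← ha, ← hb])⟩
    | single S v =>
      by_cases hS : S = 0
      · subst hS; exact ⟨v, edag_single_zero v⟩
      · exact ⟨0, (edag_single_ne hS v).trans (map_zero _).symm⟩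
  obtain ⟨v, hv⟩ := key y
  exact ⟨v, h.symm.trans hv⟩

end Cl

section IsF

variable {V' : Type w₁} [AddCommGroup V'] [Module k V'] [Module (KLR D β) V'] {V : Type w₂} [AddCommGroup V] [Module k V] [Module (RC D β) V]
  [IsScalarTower k (RC D β) V]

/-- `ι` is a homomorphism to `F(V)`. -/
structure IsFHom (ι : V' →ₗ[k] V) : Prop where
  edag_smul : ∀ u, edag D β • ι u = ι u
  gen_smul : ∀ (g : GenR β) u, ι (KLR.gen D g • u) = genF D g • ι u

/-- `ι` is an isomorphism to `F(V)`. -/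
structure IsF (ι : V' →ₗ[k] V) : Prop extends IsFHom (D := D) (β := β) ι where
  injective : Function.Injective ι
  exists_eq : ∀ v, edag D β • v = v → ∃ u, ι u = v

/-- `𝔠^S u ↦ 𝔠^S ι(u)`. -/
def Cl.ofHomK (D : Datum k I) (β : I →₀ ℕ) {V' : Type w₁} [AddCommGroup V'] [Module k V'] {V : Type w₂} [AddCommGroup V]
    [Module k V] [Module (RC D β) V] [IsScalarTower k (RC D β) V] (ι : V' →ₗ[k] V) :
    Cl β V' →ₗ[k] V :=
  Cl.desc fun S => Algebra.lsmul k k V (RC.C D S) ∘ₗ ι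

theorem Cl.ofHomK_single {V' : Type w₁} [AddCommGroup V'] [Module k V'] {V : Type w₂}
    [AddCommGroup V] [Module k V] [Module (RC D β) V] [IsScalarTower k (RC D β) V] (ι : V' →ₗ[k] V) (S : Fin (ht β) → ZMod 2) (u : V') :
    Cl.ofHomK D β ι (Cl.single k S u) = RC.C D S • ι u := Cl.desc_single _ _ _

theorem IsF.hom_ext {ι : V' →ₗ[k] V} (hι : IsF (D := D) (β := β) ι) {W : Type w₃} [AddCommGroup W]
    [Module (RC D β) W] {f g : V →ₗ[RC D β] W} (h : ∀ u, f (ι u) = g (ι u)) : f = g :=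
  eq_of_edag fun v hv => by
    obtain ⟨u, rfl⟩ := hι.exists_eq v hv
    exact h u

variable [IsScalarTower k (KLR D β) V']

/-- The homomorphism `𝔠^S u ↦ 𝔠^S ι(u)`. -/
def Cl.ofHom {ι : V' →ₗ[k] V} (hι : IsFHom (D := D) (β := β) ι) : Cl β V' →ₗ[RC D β] V :=
  RC.linOfGen (Cl.ofHomK D β ι) fun g y => by
    rw [Cl.gen_smul]
    change (Cl.ofHomK D β ι ∘ₗ Cl.act D V' g) y = (Algebra.lsmul k k V (RC.gen D g) ∘ₗ Cl.ofHomK D β ι) y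
    congr 1
    refine Cl.hom_ext fun S v => ?_
    rw [LinearMap.comp_apply, LinearMap.comp_apply]
    change _ = RC.gen D g • Cl.ofHomK D β ι (Cl.single k S v)
    rw [Cl.ofHomK_single, smul_smul]
    cases g with
    | e μ =>
      change _ = (RC.e D (Cl.pair (Cl.fst μ) (Cl.snd μ)) * _) • _
      rw [RC.e_mul_C, ← hι.edag_smul, mul_smul, smul_smul (RC.e D _)]
      by_cases h : Cl.snd μ = S
      · subst h
        rw [Cl.act_e, Cl.ofHomK_single, show Cl.snd μ + Cl.snd μ = 0 from Cl.add_self _,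
          RC.e_dag_edag]
        exact congrArg _ (hι.gen_smul (.e (Cl.fst μ)) v)
      · rw [Cl.act_e_ne h, map_zero, RC.e_mul_edag_ne, zero_smul, smul_zero]
        intro h'
        exact h (by rw [← add_zero (Cl.snd μ), ← Cl.add_self S, ← add_assoc, h', zero_add])
    | x p =>
      rw [Cl.act_x, map_smul, Cl.ofHomK_single]
      refine Eq.trans ?_ (congrArg (· • ι v) (RC.x_mul_C p S).symm)
      rw [smul_assoc, mul_smul]
      exact congrArg (fun z => sgn k (S p) • RC.C D S • z) (hι.gen_smul (.x p) v)
    | s a =>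
      rw [Cl.act_s, map_smul, Cl.ofHomK_single]
      refine Eq.trans ?_ (congrArg (· • ι v) (RC.s_mul_C a S).symm)
      rw [smul_assoc, mul_smul]
      exact congrArg (fun z => sgn k (cross a S) • RC.C D (swapS a S) • z) (hι.gen_smul (.s a) v)
    | c p =>
      rw [Cl.act_c, map_smul, Cl.ofHomK_single]
      refine Eq.trans ?_ (congrArg (· • ι v) (RC.c_mul_C p S).symm)
      rw [smul_assoc]

theorem Cl.ofHom_single {ι : V' →ₗ[k] V} (hι : IsFHom (D := D) (β := β) ι)
    (S : Fin (ht β) → ZMod 2) (u : V') :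
    Cl.ofHom hι (Cl.single k S u) = RC.C D S • ι u := Cl.ofHomK_single ι S u

theorem Cl.ofHom_single_zero {ι : V' →ₗ[k] V} (hι : IsFHom (D := D) (β := β) ι) (u : V') :
    Cl.ofHom hι (Cl.single k 0 u) = ι u := by
  rw [Cl.ofHom_single, RC.C_zero, one_smul]

theorem Cl.ofHom_injective {ι : V' →ₗ[k] V} (hι : IsFHom (D := D) (β := β) ι)
    (h : Function.Injective ι) : Function.Injective (Cl.ofHom hι) := by
  refine injective_of_edag (D := D) fun y hy h0 => ?_
  obtain ⟨v, rfl⟩ := Cl.exists_single_zero D hy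
  rw [Cl.ofHom_single_zero] at h0
  rw [(injective_iff_map_eq_zero ι).1 h v h0, map_zero]

namespace IsF

variable {ι : V' →ₗ[k] V}

/-- The isomorphism `𝔠^S u ↦ 𝔠^S ι(u)`. -/
def equiv (hι : IsF (D := D) (β := β) ι) : Cl β V' ≃ₗ[RC D β] V :=
  LinearEquiv.ofBijective (Cl.ofHom hι.toIsFHom) ⟨Cl.ofHom_injective _ hι.injective,
    surjective_of_edag fun w hw => by
      obtain ⟨u, rfl⟩ := hι.exists_eq w hw
      exact ⟨Cl.single k 0 u, Cl.ofHom_single_zero _ u⟩⟩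

theorem equiv_symm_apply (hι : IsF (D := D) (β := β) ι) (u : V') : hι.equiv.symm (ι u) = Cl.single k 0 u := by
  rw [LinearEquiv.symm_apply_eq]
  exact (Cl.ofHom_single_zero hι.toIsFHom u).symm

variable {W' : Type w₃} [AddCommGroup W'] [Module k W'] [Module (KLR D β) W']
  [IsScalarTower k (KLR D β) W'] {W : Type w₄} [AddCommGroup W] [Module k W] [Module (RC D β) W]
  [IsScalarTower k (RC D β) W]

theorem exists_ext (hι : IsF (D := D) (β := β) ι) {κ : W' →ₗ[k] W} (hκ : IsFHom (D := D) (β := β) κ) (f : V' →ₗ[KLR D β] W') :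
    ∃ g : V →ₗ[RC D β] W, ∀ u, g (ι u) = κ (f u) := by
  have h : IsFHom (D := D) (β := β) (κ ∘ₗ f.restrictScalars k) :=
    ⟨fun u => hκ.edag_smul (f u), fun g u => (congrArg κ (map_smul f _ u)).trans (hκ.gen_smul g _)⟩
  refine ⟨Cl.ofHom h ∘ₗ hι.equiv.symm.toLinearMap, fun u => ?_⟩
  rw [LinearMap.comp_apply]
  change Cl.ofHom h (hι.equiv.symm (ι u)) = _
  rw [hι.equiv_symm_apply, Cl.ofHom_single_zero]
  rfl

end IsF

end IsF

end Morita

/-! ### Parities -/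

section Parity

variable {k : Type u} [Field k] {I : Type v} {D : Datum k I} {β : I →₀ ℕ}

namespace SMod

variable (M : SMod.{u, v, w} D β)

/-- The projection to the elements of parity `i`. -/
def proj (i : ZMod 2) : Module.End k M.V :=
  if i = 0 then Submodule.projection (M.par 0) (M.par 1) M.compl
  else Submodule.projection (M.par 1) (M.par 0) M.compl.symm

/-- The parity involution. -/
def Θ : Module.End k M.V := M.proj 0 - M.proj 1

variable {M}

theorem proj_add (u : M.V) : M.proj 0 u + M.proj 1 u = u :=
  Submodule.projection_add_projection_eq_self M.compl u

theorem proj_mem (i : ZMod 2) (u : M.V) : M.proj i u ∈ M.par i := by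
  rcases zmod_two_cases i with rfl | rfl
  · exact Submodule.projection_apply_mem M.compl u
  · exact Submodule.projection_apply_mem M.compl.symm u

theorem proj_of_mem {i : ZMod 2} {u : M.V} (hu : u ∈ M.par i) (j : ZMod 2) :
    M.proj j u = if j = i then u else 0 := by
  rcases zmod_two_cases i with rfl | rfl <;> rcases zmod_two_cases j with rfl | rfl
  · exact Submodule.projection_apply_of_mem_left M.compl hu
  · exact Submodule.projection_apply_of_mem_right M.compl.symm hu
  · exact Submodule.projection_apply_of_mem_right M.compl hu
  · exact Submodule.projection_apply_of_mem_left M.compl.symm hu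

theorem Θ_of_mem {i : ZMod 2} {u : M.V} (hu : u ∈ M.par i) : M.Θ u = sgn k i • u := by
  rw [Θ, LinearMap.sub_apply, proj_of_mem hu, proj_of_mem hu]
  rcases zmod_two_cases i with rfl | rfl <;> simp

theorem par_ext {W : Type w₁} [AddCommGroup W] [Module k W] {f g : M.V →ₗ[k] W}
    (h : ∀ i, ∀ u ∈ M.par i, f u = g u) : f = g := by
  refine LinearMap.ext fun u => ?_
  rw [← proj_add u, map_add, map_add, h 0 _ (proj_mem 0 u), h 1 _ (proj_mem 1 u)]

theorem Θ_Θ (u : M.V) : M.Θ (M.Θ u) = u := by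
  refine LinearMap.congr_fun (f := M.Θ ∘ₗ M.Θ) (g := LinearMap.id) (par_ext fun i u hu => ?_) u
  rw [LinearMap.comp_apply, Θ_of_mem hu, map_smul, Θ_of_mem hu, sgn_smul_sgn_smul]
  rfl

theorem Θ_gen (g : GenC β) (u : M.V) :
    M.Θ (RC.gen D g • u) = sgn k g.parity • RC.gen D g • M.Θ u := by
  refine LinearMap.congr_fun (f := M.Θ ∘ₗ Algebra.lsmul k k M.V (RC.gen D g))
    (g := sgn k g.parity • Algebra.lsmul k k M.V (RC.gen D g) ∘ₗ M.Θ) (par_ext fun i u hu => ?_) u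
  change M.Θ (RC.gen D g • u) = sgn k g.parity • RC.gen D g • M.Θ u
  rw [Θ_of_mem hu, Θ_of_mem (M.gen_mem g i u hu), smul_comm _ (sgn k i), smul_smul, sgn_add, mul_comm]

theorem Θ_c (p : Fin (ht β)) (u : M.V) : M.Θ (RC.c D p • u) = -(RC.c D p • M.Θ u) := by
  refine (Θ_gen (.c p) u).trans ?_
  rw [show (GenC.c p).parity = 1 from rfl, sgn_one, neg_one_smul]
  rfl

theorem proj_gen {g : GenC β} (hg : g.parity = 0) (i : ZMod 2) (u : M.V) :
    M.proj i (RC.gen D g • u) = RC.gen D g • M.proj i u := by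
  refine LinearMap.congr_fun (f := M.proj i ∘ₗ Algebra.lsmul k k M.V (RC.gen D g))
    (g := Algebra.lsmul k k M.V (RC.gen D g) ∘ₗ M.proj i) (par_ext fun j u hu => ?_) u
  change M.proj i (RC.gen D g • u) = RC.gen D g • M.proj i u
  have := M.gen_mem g j u hu
  rw [hg, add_zero] at this
  rw [proj_of_mem hu, proj_of_mem this]
  split_ifs
  · rfl
  · rw [smul_zero]

theorem proj_genF (g : GenR β) (i : ZMod 2) (u : M.V) :
    M.proj i (genF D g • u) = genF D g • M.proj i u := by
  cases g with
  | e ν => exact proj_gen (g := .e ν.dag) rfl i u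
  | x p => exact proj_gen (g := .x p) rfl i u
  | s a => exact proj_gen (g := .s a) rfl i u

end SMod

namespace IsF

variable {V' : Type w₁} [AddCommGroup V'] [Module k V'] [Module (KLR D β) V']
  [IsScalarTower k (KLR D β) V'] {V : Type w₂} [AddCommGroup V] [Module k V] [Module (RC D β) V]
  {ι : V' →ₗ[k] V}

theorem exists_restrict [IsScalarTower k (RC D β) V] (hι : IsF (D := D) (β := β) ι)
    (T : Module.End k V) (hT : ∀ (g : GenR β) v, T (genF D g • v) = genF D g • T v) :
    ∃ t : V' →ₗ[KLR D β] V', ∀ u, ι (t u) = T (ι u) := by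
  have h : ∀ u, ∃ u', ι u' = T (ι u) := fun u => by
    refine hι.exists_eq _ ?_
    conv_rhs => rw [← hι.edag_smul, edag, Finset.sum_smul, map_sum]
    rw [edag, Finset.sum_smul]
    exact Finset.sum_congr rfl fun ν _ => (hT (.e ν) _).symm
  choose t ht using h
  have inj := hι.injective
  let tk : V' →ₗ[k] V' :=
    { toFun := t
      map_add' := fun a b => inj (by rw [ht, map_add, map_add, map_add, ht, ht])
      map_smul' := fun r a => inj (by
        rw [ht, map_smul, map_smul, RingHom.id_apply, map_smul, ht]) }
  refine ⟨KLR.linOfGen tk fun g v => inj ?_, ht⟩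
  change ι (t _) = ι (_ • t v)
  rw [ht, hι.gen_smul, hι.gen_smul, hT, ht]

end IsF

section

variable {M : SMod.{u, v, w₁} D β} {A : KMod.{u, v, w₂} D β} {ι : A.V →ₗ[k] M.V}

namespace IsF

/-- The projection to the elements of parity `i`. -/
def pr (hι : IsF (D := D) (β := β) ι) (i : ZMod 2) : A.V →ₗ[KLR D β] A.V :=
  (hι.exists_restrict (M.proj i) fun g u => SMod.proj_genF g i u).choose

theorem ι_pr (hι : IsF (D := D) (β := β) ι) (i : ZMod 2) (u : A.V) :
    ι (hι.pr i u) = M.proj i (ι u) :=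
  (hι.exists_restrict (M.proj i) fun g u => SMod.proj_genF g i u).choose_spec u

/-- The parity involution. -/
def θ (hι : IsF (D := D) (β := β) ι) : A.V →ₗ[KLR D β] A.V := hι.pr 0 - hι.pr 1

theorem ι_θ (hι : IsF (D := D) (β := β) ι) (u : A.V) : ι (hι.θ u) = M.Θ (ι u) := by
  rw [θ, LinearMap.sub_apply, map_sub, ι_pr, ι_pr]; rfl

theorem θ_θ (hι : IsF (D := D) (β := β) ι) (u : A.V) : hι.θ (hι.θ u) = u :=
  hι.injective (by rw [ι_θ, ι_θ, SMod.Θ_Θ])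

theorem pr_add (hι : IsF (D := D) (β := β) ι) (u : A.V) : hι.pr 0 u + hι.pr 1 u = u :=
  hι.injective (by rw [map_add, ι_pr, ι_pr, SMod.proj_add])

/-- The power of the parity involution with given exponent. -/
def θpow (hι : IsF (D := D) (β := β) ι) (i : ZMod 2) : A.V →ₗ[KLR D β] A.V :=
  if i = 0 then LinearMap.id else hι.θ

theorem θpow_zero (hι : IsF (D := D) (β := β) ι) : hι.θpow 0 = LinearMap.id := if_pos rfl

theorem θpow_succ (hι : IsF (D := D) (β := β) ι) (i : ZMod 2) (u : A.V) :
    hι.θpow (i + 1) (hι.θ u) = hι.θpow i u := by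
  rcases zmod_two_cases i with rfl | rfl
  · rw [zero_add]; exact hι.θ_θ u
  · rfl

end IsF

end

namespace SMod

variable (M : SMod.{u, v, w₁} D β)

theorem inclF_isF : IsF (D := D) (β := β) M.inclF where
  edag_smul := M.edag_inclF
  gen_smul := M.inclF_gen_smul
  injective := FMod.incl_injective D β M.V
  exists_eq v hv := ⟨FMod.of D β v, hv⟩

end SMod

end Parity

/-! ### Convolution products of `RC`-modules -/

section Conv

variable {k : Type u} [Field k] {I : Type v} {D : Datum k I} {β₁ β₂ β : I →₀ ℕ}

namespace SMod

variable (hβ : β₁ + β₂ = β) {M : SMod.{u, v, w₁} D β₁} {N : SMod.{u, v, w₂} D β₂}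

theorem c_left (p : Fin (ht β₁)) (u : M.V) (v : N.V) :
    RC.c D (inL hβ p) • tens hβ M N u v = tens hβ M N (RC.c D p • u) v := Ind.rel (ConvRel.cL p u v)

variable (M N) in
/-- The bilinear map `(u, v) ↦ u ⊗ v`. -/
def tensₗ : M.V →ₗ[k] N.V →ₗ[k] conv hβ M N := TensorProduct.curry (Ind.mk _)

theorem tens_smul_left (r : k) (u : M.V) (v : N.V) :
    tens hβ M N (r • u) v = r • tens hβ M N u v := (tensₗ hβ M N).map_smul₂ r u v

theorem tens_smul_right (r : k) (u : M.V) (v : N.V) :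
    tens hβ M N u (r • v) = r • tens hβ M N u v := (tensₗ hβ M N u).map_smul r v

theorem c_right (p : Fin (ht β₂)) (u : M.V) (v : N.V) :
    RC.c D (inR hβ p) • tens hβ M N u v = tens hβ M N (M.Θ u) (RC.c D p • v) := by
  refine LinearMap.congr_fun
    (f := Algebra.lsmul k k (conv hβ M N) (RC.c D (inR hβ p)) ∘ₗ (tensₗ hβ M N).flip v)
    (g := (tensₗ hβ M N).flip (RC.c D p • v) ∘ₗ M.Θ) (par_ext fun i u hu => ?_) u
  change RC.c D (inR hβ p) • tens hβ M N u v = tens hβ M N (M.Θ u) (RC.c D p • v)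
  rw [Θ_of_mem hu, tens_smul_left]
  exact (Ind.rel (ConvRel.cR p i u v hu)).trans (map_smul (Ind.mk {t | ConvRel hβ M N t}) _ _)

theorem tens_c_right (p : Fin (ht β₂)) (u : M.V) (v : N.V) :
    tens hβ M N u (RC.c D p • v) = RC.c D (inR hβ p) • tens hβ M N (M.Θ u) v := by
  rw [c_right, Θ_Θ]

theorem conv_hom_ext {hβ : β₁ + β₂ = β} {P : Type w} [AddCommGroup P] [Module k P]
    [Module (RC D β) P] [IsScalarTower k (RC D β) P]
    {f g : conv hβ M N →ₗ[RC D β] P} (h : ∀ u v, f (tens hβ M N u v) = g (tens hβ M N u v)) : f = g := by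
  refine Ind.hom_ext fun t => ?_
  induction t with
  | zero => simp
  | tmul u v => exact h u v
  | add a b iha ihb => rw [map_add, map_add, map_add, iha, ihb]

theorem convMap_tens {M' : SMod.{u, v, w₃} D β₁} {N' : SMod.{u, v, w₄} D β₂}
    (f : M.V →ₗ[RC D β₁] M'.V) (hf : ∀ p m, m ∈ M.par p → f m ∈ M'.par p)
    (g : N.V →ₗ[RC D β₂] N'.V) (u : M.V) (v : N.V) :
    convMap hβ M M' N N' f hf g (tens hβ M N u v) = tens hβ M' N' (f u) (g v) := Ind.lift_mk _ _ _

/-- A subspace that contains `u ⊗ v` for all `u` in `F(M)`, `v` in `F(N)` and is stable under the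
`𝔠_p` contains all `u ⊗ v`. -/
theorem tens_mem_of_edag {U : Submodule k (conv hβ M N)}
    (h : ∀ u v, edag D β₁ • u = u → edag D β₂ • v = v → tens hβ M N u v ∈ U)
    (hc : ∀ (p : Fin (ht β)), ∀ t ∈ U, RC.c D p • t ∈ U) (u : M.V) (v : N.V) :
    tens hβ M N u v ∈ U := by
  have h1 : ∀ v, edag D β₂ • v = v → ∀ u, tens hβ M N u v ∈ U := by
    intro v hv u
    have : U.comap ((tensₗ hβ M N).flip v) = ⊤ := eq_top_of_edag D β₁ (fun u hu => h u v hu hv)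
      fun p u hu => by
        change tens hβ M N _ _ ∈ U
        rw [← c_left]
        exact hc _ _ hu
    exact (this ▸ Submodule.mem_top : u ∈ U.comap ((tensₗ hβ M N).flip v))
  have : (⨅ u, U.comap (tensₗ hβ M N u)) = ⊤ := eq_top_of_edag D β₂
    (fun v hv => (Submodule.mem_iInf _).2 fun u => h1 v hv u) fun p v hv => by
      refine (Submodule.mem_iInf _).2 fun u => ?_
      change tens hβ M N _ _ ∈ U
      rw [tens_c_right]
      exact hc _ _ ((Submodule.mem_iInf _).1 hv _)
  exact (Submodule.mem_iInf _).1 (this ▸ Submodule.mem_top : v ∈ ⨅ u, U.comap (tensₗ hβ M N u)) u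

end SMod

end Conv

/-! ### Convolution products and `F` -/

section Concat

variable {I : Type v} {β₁ β₂ β : I →₀ ℕ} (hβ : β₁ + β₂ = β)

theorem concat_inL {X : Type*} (f : Fin (ht β₁) → X) (g : Fin (ht β₂) → X) (p : Fin (ht β₁)) :
    concat hβ f g (inL hβ p) = f p :=
  Fin.append_left f g p

theorem concat_inR {X : Type*} (f : Fin (ht β₁) → X) (g : Fin (ht β₂) → X) (p : Fin (ht β₂)) :
    concat hβ f g (inR hβ p) = g p :=
  Fin.append_right f g p

theorem sum_pos {X : Type*} [AddCommMonoid X] (F : Fin (ht β) → X) :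
    ∑ q, F q = ∑ p, F (inL hβ p) + ∑ p, F (inR hβ p) := by
  rw [← Equiv.sum_comp (finCongr (ht_add hβ)), Fin.sum_univ_add]
  rfl

theorem inL_injective : Function.Injective (inL (β₁ := β₁) hβ) := fun p q h =>
  Fin.ext (by simpa [inL] using h)

theorem inR_injective : Function.Injective (inR (β₂ := β₂) hβ) := fun p q h =>
  Fin.ext (by simpa [inR] using h)

theorem inL_ne_inR (p : Fin (ht β₁)) (q : Fin (ht β₂)) : inL hβ p ≠ inR hβ q := fun h => by
  have := congrArg Fin.val h
  simp only [inL, inR] at this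
  omega

theorem concat_ext {X : Type*} {f f' : Fin (ht β) → X} (h₁ : ∀ p, f (inL hβ p) = f' (inL hβ p))
    (h₂ : ∀ p, f (inR hβ p) = f' (inR hβ p)) : f = f' := by
  funext p
  rcases pos_cases hβ p with ⟨i, rfl⟩ | ⟨i, rfl⟩
  · exact h₁ i
  · exact h₂ i

theorem concat_injective {X : Type*} {f f' : Fin (ht β₁) → X} {g g' : Fin (ht β₂) → X}
    (h : concat hβ f g = concat hβ f' g') : f = f' ∧ g = g' := by
  refine ⟨funext fun p => ?_, funext fun p => ?_⟩
  · rw [← concat_inL hβ f g, h, concat_inL]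
  · rw [← concat_inR hβ f g, h, concat_inR]

variable (S : Fin (ht β₁) → ZMod 2) (T : Fin (ht β₂) → ZMod 2)

theorem toggle_inL (p : Fin (ht β₁)) : toggle (inL hβ p) (concat hβ S T) = concat hβ (toggle p S) T := by
  refine concat_ext hβ (fun q => ?_) fun q => ?_
  · by_cases h : q = p
    · rw [h, toggle_same, concat_inL, concat_inL, toggle_same]
    · rw [toggle_ne (fun h' => h (inL_injective hβ h')), concat_inL, concat_inL, toggle_ne h]
  · rw [toggle_ne (inL_ne_inR hβ p q).symm, concat_inR, concat_inR]

theorem toggle_inR (p : Fin (ht β₂)) : toggle (inR hβ p) (concat hβ S T) = concat hβ S (toggle p T) := by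
  refine concat_ext hβ (fun q => ?_) fun q => ?_
  · rw [toggle_ne (inL_ne_inR hβ q p), concat_inL, concat_inL]
  · by_cases h : q = p
    · rw [h, toggle_same, concat_inR, concat_inR, toggle_same]
    · rw [toggle_ne (fun h' => h (inR_injective hβ h')), concat_inR, concat_inR, toggle_ne h]

theorem swapS_crL (a : Fin (ht β₁ - 1)) :
    swapS (crL hβ a) (concat hβ S T) = concat hβ (swapS a S) T := by
  refine concat_ext hβ (fun q => ?_) fun q => ?_
  · by_cases h1 : q = lo a
    · rw [h1, ← lo_crL, swapS_lo, hi_crL, lo_crL, concat_inL, concat_inL, swapS_lo]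
    by_cases h2 : q = hi a
    · rw [h2, ← hi_crL, swapS_hi, hi_crL, lo_crL, concat_inL, concat_inL, swapS_hi]
    rw [swapS_of_ne _ _ (fun h' => h1 (inL_injective hβ h')) (fun h' => h2 (inL_injective hβ h')),
      concat_inL, concat_inL, swapS_of_ne a S h1 h2]
  · rw [swapS_of_ne (crL hβ a) _ (inL_ne_inR hβ (lo a) q).symm (inL_ne_inR hβ (hi a) q).symm,
      concat_inR, concat_inR]

theorem swapS_crR (a : Fin (ht β₂ - 1)) :
    swapS (crR hβ a) (concat hβ S T) = concat hβ S (swapS a T) := by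
  refine concat_ext hβ (fun q => ?_) fun q => ?_
  · rw [swapS_of_ne, concat_inL, concat_inL]
    · rw [lo_crR]; exact inL_ne_inR hβ q _
    · rw [hi_crR]; exact inL_ne_inR hβ q _
  · by_cases h1 : q = lo a
    · rw [h1, ← lo_crR, swapS_lo, hi_crR, lo_crR, concat_inR, concat_inR, swapS_lo]
    by_cases h2 : q = hi a
    · rw [h2, ← hi_crR, swapS_hi, hi_crR, lo_crR, concat_inR, concat_inR, swapS_hi]
    rw [swapS_of_ne, concat_inR, concat_inR, swapS_of_ne a T h1 h2]
    · rw [lo_crR]; exact fun h' => h1 (inR_injective hβ h')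
    · rw [hi_crR]; exact fun h' => h2 (inR_injective hβ h')

theorem cross_crL (a : Fin (ht β₁ - 1)) : cross (crL hβ a) (concat hβ S T) = cross a S := by
  rw [cross, lo_crL, hi_crL, concat_inL, concat_inL, cross]

theorem cross_crR (a : Fin (ht β₂ - 1)) : cross (crR hβ a) (concat hβ S T) = cross a T := by
  rw [cross, lo_crR, hi_crR, concat_inR, concat_inR, cross]

theorem below_inL (p : Fin (ht β₁)) : below (inL hβ p) (concat hβ S T) = below p S := by
  rw [below, sum_pos hβ, Finset.sum_eq_zero (s := Finset.univ (α := Fin (ht β₂))), add_zero, below]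
  · simp only [concat_inL]; rfl
  · intro q _
    rw [if_neg]
    simp only [inL, inR, Fin.lt_def]
    omega

theorem below_inR (p : Fin (ht β₂)) :
    below (inR hβ p) (concat hβ S T) = ∑ q, S q + below p T := by
  rw [below, sum_pos hβ, below]
  congr 1
  · refine Finset.sum_congr rfl fun q _ => ?_
    rw [concat_inL, if_pos]
    simp only [inL, inR, Fin.lt_def]
    omega
  · refine Finset.sum_congr rfl fun q _ => ?_
    rw [concat_inR]
    simp only [inR, Fin.lt_def, add_lt_add_iff_left]

theorem snd_append (μ : JSeq β₁) (η : JSeq β₂) :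
    Cl.snd (JSeq.append hβ μ η) = concat hβ (Cl.snd μ) (Cl.snd η) := by
  refine concat_ext hβ (fun q => ?_) fun q => ?_
  · rw [concat_inL]
    exact congrArg Prod.snd (concat_inL hβ μ.1 η.1 q)
  · rw [concat_inR]
    exact congrArg Prod.snd (concat_inR hβ μ.1 η.1 q)

theorem fst_append (μ : JSeq β₁) (η : JSeq β₂) :
    Cl.fst (JSeq.append hβ μ η) = ISeq.append hβ (Cl.fst μ) (Cl.fst η) := by
  refine ISeq.ext (concat_ext hβ (fun q => ?_) fun q => ?_)
  · rw [ISeq.append_inL]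
    exact congrArg Prod.fst (concat_inL hβ μ.1 η.1 q)
  · rw [ISeq.append_inR]
    exact congrArg Prod.fst (concat_inR hβ μ.1 η.1 q)

theorem sum_swapS {n : ℕ} (a : Fin (n - 1)) (T : Fin n → ZMod 2) : ∑ q, swapS a T q = ∑ q, T q :=
  Equiv.sum_comp (Equiv.swap (lo a) (hi a)) T

theorem sum_toggle {n : ℕ} (p : Fin n) (T : Fin n → ZMod 2) : ∑ q, toggle p T q = ∑ q, T q + 1 := by
  simp [toggle, Finset.sum_add_distrib]

end Concat

section ConvF

variable {k : Type u} [Field k] {I : Type v} {D : Datum k I} {β₁ β₂ β : I →₀ ℕ}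

namespace IsFHom

variable {V' : Type w₁} [AddCommGroup V'] [Module k V'] [Module (KLR D β) V']
  [IsScalarTower k (KLR D β) V'] {V : Type w₂} [AddCommGroup V] [Module k V] [Module (RC D β) V]
  [IsScalarTower k (RC D β) V] {ι : V' →ₗ[k] V}

/-- The map to `F(V)`. -/
def toFk (h : IsFHom (D := D) (β := β) ι) : V' →ₗ[k] FMod D β V :=
  LinearMap.codRestrict (FSpace D β V) ι fun u => (mem_FSpace D β).2 (h.edag_smul u)

/-- The homomorphism to `F(V)`. -/
def toF (h : IsFHom (D := D) (β := β) ι) : V' →ₗ[KLR D β] FMod D β V :=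
  KLR.linOfGen (V := V') (W := FMod D β V) h.toFk fun g u => FMod.incl_injective D β V (by
      rw [FMod.incl_gen_smul]
      exact h.gen_smul g u)

theorem comp_incl (f : V' →ₗ[KLR D β] FMod D β V) :
    IsFHom (D := D) (β := β) (FMod.incl D β V ∘ₗ f.restrictScalars k) where
  edag_smul u := FMod.edag_incl D β V (f u)
  gen_smul g u := (congrArg (FMod.incl D β V) (map_smul f _ u)).trans (FMod.incl_gen_smul D β V g _)

theorem _root_.QHC.Cl.single_isFHom :
    IsFHom (D := D) (β := β) (Cl.single k 0 : V' →ₗ[k] Cl β V') where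
  edag_smul u := Cl.edag_single_zero u
  gen_smul g u := by
    cases g with
    | e ν => exact ((Cl.gen_smul (.e ν.dag) _).trans (Cl.act_e ν.dag u)).symm
    | x p =>
      refine ((Cl.gen_smul (.x p) _).trans ((Cl.act_x p 0 u).trans ?_)).symm
      rw [Pi.zero_apply, sgn_zero, one_smul]; rfl
    | s a =>
      refine ((Cl.gen_smul (.s a) _).trans ((Cl.act_s a 0 u).trans ?_)).symm
      rw [cross, Pi.zero_apply, zero_mul, sgn_zero, one_smul]; rfl

theorem eq_of_tens {A : KMod.{u, v, w₃} D β₁} {B : KMod.{u, v, w₄} D β₂} {hβ : β₁ + β₂ = β}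
    {f g : KMod.conv hβ A B →ₗ[k] V} (hf : IsFHom (D := D) (β := β) f)
    (hg : IsFHom (D := D) (β := β) g)
    (h : ∀ u v, f (KMod.tens hβ A B u v) = g (KMod.tens hβ A B u v)) : f = g := by
  have : hf.toF = hg.toF := KMod.conv_hom_ext fun u v => FMod.incl_injective D β V (h u v)
  exact LinearMap.ext fun t => congrArg (FMod.incl D β V) (LinearMap.congr_fun this t)

end IsFHom

section

variable (hβ : β₁ + β₂ = β) {M : SMod.{u, v, w₁} D β₁} {N : SMod.{u, v, w₂} D β₂}
  {A : KMod.{u, v, w₃} D β₁} {B : KMod.{u, v, w₄} D β₂} {ι : A.V →ₗ[k] M.V} {κ : B.V →ₗ[k] N.V}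

/-- The homomorphism to `F(M)`. -/
def IsFHom.toSF {M : SMod.{u, v, w₁} D β} {A : KMod.{u, v, w₃} D β} {ι : A.V →ₗ[k] M.V}
    (hι : IsFHom (D := D) (β := β) ι) : A.V →ₗ[KLR D β] M.F.V := hι.toF

/-- The map `u ⊗ v ↦ ι(u) ⊗ κ(v)`. -/
def convι (hι : IsFHom (D := D) (β := β₁) ι) (hκ : IsFHom (D := D) (β := β₂) κ) :
    KMod.conv hβ A B →ₗ[k] SMod.conv hβ M N :=
  FMod.incl D β _ ∘ₗ (convF hβ M N ∘ₗ
    KMod.convMap hβ A M.F B N.F hι.toSF hκ.toSF).restrictScalars k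

theorem convι_isFHom (hι : IsFHom (D := D) (β := β₁) ι) (hκ : IsFHom (D := D) (β := β₂) κ) :
    IsFHom (D := D) (β := β) (convι hβ hι hκ) := IsFHom.comp_incl _

theorem convι_tens (hι : IsFHom (D := D) (β := β₁) ι) (hκ : IsFHom (D := D) (β := β₂) κ)
    (u : A.V) (v : B.V) :
    convι hβ hι hκ (KMod.tens hβ A B u v) = SMod.tens hβ M N (ι u) (κ v) := by
  change FMod.incl D β _ (convF hβ M N (KMod.convMap hβ A M.F B N.F _ _ _)) = _
  rw [KMod.convMap_tens, convF_tens]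
  rfl

variable (A B) in
/-- The bilinear map underlying the homomorphism from `M ∘ N` to the module with given image
`A ∘ B` under `F`. -/
def clTens (θ : ZMod 2 → A.V →ₗ[KLR D β₁] A.V) :
    Cl β₁ A.V →ₗ[k] Cl β₂ B.V →ₗ[k] Cl β (KMod.conv hβ A B) :=
  Cl.desc fun S => LinearMap.flip (Cl.desc fun T =>
    LinearMap.flip (((TensorProduct.curry (Ind.mk {t | KMod.ConvRel hβ A B t})).compr₂
      (Cl.single k (concat hβ S T))) ∘ₗ (θ (∑ q, T q)).restrictScalars k))

variable (θ : ZMod 2 → A.V →ₗ[KLR D β₁] A.V)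

theorem clTens_single (S : Fin (ht β₁) → ZMod 2)
    (T : Fin (ht β₂) → ZMod 2) (u : A.V) (v : B.V) :
    clTens hβ A B θ (Cl.single k S u) (Cl.single k T v) =
      Cl.single k (concat hβ S T) (KMod.tens hβ A B (θ (∑ q, T q) u) v) := by
  rw [clTens, Cl.desc_single, LinearMap.flip_apply, Cl.desc_single]
  rfl

theorem clTens_rel {G : Module.End k (Cl β (KMod.conv hβ A B))} {G₁ : Module.End k (Cl β₁ A.V)}
    {G₂ : Module.End k (Cl β₂ B.V)}
    (h : ∀ S T u v, G (clTens hβ A B θ (Cl.single k S u) (Cl.single k T v)) =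
      clTens hβ A B θ (G₁ (Cl.single k S u)) (G₂ (Cl.single k T v))) (f : Cl β₁ A.V)
    (g : Cl β₂ B.V) : G (clTens hβ A B θ f g) = clTens hβ A B θ (G₁ f) (G₂ g) :=
  LinearMap.congr_fun₂ (f := (clTens hβ A B θ).compr₂ G)
    (g := (clTens hβ A B θ).compl₁₂ G₁ G₂)
    (Cl.hom_ext fun S u => Cl.hom_ext fun T v => h S T u v) f g

variable {hβ} {θ} (f : Cl β₁ A.V) (g : Cl β₂ B.V)

theorem clTens_e (μ : JSeq β₁) (η : JSeq β₂) :
    Cl.act D _ (.e (JSeq.append hβ μ η)) (clTens hβ A B θ f g) =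
      clTens hβ A B θ (Cl.act D _ (.e μ) f) (Cl.act D _ (.e η) g) := by
  refine clTens_rel hβ θ (fun S T u v => ?_) f g
  rw [clTens_single]
  by_cases h : Cl.snd (JSeq.append hβ μ η) = concat hβ S T
  · obtain ⟨rfl, rfl⟩ := concat_injective hβ ((snd_append hβ μ η).symm.trans h)
    rw [← h, Cl.act_e, Cl.act_e, Cl.act_e, clTens_single, h, fst_append, KMod.e_tens, map_smul]
  · rw [Cl.act_e_ne h]
    by_cases h1 : Cl.snd μ = S
    · rw [Cl.act_e_ne (μ := η), map_zero]
      exact fun h2 => h (by rw [snd_append, h1, h2])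
    · rw [Cl.act_e_ne h1, map_zero, LinearMap.zero_apply]

theorem clTens_xL (p : Fin (ht β₁)) :
    Cl.act D _ (.x (inL hβ p)) (clTens hβ A B θ f g) =
      clTens hβ A B θ (Cl.act D _ (.x p) f) g := by
  refine clTens_rel hβ θ (G₂ := LinearMap.id) (fun S T u v => ?_) f g
  rw [clTens_single, Cl.act_x, Cl.act_x, concat_inL, KMod.x_left, map_smul, LinearMap.smul_apply,
    LinearMap.id_apply, clTens_single, map_smul]

theorem clTens_xR (p : Fin (ht β₂)) :
    Cl.act D _ (.x (inR hβ p)) (clTens hβ A B θ f g) =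
      clTens hβ A B θ f (Cl.act D _ (.x p) g) := by
  refine clTens_rel hβ θ (G₁ := LinearMap.id) (fun S T u v => ?_) f g
  rw [clTens_single, Cl.act_x, Cl.act_x, concat_inR, KMod.x_right, LinearMap.map_smul,
    LinearMap.id_apply, clTens_single]

theorem clTens_sL (a : Fin (ht β₁ - 1)) :
    Cl.act D _ (.s (crL hβ a)) (clTens hβ A B θ f g) =
      clTens hβ A B θ (Cl.act D _ (.s a) f) g := by
  refine clTens_rel hβ θ (G₂ := LinearMap.id) (fun S T u v => ?_) f g
  rw [clTens_single, Cl.act_s, Cl.act_s, cross_crL, swapS_crL, KMod.s_left, LinearMap.map_smul,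
    LinearMap.smul_apply, LinearMap.id_apply, clTens_single, map_smul]

theorem clTens_sR (a : Fin (ht β₂ - 1)) :
    Cl.act D _ (.s (crR hβ a)) (clTens hβ A B θ f g) =
      clTens hβ A B θ f (Cl.act D _ (.s a) g) := by
  refine clTens_rel hβ θ (G₁ := LinearMap.id) (fun S T u v => ?_) f g
  rw [clTens_single, Cl.act_s, Cl.act_s, cross_crR, swapS_crR, KMod.s_right, LinearMap.map_smul,
    LinearMap.id_apply, clTens_single, sum_swapS]

theorem clTens_cL (p : Fin (ht β₁)) :
    Cl.act D _ (.c (inL hβ p)) (clTens hβ A B θ f g) =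
      clTens hβ A B θ (Cl.act D _ (.c p) f) g := by
  refine clTens_rel hβ θ (G₂ := LinearMap.id) (fun S T u v => ?_) f g
  rw [clTens_single, Cl.act_c, Cl.act_c, below_inL, toggle_inL, LinearMap.map_smul,
    LinearMap.smul_apply, LinearMap.id_apply, clTens_single]

variable (β₁) in
/-- The parity involution of the module with given image under `F`. -/
def clΘ (θ : A.V →ₗ[KLR D β₁] A.V) : Cl β₁ A.V →ₗ[k] Cl β₁ A.V :=
  Cl.desc fun S => sgn k (∑ q, S q) • (Cl.single k S ∘ₗ θ.restrictScalars k)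

theorem clΘ_single (θ : A.V →ₗ[KLR D β₁] A.V) (S : Fin (ht β₁) → ZMod 2) (u : A.V) :
    clΘ β₁ θ (Cl.single k S u) = sgn k (∑ q, S q) • Cl.single k S (θ u) := Cl.desc_single _ _ _

theorem clTens_cR {θ₁ : A.V →ₗ[KLR D β₁] A.V} (hθ : ∀ i u, θ (i + 1) (θ₁ u) = θ i u)
    (p : Fin (ht β₂)) :
    Cl.act D _ (.c (inR hβ p)) (clTens hβ A B θ f g) =
      clTens hβ A B θ (clΘ β₁ θ₁ f) (Cl.act D _ (.c p) g) := by
  refine clTens_rel hβ θ (fun S T u v => ?_) f g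
  rw [clTens_single, Cl.act_c, Cl.act_c, clΘ_single, below_inR, toggle_inR, LinearMap.map_smul,
    LinearMap.map_smul, LinearMap.smul_apply, clTens_single, sum_toggle, hθ, smul_smul, sgn_add,
    mul_comm]

end

section

variable {M : SMod.{u, v, w₁} D β₁} {A : KMod.{u, v, w₃} D β₁} {ι : A.V →ₗ[k] M.V}

theorem SMod.Θ_C (S : Fin (ht β₁) → ZMod 2) (u : M.V) :
    M.Θ (RC.C D S • u) = sgn k (∑ q, S q) • RC.C D S • M.Θ u := by
  induction S using toggle_induction with
  | h0 => simp [RC.C_zero]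
  | h1 p S ih =>
    rw [RC.C_toggle, smul_assoc, map_smul, mul_smul, SMod.Θ_c, ih, smul_comm _ (sgn k (∑ q, S q)),
      ← mul_smul (RC.c D p), ← smul_neg, ← neg_smul, sum_toggle, sgn_add, sgn_one, mul_neg_one,
      smul_comm (sgn k (below p S)), neg_smul, smul_assoc]
    simp

theorem IsF.equiv_symm_Θ (hι : IsF (D := D) (β := β₁) ι) (u : M.V) :
    hι.equiv.symm (M.Θ u) = clΘ β₁ hι.θ (hι.equiv.symm u) := by
  obtain ⟨f, rfl⟩ := hι.equiv.surjective u
  rw [LinearEquiv.symm_apply_apply, LinearEquiv.symm_apply_eq]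
  have : M.Θ ∘ₗ (hι.equiv.toLinearMap.restrictScalars k) =
      (hι.equiv.toLinearMap.restrictScalars k) ∘ₗ clΘ β₁ hι.θ := by
    refine Cl.hom_ext fun S u => ?_
    rw [LinearMap.comp_apply, LinearMap.comp_apply, clΘ_single, map_smul]
    change M.Θ (Cl.ofHom hι.toIsFHom (Cl.single k S u)) =
      sgn k (∑ q, S q) • Cl.ofHom hι.toIsFHom (Cl.single k S (hι.θ u))
    rw [Cl.ofHom_single, Cl.ofHom_single, SMod.Θ_C, hι.ι_θ]
  exact LinearMap.congr_fun this f

end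

section

variable (hβ : β₁ + β₂ = β) {M : SMod.{u, v, w₁} D β₁} {N : SMod.{u, v, w₂} D β₂}
  {A : KMod.{u, v, w₃} D β₁} {B : KMod.{u, v, w₄} D β₂} {ι : A.V →ₗ[k] M.V} {κ : B.V →ₗ[k] N.V}

theorem IsF.equiv_symm_gen (hι : IsF (D := D) (β := β₁) ι) (g : GenC β₁) (u : M.V) :
    hι.equiv.symm (RC.gen D g • u) = Cl.act D _ g (hι.equiv.symm u) := by
  rw [map_smul, Cl.gen_smul]

/-- The bilinear map underlying the homomorphism from `M ∘ N` to the module with image `A ∘ B`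
under `F`. -/
def toClMap (hι : IsF (D := D) (β := β₁) ι) (hκ : IsF (D := D) (β := β₂) κ) :
    M.V ⊗[k] N.V →ₗ[k] Cl β (KMod.conv hβ A B) :=
  TensorProduct.lift ((clTens hβ A B hι.θpow).compl₁₂
    (hι.equiv.symm.toLinearMap.restrictScalars k) (hκ.equiv.symm.toLinearMap.restrictScalars k))

theorem toClMap_tmul (hι : IsF (D := D) (β := β₁) ι) (hκ : IsF (D := D) (β := β₂) κ) (u : M.V)
    (v : N.V) : toClMap hβ hι hκ (u ⊗ₜ v) =
      clTens hβ A B hι.θpow (hι.equiv.symm u) (hκ.equiv.symm v) := rfl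

/-- The homomorphism from `M ∘ N` to the module with image `A ∘ B` under `F`. -/
def toCl (hι : IsF (D := D) (β := β₁) ι) (hκ : IsF (D := D) (β := β₂) κ) :
    SMod.conv hβ M N →ₗ[RC D β] Cl β (KMod.conv hβ A B) :=
  Ind.lift (toClMap hβ hι hκ) fun t ht => by
    cases ht <;>
      refine (map_sub (Ind.act (toClMap hβ hι hκ)) _ _).trans (sub_eq_zero.2 ?_) <;>
      simp only [Ind.act_tmul, one_smul] <;>
      refine (Cl.gen_smul _ _).trans ?_
    case e μ η u v =>
      exact (clTens_e _ _ _ _).trans (congrArg₂ (fun f g => clTens hβ A B hι.θpow f g)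
        (hι.equiv_symm_gen (.e μ) u).symm (hκ.equiv_symm_gen (.e η) v).symm)
    case xL p u v =>
      exact (clTens_xL _ _ _).trans (congrArg (fun f => clTens hβ A B hι.θpow f _)
        (hι.equiv_symm_gen (.x p) u).symm)
    case xR p u v =>
      exact (clTens_xR _ _ _).trans (congrArg (fun f => clTens hβ A B hι.θpow _ f)
        (hκ.equiv_symm_gen (.x p) v).symm)
    case sL p u v =>
      exact (clTens_sL _ _ _).trans (congrArg (fun f => clTens hβ A B hι.θpow f _)
        (hι.equiv_symm_gen (.s p) u).symm)
    case sR p u v =>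
      exact (clTens_sR _ _ _).trans (congrArg (fun f => clTens hβ A B hι.θpow _ f)
        (hκ.equiv_symm_gen (.s p) v).symm)
    case cL p u v =>
      exact (clTens_cL _ _ _).trans (congrArg (fun f => clTens hβ A B hι.θpow f _)
        (hι.equiv_symm_gen (.c p) u).symm)
    case cR p i u v hu =>
      refine (clTens_cR _ _ hι.θpow_succ p).trans
        ((congrArg₂ (fun f g => clTens hβ A B hι.θpow f g)
        (hι.equiv_symm_Θ u).symm (hκ.equiv_symm_gen (.c p) v).symm).trans ?_)
      rw [SMod.Θ_of_mem hu, TensorProduct.smul_tmul']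
      rfl

theorem toCl_tens (hι : IsF (D := D) (β := β₁) ι) (hκ : IsF (D := D) (β := β₂) κ) (u : A.V)
    (v : B.V) : toCl hβ hι hκ (SMod.tens hβ M N (ι u) (κ v)) =
      Cl.single k 0 (KMod.tens hβ A B u v) := by
  refine (Ind.lift_mk _ _ _).trans ?_
  rw [toClMap_tmul, IsF.equiv_symm_apply, IsF.equiv_symm_apply, clTens_single]
  simp only [Pi.zero_apply, Finset.sum_const_zero, IsF.θpow_zero, LinearMap.id_apply]
  have h : concat hβ (0 : Fin (ht β₁) → ZMod 2) (0 : Fin (ht β₂) → ZMod 2) = 0 :=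
    concat_ext hβ (fun p => by rw [concat_inL]; rfl) fun p => by rw [concat_inR]; rfl
  rw [h]

theorem convι_isF (hι : IsF (D := D) (β := β₁) ι) (hκ : IsF (D := D) (β := β₂) κ) :
    IsF (D := D) (β := β) (convι hβ hι.toIsFHom hκ.toIsFHom) where
  toIsFHom := convι_isFHom hβ hι.toIsFHom hκ.toIsFHom
  injective := by
    have h : ((toCl hβ hι hκ).restrictScalars k) ∘ₗ convι hβ hι.toIsFHom hκ.toIsFHom =
        Cl.single k 0 := by
      refine IsFHom.eq_of_tens (D := D) ?_ Cl.single_isFHom fun u v => ?_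
      · have hj := convι_isFHom hβ hι.toIsFHom hκ.toIsFHom
        exact ⟨fun u => (map_smul (toCl hβ hι hκ) _ _).symm.trans (congrArg _ (hj.edag_smul u)),
          fun g u => (congrArg (toCl hβ hι hκ) (hj.gen_smul g u)).trans
            (map_smul (toCl hβ hι hκ) _ _)⟩
      · rw [LinearMap.comp_apply, convι_tens]
        exact toCl_tens hβ hι hκ u v
    refine Function.Injective.of_comp (f := toCl hβ hι hκ) ?_
    have := Cl.single_injective (k := k) (β := β) (V := KMod.conv hβ A B) 0
    rw [← h] at this
    exact this
  exists_eq := by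
    have hj := convι_isFHom hβ hι.toIsFHom hκ.toIsFHom
    have htop : (LinearMap.range (Cl.ofHom hj)).restrictScalars k = ⊤ := by
      rw [eq_top_iff]
      intro t _
      refine Ind.induction_on _ (fun a t => Submodule.smul_mem (LinearMap.range (Cl.ofHom hj)) a ?_) t
      induction t with
      | zero => rw [map_zero]; exact Submodule.zero_mem _
      | add a b iha ihb => rw [map_add]; exact Submodule.add_mem _ iha ihb
      | tmul u v =>
        refine SMod.tens_mem_of_edag hβ (U := (LinearMap.range (Cl.ofHom hj)).restrictScalars k)
          (fun u v hu hv => ?_) (fun p t ht => Submodule.smul_mem (LinearMap.range (Cl.ofHom hj)) _ ht) u v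
        obtain ⟨u, rfl⟩ := hι.exists_eq u hu
        obtain ⟨v, rfl⟩ := hκ.exists_eq v hv
        exact ⟨Cl.single k 0 (KMod.tens hβ A B u v), by
          rw [Cl.ofHom_single_zero, convι_tens]⟩
    intro t ht
    obtain ⟨y, rfl⟩ : t ∈ LinearMap.range (Cl.ofHom hj) :=
      (htop ▸ Submodule.mem_top : t ∈ (LinearMap.range (Cl.ofHom hj)).restrictScalars k)
    rw [← map_smul] at ht
    obtain ⟨v, hv⟩ := Cl.exists_single_zero D (y := edag D β • y) (by rw [smul_smul, edag_mul_self])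
    exact ⟨v, by rw [← ht, hv, Cl.ofHom_single_zero]⟩

end

section

variable (hβ : β₁ + β₂ = β) (M : SMod.{u, v, w₁} D β₁) (N : SMod.{u, v, w₂} D β₂)

theorem incl_convF : FMod.incl D β _ ∘ₗ (convF hβ M N).restrictScalars k =
    convι hβ M.inclF_isF.toIsFHom N.inclF_isF.toIsFHom :=
  IsFHom.eq_of_tens (IsFHom.comp_incl _) (convι_isFHom hβ _ _) fun u v => by
    rw [convι_tens]
    exact convF_tens hβ M N u v

theorem convF_bijective : Function.Bijective (convF hβ M N) := by
  have h := convι_isF hβ M.inclF_isF N.inclF_isF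
  have h1 : ∀ t, FMod.incl D β _ (convF hβ M N t) =
      convι hβ M.inclF_isF.toIsFHom N.inclF_isF.toIsFHom t :=
    LinearMap.congr_fun (incl_convF hβ M N)
  refine ⟨fun a b hab => h.injective ?_, fun t => ?_⟩
  · rw [← h1, hab, h1]
  · obtain ⟨s, hs⟩ := h.exists_eq _ (FMod.edag_incl D β _ t)
    exact ⟨s, FMod.incl_injective D β _ ((h1 s).trans hs)⟩

end

end ConvF

/-! ### The intertwiners of `RC` -/

section Intertwiners

variable {k : Type u} [Field k] {I : Type v} {D : Datum k I} {β₁ β₂ β : I →₀ ℕ}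

namespace RC

theorem phi_mul_e_ne (a : Fin (ht β - 1)) {ν : JSeq β} (h : (ν.seq (lo a)).1 ≠ (ν.seq (hi a)).1) :
    phi D a * e D ν = s D a * e D ν := by
  classical
  rw [phi, Finset.sum_mul, Finset.sum_eq_single ν]
  · rw [mul_assoc, e_mul_self, if_pos h]
  · intro μ _ h
    rw [mul_assoc, e_mul_ne h, mul_zero]
  · simp

theorem phi_mul_e_eq (a : Fin (ht β - 1)) {ν : JSeq β} (h : (ν.seq (lo a)).1 = (ν.seq (hi a)).1) :
    phi D a * e D ν = (sgn k (ν.seq (lo a)).2 • (s D a * x D (lo a)) -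
      sgn k (ν.seq (hi a)).2 • (x D (lo a) * s D a)) * e D ν := by
  classical
  rw [phi, Finset.sum_mul, Finset.sum_eq_single ν]
  · rw [mul_assoc, e_mul_self, if_neg (not_not.2 h)]
    congr 1
    split_ifs with h'
    · rw [h', smul_sub]
    · have h2 : (ν.seq (lo a)).2 = (ν.seq (hi a)).2 + 1 := by
        have : (ν.seq (lo a)).2 ≠ (ν.seq (hi a)).2 := fun h2 => h' (Prod.ext h h2)
        generalize (ν.seq (lo a)).2 = i, (ν.seq (hi a)).2 = j at this
        revert i j
        decide
      rw [h2, sgn_add, sgn_one, mul_neg_one, smul_add, neg_smul, neg_smul,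
        ← sub_eq_add_neg]
  · intro μ _ h
    rw [mul_assoc, e_mul_ne h, mul_zero]
  · simp

theorem sgn_flip_same (p : Fin (ht β)) (ν : JSeq β) :
    sgn k ((ν.flip p).seq p).2 = -sgn k (ν.seq p).2 := by
  simp [JSeq.flip, cJ, sgn_one_sub]

theorem flip_ne {p q : Fin (ht β)} (h : q ≠ p) (ν : JSeq β) : (ν.flip p).seq q = ν.seq q := by
  simp [JSeq.flip, h]

theorem flip_fst (p q : Fin (ht β)) (ν : JSeq β) : ((ν.flip p).seq q).1 = (ν.seq q).1 := by
  by_cases h : q = p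
  · subst h; simp [JSeq.flip, cJ]
  · rw [flip_ne h]

theorem phi_c (a : Fin (ht β - 1)) (p : Fin (ht β)) :
    phi D a * c D p = c D (Equiv.swap (lo a) (hi a) p) * phi D a := by
  refine ext_e (AlgHom.id k _) fun ν => ?_
  rw [AlgHom.id_apply, mul_assoc, mul_assoc, c_e, ← mul_assoc]
  by_cases h : (ν.seq (lo a)).1 = (ν.seq (hi a)).1
  · rw [phi_mul_e_eq a h, phi_mul_e_eq a (by rw [flip_fst, flip_fst, h]), mul_assoc, ← c_e,
      ← mul_assoc, ← mul_assoc]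
    congr 1
    have hl : lo a ≠ hi a := lo_ne_hi a
    by_cases h1 : p = lo a
    · subst h1
      rw [sgn_flip_same, flip_ne hl.symm, Equiv.swap_apply_left, sub_mul, mul_sub, smul_mul_assoc,
        smul_mul_assoc, mul_smul_comm, mul_smul_comm, neg_smul, ← smul_neg]
      congr 2
      · rw [mul_assoc, ← mul_neg, ← c_x_self, ← mul_assoc, s_c, Equiv.swap_apply_left, mul_assoc]
      · rw [mul_assoc, s_c, Equiv.swap_apply_left, ← mul_assoc, ← c_x hl.symm, mul_assoc]
    by_cases h2 : p = hi a
    · subst h2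
      rw [sgn_flip_same, flip_ne hl, Equiv.swap_apply_right, sub_mul, mul_sub, smul_mul_assoc,
        smul_mul_assoc, mul_smul_comm, mul_smul_comm, neg_smul, ← smul_neg]
      congr 2
      · rw [mul_assoc, ← c_x hl.symm, ← mul_assoc, s_c, Equiv.swap_apply_right, mul_assoc]
      · rw [mul_assoc, s_c, Equiv.swap_apply_right, ← mul_assoc, ← mul_assoc, c_x_self, neg_mul]
    · rw [flip_ne (Ne.symm h1), flip_ne (Ne.symm h2), Equiv.swap_apply_of_ne_of_ne h1 h2, sub_mul,
        mul_sub, smul_mul_assoc, smul_mul_assoc, mul_smul_comm, mul_smul_comm]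
      have h3 : s D a * c D p = c D p * s D a := by rw [s_c, Equiv.swap_apply_of_ne_of_ne h1 h2]
      congr 2
      · rw [mul_assoc, ← c_x h1, ← mul_assoc, h3, mul_assoc]
      · rw [mul_assoc, h3, ← mul_assoc, ← c_x h1, mul_assoc]
  · rw [phi_mul_e_ne a h, phi_mul_e_ne a (by rwa [flip_fst, flip_fst]), mul_assoc, ← c_e, ← mul_assoc,
      s_c, mul_assoc]

theorem wordProd_c_aux (hβ : β₁ + β₂ = β) : ∃ w : Shuffle (ht β₁) (ht β₂) (ht β),
    w.At 0 (ht β₂) ∧ ∀ s, wordProd hβ (phi D) * c D ((Shuffle.base (ht_add hβ)).equiv.symm s) =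
      c D (w.equiv.symm s) * wordProd hβ (phi D) := by
  have := wordProd_smul_induct (G := RC D β) (X := RC D β) hβ (phi D)
    (fun i j b => ∃ w : Shuffle (ht β₁) (ht β₂) (ht β), w.At i j ∧ ∀ s,
      b * c D ((Shuffle.base (ht_add hβ)).equiv.symm s) = c D (w.equiv.symm s) * b)
    (fun i x ⟨w, hw, h⟩ => ⟨w, hw.carry, h⟩)
    (fun i j a x ha ⟨w, hw, h⟩ => ⟨w.sw a, hw.step ha, fun s => by
      have hm := Shuffle.mixed_LR (hw.lo_eq ha) (hw.hi_eq ha)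
      rw [smul_eq_mul, mul_assoc, h, ← mul_assoc, phi_c, mul_assoc, Shuffle.sw_equiv hm]
      simp⟩)
    (x := 1) ⟨_, Shuffle.At.base _, fun s => by rw [one_mul, mul_one]⟩
  obtain ⟨w, hw, h⟩ := this
  exact ⟨w, hw, fun s => by simpa using h s⟩

theorem wordProd_c (h₁₂ : β₁ + β₂ = β) (h₂₁ : β₂ + β₁ = β) :
    (∀ q, wordProd h₂₁ (phi D) * c D (inL h₂₁ q) = c D (inR h₁₂ q) * wordProd h₂₁ (phi D)) ∧
    ∀ p, wordProd h₂₁ (phi D) * c D (inR h₂₁ p) = c D (inL h₁₂ p) * wordProd h₂₁ (phi D) := by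
  obtain ⟨w, hw, h⟩ := wordProd_c_aux (D := D) h₂₁
  have hL : ∀ q, w.equiv.symm (.inl q) = inR h₁₂ q := fun q => Fin.ext <| by
    rw [hw.1]
    simp only [not_lt_zero, if_false, inR]
    split_ifs <;> omega
  have hR : ∀ p, w.equiv.symm (.inr p) = inL h₁₂ p := fun p => Fin.ext <| by
    rw [hw.2, if_pos p.2]
    rfl
  refine ⟨fun q => ?_, fun p => ?_⟩
  · rw [← hL, ← h, ← base_lo_left h₂₁, Equiv.symm_apply_apply]
  · rw [← hR, ← h, ← base_lo_right h₂₁, Equiv.symm_apply_apply]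

end RC

theorem ofFn_prod_smul {G : Type*} {H : Type*} {X : Type*} {Y : Type*} [Monoid G] [MulAction G X]
    [Monoid H] [MulAction H Y] (j : X → Y) {n : ℕ} {f : Fin n → G} {g : Fin n → H}
    (h : ∀ i t, j (f i • t) = g i • j t) (t : X) :
    j ((List.ofFn f).prod • t) = (List.ofFn g).prod • j t := by
  induction n generalizing t with
  | zero => simp
  | succ n ih =>
    rw [List.ofFn_succ, List.ofFn_succ, List.prod_cons, List.prod_cons, mul_smul, mul_smul, h,
      ih fun i => h i.succ]

namespace IsFHom

variable {V' : Type w₁} [AddCommGroup V'] [Module k V'] [Module (KLR D β) V'] {V : Type w₂}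
  [AddCommGroup V] [Module k V] [Module (RC D β) V] {j : V' →ₗ[k] V}

theorem e_dag_smul (hj : IsFHom (D := D) (β := β) j) (ν : ISeq β) (t : V') :
    j (KLR.e D ν • t) = RC.e D ν.dag • j t := hj.gen_smul (.e ν) t

theorem x_smul (hj : IsFHom (D := D) (β := β) j) (p : Fin (ht β)) (t : V') :
    j (KLR.x D p • t) = RC.x D p • j t := hj.gen_smul (.x p) t

theorem s_smul (hj : IsFHom (D := D) (β := β) j) (a : Fin (ht β - 1)) (t : V') :
    j (KLR.s D a • t) = RC.s D a • j t := hj.gen_smul (.s a) t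

theorem phi_smul (hj : IsFHom (D := D) (β := β) j) (a : Fin (ht β - 1)) (t : V') :
    j (KLR.phi D a • t) = RC.phi D a • j t := by
  classical
  have key : ∀ ν : ISeq β, j (KLR.phi D a • KLR.e D ν • t) = RC.phi D a • RC.e D ν.dag • j t := by
    intro ν
    by_cases h : ν.seq (lo a) = ν.seq (hi a)
    · rw [smul_smul, smul_smul, KLR.phi_mul_e, if_neg (not_not.2 h), RC.phi_mul_e_eq a (ν := ν.dag) h]
      change j ((_ * KLR.e D ν) • t) = ((sgn k 0 • _ - sgn k 0 • _) * RC.e D ν.dag) • j t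
      rw [sgn_zero, one_smul, one_smul, mul_smul, mul_smul, sub_smul, sub_smul, map_sub, mul_smul,
        mul_smul, mul_smul, mul_smul, hj.s_smul, hj.x_smul, hj.x_smul, hj.s_smul, hj.e_dag_smul]
    · rw [smul_smul, smul_smul, KLR.phi_mul_e, if_pos h, RC.phi_mul_e_ne a (ν := ν.dag) h, mul_smul,
        mul_smul, hj.s_smul, hj.e_dag_smul]
  have h1 : ∑ ν : ISeq β, KLR.e D ν • t = t := by rw [← Finset.sum_smul, KLR.sum_e, one_smul]
  have h2 : ∑ ν : ISeq β, RC.e D ν.dag • j t = j t := by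
    rw [← Finset.sum_smul]
    exact hj.edag_smul t
  conv_lhs => rw [← h1, Finset.smul_sum, map_sum]
  conv_rhs => rw [← h2, Finset.smul_sum]
  exact Finset.sum_congr rfl fun ν _ => key ν

theorem wordProd_smul (hj : IsFHom (D := D) (β := β) j) (hβ : β₁ + β₂ = β) (t : V') :
    j (wordProd hβ (KLR.phi D) • t) = wordProd hβ (RC.phi D) • j t :=
  ofFn_prod_smul j (fun _ => ofFn_prod_smul j fun _ => hj.phi_smul _) t

end IsFHom

end Intertwiners

/-! ### The R-matrices of `RC`-modules -/

section RMatrixC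

variable {k : Type u} [Field k] {I : Type v} {D : Datum k I} {β₁ β₂ β : I →₀ ℕ}

theorem KMod.tens_zero_right (hβ : β₁ + β₂ = β) {A : KMod.{u, v, w₁} D β₁} {B : KMod.{u, v, w₂} D β₂}
    (a : A.V) : KMod.tens hβ A B a 0 = 0 := by
  rw [KMod.tens, TensorProduct.tmul_zero, map_zero]

namespace IsF

variable {M : SMod.{u, v, w₁} D β} {A : KMod.{u, v, w₂} D β} {ι : A.V →ₗ[k] M.V}

theorem pr_of_mem (hι : IsF (D := D) (β := β) ι) {i : ZMod 2} {a : A.V} (ha : ι a ∈ M.par i)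
    (j : ZMod 2) : hι.pr j a = if j = i then a else 0 := by
  refine hι.injective ?_
  rw [ι_pr, SMod.proj_of_mem ha]
  split_ifs
  · rfl
  · rw [map_zero]

theorem ι_pr_mem (hι : IsF (D := D) (β := β) ι) (i : ZMod 2) (a : A.V) : ι (hι.pr i a) ∈ M.par i := by
  rw [ι_pr]
  exact SMod.proj_mem i _

theorem θ_of_mem (hι : IsF (D := D) (β := β) ι) {i : ZMod 2} {a : A.V} (ha : ι a ∈ M.par i) :
    hι.θ a = sgn k i • a := by
  refine hι.injective ?_
  rw [ι_θ, SMod.Θ_of_mem ha, map_smul]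

/-- An even map commutes with the projections. -/
theorem map_pr (hι : IsF (D := D) (β := β) ι) {M₂ : SMod.{u, v, w₃} D β} {A₂ : KMod.{u, v, w₄} D β}
    {ι₂ : A₂.V →ₗ[k] M₂.V} (hι₂ : IsF (D := D) (β := β) ι₂) {f : M.V →ₗ[RC D β] M₂.V}
    (hf : ∀ p m, m ∈ M.par p → f m ∈ M₂.par p) {f' : A.V →ₗ[KLR D β] A₂.V}
    (h : ∀ a, f (ι a) = ι₂ (f' a)) (i : ZMod 2) (a : A.V) : f' (hι.pr i a) = hι₂.pr i (f' a) := by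
  have key : ∀ j, ∀ a, ι a ∈ M.par j → f' (hι.pr i a) = hι₂.pr i (f' a) := by
    intro j a ha
    have h' : ι₂ (f' a) ∈ M₂.par j := by rw [← h]; exact hf j _ ha
    rw [hι.pr_of_mem ha, hι₂.pr_of_mem h']
    split_ifs
    · rfl
    · rw [map_zero]
  rw [← hι.pr_add a, map_add, map_add, map_add, map_add, key 0 _ (hι.ι_pr_mem 0 a),
    key 1 _ (hι.ι_pr_mem 1 a)]

theorem map_θ (hι : IsF (D := D) (β := β) ι) {M₂ : SMod.{u, v, w₃} D β} {A₂ : KMod.{u, v, w₄} D β}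
    {ι₂ : A₂.V →ₗ[k] M₂.V} (hι₂ : IsF (D := D) (β := β) ι₂) {f : M.V →ₗ[RC D β] M₂.V}
    (hf : ∀ p m, m ∈ M.par p → f m ∈ M₂.par p) {f' : A.V →ₗ[KLR D β] A₂.V}
    (h : ∀ a, f (ι a) = ι₂ (f' a)) (a : A.V) : f' (hι.θ a) = hι₂.θ (f' a) := by
  rw [θ, θ, LinearMap.sub_apply, LinearMap.sub_apply, map_sub, map_pr hι hι₂ hf h, map_pr hι hι₂ hf h]

end IsF

section Koszul

variable (hβ : β₁ + β₂ = β) {M : SMod.{u, v, w₁} D β₁} {N : SMod.{u, v, w₂} D β₂}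
  {A : KMod.{u, v, w₃} D β₁} {B : KMod.{u, v, w₄} D β₂} {ι : A.V →ₗ[k] M.V} {κ : B.V →ₗ[k] N.V}
  (hι : IsF (D := D) (β := β₁) ι) (hκ : IsF (D := D) (β := β₂) κ)

/-- The map `u ⊗ v ↦ (-1)^{p(u)p(v)} u ⊗ v`. -/
def koszul : KMod.conv hβ A B →ₗ[KLR D β] KMod.conv hβ A B :=
  KMod.convMap hβ A A B B LinearMap.id (hκ.pr 0) + KMod.convMap hβ A A B B hι.θ (hκ.pr 1)

theorem koszul_tens (a : A.V) (b : B.V) : koszul hβ hι hκ (KMod.tens hβ A B a b) =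
    KMod.tens hβ A B a (hκ.pr 0 b) + KMod.tens hβ A B (hι.θ a) (hκ.pr 1 b) := by
  rw [koszul, LinearMap.add_apply, KMod.convMap_tens, KMod.convMap_tens]
  rfl

theorem koszul_tens_of_mem {i j : ZMod 2} {a : A.V} {b : B.V} (ha : ι a ∈ M.par i)
    (hb : κ b ∈ N.par j) : koszul hβ hι hκ (KMod.tens hβ A B a b) =
      sgn k (i * j) • KMod.tens hβ A B a b := by
  rw [koszul_tens, hκ.pr_of_mem hb, hκ.pr_of_mem hb, hι.θ_of_mem ha]
  rcases zmod_two_cases j with rfl | rfl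
  · rw [if_pos rfl, if_neg (by decide), KMod.tens_zero_right, add_zero, mul_zero, sgn_zero, one_smul]
  · rw [if_neg (by decide), if_pos rfl, KMod.tens_zero_right, zero_add, mul_one, KMod.tens,
      ← TensorProduct.smul_tmul', map_smul]
    rfl

theorem koszul_koszul (t : KMod.conv hβ A B) : koszul hβ hι hκ (koszul hβ hι hκ t) = t := by
  refine LinearMap.congr_fun (f := koszul hβ hι hκ ∘ₗ koszul hβ hι hκ) (g := LinearMap.id)
    (KMod.conv_hom_ext fun a b => ?_) t
  rw [LinearMap.comp_apply, LinearMap.id_apply, koszul_tens, map_add, koszul_tens, koszul_tens, hι.θ_θ,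
    hκ.pr_of_mem (hκ.ι_pr_mem 0 b), hκ.pr_of_mem (hκ.ι_pr_mem 0 b),
    hκ.pr_of_mem (hκ.ι_pr_mem 1 b), hκ.pr_of_mem (hκ.ι_pr_mem 1 b), if_pos rfl, if_neg (by decide),
    if_neg (by decide), if_pos rfl, KMod.tens_zero_right, add_zero, zero_add,
    KMod.tens, KMod.tens, ← map_add, ← TensorProduct.tmul_add, hκ.pr_add]
  rfl

theorem koszul_surjective : Function.Surjective (koszul hβ hι hκ) := fun t =>
  ⟨_, koszul_koszul hβ hι hκ t⟩

end Koszul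

namespace SMod

variable (h₁₂ : β₁ + β₂ = β) (h₂₁ : β₂ + β₁ = β) {M : SMod.{u, v, w₁} D β₁} {N : SMod.{u, v, w₂} D β₂}

theorem IsRMatrix.unique {R R' : conv h₁₂ M N →ₗ[RC D β] conv h₂₁ N M}
    (hR : IsRMatrix h₁₂ h₂₁ M N R) (hR' : IsRMatrix h₁₂ h₂₁ M N R') : R' = R := by
  refine conv_hom_ext fun u v => LinearMap.congr_fun₂
    (f := (tensₗ h₁₂ M N).compr₂ (R'.restrictScalars k))
    (g := (tensₗ h₁₂ M N).compr₂ (R.restrictScalars k))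
    (par_ext fun i u hu => par_ext fun j v hv => ?_) u v
  exact (hR' i j u v hu hv).trans (hR i j u v hu hv).symm

variable (M N) in
/-- The bilinear map `(u, v) ↦ (-1)^{p(u)p(v)} v ⊗ u`. -/
def braid : M.V →ₗ[k] N.V →ₗ[k] conv h₂₁ N M :=
  (tensₗ h₂₁ N M).flip.compl₂ (N.proj 0) + (tensₗ h₂₁ N M).flip.compl₁₂ M.Θ (N.proj 1)

theorem braid_apply (u : M.V) (v : N.V) : braid h₂₁ M N u v =
    tens h₂₁ N M (N.proj 0 v) u + tens h₂₁ N M (N.proj 1 v) (M.Θ u) := rfl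

theorem tens_zero_left (v : N.V) : tens h₁₂ M N 0 v = 0 := by
  rw [tens, TensorProduct.zero_tmul, map_zero]

theorem braid_of_mem {i j : ZMod 2} {u : M.V} {v : N.V} (hu : u ∈ M.par i) (hv : v ∈ N.par j) :
    braid h₂₁ M N u v = sgn k (i * j) • tens h₂₁ N M v u := by
  rw [braid_apply, proj_of_mem hv, proj_of_mem hv, Θ_of_mem hu]
  rcases zmod_two_cases j with rfl | rfl
  · rw [if_pos rfl, if_neg (by decide), tens_zero_left, add_zero, mul_zero, sgn_zero, one_smul]
  · rw [if_neg (by decide), if_pos rfl, tens_zero_left, zero_add, mul_one, tens_smul_right]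

theorem proj_c (p : Fin (ht β₁)) (i : ZMod 2) (u : M.V) :
    M.proj i (RC.c D p • u) = RC.c D p • M.proj (i + 1) u := by
  refine LinearMap.congr_fun (f := M.proj i ∘ₗ Algebra.lsmul k k M.V (RC.c D p))
    (g := Algebra.lsmul k k M.V (RC.c D p) ∘ₗ M.proj (i + 1)) (par_ext fun j u hu => ?_) u
  change M.proj i (RC.c D p • u) = RC.c D p • M.proj (i + 1) u
  rw [proj_of_mem hu]
  refine (proj_of_mem (M.gen_mem (.c p) j u hu) i).trans ?_
  change (if i = j + 1 then _ else _) = _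
  have : i = j + 1 ↔ i + 1 = j := (by decide : ∀ i j : ZMod 2, i = j + 1 ↔ i + 1 = j) i j
  rw [if_congr this rfl rfl]
  split_ifs
  · rfl
  · rw [smul_zero]

theorem braid_c_left (p : Fin (ht β₁)) (u : M.V) (v : N.V) :
    braid h₂₁ M N (RC.c D p • u) v = RC.c D (inR h₂₁ p) • braid h₂₁ M N u v := by
  rw [braid_apply, braid_apply, Θ_c, smul_add, tens_c_right, Θ_of_mem (proj_mem 0 v), sgn_zero, one_smul]
  congr 1
  rw [c_right, Θ_of_mem (proj_mem 1 v), sgn_one, neg_one_smul, tens, tens, TensorProduct.neg_tmul,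
    TensorProduct.tmul_neg]

theorem braid_c_right (p : Fin (ht β₂)) (u : M.V) (v : N.V) :
    braid h₂₁ M N u (RC.c D p • v) = RC.c D (inL h₂₁ p) • braid h₂₁ M N (M.Θ u) v := by
  rw [braid_apply, braid_apply, proj_c, proj_c, Θ_Θ, smul_add, c_left, c_left, add_comm]
  rfl

variable {A : KMod.{u, v, w₃} D β₁} {B : KMod.{u, v, w₄} D β₂} {ι : A.V →ₗ[k] M.V} {κ : B.V →ₗ[k] N.V}

theorem isRMatrix_of (hι : IsF (D := D) (β := β₁) ι) (hκ : IsF (D := D) (β := β₂) κ)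
    {R : conv h₁₂ M N →ₗ[RC D β] conv h₂₁ N M} {R' : KMod.conv h₁₂ A B →ₗ[KLR D β] KMod.conv h₂₁ B A}
    (hR' : KMod.IsRMatrix h₁₂ h₂₁ A B R')
    (hR : ∀ t, R (convι h₁₂ hι.toIsFHom hκ.toIsFHom t) =
      convι h₂₁ hκ.toIsFHom hι.toIsFHom (R' (koszul h₁₂ hι hκ t))) : IsRMatrix h₁₂ h₂₁ M N R := by
  obtain ⟨hcL, hcR⟩ := RC.wordProd_c (D := D) h₁₂ h₂₁
  let F : M.V →ₗ[k] N.V →ₗ[k] conv h₂₁ N M := (tensₗ h₁₂ M N).compr₂ (R.restrictScalars k)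
  let G : M.V →ₗ[k] N.V →ₗ[k] conv h₂₁ N M :=
    (braid h₂₁ M N).compr₂ (Algebra.lsmul k k (conv h₂₁ N M) (wordProd h₂₁ (RC.phi D)))
  have hF : ∀ u v, F u v = R (tens h₁₂ M N u v) := fun _ _ => rfl
  have hG : ∀ u v, G u v = wordProd h₂₁ (RC.phi D) • braid h₂₁ M N u v := fun _ _ => rfl
  have h0 : ∀ u v, edag D β₁ • u = u → edag D β₂ • v = v → F u v = G u v := by
    intro u v hu hv
    obtain ⟨a, rfl⟩ := hι.exists_eq u hu
    obtain ⟨b, rfl⟩ := hκ.exists_eq v hv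
    rw [hF, hG, ← convι_tens h₁₂ hι.toIsFHom hκ.toIsFHom, hR, koszul_tens, map_add, hR', hR', ← smul_add,
      (convι_isFHom h₂₁ hκ.toIsFHom hι.toIsFHom).wordProd_smul, map_add, convι_tens, convι_tens, hκ.ι_pr,
      hκ.ι_pr, hι.ι_θ]
    rfl
  have h1 : ∀ v, edag D β₂ • v = v → ∀ u, F u v = G u v := by
    intro v hv u
    have : LinearMap.eqLocus (F.flip v) (G.flip v) = ⊤ :=
      eq_top_of_edag D β₁ (fun u hu => h0 u v hu hv) fun p u hu => by
        change F u v = G u v at hu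
        change F _ v = G _ v
        rw [hF, hG] at hu ⊢
        rw [← c_left, map_smul, hu, braid_c_left, smul_smul, smul_smul, hcR]
    exact (this ▸ Submodule.mem_top : u ∈ LinearMap.eqLocus (F.flip v) (G.flip v))
  have h2 : LinearMap.eqLocus F.flip G.flip = ⊤ :=
    eq_top_of_edag D β₂ (fun v hv => LinearMap.ext fun u => h1 v hv u) fun p v hv => by
      refine LinearMap.ext fun u => ?_
      have hv' : F (M.Θ u) v = G (M.Θ u) v := LinearMap.congr_fun hv (M.Θ u)
      change F u _ = G u _
      rw [hF, hG] at hv' ⊢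
      rw [tens_c_right, map_smul, hv', braid_c_right, smul_smul, smul_smul, hcL]
  intro i j u v hu hv
  have h3 : F u v = G u v :=
    LinearMap.congr_fun (h2 ▸ Submodule.mem_top : v ∈ LinearMap.eqLocus F.flip G.flip) u
  rw [hF, hG, braid_of_mem h₂₁ hu hv] at h3
  rw [h3]
  exact (Algebra.lsmul k k (conv h₂₁ N M) (wordProd h₂₁ (RC.phi D))).map_smul _ _

end SMod

end RMatrixC

/-! ### Renormalization and `F` -/

section Transfer

variable {k : Type u} [Field k] {I : Type v} {D : Datum k I} {β : I →₀ ℕ}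

theorem IsRenormalization.of_isF
    {P' Q' P₀' Q₀' : Type*} [AddCommGroup P'] [Module k P'] [Module (KLR D β) P']
    [IsScalarTower k (KLR D β) P'] [AddCommGroup Q'] [Module k Q'] [Module (KLR D β) Q']
    [IsScalarTower k (KLR D β) Q'] [AddCommGroup P₀'] [Module k P₀'] [Module (KLR D β) P₀']
    [IsScalarTower k (KLR D β) P₀'] [AddCommGroup Q₀'] [Module k Q₀'] [Module (KLR D β) Q₀']
    [IsScalarTower k (KLR D β) Q₀']
    {P Q P₀ Q₀ : Type*} [AddCommGroup P] [Module k P] [Module (RC D β) P]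
    [IsScalarTower k (RC D β) P] [AddCommGroup Q] [Module k Q] [Module (RC D β) Q]
    [IsScalarTower k (RC D β) Q] [AddCommGroup P₀] [Module k P₀] [Module (RC D β) P₀]
    [IsScalarTower k (RC D β) P₀] [AddCommGroup Q₀] [Module k Q₀] [Module (RC D β) Q₀]
    [IsScalarTower k (RC D β) Q₀]
    {jP : P' →ₗ[k] P} (hjP : IsF (D := D) (β := β) jP) {jQ : Q' →ₗ[k] Q} (hjQ : IsF (D := D) (β := β) jQ)
    {jP₀ : P₀' →ₗ[k] P₀} (hjP₀ : IsF (D := D) (β := β) jP₀) {jQ₀ : Q₀' →ₗ[k] Q₀}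
    (hjQ₀ : IsF (D := D) (β := β) jQ₀)
    {isR' : (P' →ₗ[KLR D β] Q') → Prop} {z' : Module.End (KLR D β) Q'} {evP' : P' →ₗ[KLR D β] P₀'}
    {evQ' : Q' →ₗ[KLR D β] Q₀'} {r : ℕ} {ρ' : P₀' →ₗ[KLR D β] Q₀'}
    (h : IsRenormalization isR' z' evP' evQ' r ρ')
    {isR : (P →ₗ[RC D β] Q) → Prop} {z : Module.End (RC D β) Q} {evP : P →ₗ[RC D β] P₀}
    {evQ : Q →ₗ[RC D β] Q₀} {E : P' →ₗ[KLR D β] P'} {E₀ : P₀' →ₗ[KLR D β] P₀'}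
    (hisR : ∀ R R', isR' R' → (∀ t, R (jP t) = jQ (R' (E t))) → isR R)
    (huniq : ∀ R R', isR R → isR R' → R' = R) (hz : ∀ t, z (jQ t) = jQ (z' t))
    (hevP : ∀ t, evP (jP t) = jP₀ (evP' t)) (hevQ : ∀ t, evQ (jQ t) = jQ₀ (evQ' t))
    (hE : ∀ t, evP' (E t) = E₀ (evP' t)) (hEs : Function.Surjective E)
    (hinj : Function.Injective z') (hsurj : Function.Surjective evP') :
    ∃ ρ : P₀ →ₗ[RC D β] Q₀, IsRenormalization isR z evP evQ r ρ ∧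
      ∀ t, ρ (jP₀ t) = jQ₀ (ρ' (E₀ t)) := by
  obtain ⟨R', T', ⟨hR', -⟩, ⟨-, hmax⟩, ⟨hT', -⟩, hρ', -⟩ := h
  obtain ⟨R, hR⟩ := hjP.exists_ext hjQ.toIsFHom (R' ∘ₗ E)
  obtain ⟨T, hT⟩ := hjP.exists_ext hjQ.toIsFHom (T' ∘ₗ E)
  obtain ⟨ρ, hρ⟩ := hjP₀.exists_ext hjQ₀.toIsFHom (ρ' ∘ₗ E₀)
  have hza : ∀ (a : ℕ) t, (z ^ a) (jQ t) = jQ ((z' ^ a) t) := by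
    intro a
    induction a with
    | zero => intro t; rfl
    | succ a ih =>
      intro t
      rw [pow_succ', pow_succ', Module.End.mul_apply, Module.End.mul_apply, ih, hz]
  have hzinj : Function.Injective z := injective_of_edag (D := D) (β := β) fun v hv h0 => by
    obtain ⟨t, rfl⟩ := hjQ.exists_eq v hv
    rw [hz, ← map_zero jQ] at h0
    rw [hinj ((hjQ.injective h0).trans (map_zero z').symm), map_zero]
  have hzainj : Function.Injective (z ^ r) := by
    rw [Module.End.coe_pow]
    exact hzinj.iterate r
  have hTR : ∀ m, (z ^ r) (T m) = R m := by
    refine LinearMap.congr_fun (f := (z ^ r) ∘ₗ T) (hjP.hom_ext fun t => ?_)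
    rw [LinearMap.comp_apply, hT, hR, hza]
    exact congrArg jQ (hT' _)
  have hevPs : Function.Surjective evP := surjective_of_edag fun w hw => by
    obtain ⟨t, rfl⟩ := hjP₀.exists_eq w hw
    obtain ⟨s, rfl⟩ := hsurj t
    exact ⟨jP s, hevP s⟩
  have hρT : ∀ m, ρ (evP m) = evQ (T m) := by
    refine LinearMap.congr_fun (f := ρ ∘ₗ evP) (g := evQ ∘ₗ T) (hjP.hom_ext fun t => ?_)
    rw [LinearMap.comp_apply, LinearMap.comp_apply, hevP, hρ, hT, hevQ, LinearMap.comp_apply,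
      LinearMap.comp_apply, ← hρ', hE]
  have hRis : isR R := hisR R R' hR' hR
  refine ⟨ρ, ⟨R, T, ⟨hRis, fun R₁ hR₁ => huniq R R₁ hRis hR₁⟩, ⟨?_, fun a ha => hmax ?_⟩,
    ⟨hTR, fun T₁ hT₁ => LinearMap.ext fun m => hzainj ((hT₁ m).trans (hTR m).symm)⟩,
    hρT, fun ρ₁ hρ₁ => LinearMap.ext fun m => ?_⟩, hρ⟩
  · rintro _ ⟨m, rfl⟩
    exact ⟨T m, hTR m⟩
  · rintro _ ⟨m, rfl⟩
    obtain ⟨t, rfl⟩ := hEs m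
    obtain ⟨q, hq⟩ := ha ⟨jP t, rfl⟩
    obtain ⟨s, hs⟩ := hjQ.exists_eq (edag D β • q) (by rw [smul_smul, edag_mul_self])
    refine ⟨s, hjQ.injective ?_⟩
    rw [← hza, hs, map_smul, hq, hR, hjQ.edag_smul]
    rfl
  · obtain ⟨m, rfl⟩ := hevPs m
    exact (hρ₁ m).trans (hρT m).symm

end Transfer

/-! ### Affinizations and `F` -/

section AffF

variable {k : Type u} [Field k] {I : Type v} {D : Datum k I} {β₁ β₂ β : I →₀ ℕ}

theorem RC.sg_mul_edag (p : Fin (ht β)) : RC.sg D p * edag D β = edag D β := by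
  rw [edag, Finset.mul_sum]
  refine Finset.sum_congr rfl fun ν _ => (RC.sg_mul_e p ν.dag).trans ?_
  change sgn k 0 • _ = _
  rw [sgn_zero, one_smul]

namespace IsFHom

variable {V' : Type w₁} [AddCommGroup V'] [Module k V'] [Module (KLR D β) V'] {V : Type w₂}
  [AddCommGroup V] [Module k V] [Module (RC D β) V] {ι : V' →ₗ[k] V}

theorem comp_left [IsScalarTower k (RC D β) V] (hι : IsFHom (D := D) (β := β) ι) {W : Type w₃}
    [AddCommGroup W] [Module k W] [Module (RC D β) W] [IsScalarTower k (RC D β) W]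
    (f : V →ₗ[RC D β] W) : IsFHom (D := D) (β := β) (f.restrictScalars k ∘ₗ ι) where
  edag_smul u := (map_smul f _ _).symm.trans (congrArg f (hι.edag_smul u))
  gen_smul g u := (congrArg f (hι.gen_smul g u)).trans (map_smul f _ _)

theorem comp_right [IsScalarTower k (KLR D β) V'] (hι : IsFHom (D := D) (β := β) ι) {W' : Type w₃}
    [AddCommGroup W'] [Module k W'] [Module (KLR D β) W'] [IsScalarTower k (KLR D β) W']
    (f : W' →ₗ[KLR D β] V') : IsFHom (D := D) (β := β) (ι ∘ₗ f.restrictScalars k) where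
  edag_smul u := hι.edag_smul (f u)
  gen_smul g u := (congrArg ι (map_smul f _ u)).trans (hι.gen_smul g _)

theorem sg_smul (hι : IsFHom (D := D) (β := β) ι) (p : Fin (ht β)) (u : V') :
    RC.sg D p • ι u = ι u := by
  rw [← hι.edag_smul, smul_smul, RC.sg_mul_edag]

end IsFHom

section ConvMap

variable (hβ : β₁ + β₂ = β) {M : SMod.{u, v, w₁} D β₁} {N : SMod.{u, v, w₂} D β₂}
  {A : KMod.{u, v, w₃} D β₁} {B : KMod.{u, v, w₄} D β₂} {ι : A.V →ₗ[k] M.V} {κ : B.V →ₗ[k] N.V}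
  {M' : SMod D β₁} {N' : SMod D β₂} {A' : KMod D β₁} {B' : KMod D β₂} {ι' : A'.V →ₗ[k] M'.V}
  {κ' : B'.V →ₗ[k] N'.V}

theorem convMap_convι (hι : IsFHom (D := D) (β := β₁) ι) (hκ : IsFHom (D := D) (β := β₂) κ)
    (hι' : IsFHom (D := D) (β := β₁) ι') (hκ' : IsFHom (D := D) (β := β₂) κ')
    {f : M.V →ₗ[RC D β₁] M'.V} (hf : ∀ p m, m ∈ M.par p → f m ∈ M'.par p) {g : N.V →ₗ[RC D β₂] N'.V}
    {f' : A.V →ₗ[KLR D β₁] A'.V} {g' : B.V →ₗ[KLR D β₂] B'.V} (hf' : ∀ a, f (ι a) = ι' (f' a))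
    (hg' : ∀ b, g (κ b) = κ' (g' b)) (t : KMod.conv hβ A B) :
    SMod.convMap hβ M M' N N' f hf g (convι hβ hι hκ t) =
      convι hβ hι' hκ' (KMod.convMap hβ A A' B B' f' g' t) := by
  refine LinearMap.congr_fun (f := (SMod.convMap hβ M M' N N' f hf g).restrictScalars k ∘ₗ convι hβ hι hκ)
    (g := convι hβ hι' hκ' ∘ₗ (KMod.convMap hβ A A' B B' f' g').restrictScalars k)
    (IsFHom.eq_of_tens ((convι_isFHom hβ hι hκ).comp_left _) ((convι_isFHom hβ hι' hκ').comp_right _)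
      fun a b => ?_) t
  change SMod.convMap hβ M M' N N' f hf g (convι hβ hι hκ _) = convι hβ hι' hκ' (KMod.convMap hβ A A' B B' f' g' _)
  rw [convι_tens, SMod.convMap_tens, KMod.convMap_tens, convι_tens, hf', hg']

theorem convMap_koszul (hι : IsF (D := D) (β := β₁) ι) (hκ : IsF (D := D) (β := β₂) κ)
    (hι' : IsF (D := D) (β := β₁) ι') (hκ' : IsF (D := D) (β := β₂) κ')
    {f' : A.V →ₗ[KLR D β₁] A'.V} {g' : B.V →ₗ[KLR D β₂] B'.V} (hf' : ∀ a, f' (hι.θ a) = hι'.θ (f' a))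
    (hg' : ∀ i b, g' (hκ.pr i b) = hκ'.pr i (g' b)) (t : KMod.conv hβ A B) :
    KMod.convMap hβ A A' B B' f' g' (koszul hβ hι hκ t) =
      koszul hβ hι' hκ' (KMod.convMap hβ A A' B B' f' g' t) := by
  refine LinearMap.congr_fun (f := KMod.convMap hβ A A' B B' f' g' ∘ₗ koszul hβ hι hκ)
    (g := koszul hβ hι' hκ' ∘ₗ KMod.convMap hβ A A' B B' f' g') (KMod.conv_hom_ext fun a b => ?_) t
  rw [LinearMap.comp_apply, LinearMap.comp_apply, koszul_tens, map_add, KMod.convMap_tens,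
    KMod.convMap_tens, KMod.convMap_tens, koszul_tens, hf', hg', hg']

end ConvMap

namespace SMod

variable [D.IsSymmetric] (M : SMod.{u, v, w} D β)

/-- `f ⊗ u ↦ f ⊗ u`. -/
def affι : M.F.aff.V →ₗ[k] M.aff.V := LinearMap.lTensor (Polynomial k) M.inclF

theorem edag_aff (m : M.aff.V) : edag D β • m = M.affExt (edag D β) m := by
  rw [edag, Finset.sum_smul, map_sum]
  exact (Finset.sum_congr rfl fun ν _ => M.aff_gen_smul (.e ν.dag) m).trans
    (LinearMap.sum_apply (M := Aff k M.V) (M₂ := Aff k M.V) _ _ _).symm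

theorem affExt_affι {a : RC D β} {a' : KLR D β} (h : ∀ u, a • M.inclF u = M.inclF (a' • u)) (u : M.F.aff.V) :
    M.affι (M.F.affExt a' u) = M.affExt a (M.affι u) := by
  refine LinearMap.congr_fun (f := M.affι ∘ₗ M.F.affExt a') (g := M.affExt a ∘ₗ M.affι)
    (TensorProduct.ext' (M := Polynomial k) (N := M.F.V) fun q u => ?_) u
  exact congrArg (Aff.tmul q) (h u).symm

theorem affι_affZ (u : M.F.aff.V) : M.affZ (M.affι u) = M.affι (M.F.affZ u) :=
  LinearMap.congr_fun (f := Aff.z M.V ∘ₗ M.affι) (g := M.affι ∘ₗ Aff.z M.F.V)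
    (TensorProduct.ext' (M := Polynomial k) (N := M.F.V) fun _ _ => rfl) u

theorem affEv_affι (u : M.F.aff.V) : M.affEv (M.affι u) = M.inclF (M.F.affEv u) :=
  LinearMap.congr_fun (f := Aff.ev M.V ∘ₗ M.affι) (g := M.inclF ∘ₗ Aff.ev M.F.V)
    (TensorProduct.ext' (M := Polynomial k) (N := M.F.V) fun q u => by
      change Aff.ev M.V (Aff.tmul q (M.inclF u)) = M.inclF (Aff.ev M.F.V (Aff.tmul q u))
      rw [Aff.ev_tmul, Aff.ev_tmul, map_smul]) u

theorem affι_isF : IsF (D := D) (β := β) M.affι where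
  edag_smul u := by
    rw [edag_aff, ← M.affExt_affι (a' := 1) fun u => by rw [one_smul, M.inclF_isF.edag_smul], map_one]
    rfl
  gen_smul g u := by
    have h : ∀ g : GenR β, M.affι (M.F.affExt (KLR.gen D g) u) = M.affExt (genF D g) (M.affι u) :=
      fun g => M.affExt_affι (fun u => (M.inclF_isF.gen_smul g u).symm) u
    rw [KMod.aff_gen_smul]
    cases g with
    | e ν => exact (h (.e ν)).trans (M.aff_gen_smul (.e ν.dag) _).symm
    | s a => exact (h (.s a)).trans (M.aff_gen_smul (.s a) _).symm
    | x p =>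
      refine Eq.trans ?_ (M.aff_gen_smul (.x p) _).symm
      refine (map_add M.affι _ _).trans (congrArg₂ _ (h (.x p)) ?_)
      refine (M.affι_affZ u).symm.trans (congrArg (Aff.z M.V) ?_)
      rw [← M.affExt_affι (a' := 1) fun u => by rw [one_smul, M.inclF_isF.sg_smul], map_one]
      rfl
  injective := Module.Flat.lTensor_preserves_injective_linearMap _ M.inclF_isF.injective
  exists_eq v hv := by
    let of : M.V →ₗ[k] M.F.V :=
      { toFun := M.toF
        map_add' := fun a b => M.inclF_isF.injective (smul_add _ a b)
        map_smul' := fun r a => M.inclF_isF.injective (smul_comm (edag D β) r a) }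
    refine ⟨LinearMap.lTensor (Polynomial k) of v, ?_⟩
    conv_rhs => rw [← hv, edag_aff]
    refine LinearMap.congr_fun (f := M.affι ∘ₗ LinearMap.lTensor (Polynomial k) of)
      (g := M.affExt (edag D β)) (TensorProduct.ext' (M := Polynomial k) (N := M.V) fun q u => ?_) v
    rfl

end SMod

end AffF

section Main

variable {k : Type u} [Field k] {I : Type v} {D : Datum k I} {β : I →₀ ℕ}

theorem SMod.inclF_toF_mem (M : SMod.{u, v, w} D β) {i : ZMod 2} {m : M.V} (hm : m ∈ M.par i) :
    M.inclF (M.toF m) ∈ M.par i := by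
  change edag D β • m ∈ _
  rw [edag, Finset.sum_smul]
  exact Submodule.sum_mem _ fun ν _ => M.e_mem _ hm

theorem SMod.nontrivial_F (M : SMod.{u, v, w} D β) [Nontrivial M.V] : Nontrivial M.F.V := by
  by_contra h
  rw [not_nontrivial_iff_subsingleton] at h
  have : (⊥ : Submodule k M.V) = ⊤ := eq_top_of_edag D β (fun v hv => by
    obtain ⟨u, rfl⟩ := M.inclF_isF.exists_eq v hv
    rw [Subsingleton.elim u 0, map_zero]
    exact Submodule.zero_mem _) fun p v hv => by
      rw [(Submodule.mem_bot k).1 hv, smul_zero]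
      exact Submodule.zero_mem _
  exact bot_ne_top this

section

variable {β₁ β₂ : I →₀ ℕ} (h₁₂ : β₁ + β₂ = β) (h₂₁ : β₂ + β₁ = β) {M : SMod.{u, v, w₁} D β₁}
  {N : SMod.{u, v, w₂} D β₂} {κ : KMod.conv h₁₂ M.F N.F →ₗ[KLR D β] KMod.conv h₂₁ N.F M.F}

theorem map_convF {ρ : SMod.conv h₁₂ M N →ₗ[RC D β] SMod.conv h₂₁ N M}
    (h : ∀ t, ρ (convι h₁₂ M.inclF_isF.toIsFHom N.inclF_isF.toIsFHom t) =
        convι h₂₁ N.inclF_isF.toIsFHom M.inclF_isF.toIsFHom (κ (koszul h₁₂ M.inclF_isF N.inclF_isF t)))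
    {i j : ZMod 2} {m₁ : M.V} {m₂ : N.V} (hm₁ : m₁ ∈ M.par i) (hm₂ : m₂ ∈ N.par j) :
    FMod.map ρ (convF h₁₂ M N (KMod.tens h₁₂ M.F N.F (M.toF m₁) (N.toF m₂))) =
      sgn k (i * j) • convF h₂₁ N M (κ (KMod.tens h₁₂ M.F N.F (M.toF m₁) (N.toF m₂))) := by
  have h1 : ∀ t, FMod.incl D β _ (convF h₁₂ M N t) = _ := LinearMap.congr_fun (incl_convF h₁₂ M N)
  have h2 : ∀ t, FMod.incl D β _ (convF h₂₁ N M t) = _ := LinearMap.congr_fun (incl_convF h₂₁ N M)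
  refine FMod.incl_injective D β _ ?_
  rw [map_smul, h2]
  change ρ (FMod.incl D β _ (convF h₁₂ M N _)) = _
  rw [h1, h, koszul_tens_of_mem h₁₂ _ _ (M.inclF_toF_mem hm₁) (N.inclF_toF_mem hm₂), LinearMap.map_smul_of_tower, map_smul]

end

end Main

section Main

variable {k : Type u} [Field k] {I : Type v} {D : Datum k I} {β₁ β₂ β : I →₀ ℕ} [D.IsSymmetric]
  (h₁₂ : β₁ + β₂ = β) (h₂₁ : β₂ + β₁ = β) {M : SMod.{u, v, w₁} D β₁} {N : SMod.{u, v, w₂} D β₂} {r : ℕ}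
  {κ : KMod.conv h₁₂ M.F N.F →ₗ[KLR D β] KMod.conv h₂₁ N.F M.F}

theorem SMod.exists_isRenormL (h : KMod.IsRenormL h₁₂ h₂₁ M.F N.F r κ) :
    ∃ ρ, SMod.IsRenormL h₁₂ h₂₁ M N r ρ ∧
      ∀ t, ρ (convι h₁₂ M.inclF_isF.toIsFHom N.inclF_isF.toIsFHom t) =
        convι h₂₁ N.inclF_isF.toIsFHom M.inclF_isF.toIsFHom (κ (koszul h₁₂ M.inclF_isF N.inclF_isF t)) :=
  IsRenormalization.of_isF (convι_isF h₁₂ M.affι_isF N.inclF_isF) (convι_isF h₂₁ N.inclF_isF M.affι_isF)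
    (convι_isF h₁₂ M.inclF_isF N.inclF_isF) (convι_isF h₂₁ N.inclF_isF M.inclF_isF) h
    (E := koszul h₁₂ M.affι_isF N.inclF_isF)
    (fun _ _ hR' hR => isRMatrix_of h₁₂ h₂₁ M.affι_isF N.inclF_isF hR' hR)
    (fun _ _ hR hR' => hR.unique h₁₂ h₂₁ hR')
    (convMap_convι h₂₁ _ _ _ _ _ (fun _ => rfl) M.affι_affZ)
    (convMap_convι h₁₂ _ _ _ _ _ M.affEv_affι fun _ => rfl)
    (convMap_convι h₂₁ _ _ _ _ _ (fun _ => rfl) M.affEv_affι)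
    (convMap_koszul h₁₂ _ _ _ _ (IsF.map_θ M.affι_isF M.inclF_isF M.affEv_mem M.affEv_affι) fun _ _ => rfl)
    (koszul_surjective h₁₂ _ _) (KMod.affZ_right_injective h₂₁ M.F N.F)
    (KMod.convMap_surjective h₁₂ (KMod.affEv_surjective _) Function.surjective_id)

theorem SMod.exists_isRenormR (h : KMod.IsRenormR h₁₂ h₂₁ M.F N.F r κ) :
    ∃ ρ, SMod.IsRenormR h₁₂ h₂₁ M N r ρ ∧
      ∀ t, ρ (convι h₁₂ M.inclF_isF.toIsFHom N.inclF_isF.toIsFHom t) =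
        convι h₂₁ N.inclF_isF.toIsFHom M.inclF_isF.toIsFHom (κ (koszul h₁₂ M.inclF_isF N.inclF_isF t)) :=
  IsRenormalization.of_isF (convι_isF h₁₂ M.inclF_isF N.affι_isF) (convι_isF h₂₁ N.affι_isF M.inclF_isF)
    (convι_isF h₁₂ M.inclF_isF N.inclF_isF) (convι_isF h₂₁ N.inclF_isF M.inclF_isF) h
    (E := koszul h₁₂ M.inclF_isF N.affι_isF)
    (fun _ _ hR' hR => isRMatrix_of h₁₂ h₂₁ M.inclF_isF N.affι_isF hR' hR)
    (fun _ _ hR hR' => hR.unique h₁₂ h₂₁ hR')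
    (convMap_convι h₂₁ _ _ _ _ _ N.affι_affZ fun _ => rfl)
    (convMap_convι h₁₂ _ _ _ _ _ (fun _ => rfl) N.affEv_affι)
    (convMap_convι h₂₁ _ _ _ _ _ N.affEv_affι fun _ => rfl)
    (convMap_koszul h₁₂ _ _ _ _ (fun _ => rfl) (IsF.map_pr N.affι_isF N.inclF_isF N.affEv_mem N.affEv_affι))
    (koszul_surjective h₁₂ _ _) (KMod.affZ_left_injective h₂₁ M.F N.F)
    (KMod.convMap_surjective h₁₂ Function.surjective_id (KMod.affEv_surjective _))

end Main

end QHC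

end

theorem mainTheorem11 {k : Type u} [Field k] (hk : (2 : k) ≠ 0) {I : Type v} (D : QHC.Datum k I)
    [D.IsSymmetric] (β₁ β₂ β : I →₀ ℕ) (h₁₂ : β₁ + β₂ = β) (h₂₁ : β₂ + β₁ = β)
    (M₁ : QHC.SMod.{u, v, w₁} D β₁) (M₂ : QHC.SMod.{u, v, w₂} D β₂)
    [Nontrivial M₁.V] [Nontrivial M₂.V] :
    Function.Bijective (QHC.convF h₁₂ M₁ M₂) ∧ Function.Bijective (QHC.convF h₂₁ M₂ M₁) ∧
    (∃ (r : ℕ) (ρ : QHC.SMod.conv h₁₂ M₁ M₂ →ₗ[QHC.RC D β] QHC.SMod.conv h₂₁ M₂ M₁)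
      (κ : QHC.KMod.conv h₁₂ M₁.F M₂.F →ₗ[QHC.KLR D β] QHC.KMod.conv h₂₁ M₂.F M₁.F),
      QHC.SMod.IsRenormL h₁₂ h₂₁ M₁ M₂ r ρ ∧ QHC.KMod.IsRenormL h₁₂ h₂₁ M₁.F M₂.F r κ ∧
      ∀ (i j : ZMod 2) (m₁ : M₁.V) (m₂ : M₂.V), m₁ ∈ M₁.par i → m₂ ∈ M₂.par j →
        QHC.FMod.map ρ (QHC.convF h₁₂ M₁ M₂
          (QHC.KMod.tens h₁₂ M₁.F M₂.F (M₁.toF m₁) (M₂.toF m₂))) =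
        QHC.sgn k (i * j) • QHC.convF h₂₁ M₂ M₁
          (κ (QHC.KMod.tens h₁₂ M₁.F M₂.F (M₁.toF m₁) (M₂.toF m₂)))) ∧
    (∃ (s : ℕ) (ρ : QHC.SMod.conv h₁₂ M₁ M₂ →ₗ[QHC.RC D β] QHC.SMod.conv h₂₁ M₂ M₁)
      (κ : QHC.KMod.conv h₁₂ M₁.F M₂.F →ₗ[QHC.KLR D β] QHC.KMod.conv h₂₁ M₂.F M₁.F),
      QHC.SMod.IsRenormR h₁₂ h₂₁ M₁ M₂ s ρ ∧ QHC.KMod.IsRenormR h₁₂ h₂₁ M₁.F M₂.F s κ ∧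
      ∀ (i j : ZMod 2) (m₁ : M₁.V) (m₂ : M₂.V), m₁ ∈ M₁.par i → m₂ ∈ M₂.par j →
        QHC.FMod.map ρ (QHC.convF h₁₂ M₁ M₂
          (QHC.KMod.tens h₁₂ M₁.F M₂.F (M₁.toF m₁) (M₂.toF m₂))) =
        QHC.sgn k (i * j) • QHC.convF h₂₁ M₂ M₁
          (κ (QHC.KMod.tens h₁₂ M₁.F M₂.F (M₁.toF m₁) (M₂.toF m₂)))) := by
  have := M₁.nontrivial_F
  have := M₂.nontrivial_F
  refine ⟨QHC.convF_bijective h₁₂ M₁ M₂, QHC.convF_bijective h₂₁ M₂ M₁, ?_, ?_⟩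
  · obtain ⟨r, κ, hκ⟩ := QHC.KMod.exists_isRenormL h₁₂ h₂₁ M₁.F M₂.F
    obtain ⟨ρ, hρ, h⟩ := QHC.SMod.exists_isRenormL h₁₂ h₂₁ hκ
    exact ⟨r, ρ, κ, hρ, hκ, fun i j m₁ m₂ hm₁ hm₂ => QHC.map_convF h₁₂ h₂₁ h hm₁ hm₂⟩
  · obtain ⟨s, κ, hκ⟩ := QHC.KMod.exists_isRenormR h₁₂ h₂₁ M₁.F M₂.F
    obtain ⟨ρ, hρ, h⟩ := QHC.SMod.exists_isRenormR h₁₂ h₂₁ hκ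
    exact ⟨s, ρ, κ, hρ, hκ, fun i j m₁ m₂ hm₁ hm₂ => QHC.map_convF h₁₂ h₂₁ h hm₁ hm₂⟩
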